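/- **Conventions.** A *knotoid diagram* $K$ in $S^2$ is an oriented immersed arc from a point (the leg) to another point (the head) whose only singularities are $n$ transverse double points with over/under information (crossings). Let $n_+$, $n_-$ be the numbers of positive and negative crossings and $\mathrm{wr}(K)=n_+-n_-$. $\mathrm{Mir}(K)$ is obtained by switching all crossings, and $\mathrm{Sym}(K)$ by reflecting the projection in a line while keeping the over/under information. A *state* $s$ chooses the $0$- or the $1$-smoothing at each crossing (the $0$-smoothing, i.e. the $A$-smoothing, opens the two regions swept by the overpass when it is turned counterclockwise). The smoothed diagram consists of $|s|$ components, of which exactly one, $k_s$, is a segment; orient it from the leg to the head. Let $\|s\|$ be the number of $1$-smoothings and $\sigma_s=n-2\|s\|$. Let $\alpha$ be the canonical shortcut of $K$, that is, $K$ pushed slightly to its right, directed from leg to head. Let $\gamma\cdot\alpha$ be the number of times the curve $\gamma$ crosses $\alpha$ from right to left minus the number of times from left to right. Put $\mu(s)=k_s\cdot\alpha-K\cdot\alpha$. The Jones and Turaev polynomials of $K$ are $$J_K=(-A^3)^{-\mathrm{wr}(K)}\sum_s A^{\sigma_s}(-A^2-A^{-2})^{|s|-1},\qquad T_K=(-A^3)^{-\mathrm{wr}(K)}\,u^{-K\cdot\alpha}\sum_s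 A^{\sigma_s}u^{k_s\cdot\alpha}(-A^2-A^{-2})^{|s|-1}.$$ Let $\mathcal A=\mathbb Q[X]/(X^2)$ with $\deg 1=1$, $\deg X=-1$. Order the crossings. The chain complex $C(K)$ is the direct sum over all states $s$ of $\mathcal A^{\otimes(|s|-1)}\otimes X\mathcal A\otimes\Lambda^{\|s\|}\mathcal V_s$, with one factor $\mathcal A$ for each closed component, the factor $X\mathcal A$ for $k_s$, and $\mathcal V_s$ the $\mathbb Q$-vector space with basis the $1$-smoothed crossings of $s$. A homogeneous element $v$ in the summand of $s$ has gradings $i=\|s\|-n_-$, $j=\deg(v)+i+n_+-n_-+1$ (the $q$-grading), and $k=\mu(s)$ (the $u$-grading). The differential is the sum of the edge maps that change one smoothing at a crossing $c$ from $0$ to $1$. Such a map multiplies by the wedge factor $c$ on the left; it is the multiplication $1\otimes1\mapsto1$, $1\otimes X,\,X\otimes1\mapsto X$, $X\otimes X\mapsto0$ if two components merge; it is the comultiplication $1\mapsto1\otimes X+X\otimes1$, $X\mapsto X\otimes X$ if one component is divided into two; and it is $0$ if the number of components does not change. The *winding homology* $H_{i,j}^k(K)$ is the homology of this triply graded complex.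 The *Khovanov knotoid homology* $Kh_{i,j}(K)$ is the homology of the same complex without the $u$-grading. Two diagrams have the same winding (resp. Khovanov) homology if these spaces are isomorphic in each degree. For two invariants $I$, $I'$, say that $I$ *determines* $I'$ if any two knotoid diagrams in $S^2$ with the same $I$ have the same $I'$. Say that $I$ is *stronger* than $I'$ if $I$ determines $I'$ and there are two knotoid diagrams with the same $I'$ and different $I$. **The diagrams $K_1,\dots,K_9$.** Each is given by its signed Gauss code. The diagram with $n$ crossings is walked along from the leg to the head, and the $2n$ passes through crossings are numbered $0,\dots,2n-1$. The entry $(a\,b\,\pm)$ stands for a crossing of the sign $\pm$ which is passed as an underpass at number $a$ and as an overpass at number $b$; the order of the entries is the order of the crossings. - $K_1$: $(3\,0\,+)(1\,10\,-)(9\,2\,-)(14\,4\,-)(5\,19\,-)(13\,6\,+)(7\,17\,+)(16\,8\,+)(11\,15\,+)(18\,12\,+)$ - $K_2$: $(0\,5\,-)(12\,1\,+)(2\,9\,+)(17\,3\,+)(4\,14\,+)(6\,13\,-)(19\,7\,+)(8\,18\,+)(10\,16\,-)(15\,11\,-)$ - $K_3$: $(3\,0\,+)(1\,12\,-)(11\,2\,-)(16\,4\,-)(5\,17\,-)(13\,6\,+)(7\,14\,+)(18\,8\,-)(9\,19\,-)(15\,10\,+)$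 - $K_4$: $(3\,0\,+)(1\,12\,-)(11\,2\,-)(16\,4\,-)(5\,23\,-)(15\,6\,+)(21\,7\,-)(8\,20\,-)(19\,9\,-)(10\,18\,-)(13\,17\,+)(22\,14\,+)$ - $K_5$: $(3\,0\,+)(1\,10\,-)(9\,2\,-)(4\,13\,-)(19\,5\,+)(16\,6\,-)(7\,15\,-)(14\,8\,-)(11\,17\,-)(18\,12\,-)$ - $K_6$: $(3\,0\,+)(1\,10\,-)(9\,2\,-)(4\,17\,-)(19\,5\,-)(6\,20\,-)(12\,7\,+)(8\,15\,+)(16\,11\,+)(21\,13\,-)(14\,22\,-)(23\,18\,-)$ - $K_7$: $(3\,0\,+)(1\,6\,+)(7\,2\,+)(4\,12\,+)(13\,5\,+)(8\,18\,-)(9\,22\,-)(16\,10\,-)(20\,11\,-)(19\,14\,+)(23\,15\,+)(21\,17\,-)$ - $K_8$: $(3\,0\,+)(1\,9\,-)(8\,2\,-)(15\,4\,-)(5\,22\,+)(13\,6\,+)(20\,7\,+)(16\,10\,-)(11\,17\,-)(12\,19\,+)(21\,14\,+)(23\,18\,-)$ - $K_9$: $(5\,0\,+)(1\,12\,-)(9\,2\,-)(3\,19\,-)(16\,4\,-)(15\,6\,+)(7\,20\,+)(23\,8\,+)(18\,10\,+)(11\,17\,+)(22\,13\,-)(14\,21\,-)$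 They come from minimal diagrams of prime knots, by deleting the last pass of the diagram of $11a_{138}$, $\overline{11a_{285}}$, $11a_{217}$, $13n_{3187}$, $11n_{113}$, $13n_{2685}$ for $K_1,\dots,K_6$, and the last two passes of the diagram of $14n_{3532}$, $14n_{12378}$, $14n_{22768}$ for $K_7,K_8,K_9$. **Statement.** The following hold. 1. For each $K\in\{K_7,K_8,K_9\}$, the diagrams $K$ and $\mathrm{Sym}(\mathrm{Mir}(K))$ have the same Turaev polynomial and the same Khovanov knotoid homology, but different winding homology. Moreover $H_{i,j}^k(\mathrm{Sym}(\mathrm{Mir}(K)))\cong H_{i,j}^{-k}(K)$ for all $i,j,k\in\mathbb Z$. 2. $K_1$ and $K_2$ have the same Jones polynomial and the same Khovanov knotoid homology, but different Turaev polynomials and different winding homology. 3. $K_3$ and $K_4$ have the same Jones polynomial and the same Turaev polynomial, but different Khovanov knotoid homology and different winding homology. 4. $K_5$ and $K_6$ have the same Jones polynomial and the same Turaev polynomial, but different Khovanov knotoid homology; their winding homology differs in some degree $(i,j,k)$ with $k=0$ and in some degree with $k\neq0$. 5. The Turaev polynomial and the Khovanov knotoid homology are each stronger than the Jones polynomial.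 The winding homology is stronger than the Turaev polynomial and stronger than the Khovanov knotoid homology. Neither of the Turaev polynomial and the Khovanov knotoid homology determines the other. The winding homology is stronger than the pair consisting of the Turaev polynomial and the Khovanov knotoid homology. -/

import Mathlib

/-- The combinatorial data of an oriented open-ended knot-type diagram with `n` crossings.
Walking from the leg to the head one passes `2 * n` times through a crossing; these passes are
numbered `0, …, 2 * n - 1`.  The crossing `c` is passed as an underpass at time `underPass c` and as an
overpass at time `overPass c`; `pos c` records whether `c` is a positive crossing.
The walk is cut by the passes into `2 * n + 1` edges `0, …, 2 * n`; pass number `t` leads from edge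
`t` to edge `t + 1`, the leg is the free end of edge `0` and the head that of edge `2 * n`. -/
structure KnotoidCode where
  n : ℕ
  underPass : Fin n → Fin (2 * n)
  overPass : Fin n → Fin (2 * n)
  pos : Fin n → Bool
  bij : Function.Bijective (Sum.elim underPass overPass)

namespace KnotoidCode

variable (D : KnotoidCode)

abbrev Edge : Type := Fin (2 * D.n + 1)

/-- Around a crossing `c` there are four half-edges, at positions `0, 1, 2, 3` in counterclockwise
order, where `0` is the incoming half-edge of the underpass (so `2` is the outgoing one).  At a
positive crossing the overpass runs from position `3` to position `1`, at a negative crossing from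
`1` to `3`.  `D.edge c p` is the edge which contains the half-edge at position `p`. -/
def edge (c : Fin D.n) (p : Fin 4) : D.Edge :=
  match p with
  | 0 => (D.underPass c).castSucc
  | 1 => if D.pos c then (D.overPass c).succ else (D.overPass c).castSucc
  | 2 => (D.underPass c).succ
  | 3 => if D.pos c then (D.overPass c).castSucc else (D.overPass c).succ

/-- Whether the diagram is oriented towards the crossing along the half-edge `p` of `c`. -/
def inward (c : Fin D.n) (p : Fin 4) : Bool :=
  match p with
  | 0 => true
  | 1 => !D.pos c
  | 2 => false
  | 3 => D.pos c

/-! ### Regions of the complement, and diagrams in the sphere -/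

/-- The two sides of an edge: `(e, true)` is the left side and `(e, false)` the right side of `e`,
with respect to the orientation of the diagram. -/
abbrev Side : Type := D.Edge × Bool

/-- The side of the half-edge `p` of `c` facing the corner between the positions `p` and `p + 1`. -/
def ccwSide (c : Fin D.n) (p : Fin 4) : D.Side := (D.edge c p, !D.inward c p)

/-- The side of the half-edge `p` of `c` facing the corner between the positions `p - 1` and `p`. -/
def cwSide (c : Fin D.n) (p : Fin 4) : D.Side := (D.edge c p, D.inward c p)

/-- Sides that meet at a corner of a crossing, or at the leg, or at the head, bound the same
region. -/
inductive SideAdj : D.Side → D.Side → Prop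
  | corner (c : Fin D.n) (p : Fin 4) : SideAdj (D.ccwSide c p) (D.cwSide c (p + 1))
  | leg : SideAdj (0, true) (0, false)
  | head : SideAdj (Fin.last _, true) (Fin.last _, false)

/-- The regions of the closed oriented surface in which the diagram is cellularly embedded. -/
abbrev Region : Type := Quot D.SideAdj

/-- The surface is a sphere.  The diagram is a connected graph with `n + 2` vertices (the crossings,
the leg and the head) and `2 * n + 1` edges, so that Euler characteristic `2` means `n + 1`
regions. -/
def IsSpherical : Prop := Nat.card D.Region = D.n + 1

/-- A certificate for `IsSpherical`: a numbering `f` of the regions, a side `r i` of each region, and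
a table `par` which leads from each side to the chosen side of its region in at most `k` steps. -/
theorem isSpherical_of_tables (D : KnotoidCode) {k : ℕ} (f : D.Side → Fin (D.n + 1))
    (r : Fin (D.n + 1) → D.Side) (par : D.Side → D.Side)
    (h1 : ∀ c p, f (D.ccwSide c p) = f (D.cwSide c (p + 1)))
    (h2 : f (0, true) = f (0, false)) (h3 : f (Fin.last _, true) = f (Fin.last _, false))
    (h4 : ∀ i, f (r i) = i)
    (h5 : ∀ x, par x = x ∨ (∃ c p, x = D.ccwSide c p ∧ par x = D.cwSide c (p + 1)) ∨
      (∃ c p, par x = D.ccwSide c p ∧ x = D.cwSide c (p + 1)) ∨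
      (x.1 = (par x).1 ∧ (x.1 = 0 ∨ x.1 = Fin.last _)))
    (h6 : ∀ x, par^[k] x = r (f x)) : D.IsSpherical := by
  have hf : ∀ x y, D.SideAdj x y → f x = f y := by
    intro x y h
    cases h with
    | corner c p => exact h1 c p
    | leg => exact h2
    | head => exact h3
  have hp : ∀ x, Quot.mk D.SideAdj (par x) = Quot.mk D.SideAdj x := by
    intro x
    rcases h5 x with h | ⟨c, p, h, h'⟩ | ⟨c, p, h, h'⟩ | ⟨h, h'⟩
    · rw [h]
    · rw [h', h]; exact (Quot.sound (SideAdj.corner c p)).symm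
    · rw [h, h']; exact Quot.sound (SideAdj.corner c p)
    · generalize par x = y at h
      obtain ⟨x1, x2⟩ := x
      obtain ⟨y1, y2⟩ := y
      simp only at h h'
      subst h
      rcases h' with rfl | rfl
      · have hl := Quot.sound (SideAdj.leg (D := D))
        cases x2 <;> cases y2 <;> first | rfl | exact hl | exact hl.symm
      · have hl := Quot.sound (SideAdj.head (D := D))
        cases x2 <;> cases y2 <;> first | rfl | exact hl | exact hl.symm
  have hk : ∀ j x, Quot.mk D.SideAdj (par^[j] x) = Quot.mk D.SideAdj x := by
    intro j
    induction j with
    | zero => intro x; rfl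
    | succ j ih => intro x; rw [Function.iterate_succ_apply, ih, hp]
  let e : D.Region ≃ Fin (D.n + 1) :=
    { toFun := Quot.lift f hf
      invFun := fun i => Quot.mk _ (r i)
      left_inv := by
        intro q
        induction q using Quot.ind with
        | mk x => exact (congrArg _ (h6 x)).symm.trans (hk k x)
      right_inv := fun i => h4 i }
  exact (Nat.card_congr e).trans (Nat.card_fin _)

/-! ### Mirror image and symmetric reflection of codes -/

/-- Switching all crossings. -/
def mir : KnotoidCode where
  n := D.n
  underPass := D.overPass
  overPass := D.underPass
  pos c := !D.pos c
  bij := by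
    have h : Sum.elim D.overPass D.underPass = Sum.elim D.underPass D.overPass ∘ Equiv.sumComm _ _ := by
      funext x; cases x <;> rfl
    rw [h]
    exact D.bij.comp (Equiv.bijective _)

/-- Reflecting the projection in a line, keeping over- and underpasses. -/
def sym : KnotoidCode where
  n := D.n
  underPass := D.underPass
  overPass := D.overPass
  pos c := !D.pos c
  bij := D.bij

theorem edge_mir (c : Fin D.n) (p : Fin 4) :
    D.mir.edge c p = D.edge c (if D.pos c then p + 3 else p + 1) := by
  cases h : D.pos c <;> fin_cases p <;> simp [edge, mir, h]

theorem inward_mir (c : Fin D.n) (p : Fin 4) :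
    D.mir.inward c p = D.inward c (if D.pos c then p + 3 else p + 1) := by
  cases h : D.pos c <;> fin_cases p <;> simp [inward, mir, h]

theorem edge_sym (c : Fin D.n) (p : Fin 4) : D.sym.edge c p = D.edge c (-p) := by
  cases h : D.pos c <;> fin_cases p <;> simp [edge, sym, h] <;> rfl

theorem inward_sym (c : Fin D.n) (p : Fin 4) : D.sym.inward c p = D.inward c (-p) := by
  cases h : D.pos c <;> fin_cases p <;> simp [inward, sym, h] <;> rfl

theorem card_region_le {D D' : KnotoidCode} (f : D.Side → D'.Side) (hf : Function.Surjective f)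
    (h : ∀ x y, D.SideAdj x y → Quot.mk D'.SideAdj (f x) = Quot.mk D'.SideAdj (f y)) :
    Nat.card D'.Region ≤ Nat.card D.Region := by
  refine Nat.card_le_card_of_surjective
    (Quot.lift (fun x => Quot.mk D'.SideAdj (f x)) h : D.Region → D'.Region) fun y => ?_
  induction y using Quot.ind with
  | mk x =>
    obtain ⟨z, rfl⟩ := hf x
    exact ⟨Quot.mk _ z, rfl⟩

theorem mir_mir : D.mir.mir = D := by
  cases D; simp [mir]

theorem sym_sym : D.sym.sym = D := by
  cases D; simp [sym]

/-- Switching crossings does not move the sides of the edges. -/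
def mirSide (x : D.mir.Side) : D.Side := x

/-- Reflecting exchanges the two sides of each edge. -/
def symSide (x : D.sym.Side) : D.Side := (x.1, !x.2)

theorem card_region_mir_le (D : KnotoidCode) : Nat.card D.Region ≤ Nat.card D.mir.Region := by
  refine card_region_le D.mirSide (fun x => ⟨x, rfl⟩) fun x y h => ?_
  cases h with
  | corner c p =>
    have h1 := Quot.sound (SideAdj.corner (D := D) c (if D.pos c then p + 3 else p + 1))
    have h2 : D.mirSide (D.mir.ccwSide c p) = D.ccwSide c (if D.pos c then p + 3 else p + 1) := by
      exact Prod.ext (D.edge_mir c p) (congrArg not (D.inward_mir c p))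
    have h3 : D.mirSide (D.mir.cwSide c (p + 1))
        = D.cwSide c ((if D.pos c then p + 3 else p + 1) + 1) := by
      have e1 : (if D.pos c then p + 1 + 3 else p + 1 + 1)
          = (if D.pos c then p + 3 else p + 1) + 1 := by
        cases D.pos c <;> fin_cases p <;> rfl
      rw [← e1]
      exact Prod.ext (D.edge_mir c (p + 1)) (D.inward_mir c (p + 1))
    rw [h2, h3]; exact h1
  | leg => exact Quot.sound SideAdj.leg
  | head => exact Quot.sound SideAdj.head

theorem card_region_sym_le (D : KnotoidCode) : Nat.card D.Region ≤ Nat.card D.sym.Region := by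
  refine card_region_le D.symSide (fun x => ⟨(x.1, !x.2), ?_⟩) fun x y h => ?_
  · simp [symSide]
  cases h with
  | corner c p =>
    have h1 := Quot.sound (SideAdj.corner (D := D) c (-(p + 1)))
    have e1 : -(p + 1) + 1 = -p := by fin_cases p <;> rfl
    have h2 : D.symSide (D.sym.ccwSide c p) = D.cwSide c (-p) := by
      exact Prod.ext (D.edge_sym c p)
        ((congrArg (fun b => !!b) (D.inward_sym c p)).trans (Bool.not_not _))
    have h3 : D.symSide (D.sym.cwSide c (p + 1)) = D.ccwSide c (-(p + 1)) := by
      exact Prod.ext (D.edge_sym c (p + 1)) (congrArg not (D.inward_sym c (p + 1)))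
    rw [h2, h3]
    rw [e1] at h1
    exact h1.symm
  | leg => exact (Quot.sound SideAdj.leg).symm
  | head => exact (Quot.sound SideAdj.head).symm

theorem IsSpherical.mir {D : KnotoidCode} (h : D.IsSpherical) : D.mir.IsSpherical := by
  have h1 := card_region_mir_le D
  have h2 := card_region_mir_le D.mir
  rw [mir_mir] at h2
  exact (le_antisymm h2 h1).trans h

theorem IsSpherical.sym {D : KnotoidCode} (h : D.IsSpherical) : D.sym.IsSpherical := by
  have h1 := card_region_sym_le D
  have h2 := card_region_sym_le D.sym
  rw [sym_sym] at h2
  exact (le_antisymm h2 h1).trans h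

/-! ### States -/

/-- A state chooses a smoothing at each crossing: `false` is the `0`-smoothing and `true` the
`1`-smoothing. -/
abbrev State : Type := Fin D.n → Bool

/-- The `0`-smoothing opens the two regions swept by the overpass when it is turned
counterclockwise: it connects the positions `0, 1` and `2, 3`.  The `1`-smoothing connects the
positions `0, 3` and `1, 2`. -/
def partner (b : Bool) (p : Fin 4) : Fin 4 :=
  if b then ![3, 2, 1, 0] p else ![1, 0, 3, 2] p

/-- Two edges that are connected at a smoothed crossing. -/
def Joined (s : D.State) (e e' : D.Edge) : Prop :=
  ∃ (c : Fin D.n) (p : Fin 4), e = D.edge c p ∧ e' = D.edge c (partner (s c) p)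

/-- The components of the smoothed diagram. -/
abbrev Component (s : D.State) : Type := Quot (D.Joined s)

/-- The component which contains a given edge. -/
def comp (s : D.State) (e : D.Edge) : D.Component s := Quot.mk _ e

/-- The segment component `k_s`. -/
def segment (s : D.State) : D.Component s := D.comp s 0

/-- The number `|s|` of components of a state. -/
noncomputable def numComp (s : D.State) : ℕ := Nat.card (D.Component s)

/-- The number `‖s‖` of `1`-smoothings of a state. -/
def ones (s : D.State) : ℕ := (Finset.univ.filter fun c => s c = true).card

/-- The number of positive crossings. -/
def nPlus : ℕ := (Finset.univ.filter fun c => D.pos c = true).card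

/-- The number of negative crossings. -/
def nMinus : ℕ := (Finset.univ.filter fun c => D.pos c = false).card

/-- The writhe. -/
def writhe : ℤ := D.nPlus - D.nMinus

/-! ### Intersection numbers with the canonical shortcut -/

/-- An edge with a direction: `true` is the direction of the diagram, `false` the opposite one. -/
abbrev Dart : Type := D.Edge × Bool

/-- The dart which runs into the crossing `c` along the half-edge `p`. -/
def dartIn (c : Fin D.n) (p : Fin 4) : D.Dart := (D.edge c p, D.inward c p)

/-- The dart which runs out of the crossing `c` along the half-edge `p`. -/
def dartOut (c : Fin D.n) (p : Fin 4) : D.Dart := (D.edge c p, !D.inward c p)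

/-- Walking through a smoothed crossing. -/
inductive Step (s : D.State) : D.Dart → D.Dart → Prop
  | pass (c : Fin D.n) (p : Fin 4) : Step s (D.dartIn c p) (D.dartOut c (partner (s c) p))

/-- The segment component `k_s`, oriented from the leg to the head, as a set of darts. -/
def segmentCurve (s : D.State) : Set D.Dart :=
  {d | Relation.ReflTransGen (D.Step s) (0, true) d}

/-- The diagram `K` itself, as a set of darts. -/
def wholeCurve : Set D.Dart := {d | d.2 = true}

/-- The canonical shortcut `α` is the diagram `K` pushed slightly to its right.  At each of the two
passes of `K` through the crossing `c` it crosses, once, the half-edge which leaves `c` to the right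
of that pass: for the underpass this is the half-edge `1`, for the overpass it is the half-edge `0`
at a positive and `2` at a negative crossing. -/
def crossedByUnder (_c : Fin D.n) : Fin 4 := 1

/-- See `crossedByUnder`. -/
def crossedByOver (c : Fin D.n) : Fin 4 := if D.pos c then 0 else 2

open Classical in
/-- Contribution to `γ · α` of the intersection of `α` with the half-edge `p` of `c`, which `α`
crosses with the crossing on its left: a curve running towards `c` crosses `α` from right to left
and counts `1`, a curve running away from `c` counts `-1`. -/
noncomputable def crossingNumber (γ : Set D.Dart) (c : Fin D.n) (p : Fin 4) : ℤ :=
  (if D.dartIn c p ∈ γ then 1 else 0) - (if D.dartOut c p ∈ γ then 1 else 0)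

/-- `γ · α`: the number of times the curve `γ` crosses the canonical shortcut `α` from right to left
minus the number of times from left to right. -/
noncomputable def dotShortcut (γ : Set D.Dart) : ℤ :=
  ∑ c : Fin D.n,
    (D.crossingNumber γ c (D.crossedByUnder c) + D.crossingNumber γ c (D.crossedByOver c))

/-- `μ(s) = k_s · α - K · α`. -/
noncomputable def mu (s : D.State) : ℤ :=
  D.dotShortcut (D.segmentCurve s) - D.dotShortcut D.wholeCurve

/-! ### The Jones and the Turaev polynomial -/

/-- `σ_s`: the number of `0`-smoothings minus the number of `1`-smoothings. -/
def sigma (s : D.State) : ℤ := (D.n : ℤ) - 2 * D.ones s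

/-- The factor `(-A³) ^ (-wr(K))`, with `A` the variable `T`. -/
noncomputable def writheFactor : LaurentPolynomial ℤ :=
  LaurentPolynomial.C ((Int.negOnePow D.writhe : ℤˣ) : ℤ) * LaurentPolynomial.T (-3 * D.writhe)

/-- The summand `A ^ σ_s (-A² - A⁻²) ^ (|s| - 1)` of the Kauffman bracket. -/
noncomputable def bracketTerm (s : D.State) : LaurentPolynomial ℤ :=
  LaurentPolynomial.T (D.sigma s)
    * (-LaurentPolynomial.T 2 - LaurentPolynomial.T (-2)) ^ (D.numComp s - 1)

/-- The Jones polynomial `(-A³) ^ (-wr(K)) ⟨K⟩ ∈ ℤ[A, A⁻¹]`. -/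
noncomputable def jones : LaurentPolynomial ℤ :=
  D.writheFactor * ∑ s : D.State, D.bracketTerm s

/-- The Turaev polynomial, in `ℤ[A, A⁻¹][u, u⁻¹]`. -/
noncomputable def turaev : LaurentPolynomial (LaurentPolynomial ℤ) :=
  LaurentPolynomial.C D.writheFactor * LaurentPolynomial.T (-D.dotShortcut D.wholeCurve)
    * ∑ s : D.State, LaurentPolynomial.C (D.bracketTerm s)
        * LaurentPolynomial.T (D.dotShortcut (D.segmentCurve s))

/-! ### The chain complex

`𝒜 = ℚ[X]/(X²)` has the basis `1, X`, encoded by `true, false`. -/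

/-- The basis vectors of the chain complex: a state, and a basis vector of `𝒜` for each of its
components, which is `X` for the segment component.  For each state they form the standard basis of
`𝒜^{⊗(|s| - 1)} ⊗ X𝒜 ⊗ Λ^{‖s‖} 𝒱_s`, where the exterior power is spanned by the wedge product of the
`1`-smoothed crossings in increasing order. -/
structure Generator where
  state : D.State
  label : D.Component state → Bool
  label_segment : label (D.segment state) = false

instance : Finite D.Generator := by
  have h : Function.Injective
      fun g : D.Generator => (⟨g.state, g.label⟩ : Σ s : D.State, D.Component s → Bool) := by
    rintro ⟨s, l, hl⟩ ⟨s', l', hl'⟩ h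
    simp only [Sigma.mk.injEq] at h
    obtain ⟨rfl, h⟩ := h
    obtain rfl := eq_of_heq h
    rfl
  exact Finite.of_injective _ h

noncomputable instance : Fintype D.Generator := Fintype.ofFinite _

variable {D} in
/-- The degree, with `deg 1 = 1` and `deg X = -1`, added up over all components. -/
noncomputable def Generator.deg (g : D.Generator) : ℤ :=
  ∑ᶠ x : D.Component g.state, if g.label x then 1 else -1

variable {D} in
/-- The homological grading. -/
def Generator.hDeg (g : D.Generator) : ℤ := (D.ones g.state : ℤ) - D.nMinus

variable {D} in
/-- The `q`-grading. -/
noncomputable def Generator.qDeg (g : D.Generator) : ℤ :=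
  g.deg + g.hDeg + D.nPlus - D.nMinus + 1

variable {D} in
/-- The `u`-grading. -/
noncomputable def Generator.uDeg (g : D.Generator) : ℤ := D.mu g.state

/-- Structure constants of the multiplication `𝒜 ⊗ 𝒜 → 𝒜`:
`1 ⊗ 1 ↦ 1`, `1 ⊗ X ↦ X`, `X ⊗ 1 ↦ X`, `X ⊗ X ↦ 0`.
On `𝒜 ⊗ X𝒜 → X𝒜` it restricts to merging a closed component into the segment component. -/
def mergeCoeff : Bool → Bool → Bool → ℤ
  | true, true, true => 1
  | true, false, false => 1
  | false, true, false => 1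
  | _, _, _ => 0

/-- Structure constants of the comultiplication `𝒜 → 𝒜 ⊗ 𝒜`:
`1 ↦ 1 ⊗ X + X ⊗ 1`, `X ↦ X ⊗ X`.
On `X𝒜 → 𝒜 ⊗ X𝒜` it restricts to dividing a closed component from the segment component. -/
def splitCoeff : Bool → Bool → Bool → ℤ
  | true, true, false => 1
  | true, false, true => 1
  | false, false, false => 1
  | _, _, _ => 0

open Classical in
/-- The coefficient of `h` in the image of `g` under the edge map which changes the smoothing of the
crossing `c` from `0` to `1`.  It is the identity on the components that do not touch `c`; on those
that do, it merges two components into one, or divides one component into two, or it is the map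
`∇ = 0` if one component is turned into one.  The sign comes from moving `c` to its place in the
wedge product. -/
noncomputable def edgeCoeff (c : Fin D.n) (g h : D.Generator) : ℤ :=
  if g.state c = false ∧ h.state = Function.update g.state c true ∧
      ∀ e : D.Edge, D.comp g.state e ≠ D.comp g.state (D.edge c 0) →
        D.comp g.state e ≠ D.comp g.state (D.edge c 2) →
          h.label (D.comp h.state e) = g.label (D.comp g.state e) then
    (-1) ^ (Finset.univ.filter fun c' => c' < c ∧ g.state c' = true).card *
      (if D.comp g.state (D.edge c 0) ≠ D.comp g.state (D.edge c 2) then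
        mergeCoeff (g.label (D.comp g.state (D.edge c 0))) (g.label (D.comp g.state (D.edge c 2)))
          (h.label (D.comp h.state (D.edge c 0)))
      else if D.comp h.state (D.edge c 0) ≠ D.comp h.state (D.edge c 2) then
        splitCoeff (g.label (D.comp g.state (D.edge c 0)))
          (h.label (D.comp h.state (D.edge c 0))) (h.label (D.comp h.state (D.edge c 2)))
      else 0)
  else 0

/-- The chains of homological degree `i` spanned by the generators with property `P`. -/
abbrev Chain (P : D.Generator → Prop) (i : ℤ) : Type := {g : D.Generator // g.hDeg = i ∧ P g} → ℚ

open Classical in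
/-- The sum of all edge maps from homological degree `i` to homological degree `i'`. -/
noncomputable def diff (P : D.Generator → Prop) (i i' : ℤ) :
    D.Chain P i →ₗ[ℚ] D.Chain P i' :=
  Matrix.mulVecLin (Matrix.of fun h g => ((∑ c : Fin D.n, D.edgeCoeff c g.1 h.1 : ℤ) : ℚ))

/-- Cycles modulo boundaries in homological degree `i`. -/
abbrev Homology (P : D.Generator → Prop) (i : ℤ) : Type :=
  LinearMap.ker (D.diff P i (i + 1)) ⧸
    (LinearMap.range (D.diff P (i - 1) i)).submoduleOf (LinearMap.ker (D.diff P i (i + 1)))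

/-- The winding homology `H_{i,j}^k`. -/
abbrev windingHomology (i j k : ℤ) : Type := D.Homology (fun g => g.qDeg = j ∧ g.uDeg = k) i

/-- The Khovanov homology `H_{i,j}`, ignoring the `u`-grading. -/
abbrev khovanovHomology (i j : ℤ) : Type := D.Homology (fun g => g.qDeg = j) i

end KnotoidCode

/-- An oriented knotoid diagram in the sphere. -/
structure KnotoidDiagram extends KnotoidCode where
  spherical : toKnotoidCode.IsSpherical

namespace KnotoidDiagram

/-- The mirror image. -/
def mir (K : KnotoidDiagram) : KnotoidDiagram := ⟨K.toKnotoidCode.mir, K.spherical.mir⟩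

/-- The symmetric reflection. -/
def sym (K : KnotoidDiagram) : KnotoidDiagram := ⟨K.toKnotoidCode.sym, K.spherical.sym⟩

/-- `Sym(Mir(K))`. -/
def symMir (K : KnotoidDiagram) : KnotoidDiagram := K.mir.sym

def SameJones (K L : KnotoidDiagram) : Prop := K.jones = L.jones

def SameTuraev (K L : KnotoidDiagram) : Prop := K.turaev = L.turaev

def SameKhovanov (K L : KnotoidDiagram) : Prop :=
  ∀ i j : ℤ, Nonempty (K.khovanovHomology i j ≃ₗ[ℚ] L.khovanovHomology i j)

def SameTuraevAndKhovanov (K L : KnotoidDiagram) : Prop := SameTuraev K L ∧ SameKhovanov K L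

def SameWinding (K L : KnotoidDiagram) : Prop :=
  ∀ i j k : ℤ, Nonempty (K.windingHomology i j k ≃ₗ[ℚ] L.windingHomology i j k)

/-- An invariant is stated by the relation of having the same value.  The first invariant determines
the second one. -/
def Determines (I J : KnotoidDiagram → KnotoidDiagram → Prop) : Prop := ∀ K L, I K L → J K L

/-- The first invariant is (strictly) stronger than the second one: it determines the second one,
and distinguishes a pair which the second one does not distinguish. -/
def Stronger (I J : KnotoidDiagram → KnotoidDiagram → Prop) : Prop :=
  Determines I J ∧ ∃ K L, J K L ∧ ¬ I K L

end KnotoidDiagram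

/-! ### The nine diagrams

Each is obtained from the minimal diagram of a prime knot, given by its least Dowker-Thistlethwaite
code, by cutting the arc before the first pass and deleting the passes at the end of the walk: the
last one for `K1` (from `11a138`), `K2` (from the mirror image of `11a285`), `K3` (`11a217`), `K4`
(`13n3187`), `K5` (`11n113`), `K6` (`13n2685`), and the last two for `K7` (`14n3532`), `K8`
(`14n12378`), `K9` (`14n22768`). -/

namespace KnotoidCode

/-- The code of `K1`. -/
def code1 : KnotoidCode where
  n := 10
  underPass := ![3, 1, 9, 14, 5, 13, 7, 16, 11, 18]
  overPass := ![0, 10, 2, 4, 19, 6, 17, 8, 15, 12]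
  pos := ![true, false, false, false, false, true, true, true, true, true]
  bij := by decide

theorem spherical1 : code1.IsSpherical :=
  code1.isSpherical_of_tables (k := 4)
    (fun x => cond x.2
      (![0, 2, 4, 0, 0, 6, 6, 0, 10, 0, 1, 2, 5, 7, 6, 5, 9, 10, 9, 5, 6] x.1)
      (![0, 1, 3, 1, 2, 5, 7, 8, 9, 4, 3, 4, 9, 8, 0, 2, 4, 0, 8, 7, 6] x.1))
    ![(0, false), (1, false), (1, true), (2, false), (2, true), (5, false), (5, true), (6, false), (7, false), (8, false), (8, true)]
    (fun x => cond x.2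
      (![(0, false), (1, true), (2, true), (0, false), (0, true), (5, true), (14, true), (17, false), (8, true), (3, true), (1, false), (1, true), (15, true), (6, false), (5, true), (5, false), (8, false), (8, true), (8, false), (5, false), (5, true)] x.1)
      (![(0, false), (1, false), (2, false), (1, false), (1, true), (5, false), (6, false), (7, false), (8, false), (2, true), (2, false), (2, true), (18, true), (7, false), (4, true), (4, false), (11, false), (9, true), (7, false), (6, false), (20, true)] x.1))
    (by decide) (by decide) (by decide) (by decide) (by decide) (by decide)

/-- The code of `K2`. -/
def code2 : KnotoidCode where
  n := 10
  underPass := ![0, 12, 2, 17, 4, 6, 19, 8, 10, 15]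
  overPass := ![5, 1, 9, 3, 14, 13, 7, 18, 16, 11]
  pos := ![false, true, true, true, true, false, true, true, false, false]
  bij := by decide

theorem spherical2 : code2.IsSpherical :=
  code2.isSpherical_of_tables (k := 3)
    (fun x => cond x.2
      (![0, 2, 4, 6, 8, 0, 0, 8, 8, 6, 5, 7, 1, 2, 0, 1, 3, 5, 6, 4, 8] x.1)
      (![0, 1, 3, 5, 7, 1, 2, 4, 9, 4, 3, 10, 3, 4, 8, 7, 10, 7, 8, 9, 8] x.1))
    ![(0, false), (1, false), (1, true), (2, false), (2, true), (3, false), (3, true), (4, false), (4, true), (8, false), (11, false)]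
    (fun x => cond x.2
      (![(0, false), (1, true), (2, true), (3, true), (4, true), (0, false), (0, true), (14, false), (18, false), (3, true), (3, false), (17, false), (1, false), (1, true), (5, true), (5, false), (12, false), (3, false), (3, true), (9, false), (7, true)] x.1)
      (![(0, false), (1, false), (2, false), (3, false), (4, false), (1, false), (1, true), (13, false), (8, false), (2, true), (2, false), (11, false), (2, false), (2, true), (4, true), (4, false), (11, false), (4, false), (4, true), (8, false), (8, true)] x.1))
    (by decide) (by decide) (by decide) (by decide) (by decide) (by decide)

/-- The code of `K3`. -/
def code3 : KnotoidCode where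
  n := 10
  underPass := ![3, 1, 11, 16, 5, 13, 7, 18, 9, 15]
  overPass := ![0, 12, 2, 4, 17, 6, 14, 8, 19, 10]
  pos := ![true, false, false, false, false, true, true, false, false, true]
  bij := by decide

theorem spherical3 : code3.IsSpherical :=
  code3.isSpherical_of_tables (k := 3)
    (fun x => cond x.2
      (![0, 2, 4, 0, 0, 6, 7, 8, 7, 6, 6, 0, 1, 2, 7, 9, 6, 5, 6, 10, 6] x.1)
      (![0, 1, 3, 1, 2, 5, 2, 4, 9, 10, 9, 4, 3, 4, 8, 4, 0, 2, 7, 9, 6] x.1))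
    ![(0, false), (1, false), (1, true), (2, false), (2, true), (5, false), (5, true), (6, true), (7, true), (8, false), (9, false)]
    (fun x => cond x.2
      (![(0, false), (1, true), (2, true), (0, false), (0, true), (5, true), (6, true), (7, true), (18, false), (18, true), (16, true), (3, true), (1, false), (1, true), (6, true), (8, false), (5, true), (5, false), (5, true), (9, false), (9, true)] x.1)
      (![(0, false), (1, false), (2, false), (1, false), (1, true), (5, false), (13, true), (13, false), (8, false), (9, false), (15, true), (2, true), (2, false), (2, true), (7, true), (11, false), (11, true), (4, false), (6, true), (8, false), (10, true)] x.1))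
    (by decide) (by decide) (by decide) (by decide) (by decide) (by decide)

/-- The code of `K4`. -/
def code4 : KnotoidCode where
  n := 12
  underPass := ![3, 1, 11, 16, 5, 15, 21, 8, 19, 10, 13, 22]
  overPass := ![0, 12, 2, 4, 23, 6, 7, 20, 9, 18, 17, 14]
  pos := ![true, false, false, false, false, true, false, false, false, false, true, true]
  bij := by decide

theorem spherical4 : code4.IsSpherical :=
  code4.isSpherical_of_tables (k := 5)
    (fun x => cond x.2
      (![0, 2, 4, 0, 0, 6, 6, 0, 10, 0, 12, 0, 1, 2, 5, 7, 6, 5, 9, 12, 9, 10, 9, 5, 6] x.1)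
      (![0, 1, 3, 1, 2, 5, 7, 8, 9, 11, 9, 4, 3, 4, 9, 8, 0, 2, 4, 0, 11, 0, 8, 7, 6] x.1))
    ![(0, false), (1, false), (1, true), (2, false), (2, true), (5, false), (5, true), (6, false), (7, false), (8, false), (8, true), (9, false), (10, true)]
    (fun x => cond x.2
      (![(0, false), (1, true), (2, true), (0, false), (0, true), (5, true), (16, true), (16, false), (8, true), (19, false), (10, true), (3, true), (1, false), (1, true), (17, true), (6, false), (5, true), (5, false), (14, false), (10, true), (8, false), (8, true), (8, false), (5, false), (5, true)] x.1)
      (![(0, false), (1, false), (2, false), (1, false), (1, true), (5, false), (6, false), (7, false), (8, false), (9, false), (20, true), (2, true), (2, false), (2, true), (22, true), (7, false), (4, true), (4, false), (13, false), (11, true), (9, false), (9, true), (7, false), (6, false), (24, true)] x.1))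
    (by decide) (by decide) (by decide) (by decide) (by decide) (by decide)

/-- The code of `K5`. -/
def code5 : KnotoidCode where
  n := 10
  underPass := ![3, 1, 9, 4, 19, 16, 7, 14, 11, 18]
  overPass := ![0, 10, 2, 13, 5, 6, 15, 8, 17, 12]
  pos := ![true, false, false, false, true, false, false, false, false, false]
  bij := by decide

theorem spherical5 : code5.IsSpherical :=
  code5.isSpherical_of_tables (k := 3)
    (fun x => cond x.2
      (![0, 2, 4, 0, 0, 6, 6, 8, 6, 0, 1, 2, 10, 2, 0, 4, 8, 4, 2, 5, 6] x.1)
      (![0, 1, 3, 1, 2, 5, 7, 4, 9, 4, 3, 4, 7, 5, 6, 9, 6, 7, 10, 7, 6] x.1))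
    ![(0, false), (1, false), (1, true), (2, false), (2, true), (5, false), (5, true), (6, false), (7, true), (8, false), (12, true)]
    (fun x => cond x.2
      (![(0, false), (1, true), (2, true), (0, false), (0, true), (5, true), (20, false), (7, true), (14, false), (3, true), (1, false), (1, true), (12, true), (4, false), (9, true), (9, false), (7, true), (11, false), (11, true), (5, false), (5, true)] x.1)
      (![(0, false), (1, false), (2, false), (1, false), (1, true), (5, false), (6, false), (17, true), (8, false), (2, true), (2, false), (2, true), (19, false), (5, false), (5, true), (8, false), (8, true), (6, false), (12, true), (6, false), (20, true)] x.1))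
    (by decide) (by decide) (by decide) (by decide) (by decide) (by decide)

/-- The code of `K6`. -/
def code6 : KnotoidCode where
  n := 12
  underPass := ![3, 1, 9, 4, 19, 6, 12, 8, 16, 21, 14, 23]
  overPass := ![0, 10, 2, 17, 5, 20, 7, 15, 11, 13, 22, 18]
  pos := ![true, false, false, false, false, false, true, true, true, false, false, false]
  bij := by decide

theorem spherical6 : code6.IsSpherical :=
  code6.isSpherical_of_tables (k := 4)
    (fun x => cond x.2
      (![0, 2, 4, 0, 0, 6, 8, 9, 11, 0, 1, 2, 5, 9, 8, 0, 4, 2, 0, 8, 7, 8, 12, 8, 6] x.1)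
      (![0, 1, 3, 1, 2, 5, 7, 5, 10, 4, 3, 4, 10, 11, 12, 11, 10, 5, 6, 6, 5, 9, 11, 0, 6] x.1))
    ![(0, false), (1, false), (1, true), (2, false), (2, true), (5, false), (5, true), (6, false), (6, true), (7, true), (8, false), (8, true), (14, false)]
    (fun x => cond x.2
      (![(0, false), (1, true), (2, true), (0, false), (0, true), (5, true), (6, true), (7, true), (8, true), (3, true), (1, false), (1, true), (17, false), (7, true), (21, true), (9, true), (11, false), (4, false), (4, true), (6, true), (6, false), (6, true), (14, false), (19, true), (19, false)] x.1)
      (![(0, false), (1, false), (2, false), (1, false), (1, true), (5, false), (6, false), (20, false), (8, false), (2, true), (2, false), (2, true), (8, false), (8, true), (14, false), (8, true), (8, false), (5, false), (5, true), (5, true), (5, false), (7, true), (13, false), (15, true), (18, false)] x.1))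
    (by decide) (by decide) (by decide) (by decide) (by decide) (by decide)

/-- The code of `K7`. -/
def code7 : KnotoidCode where
  n := 12
  underPass := ![3, 1, 7, 4, 13, 8, 9, 16, 20, 19, 23, 21]
  overPass := ![0, 6, 2, 12, 5, 18, 22, 10, 11, 14, 15, 17]
  pos := ![true, true, true, true, true, false, false, false, false, true, true, false]
  bij := by decide

theorem spherical7 : code7.IsSpherical :=
  code7.isSpherical_of_tables (k := 4)
    (fun x => cond x.2
      (![0, 2, 4, 0, 0, 6, 4, 3, 4, 8, 10, 12, 6, 5, 6, 12, 12, 11, 0, 4, 6, 0, 7, 8, 12] x.1)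
      (![0, 1, 3, 1, 2, 5, 2, 1, 0, 7, 9, 11, 0, 2, 4, 8, 10, 9, 7, 8, 12, 11, 9, 10, 12] x.1))
    ![(0, false), (1, false), (1, true), (2, false), (2, true), (5, false), (5, true), (9, false), (9, true), (10, false), (10, true), (11, false), (11, true)]
    (fun x => cond x.2
      (![(0, false), (1, true), (2, true), (0, false), (0, true), (5, true), (2, true), (2, false), (2, true), (9, true), (10, true), (11, true), (5, true), (5, false), (5, true), (20, false), (11, true), (11, false), (8, false), (8, true), (12, true), (18, true), (9, false), (9, true), (24, false)] x.1)
      (![(0, false), (1, false), (2, false), (1, false), (1, true), (5, false), (1, true), (1, false), (3, true), (9, false), (10, false), (11, false), (4, true), (4, false), (6, true), (19, false), (10, true), (10, false), (9, false), (9, true), (11, true), (11, false), (10, false), (10, true), (16, true)] x.1))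
    (by decide) (by decide) (by decide) (by decide) (by decide) (by decide)

/-- The code of `K8`. -/
def code8 : KnotoidCode where
  n := 12
  underPass := ![3, 1, 8, 15, 5, 13, 20, 16, 11, 12, 21, 23]
  overPass := ![0, 9, 2, 4, 22, 6, 7, 10, 17, 19, 14, 18]
  pos := ![true, false, false, false, true, true, true, false, false, true, true, false]
  bij := by decide

theorem spherical8 : code8.IsSpherical :=
  code8.isSpherical_of_tables (k := 3)
    (fun x => cond x.2
      (![0, 2, 4, 0, 0, 6, 8, 10, 0, 1, 2, 5, 12, 7, 8, 6, 5, 11, 5, 7, 9, 10, 8, 7, 12] x.1)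
      (![0, 1, 3, 1, 2, 5, 7, 9, 4, 3, 4, 11, 4, 9, 10, 0, 2, 4, 12, 12, 4, 0, 6, 5, 12] x.1))
    ![(0, false), (1, false), (1, true), (2, false), (2, true), (5, false), (5, true), (6, false), (6, true), (7, false), (7, true), (11, false), (12, true)]
    (fun x => cond x.2
      (![(0, false), (1, true), (2, true), (0, false), (0, true), (5, true), (6, true), (7, true), (3, true), (1, false), (1, true), (16, true), (12, true), (6, false), (6, true), (5, true), (5, false), (11, false), (23, false), (23, true), (7, false), (7, true), (6, true), (6, false), (19, false)] x.1)
      (![(0, false), (1, false), (2, false), (1, false), (1, true), (5, false), (6, false), (7, false), (2, true), (2, false), (2, true), (11, false), (17, false), (7, false), (7, true), (4, true), (4, false), (10, false), (12, true), (12, true), (8, false), (8, true), (5, true), (5, false), (18, false)] x.1))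
    (by decide) (by decide) (by decide) (by decide) (by decide) (by decide)

/-- The code of `K9`. -/
def code9 : KnotoidCode where
  n := 12
  underPass := ![5, 1, 9, 3, 16, 15, 7, 23, 18, 11, 22, 14]
  overPass := ![0, 12, 2, 19, 4, 6, 20, 8, 10, 17, 13, 21]
  pos := ![true, false, false, false, false, true, true, true, true, true, false, false]
  bij := by decide

theorem spherical9 : code9.IsSpherical :=
  code9.isSpherical_of_tables (k := 3)
    (fun x => cond x.2
      (![0, 2, 4, 6, 8, 0, 0, 8, 6, 6, 5, 7, 1, 2, 12, 2, 0, 1, 3, 5, 6, 10, 12, 10, 6] x.1)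
      (![0, 1, 3, 5, 7, 1, 2, 9, 10, 4, 3, 11, 3, 4, 10, 9, 8, 7, 11, 7, 8, 9, 2, 4, 6] x.1))
    ![(0, false), (1, false), (1, true), (2, false), (2, true), (3, false), (3, true), (4, false), (4, true), (7, false), (8, false), (11, false), (14, true)]
    (fun x => cond x.2
      (![(0, false), (1, true), (2, true), (3, true), (4, true), (0, false), (0, true), (20, false), (20, true), (3, true), (3, false), (19, false), (1, false), (1, true), (14, true), (6, false), (5, true), (5, false), (12, false), (3, false), (3, true), (8, false), (14, true), (8, false), (24, false)] x.1)
      (![(0, false), (1, false), (2, false), (3, false), (4, false), (1, false), (1, true), (7, false), (8, false), (2, true), (2, false), (11, false), (2, false), (2, true), (21, true), (7, false), (4, true), (4, false), (11, false), (4, false), (4, true), (7, false), (13, true), (13, false), (9, true)] x.1))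
    (by decide) (by decide) (by decide) (by decide) (by decide) (by decide)

end KnotoidCode

namespace KnotoidDiagram

def K1 : KnotoidDiagram := ⟨KnotoidCode.code1, KnotoidCode.spherical1⟩

def K2 : KnotoidDiagram := ⟨KnotoidCode.code2, KnotoidCode.spherical2⟩

def K3 : KnotoidDiagram := ⟨KnotoidCode.code3, KnotoidCode.spherical3⟩

def K4 : KnotoidDiagram := ⟨KnotoidCode.code4, KnotoidCode.spherical4⟩

def K5 : KnotoidDiagram := ⟨KnotoidCode.code5, KnotoidCode.spherical5⟩

def K6 : KnotoidDiagram := ⟨KnotoidCode.code6, KnotoidCode.spherical6⟩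

def K7 : KnotoidDiagram := ⟨KnotoidCode.code7, KnotoidCode.spherical7⟩

def K8 : KnotoidDiagram := ⟨KnotoidCode.code8, KnotoidCode.spherical8⟩

def K9 : KnotoidDiagram := ⟨KnotoidCode.code9, KnotoidCode.spherical9⟩

end KnotoidDiagram

/-! A state cuts the diagram into circles and one segment, and everything rests on how these change
when a single smoothing changes. Turning at smoothed crossings and reversing darts are two
involutions. The orbit of a loose end under their product is a cycle on which both act as
reflections, so every path has exactly two ends. Hence the leg and the head lie on one component,
and changing the smoothing at a crossing where two components meet always merges them
(`rel_of_not_rel`). That a component which meets itself is divided may fail for the segment, and for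
circles it needs the sphere. Comparing dimensions, with `n + 1` regions, shows that every flow on
the edges is the coboundary of a function on the regions (`exists_potential`). For a circle and
coefficients modulo `2` this is a checkerboard colouring, which forces the division
(`not_rel_of_rel`). With rational coefficients it shows that a closed curve off the segment has
intersection number zero with the shortcut (`dotShortcut_eq_zero`). As merging only inserts such a
curve into the segment, or leaves the segment alone, the differential preserves the `u`-grading. To
square the differential, a generator is written as a product of variables, one for each edge of a
list. Variables of edges on one component are equal, their squares are zero, and those on the
segment are zero. Merging keeps the product, and dividing at `c` multiplies it by the sum of the
variables of the half-edges `0` and `2`. When one component stays one component, it is the segment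
and the factor is zero, in agreement with the zero map. In this form faces commute by cases, and the
exterior signs make them anticommute (`sum_totalCoeff_mul`). Dimensions of homology are then
expressed by nullities and counts (`finrank_homology`), which add up over any grading that the
differential preserves. Expanding each factor `-A² - A⁻²` over the two labels of a circle identifies
the coefficients of the Jones and Turaev polynomials, up to sign, with Euler characteristics in
fixed gradings. So winding homology determines the Turaev polynomial, Khovanov homology determines
the Jones polynomial, Khovanov homology is the sum of the winding homologies over `k`, and `u = 1`
turns the Turaev into the Jones polynomial. The diagram Sym(Mir(K)) has the same components and edge
maps as `K`, while its shortcut crosses the complementary half-edges, so that only `u` changes sign.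
What remains are finite facts about nine diagrams. Generators are coded by natural numbers, a mask
of `1`-smoothings and a mask of the edges labelled `X`, and the kernel evaluates the following
certificates. Vanishing: ranks modulo `2` of hashed columns bound the rational ranks from below, and
if the ranks on both sides already add up to the number of generators, there is no homology
(`finrank_homology_eq_zero`). Non-vanishing: an explicit integral cycle has nonzero pairing with an
explicit cocycle (`finrank_homology_ne_zero`). Polynomials: all signed counts of generators are the
digits of one integer in base `2 ^ 40` (`packed_eq_iff`). For `K1` and `K2` the Khovanov homology is
confined to `j / 2 = i`, so the Jones polynomial determines it (`sameKhovanov_of_diagonal`). -/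

/-! ### Orbits of the group generated by two involutions -/

section Dihedral

open Function

variable {α : Type*} {r σ : α → α} {a : α}

/-- The orbit of a fixed point `a` of `σ` under `r ∘ σ`, where `r` has no fixed points, is a cycle of
even length `2 * m` on which `σ` and `r` act as reflections. -/
structure IsDihedralCycle (r σ : α → α) (a : α) (m : ℕ) : Prop where
  pos : 0 < m
  inj : ∀ i < 2 * m, ∀ j < 2 * m, (r ∘ σ)^[i] a = (r ∘ σ)^[j] a → i = j
  period : (r ∘ σ)^[2 * m] a = a
  turn : ∀ i ≤ 2 * m, σ ((r ∘ σ)^[i] a) = (r ∘ σ)^[2 * m - i] a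
  rev : ∀ i ≤ 2 * m, r ((r ∘ σ)^[i] a) = (r ∘ σ)^[2 * m - i + 1] a

/-- Conjugation by `σ` inverts `r ∘ σ` and `σ` fixes `a`, so both involutions act on the orbit of
`a` as reflections. The period is even, since for a period `2k + 1` the point number `k + 1` would
be fixed by `r`. -/
theorem exists_isDihedralCycle [Finite α] (hr : Involutive r) (hσ : Involutive σ) (hr0 : ∀ x, r x ≠ x)
    (ha : σ a = a) : ∃ m, IsDihedralCycle r σ a m := by
  set τ := r ∘ σ with hτ
  have hinj : Injective τ := hr.injective.comp hσ.injective
  have hN : 0 < minimalPeriod τ a :=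
    minimalPeriod_pos_of_mem_periodicPts (hinj.mem_periodicPts a)
  set N := minimalPeriod τ a with hNdef
  have hNa : τ^[N] a = a := iterate_minimalPeriod
  have h1 : ∀ i, τ^[i] (σ (τ^[i] a)) = a := by
    intro i
    induction i with
    | zero => simpa using ha
    | succ i ih =>
      rw [iterate_succ_apply' τ i a, iterate_succ_apply]
      have : τ (σ (τ (τ^[i] a))) = σ (τ^[i] a) := by
        simp [hτ, hσ _, hr _]
      rw [this, ih]
  have h2 : ∀ i ≤ N, σ (τ^[i] a) = τ^[N - i] a := by
    intro i hi
    apply hinj.iterate i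
    rw [h1, ← iterate_add_apply, Nat.add_sub_cancel' hi, hNa]
  have h3 : ∀ i ≤ N, r (τ^[i] a) = τ^[N - i + 1] a := by
    intro i hi
    rw [iterate_succ_apply', ← h2 i hi]
    simp [hτ, hσ _]
  have heven : Even N := by
    by_contra hodd
    rw [Nat.not_even_iff_odd] at hodd
    obtain ⟨k, hk⟩ := hodd
    have := h3 (k + 1) (by omega)
    rw [show N - (k + 1) + 1 = k + 1 by omega] at this
    exact hr0 _ this
  obtain ⟨m, hm⟩ := heven
  have hm2 : N = 2 * m := by omega
  refine ⟨m, by omega, ?_, hm2 ▸ hNa, hm2 ▸ h2, hm2 ▸ h3⟩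
  intro i hi j hj hij
  exact iterate_injOn_Iio_minimalPeriod (f := τ) (x := a) (by simpa [← hNdef, hm2] using hi)
    (by simpa [← hNdef, hm2] using hj) hij

theorem IsDihedralCycle.turn_mid {m : ℕ} (h : IsDihedralCycle r σ a m) :
    σ ((r ∘ σ)^[m] a) = (r ∘ σ)^[m] a := by
  rw [h.turn m (by have := h.pos; omega)]
  congr 2
  omega

theorem IsDihedralCycle.mid_ne {m : ℕ} (h : IsDihedralCycle r σ a m) : (r ∘ σ)^[m] a ≠ a := by
  intro h0
  have := h.inj m (by have := h.pos; omega) 0 (by have := h.pos; omega) h0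
  exact h.pos.ne' this

/-- The reflection `i ↦ 2m - i` of a cycle of length `2m` fixes `0` and `m` only. This is why a path
has precisely two ends. -/
theorem IsDihedralCycle.eq_zero_or_mid {m : ℕ} (h : IsDihedralCycle r σ a m) {i : ℕ}
    (hi : i < 2 * m) (hf : σ ((r ∘ σ)^[i] a) = (r ∘ σ)^[i] a) : i = 0 ∨ i = m := by
  rcases Nat.eq_zero_or_pos i with h0 | h0
  · exact Or.inl h0
  · rw [h.turn i hi.le] at hf
    have := h.inj _ (by omega) _ hi hf
    omega

theorem IsDihedralCycle.exists_rev {m : ℕ} (h : IsDihedralCycle r σ a m) {i : ℕ}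
    (hi : i < 2 * m) : ∃ j < 2 * m, r ((r ∘ σ)^[i] a) = (r ∘ σ)^[j] a := by
  rw [h.rev i hi.le]
  rcases Nat.eq_zero_or_pos i with rfl | h0
  · refine ⟨1, (by have := h.pos; omega : 1 < 2 * m), ?_⟩
    rw [Nat.sub_zero, Function.iterate_succ_apply', h.period]
    rfl
  · rcases Nat.lt_or_ge 1 i with h1 | h1
    · exact ⟨2 * m - i + 1, by omega, rfl⟩
    · obtain rfl : i = 1 := by omega
      refine ⟨0, by omega, ?_⟩
      rw [show 2 * m - 1 + 1 = 2 * m by omega, h.period]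
      rfl

theorem IsDihedralCycle.exists_turn {m : ℕ} (h : IsDihedralCycle r σ a m) {i : ℕ}
    (hi : i < 2 * m) : ∃ j < 2 * m, σ ((r ∘ σ)^[i] a) = (r ∘ σ)^[j] a := by
  rw [h.turn i hi.le]
  rcases Nat.eq_zero_or_pos i with rfl | h0
  · exact ⟨0, by omega, by rw [Nat.sub_zero, h.period]; rfl⟩
  · exact ⟨_, by omega, rfl⟩

end Dihedral

namespace KnotoidCode

variable (D : KnotoidCode)

/-! ### Darts -/

/-- The dart with the opposite direction. -/
def rev (d : D.Dart) : D.Dart := (d.1, !d.2)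

@[simp] theorem rev_rev (d : D.Dart) : D.rev (D.rev d) = d := by simp [rev]

theorem rev_ne (d : D.Dart) : D.rev d ≠ d := by
  intro h
  have := congrArg Prod.snd h
  simp [rev] at this

theorem eq_or_eq_rev_of_fst_eq {d d' : D.Dart} (h : d.1 = d'.1) : d = d' ∨ d = D.rev d' := by
  obtain ⟨e, b⟩ := d
  obtain ⟨e', b'⟩ := d'
  obtain rfl : e = e' := h
  cases b <;> cases b' <;> simp [rev]

@[simp] theorem rev_dartIn (c : Fin D.n) (p : Fin 4) : D.rev (D.dartIn c p) = D.dartOut c p := rfl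

@[simp] theorem rev_dartOut (c : Fin D.n) (p : Fin 4) : D.rev (D.dartOut c p) = D.dartIn c p := by
  rw [← rev_dartIn, rev_rev]

/-- The dart that ends at the leg. -/
def legDart : D.Dart := (0, false)

/-- The dart that ends at the head. -/
def headDart : D.Dart := (Fin.last _, true)

/-- The pass on which the half-edge `p` of `c` lies. -/
def passOf (c : Fin D.n) (p : Fin 4) : Fin (2 * D.n) :=
  if p = 0 ∨ p = 2 then D.underPass c else D.overPass c

theorem dartIn_eq (c : Fin D.n) (p : Fin 4) :
    D.dartIn c p = ((if D.inward c p then (D.passOf c p).castSucc else (D.passOf c p).succ),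
      D.inward c p) := by
  cases h : D.pos c <;> fin_cases p <;> simp [dartIn, inward, edge, passOf, h]

theorem passOf_inj {c c' : Fin D.n} {p p' : Fin 4} (h : D.passOf c p = D.passOf c' p') :
    c = c' ∧ ((p = 0 ∨ p = 2) ↔ (p' = 0 ∨ p' = 2)) := by
  have hi := D.bij.1
  unfold passOf at h
  split_ifs at h with h1 h2 h2
  · have := @hi (.inl c) (.inl c') h
    simp_all
  · have := @hi (.inl c) (.inr c') h
    simp_all
  · have := @hi (.inr c) (.inl c') h
    simp_all
  · have := @hi (.inr c) (.inr c') h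
    simp_all

/-- A dart is determined by the pass it runs into and its direction, and by `bij` a pass is one
strand of one crossing. So `(c, p)` is an unambiguous name for an arrival at a crossing. -/
theorem dartIn_inj {c c' : Fin D.n} {p p' : Fin 4} (h : D.dartIn c p = D.dartIn c' p') :
    c = c' ∧ p = p' := by
  rw [dartIn_eq, dartIn_eq, Prod.mk.injEq] at h
  obtain ⟨h1, h2⟩ := h
  have h3 : D.passOf c p = D.passOf c' p' := by
    rw [h2] at h1
    split_ifs at h1
    · exact Fin.castSucc_injective _ h1
    · exact Fin.succ_injective _ h1
  obtain ⟨rfl, h4⟩ := D.passOf_inj h3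
  refine ⟨rfl, ?_⟩
  cases h : D.pos c <;> fin_cases p <;> fin_cases p' <;> simp_all [inward]

theorem dartIn_ne_legDart (c : Fin D.n) (p : Fin 4) : D.dartIn c p ≠ D.legDart := by
  rw [dartIn_eq, legDart]
  intro h
  rw [Prod.mk.injEq] at h
  rw [h.2] at h
  simp at h

theorem dartIn_ne_headDart (c : Fin D.n) (p : Fin 4) : D.dartIn c p ≠ D.headDart := by
  rw [dartIn_eq, headDart]
  intro h
  rw [Prod.mk.injEq] at h
  rw [h.2] at h
  simp only [if_true, and_true] at h
  exact absurd h (Fin.castSucc_lt_last _).ne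

theorem exists_passOf (t : Fin (2 * D.n)) (b : Bool) :
    ∃ c p, D.passOf c p = t ∧ D.inward c p = b := by
  obtain ⟨c | c, hc⟩ := D.bij.2 t
  · refine ⟨c, if b then 0 else 2, ?_, ?_⟩ <;> cases b <;> simp_all [passOf, inward]
  · refine ⟨c, if b = D.pos c then 3 else 1, ?_, ?_⟩ <;> cases b <;> cases h : D.pos c <;>
      simp_all [passOf, inward]

theorem exists_dartIn {d : D.Dart} (h1 : d ≠ D.legDart) (h2 : d ≠ D.headDart) :
    ∃ c p, D.dartIn c p = d := by
  obtain ⟨e, b⟩ := d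
  cases b with
  | true =>
    have he : e ≠ Fin.last _ := fun h => h2 (by rw [h]; rfl)
    obtain ⟨t, rfl⟩ := Fin.exists_castSucc_eq.2 he
    obtain ⟨c, p, h3, h4⟩ := D.exists_passOf t true
    exact ⟨c, p, by rw [dartIn_eq, h3, h4]; simp⟩
  | false =>
    have he : e ≠ 0 := fun h => h1 (by rw [h]; rfl)
    obtain ⟨t, rfl⟩ := Fin.exists_succ_eq.2 he
    obtain ⟨c, p, h3, h4⟩ := D.exists_passOf t false
    exact ⟨c, p, by rw [dartIn_eq, h3, h4]; simp⟩

theorem dart_cases (d : D.Dart) : d = D.legDart ∨ d = D.headDart ∨ ∃ c p, D.dartIn c p = d := by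
  by_cases h1 : d = D.legDart
  · exact Or.inl h1
  · by_cases h2 : d = D.headDart
    · exact Or.inr (Or.inl h2)
    · exact Or.inr (Or.inr (D.exists_dartIn h1 h2))

@[simp] theorem partner_partner (b : Bool) (p : Fin 4) : partner b (partner b p) = p := by
  cases b <;> fin_cases p <;> rfl

theorem partner_ne (b : Bool) (p : Fin 4) : partner b p ≠ p := by
  cases b <;> fin_cases p <;> decide

/-! ### Partial states -/

/-- A choice of smoothings at some of the crossings, where `none` is a crossing at which the
four half-edges end. -/
abbrev PState : Type := Fin D.n → Option Bool

/-- A state as a partial state. -/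
def State.toP {D : KnotoidCode} (s : D.State) : D.PState := fun c => some (s c)

/-- Two edges that are connected at a smoothed crossing of a partial state. -/
def JoinedP (f : D.PState) (e e' : D.Edge) : Prop :=
  ∃ (c : Fin D.n) (p : Fin 4) (b : Bool), f c = some b ∧ e = D.edge c p ∧
    e' = D.edge c (partner b p)

/-- Two edges that lie in the same component of a partially smoothed diagram. -/
def Rel (f : D.PState) : D.Edge → D.Edge → Prop := Relation.EqvGen (D.JoinedP f)

theorem joined_eq (s : D.State) : D.Joined s = D.JoinedP (State.toP s) := by
  ext e e'
  constructor
  · rintro ⟨c, p, h1, h2⟩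
    exact ⟨c, p, s c, rfl, h1, h2⟩
  · rintro ⟨c, p, b, h0, h1, h2⟩
    obtain rfl : s c = b := Option.some.inj h0
    exact ⟨c, p, h1, h2⟩

theorem comp_eq_comp_iff {s : D.State} {e e' : D.Edge} :
    D.comp s e = D.comp s e' ↔ D.Rel (State.toP s) e e' := by
  unfold comp Rel
  rw [← joined_eq, Quot.eq]

variable {D}

theorem Rel.refl {f : D.PState} (e : D.Edge) : D.Rel f e e := Relation.EqvGen.refl e

theorem Rel.symm {f : D.PState} {e e' : D.Edge} (h : D.Rel f e e') : D.Rel f e' e :=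
  Relation.EqvGen.symm _ _ h

theorem Rel.trans {f : D.PState} {e e' e'' : D.Edge} (h : D.Rel f e e') (h' : D.Rel f e' e'') :
    D.Rel f e e'' := Relation.EqvGen.trans _ _ _ h h'

theorem rel_edge {f : D.PState} {c : Fin D.n} {b : Bool} (h : f c = some b) (p : Fin 4) :
    D.Rel f (D.edge c p) (D.edge c (partner b p)) :=
  Relation.EqvGen.rel _ _ ⟨c, p, b, h, rfl, rfl⟩

/-- A property of edges that passes through the smoothed crossings is constant on components. -/
theorem Rel.iff_of_forall {f : D.PState} {P : D.Edge → Prop}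
    (h : ∀ c p b, f c = some b → P (D.edge c p) → P (D.edge c (partner b p)))
    {e e' : D.Edge} (hr : D.Rel f e e') : P e ↔ P e' := by
  induction hr with
  | rel x y hxy =>
    obtain ⟨c, p, b, h0, rfl, rfl⟩ := hxy
    refine ⟨h c p b h0, fun h' => ?_⟩
    simpa using h c _ b h0 h'
  | refl x => exact Iff.rfl
  | symm x y _ ih => exact ih.symm
  | trans x y z _ _ ih1 ih2 => exact ih1.trans ih2

theorem Rel.mono_of {f f' : D.PState}
    (h : ∀ c p b, f c = some b → D.Rel f' (D.edge c p) (D.edge c (partner b p)))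
    {e e' : D.Edge} (hr : D.Rel f e e') : D.Rel f' e e' := by
  have := Rel.iff_of_forall (P := fun x => D.Rel f' e x)
    (fun c p b h0 h1 => h1.trans (h c p b h0)) hr
  exact this.1 (Rel.refl e)

variable (D)

open Classical in
/-- Passing from a dart that arrives at a smoothed crossing to the dart that arrives there along the
half-edge which it is connected to. -/
noncomputable def turn (f : D.PState) (d : D.Dart) : D.Dart :=
  -- The darts that arrive at no smoothed crossing are left fixed; these fixed points are the loose
  -- ends.
  if h : ∃ x : Fin D.n × Fin 4 × Bool, f x.1 = some x.2.2 ∧ D.dartIn x.1 x.2.1 = d then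
    D.dartIn h.choose.1 (partner h.choose.2.2 h.choose.2.1) else d

variable {D}

theorem turn_dartIn {f : D.PState} {c : Fin D.n} {b : Bool} (h : f c = some b) (p : Fin 4) :
    D.turn f (D.dartIn c p) = D.dartIn c (partner b p) := by
  have hx : ∃ x : Fin D.n × Fin 4 × Bool, f x.1 = some x.2.2 ∧ D.dartIn x.1 x.2.1 = D.dartIn c p :=
    ⟨(c, p, b), h, rfl⟩
  unfold turn
  rw [dif_pos hx]
  obtain ⟨h1, h2⟩ := hx.choose_spec
  generalize hx.choose = x at h1 h2
  obtain ⟨c', p', b'⟩ := x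
  obtain ⟨h3, h4⟩ := D.dartIn_inj h2
  simp only at h1 h3 h4
  subst h3 h4
  rw [h, Option.some.injEq] at h1
  rw [h1]

theorem turn_eq_self {f : D.PState} {d : D.Dart}
    (h : ∀ c p b, f c = some b → D.dartIn c p ≠ d) : D.turn f d = d := by
  unfold turn
  rw [dif_neg]
  rintro ⟨⟨c, p, b⟩, h1, h2⟩
  exact h c p b h1 h2

theorem turn_dartIn_none {f : D.PState} {c : Fin D.n} (h : f c = none) (p : Fin 4) :
    D.turn f (D.dartIn c p) = D.dartIn c p := by
  apply turn_eq_self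
  intro c' p' b h1 h2
  obtain ⟨rfl, -⟩ := D.dartIn_inj h2
  rw [h] at h1
  cases h1

theorem turn_legDart (f : D.PState) : D.turn f D.legDart = D.legDart :=
  turn_eq_self fun c p _ _ => D.dartIn_ne_legDart c p

theorem turn_headDart (f : D.PState) : D.turn f D.headDart = D.headDart :=
  turn_eq_self fun c p _ _ => D.dartIn_ne_headDart c p

theorem turn_turn (f : D.PState) : Function.Involutive (D.turn f) := by
  intro d
  by_cases h : ∃ c p b, f c = some b ∧ D.dartIn c p = d
  · obtain ⟨c, p, b, h1, rfl⟩ := h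
    rw [turn_dartIn h1, turn_dartIn h1, partner_partner]
  · push Not at h
    rw [turn_eq_self h, turn_eq_self h]

/-- The dart is not an arrival at a smoothed crossing. -/
theorem turn_eq_self_iff {f : D.PState} {d : D.Dart} :
    D.turn f d = d ↔ d = D.legDart ∨ d = D.headDart ∨ ∃ c p, f c = none ∧ D.dartIn c p = d := by
  constructor
  · intro h
    rcases D.dart_cases d with h1 | h1 | ⟨c, p, rfl⟩
    · exact Or.inl h1
    · exact Or.inr (Or.inl h1)
    · refine Or.inr (Or.inr ⟨c, p, ?_, rfl⟩)
      cases hc : f c with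
      | none => rfl
      | some b =>
        rw [turn_dartIn hc] at h
        exact absurd (D.dartIn_inj h).2 (partner_ne b p)
  · rintro (rfl | rfl | ⟨c, p, h, rfl⟩)
    · exact turn_legDart f
    · exact turn_headDart f
    · exact turn_dartIn_none h p

theorem rel_turn (f : D.PState) (d : D.Dart) : D.Rel f d.1 (D.turn f d).1 := by
  by_cases h : ∃ c p b, f c = some b ∧ D.dartIn c p = d
  · obtain ⟨c, p, b, h1, rfl⟩ := h
    rw [turn_dartIn h1]
    exact rel_edge h1 p
  · push Not at h
    rw [turn_eq_self h]
    exact Rel.refl _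

variable (D)

/-- Walking along a dart of a partially smoothed diagram and through the crossing at its end. -/
noncomputable def walk (f : D.PState) : D.Dart → D.Dart := D.rev ∘ D.turn f

variable {D}

theorem rel_walk_iterate (f : D.PState) (d : D.Dart) (i : ℕ) :
    D.Rel f d.1 ((D.walk f)^[i] d).1 := by
  induction i with
  | zero => exact Rel.refl _
  | succ i ih =>
    rw [Function.iterate_succ_apply']
    exact ih.trans (rel_turn f _)

/-- A loose end is one end of a path: walking from it reaches the other end after `m` steps and
comes back along the same edges in the opposite direction. -/
theorem exists_cycle {f : D.PState} {a : D.Dart} (ha : D.turn f a = a) :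
    ∃ m, IsDihedralCycle D.rev (D.turn f) a m :=
  exists_isDihedralCycle D.rev_rev (turn_turn f) D.rev_ne ha

/-- The component of a loose end consists of the darts reached by walking from it. -/
theorem exists_walk_of_rel {f : D.PState} {a : D.Dart} {m : ℕ}
    (h : IsDihedralCycle D.rev (D.turn f) a m) {d : D.Dart} (hr : D.Rel f a.1 d.1) :
    ∃ i < 2 * m, d = (D.walk f)^[i] a := by
  have key : ∀ {d : D.Dart} {i : ℕ}, i < 2 * m → d.1 = ((D.walk f)^[i] a).1 →
      ∃ j < 2 * m, d = (D.walk f)^[j] a := by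
    intro d i hi hd
    rcases D.eq_or_eq_rev_of_fst_eq hd with h1 | h1
    · exact ⟨i, hi, h1⟩
    · obtain ⟨j, hj, h2⟩ := h.exists_rev hi
      exact ⟨j, hj, h1.trans h2⟩
  have h1 := (Rel.iff_of_forall (P := fun e => ∃ i < 2 * m, e = ((D.walk f)^[i] a).1) ?_ hr).1
    ⟨0, by have := h.pos; omega, rfl⟩
  · obtain ⟨i, hi, h1⟩ := h1
    exact key hi h1
  · rintro c p b hc ⟨i, hi, h2⟩
    obtain ⟨j, hj, h3⟩ := key (d := D.dartIn c p) hi h2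
    obtain ⟨k, hk, h4⟩ := h.exists_turn hj
    refine ⟨k, hk, ?_⟩
    unfold walk
    rw [← h4]
    have h5 : D.turn f (D.dartIn c p) = D.dartIn c (partner b p) := turn_dartIn hc p
    rw [h3] at h5
    exact (congrArg Prod.fst h5).symm

/-- Besides `a` there is exactly one loose end in the component of a loose end `a`. -/
theorem loose_eq {f : D.PState} {a : D.Dart} {m : ℕ}
    (h : IsDihedralCycle D.rev (D.turn f) a m) {d : D.Dart} (hd : D.turn f d = d)
    (hr : D.Rel f a.1 d.1) : d = a ∨ d = (D.walk f)^[m] a := by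
  obtain ⟨i, hi, rfl⟩ := exists_walk_of_rel h hr
  rcases h.eq_zero_or_mid hi hd with rfl | rfl
  · exact Or.inl rfl
  · exact Or.inr rfl

theorem loose_unique {f : D.PState} {a b c : D.Dart} (ha : D.turn f a = a) (hb : D.turn f b = b)
    (hc : D.turn f c = c) (hab : D.Rel f a.1 b.1) (hac : D.Rel f a.1 c.1) (h1 : b ≠ a)
    (h2 : c ≠ a) : b = c := by
  obtain ⟨m, hm⟩ := exists_cycle ha
  rw [(loose_eq hm hb hab).resolve_left h1, (loose_eq hm hc hac).resolve_left h2]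

theorem exists_mate {f : D.PState} {a : D.Dart} (ha : D.turn f a = a) :
    ∃ b, b ≠ a ∧ D.turn f b = b ∧ D.Rel f a.1 b.1 := by
  obtain ⟨m, hm⟩ := exists_cycle ha
  exact ⟨(D.walk f)^[m] a, hm.mid_ne, hm.turn_mid, rel_walk_iterate f a m⟩

/-! ### The segment -/

theorem turn_toP_eq_self_iff {s : D.State} {d : D.Dart} :
    D.turn (State.toP s) d = d ↔ d = D.legDart ∨ d = D.headDart := by
  rw [turn_eq_self_iff]
  simp [State.toP]

/-- In a full state the leg and the head are the only loose ends, so each is the mate of the other.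
-/
theorem rel_leg_head (s : D.State) : D.Rel (State.toP s) 0 (Fin.last _) := by
  obtain ⟨b, h1, h2, h3⟩ := exists_mate (turn_legDart (State.toP s))
  rw [(turn_toP_eq_self_iff.1 h2).resolve_left h1] at h3
  exact h3

theorem step_iff {s : D.State} {d d' : D.Dart} :
    D.Step s d d' ↔ d ≠ D.legDart ∧ d ≠ D.headDart ∧ d' = D.walk (State.toP s) d := by
  constructor
  · rintro ⟨c, p⟩
    refine ⟨D.dartIn_ne_legDart c p, D.dartIn_ne_headDart c p, ?_⟩
    unfold walk
    rw [Function.comp_apply, turn_dartIn (b := s c) rfl, rev_dartIn]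
  · rintro ⟨h1, h2, rfl⟩
    obtain ⟨c, p, rfl⟩ := D.exists_dartIn h1 h2
    unfold walk
    rw [Function.comp_apply, turn_dartIn (b := s c) rfl, rev_dartIn]
    exact Step.pass c p

theorem walk_legDart (f : D.PState) : D.walk f D.legDart = (0, true) := by
  unfold walk
  rw [Function.comp_apply, turn_legDart]
  rfl

/-- Steps `1, …, m` of the walk from the leg follow the segment up to the head, and the remaining
steps return along it. Counting starts at `1` because step `0` is the dart that points into the leg.
-/
theorem exists_segment_cycle (s : D.State) :
    ∃ m, IsDihedralCycle D.rev (D.turn (State.toP s)) D.legDart m ∧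
      (D.walk (State.toP s))^[m] D.legDart = D.headDart ∧
      D.segmentCurve s = {d | ∃ i, 1 ≤ i ∧ i ≤ m ∧ d = (D.walk (State.toP s))^[i] D.legDart} := by
  obtain ⟨m, hm⟩ := exists_cycle (turn_legDart (State.toP s))
  have hhead : (D.walk (State.toP s))^[m] D.legDart = D.headDart :=
    (turn_toP_eq_self_iff.1 hm.turn_mid).resolve_left hm.mid_ne
  refine ⟨m, hm, hhead, ?_⟩
  ext d
  have hpos := hm.pos
  constructor
  · intro hd
    induction hd with
    | refl => exact ⟨1, le_rfl, hm.pos, (walk_legDart _).symm⟩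
    | tail _ hst ih =>
      obtain ⟨i, h1, h2, rfl⟩ := ih
      obtain ⟨h3, h4, rfl⟩ := step_iff.1 hst
      refine ⟨i + 1, by omega, ?_, by rw [Function.iterate_succ_apply']⟩
      rcases h2.lt_or_eq with h5 | rfl
      · exact h5
      · exact absurd hhead h4
  · rintro ⟨i, h1, h2, rfl⟩
    induction i, h1 using Nat.le_induction with
    | base => rw [Function.iterate_one, walk_legDart]; exact Relation.ReflTransGen.refl
    | succ i hi ih =>
      refine Relation.ReflTransGen.tail (ih (by omega)) (step_iff.2 ⟨?_, ?_, ?_⟩)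
      · intro h0
        have := hm.inj i (by omega) 0 (by omega) h0
        omega
      · intro h0
        have := hm.inj i (by omega) m (by omega) (h0.trans hhead.symm)
        omega
      · rw [Function.iterate_succ_apply']

theorem headDart_mem_segmentCurve (s : D.State) : D.headDart ∈ D.segmentCurve s := by
  obtain ⟨m, hm, hh, hs⟩ := exists_segment_cycle s
  rw [hs]
  exact ⟨m, hm.pos, le_rfl, hh.symm⟩

theorem start_mem_segmentCurve (s : D.State) : ((0, true) : D.Dart) ∈ D.segmentCurve s :=
  Relation.ReflTransGen.refl

/-- Each edge of the segment is passed in exactly one direction. -/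
theorem rev_mem_segmentCurve_iff {s : D.State} {d : D.Dart} (h : D.Rel (State.toP s) 0 d.1) :
    D.rev d ∈ D.segmentCurve s ↔ d ∉ D.segmentCurve s := by
  obtain ⟨m, hm, hh, hs⟩ := exists_segment_cycle s
  have hpos := hm.pos
  obtain ⟨i, hi, rfl⟩ := exists_walk_of_rel hm (a := D.legDart) h
  have hr : D.rev ((D.walk (State.toP s))^[i] D.legDart)
      = (D.walk (State.toP s))^[2 * m - i + 1] D.legDart := hm.rev i hi.le
  have hmem : ∀ j < 2 * m, ((D.walk (State.toP s))^[j] D.legDart ∈ D.segmentCurve s ↔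
      1 ≤ j ∧ j ≤ m) := by
    intro j hj
    rw [hs]
    constructor
    · rintro ⟨k, h1, h2, h3⟩
      have := hm.inj j hj k (by omega) h3
      omega
    · rintro ⟨h1, h2⟩
      exact ⟨j, h1, h2, rfl⟩
  rcases Nat.eq_zero_or_pos i with rfl | h0
  · have h1 : (D.walk (State.toP s))^[2 * m - 0 + 1] D.legDart
        = (D.walk (State.toP s))^[1] D.legDart := by
      have h2 : (D.walk (State.toP s))^[2 * m] D.legDart = D.legDart := hm.period
      rw [Nat.sub_zero, Function.iterate_succ_apply', h2]
      rfl
    rw [hr, h1, hmem 1 (by omega), hmem 0 (by omega)]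
    simp only [le_refl, true_and]
    omega
  · rcases Nat.lt_or_ge 1 i with h1 | h1
    · rw [hr, hmem _ (by omega), hmem i hi]
      omega
    · obtain rfl : i = 1 := by omega
      have h2 : (D.walk (State.toP s))^[2 * m] D.legDart = (D.walk (State.toP s))^[0] D.legDart :=
        hm.period
      rw [hr, show 2 * m - 1 + 1 = 2 * m by omega, h2, hmem 0 (by omega), hmem 1 (by omega)]
      omega

theorem rel_of_mem_segmentCurve {s : D.State} {d : D.Dart} (h : d ∈ D.segmentCurve s) :
    D.Rel (State.toP s) 0 d.1 := by
  obtain ⟨m, hm, hh, hs⟩ := exists_segment_cycle s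
  rw [hs] at h
  obtain ⟨i, -, -, rfl⟩ := h
  exact rel_walk_iterate (State.toP s) D.legDart i

theorem segmentCurve_step {s : D.State} {c : Fin D.n} {p : Fin 4}
    (h : D.dartIn c p ∈ D.segmentCurve s) : D.dartOut c (partner (s c) p) ∈ D.segmentCurve s :=
  Relation.ReflTransGen.tail h (Step.pass c p)

/-- Suppose that the segment leaves along the partner of `p` without having arrived along `p`. Each
of its edges is passed in exactly one direction, so it also leaves along `p`. By injectivity of the
walk it then arrived along the partner, against the direction in which that edge is passed. -/
theorem segmentCurve_step_iff {s : D.State} {c : Fin D.n} {p : Fin 4} :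
    D.dartOut c (partner (s c) p) ∈ D.segmentCurve s ↔ D.dartIn c p ∈ D.segmentCurve s := by
  refine ⟨fun h => ?_, segmentCurve_step⟩
  have h1 := rel_of_mem_segmentCurve h
  by_contra h2
  have h4 : D.Rel (State.toP s) 0 (D.dartIn c p).1 := by
    have := rel_edge (f := State.toP s) (c := c) (b := s c) rfl (partner (s c) p)
    rw [partner_partner] at this
    exact h1.trans this
  have h3 := (rev_mem_segmentCurve_iff h4).2 h2
  rw [rev_dartIn] at h3
  have h5 : D.dartIn c (partner (s c) p) ∉ D.segmentCurve s := by
    have := (rev_mem_segmentCurve_iff h1).not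
    rw [not_not, rev_dartOut] at this
    exact this.2 h
  -- the dart leaving along `p` was reached from the one arriving along its partner
  obtain ⟨m, hm, hh, hs⟩ := exists_segment_cycle s
  rw [hs] at h3
  obtain ⟨i, hi1, hi2, hi3⟩ := h3
  have h6 : D.dartIn c (partner (s c) p) = (D.walk (State.toP s))^[i - 1] D.legDart := by
    obtain ⟨j, rfl⟩ : ∃ j, i = j + 1 := ⟨i - 1, by omega⟩
    have hw : D.walk (State.toP s) (D.dartIn c (partner (s c) p)) = D.dartOut c p := by
      unfold walk
      rw [Function.comp_apply, turn_dartIn (b := s c) rfl, partner_partner, rev_dartIn]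
    rw [Function.iterate_succ_apply', ← hw] at hi3
    have hinj : Function.Injective (D.walk (State.toP s)) :=
      (Function.Involutive.injective D.rev_rev).comp (turn_turn _).injective
    exact hinj hi3
  apply h5
  rw [hs]
  refine ⟨i - 1, ?_, by omega, h6⟩
  rcases Nat.lt_or_ge (i - 1) 1 with h7 | h7
  · rw [Nat.lt_one_iff.1 h7] at h6
    exact absurd h6 (D.dartIn_ne_legDart _ _)
  · exact h7

end KnotoidCode

namespace KnotoidCode

variable {D : KnotoidCode}

/-! ### Changing the smoothing of one crossing -/

/-- Two states which agree away from `c`. -/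
def AgreeOff (c : Fin D.n) (s s' : D.State) : Prop := ∀ x, x ≠ c → s x = s' x

theorem AgreeOff.symm {c : Fin D.n} {s s' : D.State} (h : AgreeOff c s s') : AgreeOff c s' s :=
  fun x hx => (h x hx).symm

theorem rel_partner (s : D.State) (c : Fin D.n) (p : Fin 4) :
    D.Rel (State.toP s) (D.edge c p) (D.edge c (partner (s c) p)) :=
  rel_edge (f := State.toP s) rfl p

theorem rel_zero_or_two (s : D.State) (c : Fin D.n) (p : Fin 4) :
    D.Rel (State.toP s) (D.edge c 0) (D.edge c p) ∨
      D.Rel (State.toP s) (D.edge c 2) (D.edge c p) := by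
  have h := rel_partner s c
  have h0 := h 0
  have h2 := h 2
  cases hb : s c <;> rw [hb] at h0 h2 <;> fin_cases p
  · exact Or.inl (Rel.refl _)
  · exact Or.inl h0
  · exact Or.inr (Rel.refl _)
  · exact Or.inr h2
  · exact Or.inl (Rel.refl _)
  · exact Or.inr h2
  · exact Or.inr (Rel.refl _)
  · exact Or.inl h0

/-- The components that touch `c` have the same union before and after the change. -/
theorem touch_imp {c : Fin D.n} {s s' : D.State} (h : AgreeOff c s s') {e : D.Edge}
    (he : D.Rel (State.toP s) (D.edge c 0) e ∨ D.Rel (State.toP s) (D.edge c 2) e) :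
    D.Rel (State.toP s') (D.edge c 0) e ∨ D.Rel (State.toP s') (D.edge c 2) e := by
  have key : ∀ {e e'}, D.Rel (State.toP s) e e' →
      ((D.Rel (State.toP s') (D.edge c 0) e ∨ D.Rel (State.toP s') (D.edge c 2) e) ↔
      (D.Rel (State.toP s') (D.edge c 0) e' ∨ D.Rel (State.toP s') (D.edge c 2) e')) := by
    intro e e' hr
    refine Rel.iff_of_forall (P := fun e => D.Rel (State.toP s') (D.edge c 0) e ∨
      D.Rel (State.toP s') (D.edge c 2) e) ?_ hr
    intro x p b hx hP
    by_cases hxc : x = c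
    · subst hxc
      exact rel_zero_or_two s' _ _
    · have hb : s' x = b := by rw [← h x hxc]; exact Option.some.inj hx
      subst hb
      exact hP.imp (fun h' => h'.trans (rel_partner s' x p)) (fun h' => h'.trans (rel_partner s' x p))
  rcases he with he | he
  · exact (key he).1 (Or.inl (Rel.refl _))
  · exact (key he).1 (Or.inr (Rel.refl _))

/-- A component that stays away from `c` makes no use of the smoothing there, so it survives the
change. -/
theorem untouched_imp {c : Fin D.n} {s s' : D.State} (h : AgreeOff c s s') {e e' : D.Edge}
    (h0 : ¬ D.Rel (State.toP s) (D.edge c 0) e) (h2 : ¬ D.Rel (State.toP s) (D.edge c 2) e)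
    (hr : D.Rel (State.toP s) e e') : D.Rel (State.toP s') e e' := by
  refine (Rel.iff_of_forall (P := fun x => D.Rel (State.toP s') e x) ?_ hr).1 (Rel.refl _)
  intro x p b hx hP
  by_cases hxc : x = c
  · subst hxc
    exfalso
    rcases rel_zero_or_two s' x p with h' | h'
    · exact (touch_imp h.symm (Or.inl (h'.trans hP.symm))).elim h0 h2
    · exact (touch_imp h.symm (Or.inr (h'.trans hP.symm))).elim h0 h2
  · have hb : s' x = b := by rw [← h x hxc]; exact Option.some.inj hx
    subst hb
    exact hP.trans (rel_partner s' x p)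

theorem rel_all {c : Fin D.n} {s : D.State}
    (h : D.Rel (State.toP s) (D.edge c 0) (D.edge c 2)) (p p' : Fin 4) :
    D.Rel (State.toP s) (D.edge c p) (D.edge c p') := by
  have key : ∀ p, D.Rel (State.toP s) (D.edge c 0) (D.edge c p) := fun p =>
    (rel_zero_or_two s c p).elim id h.trans
  exact (key p).symm.trans (key p')

/-- If the new smoothing leaves all four half-edges in one component, the links lost at `c` are
replaced by longer ones, and the change can only merge components. -/
theorem mono_of_rel {c : Fin D.n} {s s' : D.State} (h : AgreeOff c s s')
    (h' : D.Rel (State.toP s') (D.edge c 0) (D.edge c 2)) {e e' : D.Edge}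
    (hr : D.Rel (State.toP s) e e') : D.Rel (State.toP s') e e' := by
  refine Rel.mono_of ?_ hr
  intro x p b hx
  by_cases hxc : x = c
  · subst hxc
    exact rel_all h' _ _
  · have hb : s' x = b := by rw [← h x hxc]; exact Option.some.inj hx
    subst hb
    exact rel_partner s' x p

/-- The partial state in which the crossing `c` is not smoothed. -/
def del (s : D.State) (c : Fin D.n) : D.PState := Function.update (State.toP s) c none

theorem del_self (s : D.State) (c : Fin D.n) : del s c c = none := by simp [del]

theorem del_of_ne {s : D.State} {c x : Fin D.n} (h : x ≠ c) : del s c x = some (s x) := by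
  simp [del, h, State.toP]

theorem rel_of_rel_del {c : Fin D.n} {s s' : D.State} (h : AgreeOff c s s') {e e' : D.Edge}
    (hr : D.Rel (del s c) e e') : D.Rel (State.toP s') e e' := by
  refine Rel.mono_of ?_ hr
  intro x p b hx
  have hxc : x ≠ c := by
    rintro rfl
    rw [del_self] at hx
    cases hx
  rw [del_of_ne hxc] at hx
  have hb : s' x = b := by rw [← h x hxc]; exact Option.some.inj hx
  subst hb
  exact rel_partner s' x p

theorem turn_del_dartIn (s : D.State) (c : Fin D.n) (p : Fin 4) :
    D.turn (del s c) (D.dartIn c p) = D.dartIn c p := turn_dartIn_none (del_self s c) p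

theorem loose_del {s : D.State} {c : Fin D.n} {d : D.Dart} (h : D.turn (del s c) d = d) :
    d = D.legDart ∨ d = D.headDart ∨ ∃ p, d = D.dartIn c p := by
  rcases turn_eq_self_iff.1 h with h | h | ⟨x, p, hx, rfl⟩
  · exact Or.inl h
  · exact Or.inr (Or.inl h)
  · refine Or.inr (Or.inr ⟨p, ?_⟩)
    have : x = c := by
      by_contra hxc
      rw [del_of_ne hxc] at hx
      cases hx
    rw [this]

/-- Changing the smoothing merges the two components which touch a crossing, if they are
different. -/
theorem rel_of_not_rel {c : Fin D.n} {s s' : D.State} (h : AgreeOff c s s') (hc : s' c = !s c)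
    (hn : ¬ D.Rel (State.toP s) (D.edge c 0) (D.edge c 2)) :
    D.Rel (State.toP s') (D.edge c 0) (D.edge c 2) := by
  -- With `c` left open, the path that begins at the half-edge `p` ends at the leg, at the head, or
  -- at another half-edge of `c`. In the last case it ends at the partner of `p`, because the two
  -- other half-edges lie on the other component.
  have key : ∀ p p' : Fin 4, (p' = p + 2) →
      ¬ D.Rel (State.toP s) (D.edge c p) (D.edge c p') →
      D.Rel (del s c) (D.edge c p) (D.edge c (partner (s c) p)) ∨ D.Rel (State.toP s) 0 (D.edge c p) := by
    intro p p' hp hn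
    obtain ⟨b, hb1, hb2, hb3⟩ := exists_mate (turn_del_dartIn s c p)
    have hb4 : D.Rel (State.toP s) (D.edge c p) b.1 := rel_of_rel_del (fun _ _ => rfl) hb3
    rcases loose_del hb2 with rfl | rfl | ⟨q, rfl⟩
    · exact Or.inr hb4.symm
    · exact Or.inr ((rel_leg_head s).trans hb4.symm)
    · left
      have hq : q ≠ p := fun h0 => hb1 (by rw [h0])
      have hb5 : D.Rel (State.toP s) (D.edge c p) (D.edge c q) := hb4
      have h6 := rel_partner s c p'
      have : q = partner (s c) p := by
        by_contra hq2
        apply hn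
        have hq3 : q = p' ∨ q = partner (s c) p' := by
          have : ∀ (b : Bool) (p q : Fin 4), q ≠ p → q ≠ partner b p →
              q = p + 2 ∨ q = partner b (p + 2) := by decide
          rw [hp]
          exact this _ _ _ hq hq2
        rcases hq3 with rfl | rfl
        · exact hb5
        · exact hb5.trans h6.symm
      rw [← this]
      exact hb3
  have hk0 := key 0 2 rfl hn
  have hk2 := key 2 0 rfl (fun h0 => hn h0.symm)
  have hd : ∀ {e e'}, D.Rel (del s c) e e' → D.Rel (State.toP s') e e' := rel_of_rel_del h
  have h0' := rel_partner s' c 0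
  have h2' := rel_partner s' c 2
  rw [hc] at h0' h2'
  -- At most one of the two components is the segment. A component that is not the segment joins its
  -- two half-edges away from `c`, and this links the two strands of the new smoothing.
  cases hb : s c <;> rw [hb] at hk0 hk2 h0' h2'
  · rcases hk0 with hk0 | hk0
    · exact (hd hk0).trans h2'.symm
    · rcases hk2 with hk2 | hk2
      · exact h0'.trans (hd hk2).symm
      · exact absurd (hk0.symm.trans hk2) hn
  · rcases hk0 with hk0 | hk0
    · exact (hd hk0).trans h2'.symm
    · rcases hk2 with hk2 | hk2
      · exact h0'.trans (hd hk2).symm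
      · exact absurd (hk0.symm.trans hk2) hn

/-! ### Flows on spherical diagrams have a potential -/

section Potential

variable {F : Type*} [Field F]

/-- An antisymmetric function on the darts which satisfies the conservation law at each crossing and
vanishes at the head. -/
structure IsFlow (z : D.Dart → F) : Prop where
  rev : ∀ d, z (D.rev d) = - z d
  conserve : ∀ c, z (D.dartIn c 0) + z (D.dartIn c 1) + z (D.dartIn c 2) + z (D.dartIn c 3) = 0
  head : z D.headDart = 0

/-- A function on the sides of the edges that is constant on regions. -/
structure IsPotential (φ : D.Dart → F) : Prop where
  corner : ∀ c p, φ (D.dartOut c p) = φ (D.dartIn c (p + 1))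
  leg : φ (0, true) = φ (0, false)
  head : φ (Fin.last _, true) = φ (Fin.last _, false)

variable (D F) in
/-- The space of flows. -/
def flows : Submodule F (D.Dart → F) where
  carrier := {z | IsFlow z}
  zero_mem' := ⟨by simp, by simp, by simp⟩
  add_mem' := by
    rintro a b ⟨h1, h2, h3⟩ ⟨h1', h2', h3'⟩
    refine ⟨fun d => ?_, fun c => ?_, ?_⟩
    · simp only [Pi.add_apply, h1, h1']; ring
    · simp only [Pi.add_apply]
      linear_combination h2 c + h2' c
    · simp only [Pi.add_apply, h3, h3', add_zero]
  smul_mem' := by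
    rintro k a ⟨h1, h2, h3⟩
    refine ⟨fun d => ?_, fun c => ?_, ?_⟩
    · simp only [Pi.smul_apply, smul_eq_mul, h1]; ring
    · simp only [Pi.smul_apply, smul_eq_mul]
      linear_combination k * h2 c
    · simp only [Pi.smul_apply, h3, smul_zero]

theorem IsFlow.conserve_pass {z : D.Dart → F} (h : IsFlow z) (c : Fin D.n) :
    z ((D.underPass c).castSucc, true) + z ((D.overPass c).castSucc, true)
      = z ((D.underPass c).succ, true) + z ((D.overPass c).succ, true) := by
  have h1 := h.conserve c
  have hr : ∀ e, z (e, false) = - z (e, true) := fun e => h.rev (e, true)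
  cases hb : D.pos c <;> simp [dartIn, inward, edge, hb, hr] at h1 <;>
    linear_combination h1

/-- Recursion backwards from the head. An edge before the second pass of a crossing carries zero by
assumption. At a first pass the conservation law expresses the value by three edges that come later
in the walk. -/
theorem IsFlow.eq_zero {z : D.Dart → F} (h : IsFlow z)
    (h0 : ∀ c, z ((max (D.underPass c) (D.overPass c)).castSucc, true) = 0) : z = 0 := by
  have key : ∀ k : ℕ, ∀ e : D.Edge, 2 * D.n - e.val ≤ k → z (e, true) = 0 := by
    intro k
    induction k with
    | zero =>
      intro e he
      have : e = Fin.last _ := by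
        apply Fin.ext
        have := e.isLt
        simp only [Fin.val_last]
        omega
      rw [this]
      exact h.head
    | succ k ih =>
      intro e he
      by_cases hl : e = Fin.last _
      · rw [hl]; exact h.head
      · obtain ⟨t, rfl⟩ := Fin.exists_castSucc_eq.2 hl
        simp only [Fin.val_castSucc] at he
        obtain ⟨c | c, hc⟩ := D.bij.2 t <;> simp only [Sum.elim_inl, Sum.elim_inr] at hc <;> subst hc
        · rcases le_or_gt (D.overPass c) (D.underPass c) with hle | hlt
          · have := h0 c
            rwa [max_eq_left hle] at this
          · have h1 := h.conserve_pass c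
            have hlt' : (D.underPass c).val < (D.overPass c).val := hlt
            rw [ih (D.overPass c).castSucc (by simp only [Fin.val_castSucc]; omega),
              ih (D.overPass c).succ (by simp only [Fin.val_succ]; omega),
              ih (D.underPass c).succ (by simp only [Fin.val_succ]; omega)] at h1
            simpa using h1
        · rcases le_or_gt (D.underPass c) (D.overPass c) with hle | hlt
          · have := h0 c
            rwa [max_eq_right hle] at this
          · have h1 := h.conserve_pass c
            have hlt' : (D.overPass c).val < (D.underPass c).val := hlt
            rw [ih (D.underPass c).castSucc (by simp only [Fin.val_castSucc]; omega),
              ih (D.overPass c).succ (by simp only [Fin.val_succ]; omega),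
              ih (D.underPass c).succ (by simp only [Fin.val_succ]; omega)] at h1
            simpa using h1
  funext d
  obtain ⟨e, b⟩ := d
  cases b with
  | true => exact key _ e le_rfl
  | false =>
    have := h.rev (e, true)
    rw [key _ e le_rfl, neg_zero] at this
    exact this

/-- One value per crossing, taken before its second pass, determines a flow. -/
theorem finrank_flows_le : Module.finrank F (flows D F) ≤ D.n := by
  let L : flows D F →ₗ[F] (Fin D.n → F) :=
    (LinearMap.pi fun c => LinearMap.proj ((max (D.underPass c) (D.overPass c)).castSucc, true)) ∘ₗ
      (flows D F).subtype
  have hL : Function.Injective L := by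
    rw [← LinearMap.ker_eq_bot, LinearMap.ker_eq_bot']
    intro z hz
    apply Subtype.ext
    exact IsFlow.eq_zero z.2 fun c => congrFun hz c
  simpa using LinearMap.finrank_le_finrank_of_injective hL

variable (D F) in
/-- The difference of a function on regions across the edges. -/
def coboundary : (D.Region → F) →ₗ[F] (D.Dart → F) where
  toFun φ d := φ (Quot.mk _ d) - φ (Quot.mk _ (D.rev d))
  map_add' φ ψ := by funext d; simp only [Pi.add_apply]; ring
  map_smul' k φ := by funext d; simp only [Pi.smul_apply, smul_eq_mul, RingHom.id_apply]; ring

theorem isPotential_comp_mk {R : Type*} (φ : D.Region → R) :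
    IsPotential (D := D) fun d => φ (Quot.mk _ d) where
  corner c p := congrArg φ (Quot.sound (SideAdj.corner c p))
  leg := congrArg φ (Quot.sound SideAdj.leg)
  head := congrArg φ (Quot.sound SideAdj.head)

/-- The differences across the four half-edges of a crossing telescope around it, and both sides of
the last edge belong to the same region. -/
theorem coboundary_mem_flows (φ : D.Region → F) : coboundary D F φ ∈ flows D F := by
  have h := isPotential_comp_mk φ
  refine ⟨fun d => ?_, fun c => ?_, ?_⟩
  · simp only [coboundary, LinearMap.coe_mk, AddHom.coe_mk, rev_rev]
    ring
  · simp only [coboundary, LinearMap.coe_mk, AddHom.coe_mk, rev_dartIn]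
    have h0 := h.corner c 0
    have h1 := h.corner c 1
    have h2 := h.corner c 2
    have h3 := h.corner c 3
    simp only [zero_add, show (1 : Fin 4) + 1 = 2 from rfl, show (2 : Fin 4) + 1 = 3 from rfl,
      show (3 : Fin 4) + 1 = 0 from rfl] at h0 h1 h2 h3
    linear_combination - h0 - h1 - h2 - h3
  · simp only [coboundary, LinearMap.coe_mk, AddHom.coe_mk]
    exact sub_eq_zero.2 h.head

/-- Neither crossing an edge nor turning around a corner changes the value, and consecutive edges of
the walk share a crossing. -/
theorem eq_const_of_coboundary_eq_zero {φ : D.Region → F} (h : coboundary D F φ = 0) :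
    φ = fun _ => φ (Quot.mk _ (0, true)) := by
  have hr : ∀ d, φ (Quot.mk _ d) = φ (Quot.mk _ (D.rev d)) := fun d =>
    sub_eq_zero.1 (congrFun h d)
  have hp := isPotential_comp_mk φ
  have hc : ∀ c p, φ (Quot.mk _ (D.dartIn c p)) = φ (Quot.mk _ (D.dartIn c 0)) := by
    intro c
    have hstep : ∀ p, φ (Quot.mk _ (D.dartIn c (p + 1))) = φ (Quot.mk _ (D.dartIn c p)) :=
      fun p => ((hr (D.dartIn c p)).trans (hp.corner c p)).symm
    have h1 := hstep 0
    have h2 := hstep 1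
    have h3 := hstep 2
    intro p
    fin_cases p
    · rfl
    · exact h1
    · exact h2.trans h1
    · exact h3.trans (h2.trans h1)
  have he : ∀ c p b, φ (Quot.mk _ (D.edge c p, b)) = φ (Quot.mk _ (D.dartIn c 0)) := by
    intro c p b
    rw [← hc c p]
    rcases D.eq_or_eq_rev_of_fst_eq (d := (D.edge c p, b)) (d' := D.dartIn c p) rfl with h' | h' <;>
      rw [h']
    exact (hr _).symm
  have key : ∀ (k : ℕ) (hk : k < 2 * D.n + 1) (b : Bool),
      φ (Quot.mk _ (⟨k, hk⟩, b)) = φ (Quot.mk _ (0, true)) := by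
    intro k
    induction k with
    | zero =>
      intro hk b
      cases b with
      | true => rfl
      | false => exact hp.leg.symm
    | succ k ih =>
      intro hk b
      have hk' : k < 2 * D.n := by omega
      rw [← ih (by omega) true]
      obtain ⟨c | c, hc'⟩ := D.bij.2 ⟨k, hk'⟩ <;>
        simp only [Sum.elim_inl, Sum.elim_inr] at hc'
      · have e0 : D.edge c 0 = ⟨k, by omega⟩ := by simp only [edge, hc']; rfl
        have e2 : D.edge c 2 = ⟨k + 1, hk⟩ := by simp only [edge, hc']; rfl
        rw [← e0, ← e2, he, he]
      · have e0 : ∃ p, D.edge c p = ⟨k, by omega⟩ := by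
          refine ⟨if D.pos c then 3 else 1, ?_⟩
          cases hb : D.pos c <;> simp [edge, hb, hc']
        have e2 : ∃ p, D.edge c p = ⟨k + 1, hk⟩ := by
          refine ⟨if D.pos c then 1 else 3, ?_⟩
          cases hb : D.pos c <;> simp [edge, hb, hc']
        obtain ⟨p, hp0⟩ := e0
        obtain ⟨p', hp2⟩ := e2
        rw [← hp0, ← hp2, he, he]
  funext x
  induction x using Quot.ind with
  | mk d => exact key d.1.val d.1.isLt d.2

/-- The sphere enters here. There are `n + 1` regions and only constants have zero coboundary, so
the coboundaries form a space of dimension at least `n`. They are flows, and flows have dimension at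
most `n`. -/
theorem exists_potential (hS : D.IsSpherical) {z : D.Dart → F} (hz : IsFlow z) :
    ∃ φ : D.Dart → F, IsPotential φ ∧ ∀ d, z d = φ d - φ (D.rev d) := by
  have hfin : Finite D.Region := Finite.of_surjective (Quot.mk D.SideAdj) Quot.mk_surjective
  have := Fintype.ofFinite D.Region
  have hker : Module.finrank F (LinearMap.ker (coboundary D F)) ≤ 1 := by
    have : LinearMap.ker (coboundary D F) ≤ Submodule.span F {fun _ => (1 : F)} := by
      intro φ hφ
      rw [Submodule.mem_span_singleton]
      refine ⟨φ (Quot.mk _ (0, true)), ?_⟩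
      conv_rhs => rw [eq_const_of_coboundary_eq_zero (LinearMap.mem_ker.1 hφ)]
      funext x
      simp
    exact (Submodule.finrank_mono this).trans ((finrank_span_le_card _).trans (by simp))
  have hrn := LinearMap.finrank_range_add_finrank_ker (coboundary D F)
  rw [Module.finrank_fintype_fun_eq_card, ← Nat.card_eq_fintype_card,
    show Nat.card D.Region = D.n + 1 from hS] at hrn
  have hle : LinearMap.range (coboundary D F) ≤ flows D F := by
    rintro _ ⟨φ, rfl⟩
    exact coboundary_mem_flows φ
  have heq : LinearMap.range (coboundary D F) = flows D F := by
    apply Submodule.eq_of_le_of_finrank_le hle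
    have := finrank_flows_le (D := D) (F := F)
    omega
  have hz' : z ∈ LinearMap.range (coboundary D F) := by
    rw [heq]; exact hz
  obtain ⟨φ, rfl⟩ := hz'
  exact ⟨_, isPotential_comp_mk φ, fun d => rfl⟩

end Potential

end KnotoidCode

namespace KnotoidCode

variable {D : KnotoidCode}

theorem partner_eq_or (b : Bool) (p : Fin 4) : partner b p = p + 1 ∨ p = partner b p + 1 := by
  cases b <;> fin_cases p <;> decide

/-! ### Single-cycle smoothings -/

/-- Along the boundary of a region that has no jump across the half-edge `p` or across its partner,
a potential does not change. -/
theorem IsPotential.step {F : Type*} [Field F] {φ : D.Dart → F} (h : IsPotential φ) {c : Fin D.n}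
    {b : Bool} {p : Fin 4}
    (hj : φ (D.dartIn c p) - φ (D.dartOut c p) =
      φ (D.dartOut c (partner b p)) - φ (D.dartIn c (partner b p))) :
    φ (D.dartOut c (partner b p)) = φ (D.dartIn c p) := by
  rcases partner_eq_or b p with h1 | h1
  · have := h.corner c p
    rw [← h1] at this
    linear_combination -hj - this
  · have := h.corner c (partner b p)
    rw [← h1] at this
    exact this

/-- The common form of the conservation laws: what arrives along a half-edge leaves along its
partner, for either of the two pairings. -/
theorem fin4_conserve {F : Type*} [AddCommGroup F] (f : Fin 4 → F) (b : Bool)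
    (h : ∀ p, f (partner b p) = - f p) : f 0 + f 1 + f 2 + f 3 = 0 := by
  cases b
  · have h0 : f 1 = - f 0 := h 0
    have h2 : f 3 = - f 2 := h 2
    rw [h0, h2]; abel
  · have h0 : f 3 = - f 0 := h 0
    have h2 : f 2 = - f 1 := h 1
    rw [h0, h2]; abel

open Classical in
/-- The flow modulo `2` along a component. -/
noncomputable def compFlow (s : D.State) (e : D.Edge) (d : D.Dart) : ZMod 2 :=
  if D.Rel (State.toP s) e d.1 then 1 else 0

theorem compFlow_of_rel {s : D.State} {e : D.Edge} {d : D.Dart} (h : D.Rel (State.toP s) e d.1) :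
    compFlow s e d = 1 := if_pos h

theorem compFlow_of_not_rel {s : D.State} {e : D.Edge} {d : D.Dart}
    (h : ¬ D.Rel (State.toP s) e d.1) : compFlow s e d = 0 := if_neg h

theorem compFlow_congr {s : D.State} {e : D.Edge} {d d' : D.Dart}
    (h : D.Rel (State.toP s) d.1 d'.1) : compFlow s e d = - compFlow s e d' := by
  rw [ZMod.neg_eq_self_mod_two]
  by_cases h1 : D.Rel (State.toP s) e d.1
  · rw [compFlow_of_rel h1, compFlow_of_rel (h1.trans h)]
  · rw [compFlow_of_not_rel h1, compFlow_of_not_rel fun h2 => h1 (h2.trans h.symm)]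

/-- Modulo `2` the circle needs no orientation, so antisymmetry is automatic. The value at the head
vanishes because the head lies on the segment. -/
theorem isFlow_compFlow {s : D.State} {e : D.Edge} (h : ¬ D.Rel (State.toP s) 0 e) :
    IsFlow (compFlow s e) where
  rev d := compFlow_congr (Rel.refl _)
  conserve c := by
    refine fin4_conserve (fun p => compFlow s e (D.dartIn c p)) (s c) fun p => ?_
    exact compFlow_congr (rel_partner s c p).symm
  head := compFlow_of_not_rel fun h' => h ((rel_leg_head s).trans h'.symm)

/-- If a component which is not the segment meets itself at a crossing, then changing the smoothing
there divides it into two components. -/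
theorem not_rel_of_rel (hS : D.IsSpherical) {c : Fin D.n} {s s' : D.State} (h : AgreeOff c s s')
    (hc : s' c = !s c) (hr : D.Rel (State.toP s) (D.edge c 0) (D.edge c 2))
    (h0 : ¬ D.Rel (State.toP s) 0 (D.edge c 0)) :
    ¬ D.Rel (State.toP s') (D.edge c 0) (D.edge c 2) := by
  intro hr'
  obtain ⟨φ, hφ, hz⟩ := exists_potential hS (isFlow_compFlow h0)
  have hrev : ∀ d, D.Rel (State.toP s) (D.edge c 0) d.1 → φ d = φ (D.rev d) + 1 := by
    intro d hd
    have := hz d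
    rw [compFlow_of_rel hd] at this
    linear_combination - this
  have hstep : ∀ x p b, D.Rel (State.toP s) (D.edge c 0) (D.edge x p) →
      D.Rel (State.toP s) (D.edge c 0) (D.edge x (partner b p)) →
      φ (D.dartOut x (partner b p)) = φ (D.dartIn x p) := by
    intro x p b h1 h2
    apply hφ.step
    have e1 := hrev (D.dartIn x p) h1
    have e2 := hrev (D.dartOut x (partner b p)) h2
    rw [rev_dartIn] at e1
    rw [rev_dartOut] at e2
    linear_combination e1 - e2
  -- All four half-edges lie on the circle, hence the colours of the corners alternate around `c`.
  have halt : ∀ p, φ (D.dartIn c (p + 1)) = φ (D.dartIn c p) + 1 := by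
    intro p
    rw [← hφ.corner c p]
    have := hrev (D.dartOut c p) (rel_all hr 0 p)
    rw [rev_dartOut] at this
    exact this
  have htwo : (1 : ZMod 2) + 1 = 0 := by decide
  obtain ⟨m, hm⟩ := exists_cycle (turn_del_dartIn s c 0)
  set a := D.dartIn c 0 with ha
  have hrel : ∀ i, D.Rel (State.toP s) (D.edge c 0) ((D.walk (del s c))^[i] a).1 := fun i =>
    rel_of_rel_del (fun _ _ => rfl) (rel_walk_iterate (del s c) a i)
  -- From step `1` on, when the walk leaves `c` along the half-edge `0`, the region on its left
  -- keeps its colour until the walk is back at `c`.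
  have hwalk : ∀ i, 1 ≤ i → i ≤ m → φ ((D.walk (del s c))^[i] a) = φ a + 1 := by
    intro i h1
    induction i, h1 using Nat.le_induction with
    | base =>
      intro _
      have : (D.walk (del s c))^[1] a = D.rev a := by
        simp only [Function.iterate_one, walk, Function.comp_apply]
        rw [turn_del_dartIn]
      rw [this]
      have := hrev (D.rev a) (Rel.refl _)
      rwa [rev_rev] at this
    | succ i hi ih =>
      intro him
      rw [← ih (by omega), Function.iterate_succ_apply']
      set d := (D.walk (del s c))^[i] a with hd
      have hnl : D.turn (del s c) d ≠ d := by
        intro hl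
        rcases hm.eq_zero_or_mid (i := i) (by omega) hl with h' | h' <;> omega
      rcases D.dart_cases d with h' | h' | ⟨x, p, h'⟩
      · exact absurd (h' ▸ turn_legDart _) hnl
      · exact absurd (h' ▸ turn_headDart _) hnl
      · by_cases hxc : x = c
        · subst hxc
          exact absurd (h' ▸ turn_del_dartIn _ _ _) hnl
        · have hw : D.walk (del s c) d = D.dartOut x (partner (s x) p) := by
            unfold walk
            rw [Function.comp_apply, ← h', turn_dartIn (del_of_ne hxc), rev_dartIn]
          have h1 : D.Rel (State.toP s) (D.edge c 0) (D.edge x p) := by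
            have := hrel i
            rw [← hd, ← h'] at this
            exact this
          rw [hw, ← h']
          exact hstep x p (s x) h1 (h1.trans (rel_partner s x p))
  set b := (D.walk (del s c))^[m] a with hb
  have hbl : D.turn (del s c) b = b := hm.turn_mid
  have hba : b ≠ a := hm.mid_ne
  have hφb := hwalk m hm.pos le_rfl
  rw [← hb] at hφb
  have hdel : D.Rel (del s c) (D.edge c 0) b.1 := rel_walk_iterate (del s c) a m
  rcases loose_del hbl with h' | h' | ⟨p, h'⟩
  · have := hrel m
    rw [← hb, h'] at this
    exact h0 this.symm
  · have := hrel m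
    rw [← hb, h'] at this
    exact h0 ((rel_leg_head s).trans this.symm)
  · -- the walk connects the half-edge `0` to one of its neighbours
    have hp0 : p ≠ 0 := fun h1 => hba (by rw [h', h1])
    -- The darts that arrive along opposite half-edges have the same colour on their left, but the
    -- walk arrives with the colour opposite to that of `a`.
    have hp2 : p ≠ 2 := by
      rintro rfl
      have e1 := halt 0
      have e2 := halt 1
      rw [h'] at hφb
      have e3 : φ (D.dartIn c 2) = φ (D.dartIn c 1) + 1 := e2
      have e4 : φ (D.dartIn c 1) = φ (D.dartIn c 0) + 1 := e1
      rw [e3, e4] at hφb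
      have : (1 : ZMod 2) = 0 := by linear_combination hφb
      exact absurd this (by decide)
    rw [h'] at hdel
    -- A smoothing that joins `0` to `p` closes the path between them to a circle which misses the
    -- half-edge `2`.
    have hclosed : ∀ t : D.State, AgreeOff c s t → partner (t c) 0 = p →
        ¬ D.Rel (State.toP t) (D.edge c 0) (D.edge c 2) := by
      intro t ht htp htr
      have hnot : ∀ q, q ≠ 0 → q ≠ p → ¬ D.Rel (del s c) (D.edge c 0) (D.edge c q) := by
        intro q hq0 hqp hq
        have h1 : D.dartIn c q ≠ a := fun h1 => hq0 (D.dartIn_inj h1).2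
        have := loose_unique (turn_del_dartIn s c 0) hbl (turn_del_dartIn s c q)
          (rel_walk_iterate (del s c) a m) hq hba h1
        rw [h'] at this
        exact hqp (D.dartIn_inj this).2.symm
      have := (Rel.iff_of_forall (P := fun e => D.Rel (del s c) (D.edge c 0) e) ?_ htr).1
        (Rel.refl _)
      · exact hnot 2 (by decide) (Ne.symm hp2) this
      · intro x q b' hx hP
        by_cases hxc : x = c
        · subst hxc
          have hb' : t x = b' := Option.some.inj hx
          subst hb'
          have hq : q = 0 ∨ q = p := by
            by_contra hq
            push Not at hq
            exact hnot q hq.1 hq.2 hP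
          rcases hq with rfl | rfl
          · rw [htp]; exact hdel
          · rw [← htp, partner_partner]; exact Rel.refl _
        · have hb' : s x = b' := by rw [ht x hxc]; exact Option.some.inj hx
          subst hb'
          exact hP.trans (rel_edge (del_of_ne hxc) q)
    -- Each neighbour of the half-edge `0` is its partner in one of the two smoothings, so one of
    -- the two states separates `0` from `2`.
    have hp : partner (s c) 0 = p ∨ partner (s' c) 0 = p := by
      have : ∀ b p, p ≠ 0 → p ≠ 2 → partner b 0 = p ∨ partner (!b) 0 = p := by decide
      rw [hc]
      exact this _ _ hp0 hp2
    rcases hp with hp | hp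
    · exact hclosed s (fun _ _ => rfl) hp hr
    · exact hclosed s' h hp hr'

/-! ### Merging and dividing components does not change the intersection with the shortcut -/

/-- Closure under the walk gives one inclusion. For the other, a dart of `Y` that is not on the
curve has its reverse on the curve, hence in `Y`, which is excluded. -/
theorem segmentCurve_eq {s : D.State} {Y : Set D.Dart} (h0 : ((0, true) : D.Dart) ∈ Y)
    (h1 : ∀ c p, D.dartIn c p ∈ Y → D.dartOut c (partner (s c) p) ∈ Y)
    (h2 : ∀ d ∈ Y, D.rev d ∉ Y) (h3 : ∀ d ∈ Y, D.Rel (State.toP s) 0 d.1) :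
    D.segmentCurve s = Y := by
  have hle : D.segmentCurve s ⊆ Y := by
    intro d hd
    induction hd with
    | refl => exact h0
    | tail _ hst ih =>
      obtain ⟨c, p⟩ := hst
      exact h1 c p ih
  refine hle.antisymm fun d hd => ?_
  by_contra hn
  exact h2 d hd (hle ((rev_mem_segmentCurve_iff (h3 d hd)).2 hn))

open Classical in
/-- The indicator function of a set of darts. -/
noncomputable def ind {R : Type*} [Zero R] [One R] (γ : Set D.Dart) (d : D.Dart) : R :=
  if d ∈ γ then 1 else 0

section ind

variable {R : Type*} [Zero R] [One R] {γ γ' : Set D.Dart} {d d' : D.Dart}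

theorem ind_of_mem (h : d ∈ γ) : ind (R := R) γ d = 1 := if_pos h

theorem ind_of_notMem (h : d ∉ γ) : ind (R := R) γ d = 0 := if_neg h

theorem ind_congr (h : d ∈ γ ↔ d' ∈ γ') : ind (R := R) γ d = ind γ' d' := by
  by_cases h1 : d ∈ γ
  · rw [ind_of_mem h1, ind_of_mem (h.1 h1)]
  · rw [ind_of_notMem h1, ind_of_notMem fun h2 => h1 (h.2 h2)]

end ind

theorem crossingNumber_eq (γ : Set D.Dart) (c : Fin D.n) (p : Fin 4) :
    D.crossingNumber γ c p = ind γ (D.dartIn c p) - ind γ (D.dartOut c p) := rfl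

theorem ind_union {γ γ' : Set D.Dart} (h : Disjoint γ γ') (d : D.Dart) :
    ind (R := ℤ) (γ ∪ γ') d = ind γ d + ind γ' d := by
  by_cases h1 : d ∈ γ
  · rw [ind_of_mem (Or.inl h1), ind_of_mem h1, ind_of_notMem (Set.disjoint_left.1 h h1), add_zero]
  · rw [ind_of_notMem h1, zero_add]
    exact ind_congr ⟨fun h2 => h2.resolve_left h1, Or.inr⟩

theorem crossingNumber_union {γ γ' : Set D.Dart} (h : Disjoint γ γ') (c : Fin D.n) (p : Fin 4) :
    D.crossingNumber (γ ∪ γ') c p = D.crossingNumber γ c p + D.crossingNumber γ' c p := by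
  rw [crossingNumber_eq, crossingNumber_eq, crossingNumber_eq, ind_union h, ind_union h]
  ring

theorem dotShortcut_union {γ γ' : Set D.Dart} (h : Disjoint γ γ') :
    D.dotShortcut (γ ∪ γ') = D.dotShortcut γ + D.dotShortcut γ' := by
  unfold dotShortcut
  rw [← Finset.sum_add_distrib]
  refine Finset.sum_congr rfl fun c _ => ?_
  rw [crossingNumber_union h, crossingNumber_union h]
  ring

/-- The chain with rational coefficients of a set of darts. -/
noncomputable def chain (γ : Set D.Dart) (d : D.Dart) : ℚ := ind γ d - ind γ (D.rev d)

theorem chain_rev (γ : Set D.Dart) (d : D.Dart) : chain γ (D.rev d) = - chain γ d := by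
  unfold chain
  rw [rev_rev]
  ring

theorem cast_crossingNumber (γ : Set D.Dart) (c : Fin D.n) (p : Fin 4) :
    (D.crossingNumber γ c p : ℚ) = chain γ (D.dartIn c p) := by
  have : ∀ d, ((ind γ d : ℤ) : ℚ) = ind γ d := fun d => by
    by_cases h : d ∈ γ
    · rw [ind_of_mem h, ind_of_mem h, Int.cast_one]
    · rw [ind_of_notMem h, ind_of_notMem h, Int.cast_zero]
  rw [crossingNumber_eq, Int.cast_sub, this, this]
  unfold chain
  rw [rev_dartIn]

/-- The intersection number with the shortcut is the difference of a potential at its ends. -/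
theorem cast_dotShortcut {γ : Set D.Dart} {φ : D.Dart → ℚ} (hφ : IsPotential φ)
    (hz : ∀ d, chain γ d = φ d - φ (D.rev d)) :
    (D.dotShortcut γ : ℚ) = φ (0, false) - φ (Fin.last _, false) := by
  -- Crossing numbers are jumps of `φ` across half-edges. The corner relations turn the two jumps at
  -- `c` into the changes of `φ` on the right of the diagram along the two passes through `c`.
  have hpass : ∀ c, ((D.crossingNumber γ c (D.crossedByUnder c) +
      D.crossingNumber γ c (D.crossedByOver c) : ℤ) : ℚ) =
      (φ ((D.underPass c).castSucc, false) - φ ((D.underPass c).succ, false)) +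
      (φ ((D.overPass c).castSucc, false) - φ ((D.overPass c).succ, false)) := by
    intro c
    push_cast
    rw [cast_crossingNumber, cast_crossingNumber, hz, hz, rev_dartIn, rev_dartIn]
    have h0 : φ (D.dartOut c 0) = φ (D.dartIn c 1) := hφ.corner c 0
    have h1 : φ (D.dartOut c 1) = φ (D.dartIn c 2) := hφ.corner c 1
    have h2 : φ (D.dartOut c 2) = φ (D.dartIn c 3) := hφ.corner c 2
    have h3 : φ (D.dartOut c 3) = φ (D.dartIn c 0) := hφ.corner c 3
    cases hb : D.pos c <;>
      simp only [crossedByUnder, crossedByOver, dartIn, dartOut, edge, inward, hb, if_true, if_false,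
        Bool.not_true, Bool.not_false, Bool.false_eq_true] at h0 h1 h2 h3 ⊢ <;>
      linarith
  -- Every pass is the underpass or the overpass of exactly one crossing, so the sum over crossings
  -- runs over the whole walk and telescopes.
  have hsum : ∀ f : Fin (2 * D.n) → ℚ,
      ∑ c, (f (D.underPass c) + f (D.overPass c)) = ∑ t, f t := by
    intro f
    rw [← Equiv.sum_comp (Equiv.ofBijective _ D.bij) f, Fintype.sum_sum_type,
      Finset.sum_add_distrib]
    rfl
  unfold dotShortcut
  rw [Int.cast_sum, Finset.sum_congr rfl fun c _ => hpass c]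
  rw [hsum fun t => φ (t.castSucc, false) - φ (t.succ, false), Finset.sum_sub_distrib]
  have e1 := Fin.sum_univ_castSucc fun e : Fin (2 * D.n + 1) => φ (e, false)
  have e2 := Fin.sum_univ_succ fun e : Fin (2 * D.n + 1) => φ (e, false)
  rw [e1] at e2
  linarith

theorem isFlow_chain {s : D.State} {γ : Set D.Dart}
    (h : ∀ c p, D.dartOut c (partner (s c) p) ∈ γ ↔ D.dartIn c p ∈ γ)
    (h1 : ∀ d ∈ γ, ¬ D.Rel (State.toP s) 0 d.1) : IsFlow (chain γ) where
  rev := chain_rev γ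
  conserve c := by
    refine fin4_conserve (fun p => chain γ (D.dartIn c p)) (s c) fun p => ?_
    have h2 := h c p
    have h3 := h c (partner (s c) p)
    rw [partner_partner] at h3
    unfold chain
    rw [rev_dartIn, rev_dartIn, ind_congr h2, ← ind_congr h3, neg_sub]
  head := by
    unfold chain
    have h2 : ∀ b, ((Fin.last _, b) : D.Dart) ∉ γ := fun b hb => h1 _ hb (rel_leg_head s)
    have h3 : D.headDart ∉ γ := h2 true
    have h4 : D.rev D.headDart ∉ γ := h2 false
    rw [ind_of_notMem h3, ind_of_notMem h4, sub_zero]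

/-- A closed curve that is disjoint from the segment has intersection number zero with the
shortcut. -/
theorem dotShortcut_eq_zero (hS : D.IsSpherical) {s : D.State} {γ : Set D.Dart}
    (h : ∀ c p, D.dartOut c (partner (s c) p) ∈ γ ↔ D.dartIn c p ∈ γ)
    (h1 : ∀ d ∈ γ, ¬ D.Rel (State.toP s) 0 d.1) : D.dotShortcut γ = 0 := by
  obtain ⟨φ, hφ, hz⟩ := exists_potential hS (isFlow_chain h h1)
  have h2 := cast_dotShortcut hφ hz
  have hrev : ∀ d, D.Rel (State.toP s) 0 d.1 → φ d = φ (D.rev d) := by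
    intro d hd
    have := hz d
    have h3 : d ∉ γ := fun h' => h1 _ h' hd
    have h4 : D.rev d ∉ γ := fun h' => h1 _ h' hd
    unfold chain at this
    rw [ind_of_notMem h3, ind_of_notMem h4] at this
    linarith
  -- As `γ` contains no edge of the segment, `φ` has no jump across these edges, and so it is
  -- constant along the segment from the leg to the head.
  have hseg : ∀ d ∈ D.segmentCurve s, φ d = φ (0, true) := by
    intro d hd
    induction hd with
    | refl => rfl
    | tail hd0 hst ih =>
      obtain ⟨c, p⟩ := hst
      rw [← ih]
      have h3 := rel_of_mem_segmentCurve hd0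
      have h4 : D.Rel (State.toP s) 0 (D.edge c (partner (s c) p)) := h3.trans (rel_partner s c p)
      apply hφ.step
      have e1 := hrev (D.dartIn c p) h3
      have e2 := hrev (D.dartIn c (partner (s c) p)) h4
      rw [rev_dartIn] at e1 e2
      linarith
  have h3 := hseg _ (headDart_mem_segmentCurve s)
  have h4 := hφ.head
  have h5 := hφ.leg
  unfold headDart at h3
  have : (D.dotShortcut γ : ℚ) = 0 := by rw [h2]; linarith
  exact_mod_cast this

/-- Merging a circle into the segment inserts that circle, with some orientation, and an oriented
circle off the segment contributes zero. Merging two circles leaves the segment alone. -/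
theorem dotShortcut_segmentCurve_eq (hS : D.IsSpherical) {c : Fin D.n} {s s' : D.State}
    (h : AgreeOff c s s') (hc : s' c = !s c)
    (hn : ¬ D.Rel (State.toP s) (D.edge c 0) (D.edge c 2)) :
    D.dotShortcut (D.segmentCurve s') = D.dotShortcut (D.segmentCurve s) := by
  have hmono : ∀ {e e'}, D.Rel (State.toP s) e e' → D.Rel (State.toP s') e e' :=
    mono_of_rel h (rel_of_not_rel h hc hn)
  have hstep' : ∀ x p, x ≠ c → partner (s' x) p = partner (s x) p := fun x p hx => by
    rw [h x hx]
  have hrevseg : ∀ d ∈ D.segmentCurve s, D.rev d ∉ D.segmentCurve s := by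
    intro d hd hd'
    exact (rev_mem_segmentCurve_iff (rel_of_mem_segmentCurve hd)).1 hd' hd
  by_cases ha : ∃ a, D.dartIn c a ∈ D.segmentCurve s
  · obtain ⟨a, ha⟩ := ha
    have ha0 : D.Rel (State.toP s) 0 (D.edge c a) := rel_of_mem_segmentCurve ha
    set a2 := partner (s' c) a with ha2
    -- the four half-edges are `a`, its partner, `a2` and its partner
    have hfour : ∀ p, p = a ∨ p = partner (s c) a ∨ p = a2 ∨ p = partner (s c) a2 := by
      have : ∀ b a p, p = a ∨ p = partner b a ∨ p = partner (!b) a ∨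
          p = partner b (partner (!b) a) := by decide
      rw [ha2, hc]
      exact this _ _
    have hback : partner (s' c) (partner (s c) a2) = partner (s c) a := by
      have : ∀ b a, partner (!b) (partner b (partner (!b) a)) = partner b a := by decide
      rw [ha2, hc]
      exact this _ _
    have hQ : ¬ D.Rel (State.toP s) 0 (D.edge c a2) := by
      intro hr
      apply hn
      have hall : ∀ p, D.Rel (State.toP s) 0 (D.edge c p) := by
        intro p
        rcases hfour p with rfl | rfl | rfl | rfl
        · exact ha0
        · exact ha0.trans (rel_partner s c a)
        · exact hr
        · exact hr.trans (rel_partner s c a2)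
      exact (hall 0).symm.trans (hall 2)
    obtain ⟨φ, hφ, hz⟩ := exists_potential hS (isFlow_compFlow hQ)
    have hrev : ∀ d, D.Rel (State.toP s) (D.edge c a2) d.1 → φ d = φ (D.rev d) + 1 := by
      intro d hd
      have := hz d
      rw [compFlow_of_rel hd] at this
      linear_combination - this
    have htwo : ∀ x y : ZMod 2, x = y + 1 → (y = x → False) ∧ ∀ z, z ≠ x → z = y := by decide
    -- One orientation of the merged circle: the darts which have on their left the same colour as
    -- the dart that leaves `c` along `a2`.
    set O : Set D.Dart := {d | D.Rel (State.toP s) (D.edge c a2) d.1 ∧ φ d = φ (D.dartOut c a2)}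
      with hO
    have hOseg : ∀ d ∈ O, ¬ D.Rel (State.toP s) 0 d.1 := by
      rintro d ⟨h1, -⟩ h2
      exact hQ (h2.trans h1.symm)
    have hOrev : ∀ d ∈ O, D.rev d ∉ O := by
      rintro d ⟨h1, h2⟩ ⟨-, h3⟩
      exact (htwo _ _ (hrev d h1)).1 (h3.trans h2.symm)
    have hOstep : ∀ x p, D.dartOut x (partner (s x) p) ∈ O ↔ D.dartIn x p ∈ O := by
      intro x p
      have h1 : D.Rel (State.toP s) (D.edge c a2) (D.dartOut x (partner (s x) p)).1 ↔
          D.Rel (State.toP s) (D.edge c a2) (D.dartIn x p).1 :=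
        ⟨fun h' => h'.trans (rel_partner s x p).symm, fun h' => h'.trans (rel_partner s x p)⟩
      simp only [hO, Set.mem_ofPred_eq]
      rw [h1]
      refine and_congr_right fun h2 => ?_
      rw [hφ.step (b := s x)]
      have e1 := hrev _ h2
      have e2 := hrev _ (h1.2 h2)
      rw [rev_dartIn] at e1
      rw [rev_dartOut] at e2
      linear_combination e1 - e2
    have ha2O : D.dartOut c a2 ∈ O := ⟨Rel.refl _, rfl⟩
    have ha2O' : D.dartIn c (partner (s c) a2) ∈ O := by
      rw [← hOstep, partner_partner]
      exact ha2O
    have hdisj : Disjoint (D.segmentCurve s) O := by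
      rw [Set.disjoint_left]
      intro d h1 h2
      exact hOseg d h2 (rel_of_mem_segmentCurve h1)
    have hall' : ∀ p p', D.Rel (State.toP s') (D.edge c p) (D.edge c p') :=
      rel_all (rel_of_not_rel h hc hn)
    -- The new segment follows the old one along `a` into `c`, runs once around the circle, and
    -- continues as before.
    have hY : D.segmentCurve s' = D.segmentCurve s ∪ O := by
      apply segmentCurve_eq
      · exact Or.inl (start_mem_segmentCurve s)
      · intro x p hp
        by_cases hxc : x = c
        · subst hxc
          rcases hfour p with h1 | h1 | h1 | h1
          · rw [h1, ← ha2]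
            exact Or.inr ha2O
          · exfalso
            rw [h1] at hp
            have hout := segmentCurve_step ha
            rcases hp with hp | hp
            · have := hrevseg _ hp
              rw [rev_dartIn] at this
              exact this hout
            · exact hOseg _ hp (rel_of_mem_segmentCurve (d := D.dartOut x (partner (s x) a)) hout)
          · exfalso
            rw [h1] at hp
            rcases hp with hp | hp
            · exact hQ (rel_of_mem_segmentCurve hp)
            · have := hOrev _ hp
              rw [rev_dartIn] at this
              exact this ha2O
          · rw [h1, hback]
            exact Or.inl (segmentCurve_step ha)
        · rw [hstep' x p hxc]
          exact hp.imp segmentCurve_step (hOstep x p).2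
      · rintro d (h1 | h1) (h2 | h2)
        · exact hrevseg d h1 h2
        · exact hOseg _ h2 (rel_of_mem_segmentCurve (d := d) h1)
        · exact hOseg _ h1 (rel_of_mem_segmentCurve (d := D.rev d) h2)
        · exact hOrev d h1 h2
      · rintro d (h1 | h1)
        · exact hmono (rel_of_mem_segmentCurve h1)
        · exact ((hmono ha0).trans (hall' a a2)).trans (hmono h1.1)
    rw [hY, dotShortcut_union hdisj, dotShortcut_eq_zero hS hOstep hOseg, add_zero]
  · push Not at ha
    congr 1
    apply segmentCurve_eq (start_mem_segmentCurve s)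
    · intro x p hp
      have hxc : x ≠ c := fun hxc => ha p (hxc ▸ hp)
      rw [hstep' x p hxc]
      exact segmentCurve_step hp
    · exact hrevseg
    · exact fun d hd => hmono (rel_of_mem_segmentCurve hd)

end KnotoidCode

namespace KnotoidCode

variable {D : KnotoidCode}

/-! ### Generators and lists of edges -/

/-- The label of the component through an edge. -/
def Generator.lab (g : D.Generator) (e : D.Edge) : Bool := g.label (D.comp g.state e)

theorem Generator.ext_lab {g h : D.Generator} (h1 : g.state = h.state)
    (h2 : ∀ e, g.lab e = h.lab e) : g = h := by
  obtain ⟨s, l, hl⟩ := g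
  obtain ⟨s', l', hl'⟩ := h
  dsimp only at h1
  subst h1
  congr 1
  funext x
  induction x using Quot.ind with
  | mk e => exact h2 e

theorem Generator.lab_congr {g : D.Generator} {e e' : D.Edge}
    (h : D.Rel (State.toP g.state) e e') : g.lab e = g.lab e' :=
  congrArg g.label (D.comp_eq_comp_iff.2 h)

theorem Generator.lab_of_rel_zero {g : D.Generator} {e : D.Edge}
    (h : D.Rel (State.toP g.state) 0 e) : g.lab e = false := by
  rw [← Generator.lab_congr h]
  exact g.label_segment

open Classical in
/-- The generator with label `X` on the segment and on the components through the edges of a list. -/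
noncomputable def ofEdges (s : D.State) (l : List D.Edge) : D.Generator where
  state := s
  label x := decide (x ∉ (0 :: l).map (D.comp s))
  label_segment := by simp [segment]

theorem lab_ofEdges {s : D.State} {l : List D.Edge} {e : D.Edge} :
    (ofEdges s l).lab e = false ↔ ∃ x ∈ 0 :: l, D.Rel (State.toP s) e x := by
  simp only [Generator.lab, ofEdges, decide_eq_false_iff_not, not_not, List.mem_map]
  refine exists_congr fun x => and_congr_right fun _ => ?_
  rw [eq_comm, comp_eq_comp_iff]

/-- The edges of a list lie on different components, none of which is the segment. -/
def Indep (s : D.State) (l : List D.Edge) : Prop :=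
  (0 :: l).Pairwise fun e e' => ¬ D.Rel (State.toP s) e e'

theorem Indep.eq_of_rel {s : D.State} {l : List D.Edge} (h : Indep s l) {e e' : D.Edge}
    (he : e ∈ 0 :: l) (he' : e' ∈ 0 :: l) (hr : D.Rel (State.toP s) e e') : e = e' := by
  by_contra hne
  let R := fun e e' => e ≠ e' → ¬ D.Rel (State.toP s) e e'
  have h1 : (0 :: l).Pairwise R := List.Pairwise.imp (S := R) (fun h _ => h) h
  have h2 : (0 :: l).Pairwise (flip R) :=
    List.Pairwise.imp (S := flip R) (fun h _ hr => h hr.symm) h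
  exact List.Pairwise.forall_of_forall_of_flip (fun x _ h => absurd rfl h) h1 h2 he he' hne hr

theorem indep_cons {s : D.State} {l : List D.Edge} {e : D.Edge} :
    Indep s (e :: l) ↔ Indep s l ∧ ∀ x ∈ 0 :: l, ¬ D.Rel (State.toP s) e x := by
  have h : Indep s (e :: l) ↔
      (e :: 0 :: l).Pairwise fun e e' => ¬ D.Rel (State.toP s) e e' :=
    (List.Perm.swap e 0 l).pairwise_iff fun h h' => h h'.symm
  rw [h, List.pairwise_cons, and_comm]
  rfl

theorem Indep.perm {s : D.State} {l l' : List D.Edge} (h : Indep s l) (hp : l.Perm l') :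
    Indep s l' :=
  ((hp.cons 0).pairwise_iff fun h h' => h h'.symm).1 h

theorem ofEdges_congr {s : D.State} {l l' : List D.Edge}
    (h : ∀ e, (∃ x ∈ 0 :: l, D.Rel (State.toP s) e x) ↔ ∃ x ∈ 0 :: l', D.Rel (State.toP s) e x) :
    ofEdges s l = ofEdges s l' := by
  refine Generator.ext_lab rfl fun e => ?_
  rw [Bool.eq_iff_iff, ← not_iff_not, Bool.not_eq_true, Bool.not_eq_true, lab_ofEdges, lab_ofEdges]
  exact h e

/-- Every generator is given by a list of edges on different components. -/
theorem exists_ofEdges (g : D.Generator) : ∃ l, Indep g.state l ∧ ofEdges g.state l = g := by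
  -- Greedy choice: an edge labelled `X` is added if its component is neither the segment nor
  -- already represented.
  have key : ∀ t : Finset D.Edge, ∃ l, Indep g.state l ∧ (∀ e ∈ l, g.lab e = false) ∧
      ∀ e ∈ t, g.lab e = false → ∃ x ∈ 0 :: l, D.Rel (State.toP g.state) e x := by
    intro t
    induction t using Finset.induction_on with
    | empty => exact ⟨[], List.pairwise_singleton _ _, by simp, by simp⟩
    | insert a t _ ih =>
      obtain ⟨l, h1, h2, h3⟩ := ih
      by_cases ha : g.lab a = false ∧ ¬ ∃ x ∈ 0 :: l, D.Rel (State.toP g.state) a x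
      · refine ⟨a :: l, indep_cons.2 ⟨h1, fun x hx hr => ha.2 ⟨x, hx, hr⟩⟩, ?_, ?_⟩
        · simpa using ⟨ha.1, h2⟩
        · intro e he hl
          rcases Finset.mem_insert.1 he with rfl | he
          · exact ⟨e, by simp, Rel.refl _⟩
          · obtain ⟨x, hx, hr⟩ := h3 e he hl
            refine ⟨x, ?_, hr⟩
            rcases List.mem_cons.1 hx with h | h <;> simp [h]
      · refine ⟨l, h1, h2, ?_⟩
        intro e he hl
        rcases Finset.mem_insert.1 he with rfl | he
        · by_contra hn
          exact ha ⟨hl, hn⟩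
        · exact h3 e he hl
  obtain ⟨l, h1, h2, h3⟩ := key Finset.univ
  refine ⟨l, h1, Generator.ext_lab rfl fun e => ?_⟩
  rw [Bool.eq_iff_iff, ← not_iff_not, Bool.not_eq_true, Bool.not_eq_true, lab_ofEdges]
  refine ⟨?_, h3 e (Finset.mem_univ e)⟩
  rintro ⟨x, hx, hr⟩
  rw [Generator.lab_congr hr]
  rcases List.mem_cons.1 hx with rfl | hx
  · exact Generator.lab_of_rel_zero (Rel.refl _)
  · exact h2 x hx

open Classical in
/-- The coefficient of a generator in the product of the variables of a list of edges. -/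
noncomputable def coef (s : D.State) (l : List D.Edge) (h : D.Generator) : ℤ :=
  if Indep s l ∧ h = ofEdges s l then 1 else 0

theorem coef_of_not_indep {s : D.State} {l : List D.Edge} (h : ¬ Indep s l) (k : D.Generator) :
    coef s l k = 0 := if_neg fun h' => h h'.1

theorem coef_congr {s : D.State} {l l' : List D.Edge} {k : D.Generator} (h : Indep s l ↔ Indep s l')
    (h' : ∀ e, (∃ x ∈ 0 :: l, D.Rel (State.toP s) e x) ↔ ∃ x ∈ 0 :: l', D.Rel (State.toP s) e x) :
    coef s l k = coef s l' k := by
  unfold coef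
  rw [ofEdges_congr h', propext h]

theorem coef_swap {s : D.State} {l : List D.Edge} {e e' : D.Edge} {k : D.Generator} :
    coef s (e :: e' :: l) k = coef s (e' :: e :: l) k := by
  have hp : ∀ e e', (e :: e' :: l).Perm (e' :: e :: l) := fun e e' => List.Perm.swap _ _ _
  refine coef_congr ⟨fun h => h.perm (hp e e'), fun h => h.perm (hp e' e)⟩ fun a => ?_
  refine exists_congr fun x => and_congr_left fun _ => ?_
  simp only [List.mem_cons]
  tauto

theorem coef_cons_congr {s : D.State} {l : List D.Edge} {e e' : D.Edge} {k : D.Generator}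
    (h : D.Rel (State.toP s) e e') : coef s (e :: l) k = coef s (e' :: l) k := by
  refine coef_congr ?_ fun a => ?_
  · rw [indep_cons, indep_cons]
    refine and_congr_right fun _ => forall₂_congr fun x _ => not_congr ?_
    exact ⟨fun h' => h.symm.trans h', fun h' => h.trans h'⟩
  · have : D.Rel (State.toP s) a e ↔ D.Rel (State.toP s) a e' :=
      ⟨fun h' => h'.trans h, fun h' => h'.trans h.symm⟩
    simp only [List.mem_cons, exists_eq_or_imp, this]

/-- The relation `X² = 0`. The segment carries `X` from the start, which is why the edge `0` counts
as a member of every list. -/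
theorem coef_eq_zero {s : D.State} {l : List D.Edge} {e x : D.Edge} (hx : x ∈ 0 :: l)
    (h : D.Rel (State.toP s) e x) (k : D.Generator) : coef s (e :: l) k = 0 :=
  coef_of_not_indep (fun h' => (indep_cons.1 h').2 x hx h) k

end KnotoidCode

namespace KnotoidCode

variable {D : KnotoidCode}

/-! ### The edge maps -/

/-- The sign of an edge map. -/
def edgeSign (c : Fin D.n) (s : D.State) : ℤ :=
  (-1) ^ (Finset.univ.filter fun c' => c' < c ∧ s c' = true).card

/-- The smoothing at `c` changed to the `1`-smoothing. -/
abbrev flip (c : Fin D.n) (s : D.State) : D.State := Function.update s c true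

theorem agreeOff_flip (c : Fin D.n) (s : D.State) : AgreeOff c s (flip c s) :=
  fun _ hx => (Function.update_of_ne hx _ _).symm

theorem flip_self (c : Fin D.n) (s : D.State) : flip c s c = true := Function.update_self ..

/-- The edge lies on a component that touches the crossing. -/
def Touches (s : D.State) (c : Fin D.n) (e : D.Edge) : Prop :=
  D.Rel (State.toP s) (D.edge c 0) e ∨ D.Rel (State.toP s) (D.edge c 2) e

theorem AgreeOff.touches_iff {c : Fin D.n} {s s' : D.State} (h : AgreeOff c s s') {e : D.Edge} :
    Touches s c e ↔ Touches s' c e := ⟨touch_imp h, touch_imp h.symm⟩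

theorem Touches.congr {c : Fin D.n} {s : D.State} {e e' : D.Edge} (h : D.Rel (State.toP s) e e')
    (he : Touches s c e) : Touches s c e' :=
  he.imp (fun h' => h'.trans h) (fun h' => h'.trans h)

theorem AgreeOff.rel_iff {c : Fin D.n} {s s' : D.State} (h : AgreeOff c s s') {e e' : D.Edge}
    (he : ¬ Touches s c e) : D.Rel (State.toP s) e e' ↔ D.Rel (State.toP s') e e' := by
  have he' : ¬ Touches s' c e := fun h' => he (h.touches_iff.2 h')
  exact ⟨untouched_imp h (fun h' => he (Or.inl h')) (fun h' => he (Or.inr h')),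
    untouched_imp h.symm (fun h' => he' (Or.inl h')) (fun h' => he' (Or.inr h'))⟩

/-- The generators which an edge map relates. -/
structure Adm (c : Fin D.n) (g h : D.Generator) : Prop where
  zero : g.state c = false
  state : h.state = flip c g.state
  lab : ∀ e, ¬ Touches g.state c e → h.lab e = g.lab e

theorem adm_iff {c : Fin D.n} {g h : D.Generator} : Adm c g h ↔
    (g.state c = false ∧ h.state = Function.update g.state c true ∧
      ∀ e : D.Edge, D.comp g.state e ≠ D.comp g.state (D.edge c 0) →
        D.comp g.state e ≠ D.comp g.state (D.edge c 2) →
          h.label (D.comp h.state e) = g.label (D.comp g.state e)) := by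
  have key : ∀ e, ¬ Touches g.state c e ↔ D.comp g.state e ≠ D.comp g.state (D.edge c 0) ∧
      D.comp g.state e ≠ D.comp g.state (D.edge c 2) := fun e => by
    rw [Touches, not_or, ne_comm, Ne, D.comp_eq_comp_iff, ne_comm, Ne, D.comp_eq_comp_iff]
  constructor
  · rintro ⟨h1, h2, h3⟩
    exact ⟨h1, h2, fun e h4 h5 => h3 e ((key e).2 ⟨h4, h5⟩)⟩
  · rintro ⟨h1, h2, h3⟩
    exact ⟨h1, h2, fun e h4 => h3 e ((key e).1 h4).1 ((key e).1 h4).2⟩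

theorem edgeCoeff_of_not_adm {c : Fin D.n} {g h : D.Generator} (hA : ¬ Adm c g h) :
    D.edgeCoeff c g h = 0 := if_neg fun h' => hA (adm_iff.2 h')

theorem edgeCoeff_merge {c : Fin D.n} {g h : D.Generator} (hA : Adm c g h)
    (hr : ¬ D.Rel (State.toP g.state) (D.edge c 0) (D.edge c 2)) :
    D.edgeCoeff c g h = edgeSign c g.state *
      mergeCoeff (g.lab (D.edge c 0)) (g.lab (D.edge c 2)) (h.lab (D.edge c 0)) := by
  unfold edgeCoeff
  rw [if_pos (adm_iff.1 hA), if_pos (fun h' => hr (D.comp_eq_comp_iff.1 h'))]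
  rfl

theorem edgeCoeff_split {c : Fin D.n} {g h : D.Generator} (hA : Adm c g h)
    (hr : D.Rel (State.toP g.state) (D.edge c 0) (D.edge c 2))
    (hr' : ¬ D.Rel (State.toP h.state) (D.edge c 0) (D.edge c 2)) :
    D.edgeCoeff c g h = edgeSign c g.state *
      splitCoeff (g.lab (D.edge c 0)) (h.lab (D.edge c 0)) (h.lab (D.edge c 2)) := by
  unfold edgeCoeff
  rw [if_pos (adm_iff.1 hA), if_neg (not_not.2 (D.comp_eq_comp_iff.2 hr)),
    if_pos (fun h' => hr' (D.comp_eq_comp_iff.1 h'))]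
  rfl

theorem edgeCoeff_single {c : Fin D.n} {g h : D.Generator}
    (hr : D.Rel (State.toP g.state) (D.edge c 0) (D.edge c 2))
    (hr' : D.Rel (State.toP h.state) (D.edge c 0) (D.edge c 2)) : D.edgeCoeff c g h = 0 := by
  by_cases hA : Adm c g h
  · unfold edgeCoeff
    rw [if_pos (adm_iff.1 hA), if_neg (not_not.2 (D.comp_eq_comp_iff.2 hr)),
      if_neg (not_not.2 (D.comp_eq_comp_iff.2 hr')), mul_zero]
  · exact edgeCoeff_of_not_adm hA

/-- Here `a` and `b` stand for the presence of a variable on each of the two components: the product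
vanishes only if both are present, and otherwise the result carries a variable if one of them did.
-/
theorem mergeCoeff_eq {a b : Prop} {x y z : Bool}
    [Decidable (¬ (a ∧ b) ∧ (z = false ↔ a ∨ b))] (hx : x = false ↔ a) (hy : y = false ↔ b) :
    mergeCoeff x y z = if ¬ (a ∧ b) ∧ (z = false ↔ a ∨ b) then 1 else 0 := by
  obtain rfl : (x = false) = a := propext hx
  obtain rfl : (y = false) = b := propext hy
  cases x <;> cases y <;> cases z <;> simp [mergeCoeff]

/-- The two summands are the multiplications by the variables of the two new components. A summand
drops out when its variable is already present, which leaves `X ⊗ X` as the image of `X`. -/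
theorem splitCoeff_eq {a b : Prop} {x y z : Bool}
    [Decidable (¬ a ∧ y = false ∧ (z = false ↔ b))] [Decidable (¬ b ∧ (y = false ↔ a) ∧ z = false)]
    (hx : x = false ↔ a ∨ b) (hab : ¬ (a ∧ b)) :
    splitCoeff x y z = (if ¬ a ∧ y = false ∧ (z = false ↔ b) then 1 else 0) +
      if ¬ b ∧ (y = false ↔ a) ∧ z = false then 1 else 0 := by
  by_cases ha : a <;> by_cases hb : b <;> simp only [ha, hb, and_true, true_and, or_true, true_or,
    or_self, and_self, not_true, not_false_iff, iff_true, iff_false, false_and, and_false] at hx hab ⊢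
  all_goals cases x <;> first | contradiction | skip
  all_goals cases y <;> cases z <;> simp [splitCoeff] at hx ⊢

section ofEdges

variable {c : Fin D.n} {s : D.State} {l l' : List D.Edge} {h : D.Generator}

theorem lab_ofEdges_flip (hT : ∀ x, ¬ Touches s c x → (x ∈ 0 :: l' ↔ x ∈ 0 :: l)) {e : D.Edge}
    (he : ¬ Touches s c e) : (ofEdges (flip c s) l').lab e = (ofEdges s l).lab e := by
  rw [Bool.eq_iff_iff, ← not_iff_not, Bool.not_eq_true, Bool.not_eq_true, lab_ofEdges, lab_ofEdges]
  refine exists_congr fun x => ?_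
  rw [← (agreeOff_flip c s).rel_iff he]
  exact and_congr_left fun hr => hT x fun hx => he (hx.congr hr.symm)

theorem adm_ofEdges (hc : s c = false)
    (hT : ∀ x, ¬ Touches s c x → (x ∈ 0 :: l' ↔ x ∈ 0 :: l)) :
    Adm c (ofEdges s l) (ofEdges (flip c s) l') :=
  ⟨hc, rfl, fun _ he => lab_ofEdges_flip hT he⟩

theorem eq_ofEdges_iff (hA : Adm c (ofEdges s l) h)
    (hT : ∀ x, ¬ Touches s c x → (x ∈ 0 :: l' ↔ x ∈ 0 :: l)) :
    h = ofEdges (flip c s) l' ↔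
      (h.lab (D.edge c 0) = false ↔ ∃ x ∈ 0 :: l', D.Rel (State.toP (flip c s)) (D.edge c 0) x) ∧
      (h.lab (D.edge c 2) = false ↔ ∃ x ∈ 0 :: l', D.Rel (State.toP (flip c s)) (D.edge c 2) x) := by
  constructor
  · rintro rfl
    exact ⟨lab_ofEdges, lab_ofEdges⟩
  · rintro ⟨h0, h2⟩
    rw [← lab_ofEdges, ← Bool.not_eq_true, ← Bool.not_eq_true, not_iff_not, ← Bool.eq_iff_iff]
      at h0 h2
    have hs : h.state = flip c s := hA.state
    refine Generator.ext_lab hs fun e => ?_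
    by_cases he : Touches s c e
    · rcases (agreeOff_flip c s).touches_iff.1 he with h' | h'
      · rw [← Generator.lab_congr (g := h) (by rwa [hs]), h0]
        exact Generator.lab_congr (g := ofEdges (flip c s) l') h'
      · rw [← Generator.lab_congr (g := h) (by rwa [hs]), h2]
        exact Generator.lab_congr (g := ofEdges (flip c s) l') h'
    · rw [hA.lab e he, ← lab_ofEdges_flip hT he]

theorem coef_of_not_adm (hc : s c = false)
    (hT : ∀ x, ¬ Touches s c x → (x ∈ 0 :: l' ↔ x ∈ 0 :: l)) (hA : ¬ Adm c (ofEdges s l) h) :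
    coef (flip c s) l' h = 0 := by
  refine if_neg ?_
  rintro ⟨-, rfl⟩
  exact hA (adm_ofEdges hc hT)

/-- Merging two components: the variables of both components become equal. -/
theorem edgeCoeff_ofEdges_of_not_rel (hc : s c = false) (hl : Indep s l)
    (hr : ¬ D.Rel (State.toP s) (D.edge c 0) (D.edge c 2)) (h : D.Generator) :
    D.edgeCoeff c (ofEdges s l) h = edgeSign c s * coef (flip c s) l h := by
  have hag := agreeOff_flip c s
  have hr' : D.Rel (State.toP (flip c s)) (D.edge c 0) (D.edge c 2) :=
    rel_of_not_rel hag (by rw [flip_self, hc]; rfl) hr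
  by_cases hA : Adm c (ofEdges s l) h
  swap
  · rw [edgeCoeff_of_not_adm hA, coef_of_not_adm hc (fun _ _ => Iff.rfl) hA, mul_zero]
  rw [edgeCoeff_merge hA hr]
  congr 1
  have hlab : h.lab (D.edge c 2) = h.lab (D.edge c 0) :=
    (Generator.lab_congr (by rw [hA.state]; exact hr')).symm
  set a : Prop := ∃ x ∈ 0 :: l, D.Rel (State.toP s) (D.edge c 0) x with ha
  set b : Prop := ∃ x ∈ 0 :: l, D.Rel (State.toP s) (D.edge c 2) x with hb
  have h1 : (ofEdges s l).lab (D.edge c 0) = false ↔ a := lab_ofEdges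
  have h2 : (ofEdges s l).lab (D.edge c 2) = false ↔ b := lab_ofEdges
  have htouch : ∀ x, Touches s c x ↔ D.Rel (State.toP (flip c s)) (D.edge c 0) x := fun x =>
    hag.touches_iff.trans ⟨fun h => h.elim id hr'.trans, Or.inl⟩
  have hx0 : (∃ x ∈ 0 :: l, D.Rel (State.toP (flip c s)) (D.edge c 0) x) ↔ a ∨ b := by
    simp only [← htouch, Touches, ha, hb, and_or_left, exists_or]
  have h3 : h = ofEdges (flip c s) l ↔ (h.lab (D.edge c 0) = false ↔ a ∨ b) := by
    rw [eq_ofEdges_iff hA (fun _ _ => Iff.rfl), hlab, hx0]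
    have hx2 : (∃ x ∈ 0 :: l, D.Rel (State.toP (flip c s)) (D.edge c 2) x) ↔ a ∨ b := by
      rw [← hx0]
      refine exists_congr fun x => and_congr_right fun _ => ?_
      exact ⟨hr'.trans, hr'.symm.trans⟩
    rw [hx2, and_self]
  have h4 : Indep (flip c s) l ↔ ¬ (a ∧ b) := by
    constructor
    · rintro hi ⟨⟨x, hx, h5⟩, ⟨y, hy, h6⟩⟩
      have h7 : x = y := hi.eq_of_rel hx hy
        (((htouch x).1 (Or.inl h5)).symm.trans ((htouch y).1 (Or.inr h6)))
      exact hr (h5.trans (h7 ▸ h6.symm))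
    · intro hab
      refine List.Pairwise.imp_of_mem ?_ hl
      intro x y hx hy hxy hxy'
      by_cases hxt : Touches s c x
      · have hyt : Touches s c y := (htouch y).2 (((htouch x).1 hxt).trans hxy')
        rcases hxt with h5 | h5 <;> rcases hyt with h6 | h6
        · exact hxy (h5.symm.trans h6)
        · exact hab ⟨⟨x, hx, h5⟩, ⟨y, hy, h6⟩⟩
        · exact hab ⟨⟨y, hy, h6⟩, ⟨x, hx, h5⟩⟩
        · exact hxy (h5.symm.trans h6)
      · exact hxy ((hag.rel_iff hxt).2 hxy')
  clear_value a b
  rw [coef, h3, h4]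
  classical convert mergeCoeff_eq h1 h2

/-- Dividing a component: the product is multiplied by the sum of the two new variables. -/
theorem edgeCoeff_ofEdges_of_rel (hS : D.IsSpherical) (hc : s c = false) (hl : Indep s l)
    (hr : D.Rel (State.toP s) (D.edge c 0) (D.edge c 2)) (h : D.Generator) :
    D.edgeCoeff c (ofEdges s l) h = edgeSign c s *
      (coef (flip c s) (D.edge c 0 :: l) h + coef (flip c s) (D.edge c 2 :: l) h) := by
  have hag := agreeOff_flip c s
  have hcc : flip c s c = !s c := by rw [flip_self, hc]; rfl
  have hT0 : ∀ x, ¬ Touches s c x → (x ∈ 0 :: D.edge c 0 :: l ↔ x ∈ 0 :: l) := fun x hx => by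
    have : x ≠ D.edge c 0 := fun h => hx (Or.inl (h ▸ Rel.refl _))
    simp [this]
  have hT2 : ∀ x, ¬ Touches s c x → (x ∈ 0 :: D.edge c 2 :: l ↔ x ∈ 0 :: l) := fun x hx => by
    have : x ≠ D.edge c 2 := fun h => hx (Or.inr (h ▸ Rel.refl _))
    simp [this]
  by_cases hA : Adm c (ofEdges s l) h
  swap
  · rw [edgeCoeff_of_not_adm hA, coef_of_not_adm hc hT0 hA, coef_of_not_adm hc hT2 hA, add_zero,
      mul_zero]
  by_cases hr' : D.Rel (State.toP (flip c s)) (D.edge c 0) (D.edge c 2)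
  -- One component stays one component. By sphericity it is the segment, where both new variables
  -- are zero, in agreement with `∇ = 0`.
  · have h0 : D.Rel (State.toP s) 0 (D.edge c 0) := by
      by_contra h0
      exact not_rel_of_rel hS hag hcc hr h0 hr'
    have h0' : D.Rel (State.toP (flip c s)) (D.edge c 0) 0 := (mono_of_rel hag hr' h0).symm
    rw [edgeCoeff_single hr (by rw [hA.state]; exact hr'), coef_eq_zero (by simp) h0',
      coef_eq_zero (by simp) (hr'.symm.trans h0'), add_zero, mul_zero]
  rw [edgeCoeff_split hA hr (by rw [hA.state]; exact hr')]
  congr 1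
  have hcc' : s c = !flip c s c := by rw [flip_self, hc]; rfl
  have hmono : ∀ {e e'}, D.Rel (State.toP (flip c s)) e e' → D.Rel (State.toP s) e e' :=
    mono_of_rel hag.symm hr
  set a : Prop := ∃ x ∈ 0 :: l, D.Rel (State.toP (flip c s)) (D.edge c 0) x with ha
  set b : Prop := ∃ x ∈ 0 :: l, D.Rel (State.toP (flip c s)) (D.edge c 2) x with hb
  have hab : ¬ (a ∧ b) := by
    rintro ⟨⟨x, hx, h5⟩, ⟨y, hy, h6⟩⟩
    have h7 : x = y := hl.eq_of_rel hx hy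
      ((hmono h5).symm.trans (hr.trans (hmono h6)))
    exact hr' (h5.trans (h7 ▸ h6.symm))
  have h1 : (ofEdges s l).lab (D.edge c 0) = false ↔ a ∨ b := by
    rw [lab_ofEdges, ha, hb, ← exists_or]
    refine exists_congr fun x => ?_
    rw [← and_or_left]
    refine and_congr_right fun _ => ⟨fun h5 => hag.touches_iff.1 (Or.inl h5), ?_⟩
    exact fun h5 => h5.elim hmono fun h6 => hr.trans (hmono h6)
  have hi : Indep (flip c s) l := List.Pairwise.imp (fun h5 h6 => h5 (hmono h6)) hl
  have h3 : Indep (flip c s) (D.edge c 0 :: l) ↔ ¬ a := by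
    rw [indep_cons, ha]
    push Not
    exact and_iff_right hi
  have h4 : Indep (flip c s) (D.edge c 2 :: l) ↔ ¬ b := by
    rw [indep_cons, hb]
    push Not
    exact and_iff_right hi
  have hcons : ∀ P : D.Edge → Prop, ∀ e, (∃ x ∈ 0 :: e :: l, P x) ↔ P e ∨ ∃ x ∈ 0 :: l, P x := by
    intro P e
    simp only [List.mem_cons, exists_eq_or_imp]
    exact or_left_comm
  have h5 : h = ofEdges (flip c s) (D.edge c 0 :: l) ↔
      (h.lab (D.edge c 0) = false ∧ (h.lab (D.edge c 2) = false ↔ b)) := by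
    rw [eq_ofEdges_iff hA hT0, hcons, hcons, ← ha, ← hb]
    simp only [Rel.refl, true_or, iff_true, show ¬ D.Rel (State.toP (flip c s)) (D.edge c 2)
      (D.edge c 0) from fun h6 => hr' h6.symm, false_or]
  have h6 : h = ofEdges (flip c s) (D.edge c 2 :: l) ↔
      ((h.lab (D.edge c 0) = false ↔ a) ∧ h.lab (D.edge c 2) = false) := by
    rw [eq_ofEdges_iff hA hT2, hcons, hcons, ← ha, ← hb]
    simp only [Rel.refl, true_or, iff_true, hr', false_or]
  clear_value a b
  rw [coef, coef, h3, h4, h5, h6]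
  classical convert splitCoeff_eq h1 hab

end ofEdges

end KnotoidCode

namespace KnotoidCode

variable {D : KnotoidCode}

/-! ### The square of the differential -/

theorem sum_coef_mul (s : D.State) (l : List D.Edge) (ψ : D.Generator → ℤ) (h : Indep s l) :
    ∑ g, coef s l g * ψ g = ψ (ofEdges s l) := by
  classical
  rw [Finset.sum_eq_single (ofEdges s l)]
  · rw [coef, if_pos ⟨h, rfl⟩, one_mul]
  · intro g _ hg
    rw [coef, if_neg fun h' => hg h'.2, zero_mul]
  · exact fun h' => absurd (Finset.mem_univ _) h'

theorem sum_coef_mul_of_not_indep (s : D.State) (l : List D.Edge) (ψ : D.Generator → ℤ)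
    (h : ¬ Indep s l) : ∑ g, coef s l g * ψ g = 0 :=
  Finset.sum_eq_zero fun g _ => by rw [coef_of_not_indep h, zero_mul]

open Classical in
/-- The unsigned edge map on the product of the variables of a list of edges. -/
noncomputable def edgeMap (c : Fin D.n) (s : D.State) (l : List D.Edge) (k : D.Generator) : ℤ :=
  if D.Rel (State.toP s) (D.edge c 0) (D.edge c 2) then
    coef (flip c s) (D.edge c 0 :: l) k + coef (flip c s) (D.edge c 2 :: l) k
  else coef (flip c s) l k

theorem edgeMap_of_rel {c : Fin D.n} {s : D.State}
    (h : D.Rel (State.toP s) (D.edge c 0) (D.edge c 2)) (l : List D.Edge) (k : D.Generator) :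
    edgeMap c s l k =
      coef (flip c s) (D.edge c 0 :: l) k + coef (flip c s) (D.edge c 2 :: l) k := if_pos h

theorem edgeMap_of_not_rel {c : Fin D.n} {s : D.State}
    (h : ¬ D.Rel (State.toP s) (D.edge c 0) (D.edge c 2)) (l : List D.Edge) (k : D.Generator) :
    edgeMap c s l k = coef (flip c s) l k := if_neg h

theorem edgeCoeff_ofEdges (hS : D.IsSpherical) {c : Fin D.n} {s : D.State} {l : List D.Edge}
    (hc : s c = false) (hl : Indep s l) (k : D.Generator) :
    D.edgeCoeff c (ofEdges s l) k = edgeSign c s * edgeMap c s l k := by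
  by_cases hr : D.Rel (State.toP s) (D.edge c 0) (D.edge c 2)
  · rw [edgeMap_of_rel hr, edgeCoeff_ofEdges_of_rel hS hc hl hr]
  · rw [edgeMap_of_not_rel hr, edgeCoeff_ofEdges_of_not_rel hc hl hr]

/-- A product that is zero is mapped to zero. This allows the formulas to be composed without asking
whether the intermediate products are independent. -/
theorem edgeMap_of_not_indep {c : Fin D.n} {s : D.State} {l : List D.Edge}
    (hc : s c = false) (hl : ¬ Indep s l) (k : D.Generator) : edgeMap c s l k = 0 := by
  have hag := agreeOff_flip c s
  by_cases hr : D.Rel (State.toP s) (D.edge c 0) (D.edge c 2)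
  · have key : ∀ a b : D.Edge, (∀ x, Touches (flip c s) c x →
        D.Rel (State.toP (flip c s)) a x ∨ D.Rel (State.toP (flip c s)) b x) →
        coef (flip c s) (a :: l) k = 0 := by
      intro a b hT
      refine coef_of_not_indep (fun hi => hl ?_) k
      rw [indep_cons] at hi
      refine List.Pairwise.imp_of_mem ?_ hi.1
      intro x y hx hy hxy hxy'
      by_cases hxt : Touches s c x
      · have h1 := (hT x (hag.touches_iff.1 hxt)).resolve_left (hi.2 x hx)
        have h2 := (hT y (hag.touches_iff.1 (hxt.congr hxy'))).resolve_left (hi.2 y hy)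
        exact hxy (h1.symm.trans h2)
      · exact hxy ((hag.rel_iff hxt).1 hxy')
    rw [edgeMap_of_rel hr, key _ (D.edge c 2) fun _ h => h, key _ (D.edge c 0) fun _ h => h.symm,
      add_zero]
  · rw [edgeMap_of_not_rel hr]
    refine coef_of_not_indep (fun hi => hl ?_) k
    have hr' := rel_of_not_rel hag (by rw [flip_self, hc]; rfl) hr
    exact List.Pairwise.imp (fun h5 h6 => h5 (mono_of_rel hag hr' h6)) hi

theorem sum_coef_mul_edgeCoeff (hS : D.IsSpherical) {c : Fin D.n} {s : D.State}
    (hc : s c = false) (l : List D.Edge) (k : D.Generator) :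
    ∑ h, coef s l h * D.edgeCoeff c h k = edgeSign c s * edgeMap c s l k := by
  by_cases hl : Indep s l
  · rw [sum_coef_mul s l (fun h => D.edgeCoeff c h k) hl, edgeCoeff_ofEdges hS hc hl]
  · rw [sum_coef_mul_of_not_indep s l _ hl, edgeMap_of_not_indep hc hl, mul_zero]

open Classical in
/-- The composition of two unsigned edge maps. -/
noncomputable def edgeMap₂ (c c' : Fin D.n) (s : D.State) (l : List D.Edge) (k : D.Generator) : ℤ :=
  if D.Rel (State.toP s) (D.edge c 0) (D.edge c 2) then
    edgeMap c' (flip c s) (D.edge c 0 :: l) k + edgeMap c' (flip c s) (D.edge c 2 :: l) k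
  else edgeMap c' (flip c s) l k

theorem flip_of_ne {c c' : Fin D.n} (h : c' ≠ c) (s : D.State) : flip c s c' = s c' :=
  Function.update_of_ne h _ _

theorem flip_comm (c c' : Fin D.n) (s : D.State) : flip c (flip c' s) = flip c' (flip c s) := by
  by_cases h : c = c'
  · rw [h]
  · exact (Function.update_comm h _ _ _).symm

theorem sum_edgeCoeff_mul_edgeCoeff (hS : D.IsSpherical) {c c' : Fin D.n} (hcc : c' ≠ c)
    {s : D.State} (hc : s c = false) (hc' : s c' = false) {l : List D.Edge} (hl : Indep s l)
    (k : D.Generator) :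
    ∑ h, D.edgeCoeff c (ofEdges s l) h * D.edgeCoeff c' h k =
      edgeSign c s * edgeSign c' (flip c s) * edgeMap₂ c c' s l k := by
  have hc'' : flip c s c' = false := by rw [flip_of_ne hcc, hc']
  simp_rw [edgeCoeff_ofEdges hS hc hl, mul_assoc, ← Finset.mul_sum]
  congr 1
  unfold edgeMap₂ edgeMap
  by_cases hr : D.Rel (State.toP s) (D.edge c 0) (D.edge c 2)
  · simp_rw [if_pos hr, add_mul, Finset.sum_add_distrib, sum_coef_mul_edgeCoeff hS hc'', ← mul_add]
    rfl
  · simp_rw [if_neg hr, sum_coef_mul_edgeCoeff hS hc'']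
    rfl

section square

variable {c c' : Fin D.n} {s : D.State}

/-- The conditions say that `{a, b}` and `{x, y}` meet the same components, so the two sums of
variables are equal. -/
theorem coef_add_coef {a b x y : D.Edge} {t : D.State}
    (h1 : D.Rel (State.toP t) a x ∨ D.Rel (State.toP t) a y)
    (h2 : D.Rel (State.toP t) b x ∨ D.Rel (State.toP t) b y)
    (h3 : D.Rel (State.toP t) a x ∨ D.Rel (State.toP t) b x)
    (h4 : D.Rel (State.toP t) a y ∨ D.Rel (State.toP t) b y) (l : List D.Edge) (k : D.Generator) :
    coef t (a :: l) k + coef t (b :: l) k = coef t (x :: l) k + coef t (y :: l) k := by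
  rcases h1 with h1 | h1 <;> rcases h2 with h2 | h2
  · rcases h4 with h4 | h4
    · rw [coef_cons_congr h1, coef_cons_congr h2, coef_cons_congr (h1.symm.trans h4)]
    · rw [coef_cons_congr h1, coef_cons_congr h2, coef_cons_congr (h2.symm.trans h4)]
  · rw [coef_cons_congr h1, coef_cons_congr h2]
  · rw [coef_cons_congr h1, coef_cons_congr h2, add_comm]
  · rcases h3 with h3 | h3
    · rw [coef_cons_congr h1, coef_cons_congr h2, coef_cons_congr (h3.symm.trans h1)]
    · rw [coef_cons_congr h1, coef_cons_congr h2, coef_cons_congr (h3.symm.trans h2)]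

/-- If `c` merges two components before the change at `c'` but not afterwards, then `c'` merges the
same two components. -/
theorem square_of_merge (hc : s c = false) (hc' : s c' = false)
    (h : ¬ D.Rel (State.toP s) (D.edge c 0) (D.edge c 2))
    (h' : D.Rel (State.toP (flip c' s)) (D.edge c 0) (D.edge c 2)) :
    ¬ D.Rel (State.toP s) (D.edge c' 0) (D.edge c' 2) ∧
    D.Rel (State.toP (flip c s)) (D.edge c' 0) (D.edge c' 2) ∧
    ∀ l k, coef (flip c' (flip c s)) (D.edge c 0 :: l) k +
        coef (flip c' (flip c s)) (D.edge c 2 :: l) k =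
      coef (flip c' (flip c s)) (D.edge c' 0 :: l) k +
        coef (flip c' (flip c s)) (D.edge c' 2 :: l) k := by
  have m2 : ¬ D.Rel (State.toP s) (D.edge c' 0) (D.edge c' 2) := fun hr =>
    h (mono_of_rel (agreeOff_flip c' s).symm hr h')
  have hr10 := rel_of_not_rel (agreeOff_flip c s) (by rw [flip_self, hc]; rfl) h
  have hr01 := rel_of_not_rel (agreeOff_flip c' s) (by rw [flip_self, hc']; rfl) m2
  have mono10 : ∀ {e e'}, D.Rel (State.toP s) e e' → D.Rel (State.toP (flip c s)) e e' :=
    mono_of_rel (agreeOff_flip c s) hr10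
  have mono01 : ∀ {e e'}, D.Rel (State.toP s) e e' → D.Rel (State.toP (flip c' s)) e e' :=
    mono_of_rel (agreeOff_flip c' s) hr01
  have t0 : Touches s c' (D.edge c 0) := by
    by_contra ht
    exact h (((agreeOff_flip c' s).rel_iff ht).2 h')
  have t2 : Touches s c' (D.edge c 2) := by
    by_contra ht
    exact h (((agreeOff_flip c' s).rel_iff ht).2 h'.symm).symm
  have key : (D.Rel (State.toP s) (D.edge c' 0) (D.edge c 0) ∧
      D.Rel (State.toP s) (D.edge c' 2) (D.edge c 2)) ∨
      (D.Rel (State.toP s) (D.edge c' 2) (D.edge c 0) ∧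
      D.Rel (State.toP s) (D.edge c' 0) (D.edge c 2)) := by
    rcases t0 with t0 | t0 <;> rcases t2 with t2 | t2
    · exact absurd (t0.symm.trans t2) h
    · exact Or.inl ⟨t0, t2⟩
    · exact Or.inr ⟨t0, t2⟩
    · exact absurd (t0.symm.trans t2) h
  have hr10' : D.Rel (State.toP (flip c s)) (D.edge c' 0) (D.edge c' 2) := by
    rcases key with ⟨k1, k2⟩ | ⟨k1, k2⟩
    · exact (mono10 k1).trans (hr10.trans (mono10 k2).symm)
    · exact (mono10 k2).trans (hr10.symm.trans (mono10 k1).symm)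
  refine ⟨m2, hr10', fun l k => ?_⟩
  have q1 : ∀ e, Touches s c' e → Touches (flip c' (flip c s)) c' e := fun e he =>
    (agreeOff_flip c' (flip c s)).touches_iff.1 (he.imp mono10 mono10)
  have q2 : ∀ e, Touches s c e → Touches (flip c' (flip c s)) c e := fun e he => by
    rw [← flip_comm]
    exact (agreeOff_flip c (flip c' s)).touches_iff.1 (he.imp mono01 mono01)
  have t0' : Touches s c (D.edge c' 0) := by
    rcases key with ⟨k1, k2⟩ | ⟨k1, k2⟩
    · exact Or.inl k1.symm
    · exact Or.inr k2.symm
  have t2' : Touches s c (D.edge c' 2) := by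
    rcases key with ⟨k1, k2⟩ | ⟨k1, k2⟩
    · exact Or.inr k2.symm
    · exact Or.inl k1.symm
  exact coef_add_coef ((q1 _ t0).imp Rel.symm Rel.symm) ((q1 _ t2).imp Rel.symm Rel.symm)
    (q2 _ t0') (q2 _ t2') l k

/-- If `c` merges two components only after the change at `c'`, then `c'` divides the component
which contains all half-edges at `c` and `c'`. -/
theorem square_of_split (hS : D.IsSpherical) (hc : s c = false) (hc' : s c' = false) (hne : c ≠ c')
    (h : D.Rel (State.toP s) (D.edge c 0) (D.edge c 2))
    (h' : ¬ D.Rel (State.toP (flip c' s)) (D.edge c 0) (D.edge c 2)) :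
    D.Rel (State.toP s) (D.edge c' 0) (D.edge c' 2) ∧
    (∀ l k, coef (flip c' (flip c s)) (D.edge c 0 :: l) k +
        coef (flip c' (flip c s)) (D.edge c 2 :: l) k =
      coef (flip c' (flip c s)) (D.edge c' 0 :: l) k +
        coef (flip c' (flip c s)) (D.edge c' 2 :: l) k) ∧
    (D.Rel (State.toP (flip c s)) (D.edge c' 0) (D.edge c' 2) →
      ∀ l k, coef (flip c' (flip c s)) (D.edge c' 0 :: l) k = 0 ∧
        coef (flip c' (flip c s)) (D.edge c' 2 :: l) k = 0) := by
  have r2 : D.Rel (State.toP s) (D.edge c' 0) (D.edge c' 2) := by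
    by_contra m2
    exact h' (mono_of_rel (agreeOff_flip c' s)
      (rel_of_not_rel (agreeOff_flip c' s) (by rw [flip_self, hc']; rfl) m2) h)
  have t0 : Touches (flip c' s) c' (D.edge c 0) := by
    by_contra ht
    exact h' (((agreeOff_flip c' s).symm.rel_iff ht).2 h)
  have t2 : Touches (flip c' s) c' (D.edge c 2) := by
    by_contra ht
    exact h' (((agreeOff_flip c' s).symm.rel_iff ht).2 h.symm).symm
  have hr11 : D.Rel (State.toP (flip c' (flip c s))) (D.edge c 0) (D.edge c 2) := by
    rw [← flip_comm]
    exact rel_of_not_rel (agreeOff_flip c (flip c' s))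
      (by rw [flip_self, flip_of_ne hne, hc]; rfl) h'
  have mono : ∀ {e e'}, D.Rel (State.toP (flip c' s)) e e' →
      D.Rel (State.toP (flip c' (flip c s))) e e' := by
    rw [← flip_comm] at hr11 ⊢
    exact mono_of_rel (agreeOff_flip c (flip c' s)) hr11
  have key : D.Rel (State.toP (flip c' (flip c s))) (D.edge c 0) (D.edge c' 0) ∧
      D.Rel (State.toP (flip c' (flip c s))) (D.edge c 0) (D.edge c' 2) := by
    rcases t0 with t0 | t0 <;> rcases t2 with t2 | t2
    · exact absurd (t0.symm.trans t2) h'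
    · exact ⟨(mono t0).symm, hr11.trans (mono t2).symm⟩
    · exact ⟨hr11.trans (mono t2).symm, (mono t0).symm⟩
    · exact absurd (t0.symm.trans t2) h'
  refine ⟨r2, fun l k => ?_, fun hr l k => ?_⟩
  · rw [← coef_cons_congr hr11, ← coef_cons_congr key.1, ← coef_cons_congr key.2]
  · have hr' := key.1.symm.trans key.2
    -- If `c'` meets a single component both before and after its change, this component is the
    -- segment, and its variables are zero.
    have hz : D.Rel (State.toP (flip c s)) 0 (D.edge c' 0) := by
      by_contra hz
      exact not_rel_of_rel hS (agreeOff_flip c' (flip c s))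
        (by rw [flip_self, flip_of_ne hne.symm, hc']; rfl) hr hz hr'
    have hz' := mono_of_rel (agreeOff_flip c' (flip c s)) hr' hz
    exact ⟨coef_eq_zero (by simp) hz'.symm k, coef_eq_zero (by simp) (hr'.symm.trans hz'.symm) k⟩

/-- The cases record whether each crossing meets one component or two, before and after the change
at the other. If the order does not matter for this, both sides are the same products. Otherwise
`square_of_merge` and `square_of_split` exclude the case, identify the two sums of variables, or
show that both sides vanish. -/
theorem edgeMap₂_comm (hS : D.IsSpherical) (hc : s c = false) (hc' : s c' = false) (hne : c ≠ c')
    (l : List D.Edge) (k : D.Generator) : edgeMap₂ c c' s l k = edgeMap₂ c' c s l k := by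
  have hcomm : flip c (flip c' s) = flip c' (flip c s) := flip_comm c c' s
  by_cases m1 : D.Rel (State.toP s) (D.edge c 0) (D.edge c 2) <;>
    by_cases m1' : D.Rel (State.toP (flip c' s)) (D.edge c 0) (D.edge c 2) <;>
    by_cases m2 : D.Rel (State.toP s) (D.edge c' 0) (D.edge c' 2) <;>
    by_cases m2' : D.Rel (State.toP (flip c s)) (D.edge c' 0) (D.edge c' 2) <;>
    simp only [edgeMap₂, edgeMap, m1, m1', m2, m2', if_true, if_false, hcomm]
  · rw [coef_swap (e := D.edge c' 0), coef_swap (e := D.edge c' 2),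
      coef_swap (e := D.edge c' 0) (e' := D.edge c 2),
      coef_swap (e := D.edge c' 2) (e' := D.edge c 2)]
    ring
  · have h0 := (square_of_split hS hc' hc hne.symm m2 m2').2.2 m1'
    rw [hcomm] at h0
    rw [(h0 _ k).1, (h0 _ k).2, (h0 _ k).1, (h0 _ k).2, (h0 _ k).1, (h0 _ k).2]
    norm_num
  · exact absurd m1 (square_of_merge hc' hc m2 m2').1
  · have h0 := (square_of_split hS hc hc' hne m1 m1').2.2 m2'
    rw [coef_swap (e := D.edge c' 0), coef_swap (e := D.edge c' 2),
      coef_swap (e := D.edge c' 0) (e' := D.edge c 2),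
      coef_swap (e := D.edge c' 2) (e' := D.edge c 2)]
    have h1 : ∀ a l, coef (flip c' (flip c s)) (a :: D.edge c' 0 :: l) k = 0 := fun a l => by
      rw [coef_swap, (h0 _ k).1]
    have h2 : ∀ a l, coef (flip c' (flip c s)) (a :: D.edge c' 2 :: l) k = 0 := fun a l => by
      rw [coef_swap, (h0 _ k).2]
    rw [h1, h1, h2, h2, (h0 _ k).1, (h0 _ k).2]
    norm_num
  · exact (square_of_split hS hc hc' hne m1 m1').2.1 l k
  · exact absurd (square_of_split hS hc hc' hne m1 m1').1 m2
  · exact absurd (square_of_split hS hc hc' hne m1 m1').1 m2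
  · exact absurd m2 (square_of_merge hc hc' m1 m1').1
  · exact absurd m2 (square_of_merge hc hc' m1 m1').1
  · exact ((square_of_merge hc hc' m1 m1').2.2 l k).symm
  · exact absurd (square_of_merge hc hc' m1 m1').2.1 m2'
  · exact absurd (square_of_split hS hc' hc hne.symm m2 m2').1 m1
  · exact absurd (square_of_merge hc' hc m2 m2').2.1 m1'

end square

theorem edgeSign_flip_of_lt {c c' : Fin D.n} {s : D.State} (hc : s c = false) (h : c < c') :
    edgeSign c' (flip c s) = - edgeSign c' s := by
  have : (Finset.univ.filter fun x => x < c' ∧ flip c s x = true) =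
      insert c (Finset.univ.filter fun x => x < c' ∧ s x = true) := by
    ext x
    simp only [Finset.mem_filter, Finset.mem_univ, true_and, Finset.mem_insert]
    by_cases hx : x = c
    · subst hx
      simp [h]
    · simp [hx]
  rw [edgeSign, edgeSign, this, Finset.card_insert_of_notMem (by simp [hc]), pow_succ]
  ring

theorem edgeSign_flip_of_not_lt {c c' : Fin D.n} {s : D.State} (h : ¬ c < c') :
    edgeSign c' (flip c s) = edgeSign c' s := by
  unfold edgeSign
  congr 2
  refine Finset.filter_congr fun x _ => and_congr_right fun hx => ?_
  rw [flip_of_ne]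
  rintro rfl
  exact h hx

/-- Only the larger crossing counts the smaller one among its predecessors, so exactly one of the
two signs is affected by the other change. -/
theorem edgeSign_comm {c c' : Fin D.n} {s : D.State} (hc : s c = false) (hc' : s c' = false)
    (hne : c ≠ c') : edgeSign c s * edgeSign c' (flip c s) =
      - (edgeSign c' s * edgeSign c (flip c' s)) := by
  rcases lt_or_gt_of_ne hne with h | h
  · rw [edgeSign_flip_of_lt hc h, edgeSign_flip_of_not_lt h.asymm]
    ring
  · rw [edgeSign_flip_of_lt hc' h, edgeSign_flip_of_not_lt h.asymm]
    ring

theorem adm_of_edgeCoeff_ne_zero {c : Fin D.n} {g h : D.Generator} (hn : D.edgeCoeff c g h ≠ 0) :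
    Adm c g h := by
  by_contra hA
  exact hn (edgeCoeff_of_not_adm hA)

theorem sum_edgeCoeff_anticomm (hS : D.IsSpherical) (c c' : Fin D.n) (g k : D.Generator) :
    ∑ h, D.edgeCoeff c g h * D.edgeCoeff c' h k =
      - ∑ h, D.edgeCoeff c' g h * D.edgeCoeff c h k := by
  have key : ∀ c c', (c = c' ∨ g.state c = true ∨ g.state c' = true) →
      ∑ h, D.edgeCoeff c g h * D.edgeCoeff c' h k = 0 := by
    intro c c' hcc
    refine Finset.sum_eq_zero fun h _ => ?_
    by_contra hn
    have h1 := adm_of_edgeCoeff_ne_zero (left_ne_zero_of_mul hn)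
    have h2 := adm_of_edgeCoeff_ne_zero (right_ne_zero_of_mul hn)
    have h3 := h2.zero
    rw [h1.state] at h3
    by_cases he : c' = c
    · rw [he, flip_self] at h3
      exact absurd h3 (by decide)
    · rw [flip_of_ne he] at h3
      rcases hcc with h4 | h4 | h4
      · exact he h4.symm
      · rw [h1.zero] at h4
        exact absurd h4 (by decide)
      · rw [h3] at h4
        exact absurd h4 (by decide)
  by_cases hcc : c = c' ∨ g.state c = true ∨ g.state c' = true
  · rw [key c c' hcc, key c' c (by tauto), neg_zero]
  · push Not at hcc
    obtain ⟨hne, hc, hc'⟩ := hcc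
    rw [Ne, Bool.not_eq_true] at hc hc'
    obtain ⟨l, hl, hg⟩ := exists_ofEdges g
    rw [← hg, sum_edgeCoeff_mul_edgeCoeff hS hne.symm hc hc' hl,
      sum_edgeCoeff_mul_edgeCoeff hS hne hc' hc hl, edgeMap₂_comm hS hc hc' hne,
      edgeSign_comm hc hc' hne]
    ring

/-- The matrix of the differential. -/
noncomputable def totalCoeff (g h : D.Generator) : ℤ := ∑ c : Fin D.n, D.edgeCoeff c g h

theorem sum_totalCoeff_mul (hS : D.IsSpherical) (g k : D.Generator) :
    ∑ h, totalCoeff g h * totalCoeff h k = 0 := by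
  have h1 : ∑ h, totalCoeff g h * totalCoeff h k =
      ∑ c, ∑ c', ∑ h, D.edgeCoeff c g h * D.edgeCoeff c' h k := by
    simp_rw [totalCoeff, Finset.sum_mul_sum]
    rw [Finset.sum_comm]
    exact Finset.sum_congr rfl fun c _ => Finset.sum_comm
  -- Exchanging the names of the two crossings turns the double sum into its negative.
  have h2 : ∑ c, ∑ c', ∑ h, D.edgeCoeff c g h * D.edgeCoeff c' h k =
      - ∑ c, ∑ c', ∑ h, D.edgeCoeff c g h * D.edgeCoeff c' h k := by
    nth_rewrite 1 [Finset.sum_comm]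
    simp_rw [← Finset.sum_neg_distrib]
    refine Finset.sum_congr rfl fun c _ => Finset.sum_congr rfl fun c' _ => ?_
    rw [sum_edgeCoeff_anticomm hS, Finset.sum_neg_distrib]
  rw [h1]
  omega

end KnotoidCode

namespace KnotoidCode

variable {D : KnotoidCode}

/-! ### The differential preserves the gradings -/

/-- The degree of a basis vector of `𝒜`. -/
def weight (b : Bool) : ℤ := if b then 1 else -1

instance (s : D.State) : Finite (D.Component s) := Quot.finite _

noncomputable instance (s : D.State) : Fintype (D.Component s) := Fintype.ofFinite _

noncomputable instance (s : D.State) : DecidableEq (D.Component s) := Classical.decEq _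

theorem deg_eq_sum (g : D.Generator) : g.deg = ∑ x, weight (g.label x) :=
  finsum_eq_sum_of_fintype _

theorem deg_eq_add (g : D.Generator) (c : Fin D.n) :
    g.deg = ∑ x ∈ Finset.univ \ {D.comp g.state (D.edge c 0), D.comp g.state (D.edge c 2)},
      weight (g.label x) +
      ∑ x ∈ {D.comp g.state (D.edge c 0), D.comp g.state (D.edge c 2)}, weight (g.label x) := by
  rw [deg_eq_sum, Finset.sum_sdiff (Finset.subset_univ _)]

theorem comp_mem_sdiff_iff {s : D.State} {c : Fin D.n} {e : D.Edge} :
    D.comp s e ∈ Finset.univ \ {D.comp s (D.edge c 0), D.comp s (D.edge c 2)} ↔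
      ¬ Touches s c e := by
  simp only [Finset.mem_sdiff, Finset.mem_univ, true_and, Finset.mem_insert, Finset.mem_singleton,
    Touches, ← D.comp_eq_comp_iff]
  rw [eq_comm, eq_comm (a := D.comp s e)]

theorem comp_out {s : D.State} (x : D.Component s) : D.comp s x.out = x := Quot.out_eq x

/-- The components away from `c` are the same sets of edges with the same labels in both states;
representative edges provide the bijection. -/
theorem Adm.sum_eq {c : Fin D.n} {g h : D.Generator} (hA : Adm c g h) :
    ∑ x ∈ Finset.univ \ {D.comp g.state (D.edge c 0), D.comp g.state (D.edge c 2)},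
      weight (g.label x) =
    ∑ x ∈ Finset.univ \ {D.comp h.state (D.edge c 0), D.comp h.state (D.edge c 2)},
      weight (h.label x) := by
  have hag : AgreeOff c g.state h.state := by
    rw [hA.state]
    exact agreeOff_flip c g.state
  refine Finset.sum_bij (fun x _ => D.comp h.state x.out) ?_ ?_ ?_ ?_
  · intro x hx
    rw [← comp_out x, comp_mem_sdiff_iff] at hx
    exact comp_mem_sdiff_iff.2 fun ht => hx (hag.touches_iff.2 ht)
  · intro x hx y hy hxy
    rw [← comp_out x, comp_mem_sdiff_iff] at hx
    rw [D.comp_eq_comp_iff, ← hag.rel_iff hx, ← D.comp_eq_comp_iff, comp_out, comp_out] at hxy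
    exact hxy
  · intro y hy
    rw [← comp_out y, comp_mem_sdiff_iff] at hy
    have hy' : ¬ Touches g.state c y.out := fun ht => hy (hag.touches_iff.1 ht)
    refine ⟨D.comp g.state y.out, comp_mem_sdiff_iff.2 hy', ?_⟩
    have h1 : D.comp g.state (D.comp g.state y.out).out = D.comp g.state y.out := comp_out _
    rw [D.comp_eq_comp_iff] at h1
    rw [← comp_out y, D.comp_eq_comp_iff, comp_out y]
    exact ((hag.rel_iff hy').1 h1.symm).symm
  · intro x hx
    rw [← comp_out x, comp_mem_sdiff_iff] at hx
    have := hA.lab _ hx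
    rw [Generator.lab, Generator.lab, comp_out] at this
    rw [this]

theorem weight_of_mergeCoeff : ∀ {x y z : Bool}, mergeCoeff x y z ≠ 0 →
    weight z = weight x + weight y - 1 := by decide

theorem weight_of_splitCoeff : ∀ {x y z : Bool}, splitCoeff x y z ≠ 0 →
    weight y + weight z = weight x - 1 := by decide

/-- Multiplication and comultiplication both lower the degree by one. This balances the rise of the
homological degree in the `q`-grading. -/
theorem deg_of_edgeCoeff_ne_zero {c : Fin D.n} {g h : D.Generator} (hn : D.edgeCoeff c g h ≠ 0) :
    h.deg = g.deg - 1 := by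
  have hA := adm_of_edgeCoeff_ne_zero hn
  rw [deg_eq_add g c, deg_eq_add h c, hA.sum_eq]
  by_cases hr : D.Rel (State.toP g.state) (D.edge c 0) (D.edge c 2)
  · by_cases hr' : D.Rel (State.toP h.state) (D.edge c 0) (D.edge c 2)
    · exact absurd (edgeCoeff_single hr hr') hn
    · rw [edgeCoeff_split hA hr hr'] at hn
      have h1 := weight_of_splitCoeff (right_ne_zero_of_mul hn)
      rw [Finset.sum_pair fun h' => hr' (D.comp_eq_comp_iff.1 h'),
        D.comp_eq_comp_iff.2 hr, Finset.pair_eq_singleton, Finset.sum_singleton,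
        ← D.comp_eq_comp_iff.2 hr]
      unfold Generator.lab at h1
      linarith
  · have hr' : D.Rel (State.toP h.state) (D.edge c 0) (D.edge c 2) := by
      rw [hA.state]
      exact rel_of_not_rel (agreeOff_flip c g.state) (by rw [flip_self, hA.zero]; rfl) hr
    rw [edgeCoeff_merge hA hr] at hn
    have h1 := weight_of_mergeCoeff (right_ne_zero_of_mul hn)
    rw [Finset.sum_pair fun h' => hr (D.comp_eq_comp_iff.1 h'),
      D.comp_eq_comp_iff.2 hr', Finset.pair_eq_singleton, Finset.sum_singleton,
      ← D.comp_eq_comp_iff.2 hr']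
    unfold Generator.lab at h1
    linarith

theorem ones_flip {c : Fin D.n} {s : D.State} (hc : s c = false) :
    D.ones (flip c s) = D.ones s + 1 := by
  have : (Finset.univ.filter fun x => flip c s x = true) =
      insert c (Finset.univ.filter fun x => s x = true) := by
    ext x
    simp only [Finset.mem_filter, Finset.mem_univ, true_and, Finset.mem_insert]
    by_cases hx : x = c
    · subst hx
      simp
    · simp [hx]
  rw [ones, ones, this, Finset.card_insert_of_notMem (by simp [hc])]

theorem hDeg_of_edgeCoeff_ne_zero {c : Fin D.n} {g h : D.Generator} (hn : D.edgeCoeff c g h ≠ 0) :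
    h.hDeg = g.hDeg + 1 := by
  have hA := adm_of_edgeCoeff_ne_zero hn
  rw [Generator.hDeg, Generator.hDeg, hA.state, ones_flip hA.zero]
  push_cast
  ring

theorem qDeg_of_edgeCoeff_ne_zero {c : Fin D.n} {g h : D.Generator} (hn : D.edgeCoeff c g h ≠ 0) :
    h.qDeg = g.qDeg := by
  rw [Generator.qDeg, Generator.qDeg, deg_of_edgeCoeff_ne_zero hn, hDeg_of_edgeCoeff_ne_zero hn]
  ring

/-- A division is a merger read backwards, so invariance under mergers covers both kinds of nonzero
edge maps. -/
theorem uDeg_of_edgeCoeff_ne_zero (hS : D.IsSpherical) {c : Fin D.n} {g h : D.Generator}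
    (hn : D.edgeCoeff c g h ≠ 0) : h.uDeg = g.uDeg := by
  have hA := adm_of_edgeCoeff_ne_zero hn
  unfold Generator.uDeg mu
  congr 1
  have hag : AgreeOff c g.state h.state := by
    rw [hA.state]
    exact agreeOff_flip c g.state
  have hc : h.state c = true := by rw [hA.state, flip_self]
  by_cases hr : D.Rel (State.toP g.state) (D.edge c 0) (D.edge c 2)
  · by_cases hr' : D.Rel (State.toP h.state) (D.edge c 0) (D.edge c 2)
    · exact absurd (edgeCoeff_single hr hr') hn
    · exact (dotShortcut_segmentCurve_eq hS hag.symm (by rw [hc, hA.zero]; rfl) hr').symm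
  · exact dotShortcut_segmentCurve_eq hS hag (by rw [hc, hA.zero]; rfl) hr

theorem edgeCoeff_ne_zero_of_totalCoeff_ne_zero {g h : D.Generator} (hn : totalCoeff g h ≠ 0) :
    ∃ c, D.edgeCoeff c g h ≠ 0 := by
  by_contra hall
  push Not at hall
  exact hn (Finset.sum_eq_zero fun c _ => hall c)

theorem hDeg_of_totalCoeff_ne_zero {g h : D.Generator} (hn : totalCoeff g h ≠ 0) :
    h.hDeg = g.hDeg + 1 :=
  (edgeCoeff_ne_zero_of_totalCoeff_ne_zero hn).elim fun _ h => hDeg_of_edgeCoeff_ne_zero h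

theorem qDeg_of_totalCoeff_ne_zero {g h : D.Generator} (hn : totalCoeff g h ≠ 0) :
    h.qDeg = g.qDeg :=
  (edgeCoeff_ne_zero_of_totalCoeff_ne_zero hn).elim fun _ h => qDeg_of_edgeCoeff_ne_zero h

theorem uDeg_of_totalCoeff_ne_zero (hS : D.IsSpherical) {g h : D.Generator}
    (hn : totalCoeff g h ≠ 0) : h.uDeg = g.uDeg :=
  (edgeCoeff_ne_zero_of_totalCoeff_ne_zero hn).elim fun _ h => uDeg_of_edgeCoeff_ne_zero hS h

end KnotoidCode

namespace KnotoidCode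

variable {D : KnotoidCode}

/-! ### Dimensions of homology -/

/-- The chains that are supported on the generators with property `Q` and have no boundary. -/
noncomputable def cycles (Q : D.Generator → Prop) : Submodule ℚ (D.Generator → ℚ) where
  carrier := {v | (∀ g, ¬ Q g → v g = 0) ∧ ∀ h, ∑ g, (totalCoeff g h : ℚ) * v g = 0}
  zero_mem' := by simp
  add_mem' {v w} hv hw := by
    refine ⟨fun g hg => ?_, fun h => ?_⟩
    · rw [Pi.add_apply, hv.1 g hg, hw.1 g hg, add_zero]
    · simp_rw [Pi.add_apply, mul_add, Finset.sum_add_distrib]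
      rw [hv.2 h, hw.2 h, add_zero]
  smul_mem' a v hv := by
    refine ⟨fun g hg => ?_, fun h => ?_⟩
    · rw [Pi.smul_apply, hv.1 g hg, smul_zero]
    · simp_rw [Pi.smul_apply, smul_eq_mul, mul_left_comm _ a, ← Finset.mul_sum]
      rw [hv.2 h, mul_zero]

theorem mem_cycles {Q : D.Generator → Prop} {v : D.Generator → ℚ} :
    v ∈ cycles Q ↔ (∀ g, ¬ Q g → v g = 0) ∧ ∀ h, ∑ g, (totalCoeff g h : ℚ) * v g = 0 := Iff.rfl

/-- The differential does not change the property `P`. -/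
def Closed (P : D.Generator → Prop) : Prop := ∀ g h, totalCoeff g h ≠ 0 → (P g ↔ P h)

open Classical in
/-- Extension by zero. -/
noncomputable def extend (P : D.Generator → Prop) (i : ℤ) : D.Chain P i →ₗ[ℚ] (D.Generator → ℚ) where
  toFun v g := if h : g.hDeg = i ∧ P g then v ⟨g, h⟩ else 0
  map_add' v w := by
    funext g
    by_cases h : g.hDeg = i ∧ P g <;> simp [h]
  map_smul' a v := by
    funext g
    by_cases h : g.hDeg = i ∧ P g <;> simp [h]

theorem extend_of {P : D.Generator → Prop} {i : ℤ} (v : D.Chain P i) {g : D.Generator}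
    (h : g.hDeg = i ∧ P g) : extend P i v g = v ⟨g, h⟩ := dif_pos h

theorem extend_of_not {P : D.Generator → Prop} {i : ℤ} (v : D.Chain P i) {g : D.Generator}
    (h : ¬ (g.hDeg = i ∧ P g)) : extend P i v g = 0 := dif_neg h

theorem sum_subtype_eq {ι : Type*} [Fintype ι] {Q : ι → Prop} [Fintype (Subtype Q)] (f : ι → ℚ)
    (hf : ∀ x, ¬ Q x → f x = 0) : ∑ x : Subtype Q, f x = ∑ x, f x := by
  classical
  rw [← Finset.sum_subtype (Finset.univ.filter Q) (by simp) f]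
  exact Finset.sum_filter_of_ne fun x _ hx => by_contra fun h => hx (hf x h)

open Classical in
theorem diff_apply (P : D.Generator → Prop) (i i' : ℤ) (v : D.Chain P i)
    (h : {g : D.Generator // g.hDeg = i' ∧ P g}) :
    D.diff P i i' v h = ∑ g, (totalCoeff g h.1 : ℚ) * extend P i v g := by
  rw [← sum_subtype_eq (Q := fun g => g.hDeg = i ∧ P g)]
  · simp only [diff, Matrix.mulVecLin_apply, Matrix.mulVec, dotProduct, Matrix.of_apply, totalCoeff]
    refine Finset.sum_congr rfl fun g _ => ?_
    rw [extend_of v g.2]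
  · intro g hg
    rw [extend_of_not v hg, mul_zero]

theorem extend_diff {P : D.Generator → Prop} (hP : Closed P) {i i' : ℤ} (hi : i' = i + 1)
    (v : D.Chain P i) (h : D.Generator) :
    extend P i' (D.diff P i i' v) h = ∑ g, (totalCoeff g h : ℚ) * extend P i v g := by
  by_cases hh : h.hDeg = i' ∧ P h
  · rw [extend_of _ hh, diff_apply]
  · rw [extend_of_not _ hh]
    symm
    refine Finset.sum_eq_zero fun g _ => ?_
    by_cases hg : g.hDeg = i ∧ P g
    · by_cases hn : totalCoeff g h = 0
      · rw [hn, Int.cast_zero, zero_mul]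
      · exact absurd ⟨by rw [hDeg_of_totalCoeff_ne_zero hn, hg.1, hi], (hP g h hn).1 hg.2⟩ hh
    · rw [extend_of_not v hg, mul_zero]

theorem extend_eq_zero_iff {P : D.Generator → Prop} {i : ℤ} {v : D.Chain P i} :
    (∀ g, extend P i v g = 0) ↔ v = 0 := by
  constructor
  · intro h
    funext g
    rw [← extend_of v g.2, h]
    rfl
  · rintro rfl g
    rw [map_zero]
    rfl

theorem mem_ker_diff {P : D.Generator → Prop} (hP : Closed P) {i i' : ℤ} (hi : i' = i + 1)
    {v : D.Chain P i} : v ∈ LinearMap.ker (D.diff P i i') ↔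
      ∀ h, ∑ g, (totalCoeff g h : ℚ) * extend P i v g = 0 := by
  rw [LinearMap.mem_ker, ← extend_eq_zero_iff]
  exact forall_congr' fun h => by rw [extend_diff hP hi]

theorem range_diff_le_ker (hS : D.IsSpherical) {P : D.Generator → Prop} (hP : Closed P)
    {i i' i'' : ℤ} (hi : i' = i + 1) (hi' : i'' = i' + 1) :
    LinearMap.range (D.diff P i i') ≤ LinearMap.ker (D.diff P i' i'') := by
  rintro _ ⟨v, rfl⟩
  rw [mem_ker_diff hP hi']
  intro k
  simp_rw [extend_diff hP hi, Finset.mul_sum]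
  rw [Finset.sum_comm]
  refine Finset.sum_eq_zero fun g _ => ?_
  have : ∑ h, (totalCoeff h k : ℚ) * ((totalCoeff g h : ℚ) * extend P i v g) =
      ((∑ h, totalCoeff g h * totalCoeff h k : ℤ) : ℚ) * extend P i v g := by
    push_cast
    rw [Finset.sum_mul]
    exact Finset.sum_congr rfl fun h _ => by ring
  rw [this, sum_totalCoeff_mul hS, Int.cast_zero, zero_mul]

/-- Cycles in the chain complex of `P`. -/
noncomputable def kerEquiv {P : D.Generator → Prop} (hP : Closed P) {i i' : ℤ} (hi : i' = i + 1) :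
    LinearMap.ker (D.diff P i i') ≃ₗ[ℚ] cycles fun g : D.Generator => g.hDeg = i ∧ P g :=
  LinearEquiv.ofBijective
    (LinearMap.codRestrict _ (extend P i ∘ₗ Submodule.subtype _) fun v =>
      mem_cycles.2 ⟨fun _ hg => extend_of_not v.1 hg, (mem_ker_diff hP hi).1 v.2⟩) <| by
    constructor
    · rw [← LinearMap.ker_eq_bot, LinearMap.ker_eq_bot']
      intro v hv
      apply Subtype.ext
      exact extend_eq_zero_iff.1 fun g => congrFun (congrArg Subtype.val hv) g
    · rintro ⟨w, hw⟩
      have he : ∀ g, extend P i (fun x => w x.1) g = w g := by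
        intro g
        by_cases hg : g.hDeg = i ∧ P g
        · rw [extend_of _ hg]
        · rw [extend_of_not _ hg, hw.1 g hg]
      refine ⟨⟨fun x => w x.1, (mem_ker_diff hP hi).2 fun h => ?_⟩, Subtype.ext (funext he)⟩
      simp_rw [he]
      exact hw.2 h

/-- The dimension of the space of cycles. -/
noncomputable def nullity (Q : D.Generator → Prop) : ℕ := Module.finrank ℚ (cycles Q)

/-- The number of generators in a given homological degree with property `P`. -/
noncomputable def count (P : D.Generator → Prop) (i : ℤ) : ℕ :=
  Nat.card {g : D.Generator // g.hDeg = i ∧ P g}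

/-- Rank and nullity: the boundaries in degree `i` have dimension `count P (i - 1)` minus the
nullity in degree `i - 1`. All later statements on dimensions go through this formula. -/
theorem finrank_homology (hS : D.IsSpherical) {P : D.Generator → Prop} (hP : Closed P) (i : ℤ) :
    (Module.finrank ℚ (D.Homology P i) : ℤ) = nullity (fun g => g.hDeg = i ∧ P g) +
      nullity (fun g => g.hDeg = i - 1 ∧ P g) - count P (i - 1) := by
  classical
  have hle := range_diff_le_ker hS hP (i := i - 1) (i' := i) (by ring) rfl
  have h1 := Submodule.finrank_quotient_add_finrank
    ((LinearMap.range (D.diff P (i - 1) i)).submoduleOf (LinearMap.ker (D.diff P i (i + 1))))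
  have h2 : Module.finrank ℚ
      ((LinearMap.range (D.diff P (i - 1) i)).submoduleOf (LinearMap.ker (D.diff P i (i + 1)))) =
      Module.finrank ℚ (LinearMap.range (D.diff P (i - 1) i)) :=
    (Submodule.submoduleOfEquivOfLe hle).finrank_eq
  have h3 := LinearMap.finrank_range_add_finrank_ker (D.diff P (i - 1) i)
  have h4 := (kerEquiv hP (i := i) rfl).finrank_eq
  have h5 := (kerEquiv hP (i := i - 1) (i' := i) (by ring)).finrank_eq
  have h6 : Module.finrank ℚ (D.Chain P (i - 1)) = count P (i - 1) := by
    rw [Module.finrank_fintype_fun_eq_card, count, Nat.card_eq_fintype_card]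
  unfold nullity
  unfold Homology
  omega

/-! ### Additivity over a further grading -/

open Classical in
theorem sum_totalCoeff_mul_ite {κ : D.Generator → ℤ}
    (hκ : ∀ g h, totalCoeff g h ≠ 0 → κ h = κ g) (v : D.Generator → ℚ) (k : ℤ) (h : D.Generator) :
    ∑ g, (totalCoeff g h : ℚ) * (if κ g = k then v g else 0) =
      if κ h = k then ∑ g, (totalCoeff g h : ℚ) * v g else 0 := by
  have : ∀ g, (totalCoeff g h : ℚ) * (if κ g = k then v g else 0) =
      if κ h = k then (totalCoeff g h : ℚ) * v g else 0 := by
    intro g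
    by_cases hn : totalCoeff g h = 0
    · simp [hn]
    · rw [hκ g h hn, mul_ite, mul_zero]
  simp_rw [this]
  split_ifs
  · rfl
  · exact Finset.sum_const_zero

open Classical in
/-- A space of cycles is the direct sum of its homogeneous parts. -/
noncomputable def cyclesEquiv {Q : D.Generator → Prop} {κ : D.Generator → ℤ}
    (hκ : ∀ g h, totalCoeff g h ≠ 0 → κ h = κ g) (S : Finset ℤ) (hS : ∀ g, Q g → κ g ∈ S) :
    cycles Q ≃ₗ[ℚ] (k : S) → cycles fun g : D.Generator => Q g ∧ κ g = k where
  toFun v k := ⟨fun g => if κ g = k then v.1 g else 0, by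
    refine ⟨fun g hg => ?_, fun h => ?_⟩
    · by_cases hk : κ g = k
      · exact (if_pos hk).trans (v.2.1 g fun hq => hg ⟨hq, hk⟩)
      · exact if_neg hk
    · rw [sum_totalCoeff_mul_ite hκ, v.2.2 h, ite_self]⟩
  map_add' v w := by
    funext k
    ext g
    by_cases h : κ g = k <;> simp [h]
  map_smul' a v := by
    funext k
    ext g
    by_cases h : κ g = k <;> simp [h]
  invFun w := ∑ k, ⟨(w k).1, fun g hg => (w k).2.1 g fun h => hg h.1, (w k).2.2⟩
  left_inv v := by
    ext g
    rw [Submodule.coe_sum, Finset.sum_apply]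
    by_cases hg : Q g
    · rw [Finset.sum_eq_single ⟨κ g, hS g hg⟩]
      · exact if_pos rfl
      · intro k _ hk
        exact if_neg fun h => hk (Subtype.ext h.symm)
      · exact fun h => absurd (Finset.mem_univ _) h
    · rw [v.2.1 g hg]
      refine Finset.sum_eq_zero fun k _ => ?_
      change (if κ g = k then v.1 g else 0) = 0
      rw [v.2.1 g hg, ite_self]
  right_inv w := by
    funext k
    ext g
    change (if κ g = k then (∑ k', _ : cycles Q).1 g else 0) = _
    rw [Submodule.coe_sum, Finset.sum_apply]
    by_cases hk : κ g = k
    · rw [if_pos hk, Finset.sum_eq_single k]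
      · intro k' _ hk'
        exact (w k').2.1 g fun h => hk' (Subtype.ext (h.2.symm.trans hk))
      · exact fun h => absurd (Finset.mem_univ _) h
    · rw [if_neg hk]
      exact ((w k).2.1 g fun h => hk h.2).symm

theorem nullity_eq_sum {Q : D.Generator → Prop} {κ : D.Generator → ℤ}
    (hκ : ∀ g h, totalCoeff g h ≠ 0 → κ h = κ g) (S : Finset ℤ) (hS : ∀ g, Q g → κ g ∈ S) :
    nullity Q = ∑ k ∈ S, nullity fun g : D.Generator => Q g ∧ κ g = k := by
  unfold nullity
  rw [(cyclesEquiv hκ S hS).finrank_eq, Module.finrank_pi_fintype,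
    ← Finset.sum_coe_sort S fun k => Module.finrank ℚ (cycles fun g : D.Generator => Q g ∧ κ g = k)]

theorem count_eq_sum {P : D.Generator → Prop} (κ : D.Generator → ℤ) (i : ℤ)
    (S : Finset ℤ) (hS : ∀ g, κ g ∈ S) :
    count P i = ∑ k ∈ S, count (fun g : D.Generator => P g ∧ κ g = k) i := by
  classical
  have h1 : ∀ P : D.Generator → Prop, count P i =
      (Finset.univ.filter fun g : D.Generator => g.hDeg = i ∧ P g).card := fun P => by
    rw [count, Nat.card_eq_fintype_card, Fintype.card_subtype]
  simp_rw [h1]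
  rw [Finset.card_eq_sum_card_fiberwise (f := κ) (t := S) fun g _ => hS g]
  refine Finset.sum_congr rfl fun k _ => ?_
  rw [Finset.filter_filter]
  congr 1
  ext g
  simp only [Finset.mem_filter, and_assoc]

theorem closed_qDeg (j : ℤ) : Closed fun g : D.Generator => g.qDeg = j :=
  fun _ _ hn => by simp only [qDeg_of_totalCoeff_ne_zero hn]

theorem closed_qDeg_uDeg (hS : D.IsSpherical) (j k : ℤ) :
    Closed fun g : D.Generator => g.qDeg = j ∧ g.uDeg = k :=
  fun _ _ hn => by simp only [qDeg_of_totalCoeff_ne_zero hn, uDeg_of_totalCoeff_ne_zero hS hn]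

theorem Closed.and_eq {P : D.Generator → Prop} (hP : Closed P) {κ : D.Generator → ℤ}
    (hκ : ∀ g h, totalCoeff g h ≠ 0 → κ h = κ g) (k : ℤ) : Closed fun g => P g ∧ κ g = k :=
  fun g h hn => and_congr (hP g h hn) (by rw [hκ g h hn])

/-- Nullities and counts are both additive over a grading which the differential preserves, hence so
are the dimensions. -/
theorem finrank_homology_eq_sum (hS : D.IsSpherical) {P : D.Generator → Prop} (hP : Closed P)
    {κ : D.Generator → ℤ} (hκ : ∀ g h, totalCoeff g h ≠ 0 → κ h = κ g) (S : Finset ℤ)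
    (hu : ∀ g, κ g ∈ S) (i : ℤ) : Module.finrank ℚ (D.Homology P i) =
      ∑ k ∈ S, Module.finrank ℚ (D.Homology (fun g => P g ∧ κ g = k) i) := by
  have h1 := finrank_homology hS hP i
  have h2 := fun k => finrank_homology hS (hP.and_eq hκ k) i
  have h3 := fun i => nullity_eq_sum (Q := fun g => g.hDeg = i ∧ P g) hκ S fun g _ => hu g
  have h4 := count_eq_sum (P := P) κ (i - 1) S hu
  zify
  simp_rw [h2]
  rw [h1, h3, h3, h4, Finset.sum_sub_distrib, Finset.sum_add_distrib]
  push_cast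
  simp only [and_assoc]

/-- Khovanov homology is the sum of the winding homologies. -/
theorem finrank_khovanovHomology (hS : D.IsSpherical) (S : Finset ℤ)
    (hu : ∀ g : D.Generator, g.uDeg ∈ S) (i j : ℤ) :
    Module.finrank ℚ (D.khovanovHomology i j) =
      ∑ k ∈ S, Module.finrank ℚ (D.windingHomology i j k) :=
  finrank_homology_eq_sum hS (closed_qDeg j)
    (fun _ _ hn => uDeg_of_totalCoeff_ne_zero hS hn) S hu i

end KnotoidCode

namespace KnotoidCode

variable {D : KnotoidCode}

/-! ### Euler characteristics -/

/-- The sign `(-1) ^ i`. -/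
def sgn (i : ℤ) : ℤ := (Int.negOnePow i : ℤˣ)

theorem sgn_add (i j : ℤ) : sgn (i + j) = sgn i * sgn j := by
  rw [sgn, Int.negOnePow_add, Units.val_mul, sgn, sgn]

theorem sgn_one : sgn 1 = -1 := rfl

theorem sgn_add_one (i : ℤ) : sgn (i + 1) = - sgn i := by
  rw [sgn_add, sgn_one, mul_neg_one]

theorem sgn_mul_self (i : ℤ) : sgn i * sgn i = 1 := by
  rw [sgn, ← Units.val_mul, Int.units_mul_self, Units.val_one]

theorem hDeg_bounds (g : D.Generator) : -(D.n : ℤ) ≤ g.hDeg ∧ g.hDeg ≤ D.n := by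
  have h1 : D.ones g.state ≤ D.n := (Finset.card_le_univ _).trans_eq (Fintype.card_fin _)
  have h2 : D.nMinus ≤ D.n := (Finset.card_le_univ _).trans_eq (Fintype.card_fin _)
  unfold Generator.hDeg
  omega

theorem nullity_of_forall_not {Q : D.Generator → Prop} (h : ∀ g, ¬ Q g) : nullity Q = 0 := by
  have : cycles Q = ⊥ := by
    rw [eq_bot_iff]
    intro v hv
    exact funext fun g => hv.1 g (h g)
  rw [nullity, this, finrank_bot]

open Classical in
/-- The generators with property `P`, counted with sign. -/
noncomputable def euler (P : D.Generator → Prop) : ℤ := ∑ g, if P g then sgn g.hDeg else 0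

theorem sum_sgn_mul_count (P : D.Generator → Prop) (S : Finset ℤ)
    (hS : ∀ g : D.Generator, g.hDeg ∈ S) : ∑ i ∈ S, sgn i * count P i = euler P := by
  classical
  have h1 : ∀ i, sgn i * count P i =
      ∑ g ∈ Finset.univ.filter fun g : D.Generator => g.hDeg = i, if P g then sgn g.hDeg else 0 := by
    intro i
    rw [count, Nat.card_eq_fintype_card, Fintype.card_subtype, ← Finset.sum_filter,
      Finset.filter_filter, Finset.sum_congr rfl (g := fun _ => sgn i), Finset.sum_const,
      nsmul_eq_mul, mul_comm]
    intro g hg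
    rw [(Finset.mem_filter.1 hg).2.1]
  simp_rw [h1]
  exact Finset.sum_fiberwise_of_maps_to (fun g _ => hS g) _

/-- In the alternating sum the nullities telescope and only the counts remain. The bound `n < M`
leaves room for the shift by one degree. -/
theorem sum_sgn_mul_finrank (hS : D.IsSpherical) {P : D.Generator → Prop} (hP : Closed P) {M : ℕ}
    (hM : D.n < M) :
    ∑ t ∈ Finset.range (2 * M + 1), sgn (t - M) * Module.finrank ℚ (D.Homology P (t - M)) =
      euler P := by
  set ν : ℤ → ℤ := fun i => nullity fun g : D.Generator => g.hDeg = i ∧ P g with hν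
  have h0 : ∀ i : ℤ, (M : ℤ) ≤ i ∨ i ≤ -M → ν i = 0 := by
    intro i hi
    rw [hν]
    dsimp only
    rw [nullity_of_forall_not, Nat.cast_zero]
    rintro g ⟨hg, -⟩
    have := hDeg_bounds g
    omega
  have h1 : ∀ t : ℕ, sgn (t - M) * (Module.finrank ℚ (D.Homology P (t - M)) : ℤ) =
      (sgn ((t + 1 : ℕ) - M - 1) * ν ((t + 1 : ℕ) - M - 1) - sgn (t - M - 1) * ν (t - M - 1)) +
        sgn (t - M - 1) * count P (t - M - 1) := by
    intro t
    have h2 : ((t + 1 : ℕ) : ℤ) - M - 1 = t - M := by push_cast; ring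
    have h3 : sgn ((t : ℤ) - M) = - sgn (t - M - 1) := by rw [← sgn_add_one]; congr 1; ring
    rw [finrank_homology hS hP, h2, h3]
    ring
  rw [Finset.sum_congr rfl fun t _ => h1 t, Finset.sum_add_distrib,
    Finset.sum_range_sub fun t : ℕ => sgn (t - M - 1) * ν (t - M - 1),
    h0 _ (Or.inl (by push_cast; omega)), h0 _ (Or.inr (by push_cast; omega)), mul_zero, mul_zero,
    sub_zero, zero_add, ← sum_sgn_mul_count P
      ((Finset.range (2 * M + 1)).map ⟨fun t : ℕ => (t : ℤ) - M - 1, fun a b h => by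
        have : (a : ℤ) - M - 1 = b - M - 1 := h
        omega⟩), Finset.sum_map]
  · rfl
  · intro g
    have := hDeg_bounds g
    rw [Finset.mem_map]
    exact ⟨(g.hDeg + M + 1).toNat, by rw [Finset.mem_range]; omega, by
      change ((g.hDeg + M + 1).toNat : ℤ) - M - 1 = _
      omega⟩

theorem euler_eq_of_finrank_eq {D' : KnotoidCode} (hS : D.IsSpherical) (hS' : D'.IsSpherical)
    {P : D.Generator → Prop} {P' : D'.Generator → Prop} (hP : Closed P) (hP' : Closed P')
    (h : ∀ i, Module.finrank ℚ (D.Homology P i) = Module.finrank ℚ (D'.Homology P' i)) :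
    euler P = euler P' := by
  rw [← sum_sgn_mul_finrank hS hP (M := D.n + D'.n + 1) (by omega),
    ← sum_sgn_mul_finrank hS' hP' (M := D.n + D'.n + 1) (by omega)]
  simp_rw [h]

/-! ### The polynomials as sums over generators -/

open LaurentPolynomial in
/-- The monomial `(-1) ^ a A ^ (-2 a)`. -/
noncomputable def signedT (a : ℤ) : LaurentPolynomial ℤ := C (sgn a) * T (-2 * a)

open LaurentPolynomial in
theorem signedT_add (a b : ℤ) : signedT (a + b) = signedT a * signedT b := by
  rw [signedT, signedT, signedT, sgn_add, map_mul, mul_add, T_add]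
  ring

theorem signedT_sum {ι : Type*} (s : Finset ι) (f : ι → ℤ) :
    signedT (∑ x ∈ s, f x) = ∏ x ∈ s, signedT (f x) := by
  classical
  induction s using Finset.induction_on with
  | empty => simp [signedT, sgn]
  | insert a s ha ih => rw [Finset.sum_insert ha, Finset.prod_insert ha, signedT_add, ih]

/-- A generator is a state with labels on the closed components. -/
noncomputable def generatorEquiv :
    D.Generator ≃ Σ s : D.State, ({x : D.Component s // x ≠ D.segment s} → Bool) where
  toFun g := ⟨g.state, fun x => g.label x.1⟩
  invFun p := ⟨p.1, fun x => if h : x ≠ D.segment p.1 then p.2 ⟨x, h⟩ else false,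
    dif_neg (not_not.2 rfl)⟩
  left_inv g := by
    obtain ⟨s, l, hl⟩ := g
    dsimp only
    congr 1
    funext x
    by_cases h : x = D.segment s
    · rw [dif_neg (not_not.2 h), h, hl]
    · rw [dif_pos h]
  right_inv p := by
    obtain ⟨s, l⟩ := p
    dsimp only
    congr 1
    funext x
    exact dif_pos x.2

theorem sum_generator {M : Type*} [AddCommMonoid M] (F : (s : D.State) →
    ({x : D.Component s // x ≠ D.segment s} → Bool) → M) :
    ∑ g : D.Generator, F g.state (fun x => g.label x.1) = ∑ s : D.State, ∑ l, F s l := by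
  rw [← Fintype.sum_sigma' F, ← Equiv.sum_comp generatorEquiv]
  rfl

theorem deg_add_one (g : D.Generator) :
    g.deg + 1 = ∑ x : {x : D.Component g.state // x ≠ D.segment g.state}, weight (g.label x.1) := by
  rw [deg_eq_sum, ← Fintype.sum_subtype_add_sum_subtype (fun x => x ≠ D.segment g.state)]
  have : ∑ x : {x : D.Component g.state // ¬ x ≠ D.segment g.state}, weight (g.label x.1) = -1 := by
    rw [Fintype.sum_eq_single ⟨D.segment g.state, not_not.2 rfl⟩, g.label_segment]
    · rfl
    · intro x hx
      exact absurd (Subtype.ext (not_not.1 x.2)) hx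
  rw [this]
  ring

-- `-A² - A⁻²` is the sum of the signed monomials of the labels `X` and `1`. Expanding its power
-- gives one monomial for each labelling of the closed components.
open LaurentPolynomial in
theorem bracketTerm_eq (s : D.State) :
    D.bracketTerm s = ∑ l : {x : D.Component s // x ≠ D.segment s} → Bool,
      T (D.sigma s) * signedT (∑ x, weight (l x)) := by
  have h1 : (-T 2 - T (-2) : LaurentPolynomial ℤ) = ∑ b : Bool, signedT (weight b) := by
    rw [Fintype.sum_bool]
    have : sgn (-1) = -1 := rfl
    simp only [signedT, weight, if_true, Bool.false_eq_true, if_false, sgn_one, this, map_neg,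
      map_one]
    norm_num
    ring
  have h2 : D.numComp s - 1 = Fintype.card {x : D.Component s // x ≠ D.segment s} := by
    rw [numComp, Nat.card_eq_fintype_card, Fintype.card_subtype_compl, Fintype.card_subtype_eq]
  rw [bracketTerm, h1, h2, ← Finset.mul_sum]
  congr 1
  simp_rw [signedT_sum]
  rw [← Fintype.prod_sum fun (_ : {x : D.Component s // x ≠ D.segment s}) b => signedT (weight b),
    Finset.prod_const, Finset.card_univ]

theorem nPlus_add_nMinus (D : KnotoidCode) : D.nPlus + D.nMinus = D.n := by
  have h := Finset.card_filter_add_card_filter_not (s := (Finset.univ : Finset (Fin D.n)))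
    (fun c => D.pos c = true)
  simp only [Bool.not_eq_true, Finset.card_univ, Fintype.card_fin] at h
  exact h

-- The exponents `-3 wr`, `σ_s` and `-2 (deg + 1)` add up to `-2j`. The sign `(-1) ^ (wr + deg + 1)`
-- is `(-1) ^ (i + j)`, because twice the homological degree is even.
open LaurentPolynomial in
theorem writheFactor_mul (g : D.Generator) :
    D.writheFactor * (T (D.sigma g.state) * signedT (g.deg + 1)) =
      C (sgn (g.hDeg + g.qDeg)) * T (-2 * g.qDeg) := by
  have hn := D.nPlus_add_nMinus
  have h1 : -3 * D.writhe + D.sigma g.state + -2 * (g.deg + 1) = -2 * g.qDeg := by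
    rw [writhe, sigma, Generator.qDeg, Generator.hDeg, ← hn]
    push_cast
    ring
  have h2 : g.hDeg + g.qDeg = g.hDeg + g.hDeg + (D.writhe + (g.deg + 1)) := by
    rw [writhe, Generator.qDeg]
    ring
  rw [writheFactor, signedT, ← h1, h2, sgn_add (g.hDeg + g.hDeg), sgn_add g.hDeg, sgn_mul_self,
    one_mul, sgn_add D.writhe, T_add, T_add, map_mul]
  unfold sgn
  ring

open LaurentPolynomial in
theorem jones_eq : D.jones = ∑ g : D.Generator, C (sgn (g.hDeg + g.qDeg)) * T (-2 * g.qDeg) := by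
  simp_rw [jones, bracketTerm_eq]
  rw [← sum_generator fun s l => T (D.sigma s) * signedT (∑ x, weight (l x)), Finset.mul_sum]
  refine Finset.sum_congr rfl fun g _ => ?_
  rw [← deg_add_one, writheFactor_mul]

open LaurentPolynomial in
theorem turaev_eq : D.turaev =
    ∑ g : D.Generator, C (C (sgn (g.hDeg + g.qDeg)) * T (-2 * g.qDeg)) * T g.uDeg := by
  simp_rw [turaev, bracketTerm_eq, map_sum, Finset.sum_mul]
  rw [← sum_generator fun s l => C (T (D.sigma s) * signedT (∑ x, weight (l x))) *
    T (D.dotShortcut (D.segmentCurve s)), Finset.mul_sum]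
  refine Finset.sum_congr rfl fun g _ => ?_
  rw [← deg_add_one, ← writheFactor_mul, Generator.uDeg, mu, sub_eq_neg_add, T_add]
  simp only [map_mul]
  ring

-- The Jones polynomial is the value of the Turaev polynomial at `u = 1`.
open LaurentPolynomial in
theorem jones_eq_of_turaev_eq {D' : KnotoidCode} (h : D.turaev = D'.turaev) :
    D.jones = D'.jones := by
  have key : ∀ D : KnotoidCode,
      eval₂ (RingHom.id (LaurentPolynomial ℤ)) 1 D.turaev = D.jones := by
    intro D
    rw [turaev_eq, jones_eq, map_sum]
    refine Finset.sum_congr rfl fun g _ => ?_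
    rw [eval₂_C_mul_T, one_zpow, Units.val_one, mul_one, RingHom.id_apply]
  rw [← key, h, key]

open Classical in
theorem coeff_sum_C_mul_T {ι R : Type*} [Fintype ι] [Semiring R] (κ : ι → ℤ) (r : ι → R) (k : ℤ) :
    (∑ x, LaurentPolynomial.C (r x) * LaurentPolynomial.T (κ x)).coeff k =
      ∑ x, if κ x = k then r x else 0 := by
  simp_rw [← LaurentPolynomial.single_eq_C_mul_T]
  rw [AddMonoidAlgebra.coeff_sum, Finsupp.finsetSum_apply]
  exact Finset.sum_congr rfl fun x _ => by rw [AddMonoidAlgebra.coeff_single, Finsupp.single_apply]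

/-- Generators with `q`-grading `j` are exactly those that contribute to `A ^ (-2j)`, each with the
sign `(-1) ^ (i + j)`. -/
theorem coeff_jones (D : KnotoidCode) (j : ℤ) :
    D.jones.coeff (-2 * j) = sgn j * euler fun g : D.Generator => g.qDeg = j := by
  classical
  rw [jones_eq, coeff_sum_C_mul_T, euler, Finset.mul_sum]
  refine Finset.sum_congr rfl fun g _ => ?_
  by_cases h : g.qDeg = j
  · rw [if_pos (by rw [h]), if_pos h, sgn_add, h, mul_comm]
  · rw [if_neg (by omega), if_neg h, mul_zero]

theorem coeff_jones_of_ne (D : KnotoidCode) {m : ℤ} (hm : ∀ j, m ≠ -2 * j) :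
    D.jones.coeff m = 0 := by
  classical
  rw [jones_eq, coeff_sum_C_mul_T]
  exact Finset.sum_eq_zero fun g _ => if_neg (hm _).symm

theorem coeff_coeff_turaev (D : KnotoidCode) (j k : ℤ) :
    (D.turaev.coeff k).coeff (-2 * j) =
      sgn j * euler fun g : D.Generator => g.qDeg = j ∧ g.uDeg = k := by
  classical
  rw [turaev_eq, coeff_sum_C_mul_T, AddMonoidAlgebra.coeff_sum, Finsupp.finsetSum_apply, euler,
    Finset.mul_sum]
  refine Finset.sum_congr rfl fun g _ => ?_
  by_cases hk : g.uDeg = k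
  · rw [if_pos hk, ← LaurentPolynomial.single_eq_C_mul_T, AddMonoidAlgebra.coeff_single, Finsupp.single_apply]
    by_cases h : g.qDeg = j
    · rw [if_pos (by rw [h]), if_pos ⟨h, hk⟩, sgn_add, h, mul_comm]
    · rw [if_neg (by omega), if_neg fun h' => h h'.1, mul_zero]
  · rw [if_neg hk, if_neg fun h' => hk h'.2, mul_zero]
    rfl

theorem coeff_coeff_turaev_of_ne (D : KnotoidCode) {m : ℤ} (hm : ∀ j, m ≠ -2 * j) (k : ℤ) :
    (D.turaev.coeff k).coeff m = 0 := by
  classical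
  rw [turaev_eq, coeff_sum_C_mul_T, AddMonoidAlgebra.coeff_sum, Finsupp.finsetSum_apply]
  refine Finset.sum_eq_zero fun g _ => ?_
  by_cases hk : g.uDeg = k
  · rw [if_pos hk, ← LaurentPolynomial.single_eq_C_mul_T, AddMonoidAlgebra.coeff_single, Finsupp.single_apply]
    exact if_neg (hm _).symm
  · rw [if_neg hk]
    rfl

theorem sgn_mul_left_cancel {j a b : ℤ} (h : sgn j * a = sgn j * b) : a = b := by
  have := congrArg (sgn j * ·) h
  simpa only [← mul_assoc, sgn_mul_self, one_mul] using this

/-- The coefficients of the Turaev polynomial are Euler characteristics. -/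
theorem turaev_eq_iff {D' : KnotoidCode} : D.turaev = D'.turaev ↔
    ∀ j k, euler (fun g : D.Generator => g.qDeg = j ∧ g.uDeg = k) =
      euler fun g : D'.Generator => g.qDeg = j ∧ g.uDeg = k := by
  constructor
  · intro h j k
    apply sgn_mul_left_cancel (j := j)
    rw [← coeff_coeff_turaev, h, coeff_coeff_turaev]
  · intro h
    refine LaurentPolynomial.ext fun k => LaurentPolynomial.ext fun m => ?_
    by_cases hm : ∃ j, m = -2 * j
    · obtain ⟨j, rfl⟩ := hm
      rw [coeff_coeff_turaev, coeff_coeff_turaev, h]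
    · push Not at hm
      rw [coeff_coeff_turaev_of_ne D hm, coeff_coeff_turaev_of_ne D' hm]

theorem jones_eq_of_euler {D' : KnotoidCode} (h : ∀ j, euler (fun g : D.Generator => g.qDeg = j) =
      euler fun g : D'.Generator => g.qDeg = j) : D.jones = D'.jones := by
  refine LaurentPolynomial.ext fun m => ?_
  by_cases hm : ∃ j, m = -2 * j
  · obtain ⟨j, rfl⟩ := hm
    rw [coeff_jones, coeff_jones, h]
  · push Not at hm
    rw [coeff_jones_of_ne D hm, coeff_jones_of_ne D' hm]

end KnotoidCode

/-! ### Which invariants determine which -/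

namespace KnotoidDiagram

open KnotoidCode

theorem sameWinding_iff {K L : KnotoidDiagram} : SameWinding K L ↔ ∀ i j k : ℤ,
    Module.finrank ℚ (K.windingHomology i j k) = Module.finrank ℚ (L.windingHomology i j k) :=
  forall₃_congr fun _ _ _ => FiniteDimensional.nonempty_linearEquiv_iff_finrank_eq

theorem sameKhovanov_iff {K L : KnotoidDiagram} : SameKhovanov K L ↔ ∀ i j : ℤ,
    Module.finrank ℚ (K.khovanovHomology i j) = Module.finrank ℚ (L.khovanovHomology i j) :=
  forall₂_congr fun _ _ => FiniteDimensional.nonempty_linearEquiv_iff_finrank_eq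

theorem determines_winding_turaev : Determines SameWinding SameTuraev := by
  intro K L h
  rw [sameWinding_iff] at h
  exact turaev_eq_iff.2 fun j k => euler_eq_of_finrank_eq K.spherical L.spherical
    (closed_qDeg_uDeg K.spherical j k) (closed_qDeg_uDeg L.spherical j k) fun i => h i j k

theorem determines_khovanov_jones : Determines SameKhovanov SameJones := by
  intro K L h
  rw [sameKhovanov_iff] at h
  exact jones_eq_of_euler fun j => euler_eq_of_finrank_eq K.spherical L.spherical
    (closed_qDeg j) (closed_qDeg j) fun i => h i j

theorem determines_turaev_jones : Determines SameTuraev SameJones :=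
  fun _ _ h => jones_eq_of_turaev_eq h

theorem determines_winding_khovanov : Determines SameWinding SameKhovanov := by
  classical
  intro K L h
  rw [sameWinding_iff] at h
  rw [sameKhovanov_iff]
  intro i j
  -- A finite set that contains the `u`-gradings of both diagrams, so that both decompositions run
  -- over the same index set.
  set S : Finset ℤ := Finset.univ.image (fun g : K.Generator => g.uDeg) ∪
    Finset.univ.image fun g : L.Generator => g.uDeg with hS
  have h1 : ∀ g : K.Generator, g.uDeg ∈ S := fun g =>
    Finset.mem_union_left _ (Finset.mem_image_of_mem _ (Finset.mem_univ g))
  have h2 : ∀ g : L.Generator, g.uDeg ∈ S := fun g =>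
    Finset.mem_union_right _ (Finset.mem_image_of_mem _ (Finset.mem_univ g))
  rw [finrank_khovanovHomology K.spherical S h1, finrank_khovanovHomology L.spherical S h2]
  exact Finset.sum_congr rfl fun k _ => h i j k

end KnotoidDiagram

namespace KnotoidCode

variable {D : KnotoidCode}

/-! ### The mirror image of the symmetric reflection -/

/-- The half-edge at position `p` of a crossing of `Sym(Mir(K))` in `K`. -/
def turnOver (b : Bool) (p : Fin 4) : Fin 4 := if b then -p + 3 else -p + 1

theorem turnOver_turnOver : ∀ b p, turnOver b (turnOver b p) = p := by decide

/-- The reflection of the four positions which exchanges the two strands carries each smoothing to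
itself. Hence states correspond without complementation. -/
theorem partner_turnOver : ∀ b b' p, partner b (turnOver b' p) = turnOver b' (partner b p) := by decide

theorem edge_symMir (c : Fin D.n) (p : Fin 4) :
    D.mir.sym.edge c p = D.edge c (turnOver (D.pos c) p) :=
  (D.mir.edge_sym c p).trans (D.edge_mir c (-p))

theorem inward_symMir (c : Fin D.n) (p : Fin 4) :
    D.mir.sym.inward c p = D.inward c (turnOver (D.pos c) p) :=
  (D.mir.inward_sym c p).trans (D.inward_mir c (-p))

theorem pos_symMir (c : Fin D.n) : D.mir.sym.pos c = D.pos c := Bool.not_not _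

theorem joinedP_symMir (s : D.State) (e e' : D.Edge) :
    D.mir.sym.JoinedP (State.toP (D := D.mir.sym) s) e e' ↔ D.JoinedP (State.toP s) e e' := by
  constructor
  · rintro ⟨c, p, b, h1, h2, h3⟩
    refine ⟨c, turnOver (D.pos c) p, b, h1, h2.trans (edge_symMir (D := D) c p), ?_⟩
    rw [partner_turnOver]
    exact h3.trans (edge_symMir (D := D) c _)
  · rintro ⟨c, p, b, h1, h2, h3⟩
    refine ⟨c, turnOver (D.pos c) p, b, h1, ?_, ?_⟩
    · rw [h2]
      exact ((edge_symMir c _).trans (by rw [turnOver_turnOver])).symm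
    · rw [h3, partner_turnOver]
      exact ((edge_symMir c _).trans (by rw [turnOver_turnOver])).symm

theorem rel_symMir (s : D.State) {e e' : D.Edge} :
    D.mir.sym.Rel (State.toP (D := D.mir.sym) s) e e' ↔ D.Rel (State.toP s) e e' := by
  have : D.mir.sym.JoinedP (State.toP (D := D.mir.sym) s) = D.JoinedP (State.toP s) :=
    funext fun e => funext fun e' => propext (joinedP_symMir s e e')
  unfold Rel
  rw [this]
  exact Iff.rfl

theorem comp_symMir (s : D.State) {e e' : D.Edge} :
    D.mir.sym.comp s e = D.mir.sym.comp s e' ↔ D.comp s e = D.comp s e' :=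
  D.mir.sym.comp_eq_comp_iff.trans ((rel_symMir s).trans D.comp_eq_comp_iff.symm)

/-- The components of a state of `Sym(Mir(K))` are those of the same state of `K`. -/
noncomputable def componentEquiv (s : D.State) : D.Component s ≃ D.mir.sym.Component s where
  toFun x := D.mir.sym.comp s x.out
  invFun x := D.comp s x.out
  left_inv x := by
    have h : D.mir.sym.comp s (D.mir.sym.comp s x.out).out = D.mir.sym.comp s x.out := comp_out _
    exact ((comp_symMir s).1 h).trans (comp_out x)
  right_inv x := by
    have h : D.comp s (D.comp s x.out).out = D.comp s x.out := comp_out _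
    exact ((comp_symMir s).2 h).trans (comp_out x)

theorem componentEquiv_comp (s : D.State) (e : D.Edge) :
    componentEquiv s (D.comp s e) = D.mir.sym.comp s e :=
  (comp_symMir s).2 (comp_out (D.comp s e))

/-- The generators of `Sym(Mir(K))` are those of `K`. -/
noncomputable def symMirEquiv : D.Generator ≃ D.mir.sym.Generator where
  toFun g := ⟨g.state, fun x => g.label ((componentEquiv g.state).symm x), by
    have h := componentEquiv_comp g.state (0 : D.Edge)
    rw [← Equiv.eq_symm_apply] at h
    exact (congrArg g.label h.symm).trans g.label_segment⟩
  invFun g := ⟨g.state, fun x => g.label (componentEquiv (D := D) g.state x),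
    (congrArg g.label (componentEquiv_comp (D := D) g.state 0)).trans g.label_segment⟩
  left_inv g := by
    obtain ⟨s, l, hl⟩ := g
    simp only [Equiv.symm_apply_apply]
  right_inv g := by
    obtain ⟨s, l, hl⟩ := g
    simp only [Equiv.apply_symm_apply]

theorem lab_symMirEquiv (g : D.Generator) (e : D.Edge) :
    (symMirEquiv g).lab e = g.lab e := by
  have h := componentEquiv_comp g.state e
  rw [← Equiv.eq_symm_apply] at h
  exact congrArg g.label h.symm

theorem nMinus_symMir (D : KnotoidCode) : D.mir.sym.nMinus = D.nMinus := by
  change (Finset.univ.filter fun c : Fin D.n => (!!D.pos c) = false).card = _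
  simp only [Bool.not_not]
  rfl

theorem nPlus_symMir (D : KnotoidCode) : D.mir.sym.nPlus = D.nPlus := by
  change (Finset.univ.filter fun c : Fin D.n => (!!D.pos c) = true).card = _
  simp only [Bool.not_not]
  rfl

theorem hDeg_symMirEquiv (g : D.Generator) : (symMirEquiv g).hDeg = g.hDeg := by
  unfold Generator.hDeg
  rw [nMinus_symMir]
  rfl

theorem qDeg_symMirEquiv (g : D.Generator) : (symMirEquiv g).qDeg = g.qDeg := by
  have h : (symMirEquiv g).deg = g.deg :=
    finsum_comp_equiv (componentEquiv g.state).symm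
      (f := fun x => if g.label x then (1 : ℤ) else -1)
  unfold Generator.qDeg
  rw [nMinus_symMir, nPlus_symMir, h, hDeg_symMirEquiv]

theorem dartIn_symMir (c : Fin D.n) (p : Fin 4) :
    D.mir.sym.dartIn c p = D.dartIn c (turnOver (D.pos c) p) :=
  Prod.ext (edge_symMir c p) (inward_symMir c p)

theorem dartOut_symMir (c : Fin D.n) (p : Fin 4) :
    D.mir.sym.dartOut c p = D.dartOut c (turnOver (D.pos c) p) :=
  Prod.ext (edge_symMir c p) (congrArg not (inward_symMir c p))

theorem step_symMir (s : D.State) (d d' : D.Dart) : D.mir.sym.Step s d d' ↔ D.Step s d d' := by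
  constructor
  · rintro ⟨c, p⟩
    have h1 := dartIn_symMir (D := D) c p
    have h2 := dartOut_symMir (D := D) c (partner (s c) p)
    rw [← partner_turnOver] at h2
    exact h1 ▸ h2 ▸ Step.pass (D := D) c (turnOver (D.pos c) p)
  · rintro ⟨c, p⟩
    have h1 := dartIn_symMir (D := D) c (turnOver (D.pos c) p)
    have h2 := dartOut_symMir (D := D) c (partner (s c) (turnOver (D.pos c) p))
    rw [turnOver_turnOver] at h1
    rw [partner_turnOver, turnOver_turnOver, ← partner_turnOver] at h2
    exact h1 ▸ h2 ▸ Step.pass (D := D.mir.sym) c (turnOver (D.pos c) p)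

theorem segmentCurve_symMir (s : D.State) : D.mir.sym.segmentCurve s = D.segmentCurve s := by
  have : D.mir.sym.Step s = D.Step s := funext fun d => funext fun d' => propext (step_symMir s d d')
  unfold segmentCurve
  rw [this]
  rfl

theorem crossingNumber_symMir (γ : Set D.Dart) (c : Fin D.n) (p : Fin 4) :
    D.mir.sym.crossingNumber γ c p = D.crossingNumber γ c (turnOver (D.pos c) p) := by
  have h1 := dartIn_symMir c p
  have h2 := dartOut_symMir c p
  have h3 : D.mir.sym.crossingNumber γ c p =
    ind (D := D) γ (D.mir.sym.dartIn c p) - ind (D := D) γ (D.mir.sym.dartOut c p) := rfl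
  rw [h3, h1, h2]
  rfl

/-- At each crossing the shortcut of Sym(Mir(K)) crosses the two half-edges that the shortcut of `K`
does not cross. The four crossing numbers at a crossing add up to zero, so the contributions are
opposite. -/
theorem dotShortcut_symMir {γ : Set D.Dart} (h : ∀ c, D.crossingNumber γ c 0 +
    D.crossingNumber γ c 1 + D.crossingNumber γ c 2 + D.crossingNumber γ c 3 = 0) :
    D.mir.sym.dotShortcut γ = - D.dotShortcut γ := by
  have e0 : D.mir.sym.dotShortcut γ = ∑ c : Fin D.n,
      (D.mir.sym.crossingNumber γ c (D.mir.sym.crossedByUnder c) +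
        D.mir.sym.crossingNumber γ c (D.mir.sym.crossedByOver c)) := rfl
  rw [e0, dotShortcut, eq_neg_iff_add_eq_zero]
  refine (Finset.sum_add_distrib (s := (Finset.univ : Finset (Fin D.n)))).symm.trans
    (Finset.sum_eq_zero fun c _ => ?_)
  have h1 := h c
  have e1 := crossingNumber_symMir γ c (D.mir.sym.crossedByUnder c)
  have e2 := crossingNumber_symMir γ c (D.mir.sym.crossedByOver c)
  rw [e1, e2]
  have h2 : D.mir.sym.crossedByOver c = if D.pos c then 0 else 2 := by
    rw [← pos_symMir]
    rfl
  have t1 : turnOver true 1 = 2 := rfl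
  have t2 : turnOver true 0 = 3 := rfl
  have t3 : turnOver false 1 = 0 := rfl
  have t4 : turnOver false 2 = 3 := rfl
  rw [h2]
  cases hb : D.pos c <;>
    simp only [crossedByUnder, crossedByOver, hb, if_true, if_false, Bool.false_eq_true, t1, t2, t3,
      t4] <;> linarith

theorem crossingNumber_segmentCurve (s : D.State) (c : Fin D.n) :
    D.crossingNumber (D.segmentCurve s) c 0 + D.crossingNumber (D.segmentCurve s) c 1 +
      D.crossingNumber (D.segmentCurve s) c 2 + D.crossingNumber (D.segmentCurve s) c 3 = 0 := by
  refine fin4_conserve (fun p => D.crossingNumber (D.segmentCurve s) c p) (s c) fun p => ?_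
  have h1 := segmentCurve_step_iff (s := s) (c := c) (p := p)
  have h2 := segmentCurve_step_iff (s := s) (c := c) (p := partner (s c) p)
  rw [partner_partner] at h2
  rw [crossingNumber_eq, crossingNumber_eq, ind_congr h1, ← ind_congr h2, neg_sub]

theorem crossingNumber_wholeCurve (c : Fin D.n) :
    D.crossingNumber D.wholeCurve c 0 + D.crossingNumber D.wholeCurve c 1 +
      D.crossingNumber D.wholeCurve c 2 + D.crossingNumber D.wholeCurve c 3 = 0 := by
  have h : ∀ p, D.crossingNumber D.wholeCurve c p = if D.inward c p then 1 else -1 := by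
    intro p
    rw [crossingNumber_eq]
    cases hb : D.inward c p
    · rw [ind_of_notMem (by simp [wholeCurve, dartIn, hb]),
        ind_of_mem (by simp [wholeCurve, dartOut, hb])]
      rfl
    · rw [ind_of_mem (by simp [wholeCurve, dartIn, hb]),
        ind_of_notMem (by simp [wholeCurve, dartOut, hb])]
      rfl
  cases hb : D.pos c <;> simp only [h, inward, hb] <;> rfl

theorem uDeg_symMirEquiv (g : D.Generator) : (symMirEquiv g).uDeg = - g.uDeg := by
  have h1 := dotShortcut_symMir (crossingNumber_segmentCurve g.state)
  have h2 := dotShortcut_symMir (D := D) crossingNumber_wholeCurve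
  have h3 : D.mir.sym.dotShortcut (D.mir.sym.segmentCurve g.state) =
      D.mir.sym.dotShortcut (D.segmentCurve g.state) :=
    congrArg (D.mir.sym.dotShortcut) (segmentCurve_symMir g.state)
  change D.mir.sym.dotShortcut (D.mir.sym.segmentCurve g.state) -
    D.mir.sym.dotShortcut D.wholeCurve = - (D.dotShortcut (D.segmentCurve g.state) -
    D.dotShortcut D.wholeCurve)
  rw [h3, h1, h2]
  ring

end KnotoidCode

/-! ### The edge maps of the mirrored reflection -/

namespace KnotoidCode

variable {D : KnotoidCode}

/-- Edge maps read their labels at the half-edges `0` and `2`. In any state one of these lies on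
each local strand, before and after the reflection, so at most the order of the two strands changes.
-/
theorem rel_edge_symMir (s : D.State) (c : Fin D.n) :
    (D.Rel (State.toP s) (D.mir.sym.edge c 0) (D.edge c 0) ∧
      D.Rel (State.toP s) (D.mir.sym.edge c 2) (D.edge c 2)) ∨
    (D.Rel (State.toP s) (D.mir.sym.edge c 0) (D.edge c 2) ∧
      D.Rel (State.toP s) (D.mir.sym.edge c 2) (D.edge c 0)) := by
  have key : ∀ b b', (turnOver b 0 = partner b' 0 ∧ turnOver b 2 = partner b' 2) ∨
      (turnOver b 0 = partner b' 2 ∧ turnOver b 2 = partner b' 0) := by decide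
  have e0 := edge_symMir c 0
  have e2 := edge_symMir c 2
  rcases key (D.pos c) (s c) with ⟨h0, h2⟩ | ⟨h0, h2⟩ <;> rw [h0] at e0 <;> rw [h2] at e2 <;>
    rw [e0, e2]
  · exact Or.inl ⟨(rel_partner s c 0).symm, (rel_partner s c 2).symm⟩
  · exact Or.inr ⟨(rel_partner s c 2).symm, (rel_partner s c 0).symm⟩

theorem rel_symMir_edge (s : D.State) (c : Fin D.n) :
    D.mir.sym.Rel (State.toP (D := D.mir.sym) s) (D.mir.sym.edge c 0) (D.mir.sym.edge c 2) ↔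
      D.Rel (State.toP s) (D.edge c 0) (D.edge c 2) := by
  refine (rel_symMir s).trans ?_
  rcases rel_edge_symMir s c with ⟨h0, h2⟩ | ⟨h0, h2⟩
  · exact ⟨fun h => h0.symm.trans (h.trans h2), fun h => h0.trans (h.trans h2.symm)⟩
  · exact ⟨fun h => h2.symm.trans (h.symm.trans h0), fun h => h0.trans (h.symm.trans h2.symm)⟩

theorem touches_symMir (s : D.State) (c : Fin D.n) (e : D.Edge) :
    Touches (D := D.mir.sym) s c e ↔ Touches s c e := by
  have h : Touches (D := D.mir.sym) s c e ↔
      D.Rel (State.toP s) (D.mir.sym.edge c 0) e ∨ D.Rel (State.toP s) (D.mir.sym.edge c 2) e :=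
    or_congr (rel_symMir s) (rel_symMir s)
  rw [h]
  rcases rel_edge_symMir s c with ⟨h0, h2⟩ | ⟨h0, h2⟩
  · exact or_congr ⟨h0.symm.trans, h0.trans⟩ ⟨h2.symm.trans, h2.trans⟩
  · exact (or_congr ⟨h0.symm.trans, h0.trans⟩ ⟨h2.symm.trans, h2.trans⟩).trans or_comm

theorem adm_symMir {c : Fin D.n} {g h : D.Generator} :
    Adm (D := D.mir.sym) c (symMirEquiv g) (symMirEquiv h) ↔ Adm c g h := by
  constructor
  · rintro ⟨h1, h2, h3⟩
    refine ⟨h1, h2, fun e he => ?_⟩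
    have := h3 e fun h' => he ((touches_symMir g.state c e).1 h')
    rwa [lab_symMirEquiv, lab_symMirEquiv] at this
  · rintro ⟨h1, h2, h3⟩
    refine ⟨h1, h2, fun e he => ?_⟩
    have := h3 e fun h' => he ((touches_symMir g.state c e).2 h')
    exact (lab_symMirEquiv h e).trans (this.trans (lab_symMirEquiv g e).symm)

theorem lab_symMir_edge (g : D.Generator) (c : Fin D.n) :
    ((symMirEquiv g).lab (D.mir.sym.edge c 0) = g.lab (D.edge c 0) ∧
      (symMirEquiv g).lab (D.mir.sym.edge c 2) = g.lab (D.edge c 2)) ∨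
    ((symMirEquiv g).lab (D.mir.sym.edge c 0) = g.lab (D.edge c 2) ∧
      (symMirEquiv g).lab (D.mir.sym.edge c 2) = g.lab (D.edge c 0)) := by
  have e0 := lab_symMirEquiv g (D.mir.sym.edge c 0)
  have e2 := lab_symMirEquiv g (D.mir.sym.edge c 2)
  rcases rel_edge_symMir g.state c with ⟨h0, h2⟩ | ⟨h0, h2⟩
  · exact Or.inl ⟨e0.trans (Generator.lab_congr h0), e2.trans (Generator.lab_congr h2)⟩
  · exact Or.inr ⟨e0.trans (Generator.lab_congr h0), e2.trans (Generator.lab_congr h2)⟩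

theorem mergeCoeff_comm : ∀ x y z, mergeCoeff x y z = mergeCoeff y x z := by decide

theorem splitCoeff_comm : ∀ x y z, splitCoeff x y z = splitCoeff x z y := by decide

/-- Multiplication and comultiplication are commutative, so exchanging the two strands is harmless;
the signs agree because the order of the crossings is kept. -/
theorem edgeCoeff_symMir (c : Fin D.n) (g h : D.Generator) :
    D.mir.sym.edgeCoeff c (symMirEquiv g) (symMirEquiv h) = D.edgeCoeff c g h := by
  by_cases hA : Adm c g h
  swap
  · rw [edgeCoeff_of_not_adm hA]
    exact edgeCoeff_of_not_adm fun h' => hA (adm_symMir.1 h')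
  have hA' := adm_symMir.2 hA
  have hsign : edgeSign (D := D.mir.sym) c (symMirEquiv g).state = edgeSign c g.state := rfl
  by_cases hr : D.Rel (State.toP g.state) (D.edge c 0) (D.edge c 2)
  · have hr1 := (rel_symMir_edge g.state c).2 hr
    by_cases hr' : D.Rel (State.toP h.state) (D.edge c 0) (D.edge c 2)
    · rw [edgeCoeff_single hr hr']
      exact edgeCoeff_single hr1 ((rel_symMir_edge h.state c).2 hr')
    · have hr1' := fun h' => hr' ((rel_symMir_edge h.state c).1 h')
      rw [edgeCoeff_split hA hr hr']
      refine (edgeCoeff_split hA' hr1 hr1').trans ?_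
      rw [hsign]
      congr 1
      have hg : (symMirEquiv g).lab (D.mir.sym.edge c 0) = g.lab (D.edge c 0) := by
        rcases lab_symMir_edge g c with h1 | h1
        · exact h1.1
        · exact h1.1.trans (Generator.lab_congr hr.symm)
      rcases lab_symMir_edge h c with ⟨h1, h2⟩ | ⟨h1, h2⟩
      · exact congr (congr (congrArg _ hg) h1) h2
      · exact (congr (congr (congrArg _ hg) h1) h2).trans (splitCoeff_comm _ _ _)
  · have hr1 := fun h' => hr ((rel_symMir_edge g.state c).1 h')
    rw [edgeCoeff_merge hA hr]
    refine (edgeCoeff_merge hA' hr1).trans ?_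
    rw [hsign]
    congr 1
    have hr' : D.Rel (State.toP h.state) (D.edge c 0) (D.edge c 2) := by
      rw [hA.state]
      exact rel_of_not_rel (agreeOff_flip c g.state) (by rw [flip_self, hA.zero]; rfl) hr
    have hh : (symMirEquiv h).lab (D.mir.sym.edge c 0) = h.lab (D.edge c 0) := by
      rcases lab_symMir_edge h c with h1 | h1
      · exact h1.1
      · exact h1.1.trans (Generator.lab_congr hr'.symm)
    rcases lab_symMir_edge g c with ⟨h1, h2⟩ | ⟨h1, h2⟩
    · exact congr (congr (congrArg _ h1) h2) hh
    · exact (congr (congr (congrArg _ h1) h2) hh).trans (mergeCoeff_comm _ _ _)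

theorem totalCoeff_symMir (g h : D.Generator) :
    totalCoeff (symMirEquiv g) (symMirEquiv h) = totalCoeff g h :=
  Finset.sum_congr rfl fun c _ => edgeCoeff_symMir (D := D) c g h

theorem nullity_congr {D' : KnotoidCode} (e : D.Generator ≃ D'.Generator)
    (he : ∀ g h, totalCoeff (e g) (e h) = totalCoeff g h) {Q : D.Generator → Prop}
    {Q' : D'.Generator → Prop} (hQ : ∀ g, Q' (e g) ↔ Q g) : nullity Q' = nullity Q := by
  have h : cycles Q' = (cycles Q).comap (LinearEquiv.funCongrLeft ℚ ℚ e).toLinearMap := by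
    ext v
    rw [Submodule.mem_comap, mem_cycles, mem_cycles]
    refine and_congr ?_ ?_
    · rw [← e.forall_congr_right]
      exact forall_congr' fun g => by rw [hQ]; rfl
    · rw [← e.forall_congr_right]
      refine forall_congr' fun h => ?_
      rw [← Equiv.sum_comp e]
      simp_rw [he]
      rfl
  rw [nullity, nullity, h]
  exact (LinearEquiv.ofSubmodule' (LinearEquiv.funCongrLeft ℚ ℚ e) (cycles Q)).finrank_eq

theorem finrank_homology_congr {D' : KnotoidCode} (hS : D.IsSpherical) (hS' : D'.IsSpherical)
    (e : D.Generator ≃ D'.Generator) (he : ∀ g h, totalCoeff (e g) (e h) = totalCoeff g h)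
    (hd : ∀ g, (e g).hDeg = g.hDeg) {P : D.Generator → Prop} {P' : D'.Generator → Prop}
    (hP : Closed P) (hP' : Closed P') (hPP : ∀ g, P' (e g) ↔ P g) (i : ℤ) :
    Module.finrank ℚ (D'.Homology P' i) = Module.finrank ℚ (D.Homology P i) := by
  have h1 := finrank_homology hS hP i
  have h2 := finrank_homology hS' hP' i
  have h3 : ∀ i, nullity (fun g : D'.Generator => g.hDeg = i ∧ P' g) =
      nullity fun g : D.Generator => g.hDeg = i ∧ P g :=
    fun i => nullity_congr e he fun g => by rw [hd, hPP]
  have h4 : count P' (i - 1) = count P (i - 1) :=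
    (Nat.card_congr (e.subtypeEquiv fun g => by rw [hd, hPP])).symm
  rw [h3, h3, h4] at h2
  omega

end KnotoidCode

/-! ### Homology of the mirrored reflection -/

namespace KnotoidDiagram

open KnotoidCode

theorem sameKhovanov_symMir (K : KnotoidDiagram) : SameKhovanov K K.symMir := by
  rw [sameKhovanov_iff]
  intro i j
  exact (finrank_homology_congr K.spherical K.symMir.spherical (symMirEquiv (D := K.toKnotoidCode))
    totalCoeff_symMir hDeg_symMirEquiv (closed_qDeg j) (closed_qDeg j)
    (fun g => Eq.congr_left (qDeg_symMirEquiv g)) i).symm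

theorem nonempty_windingHomology_symMir (K : KnotoidDiagram) (i j k : ℤ) :
    Nonempty (K.symMir.windingHomology i j k ≃ₗ[ℚ] K.windingHomology i j (-k)) := by
  rw [FiniteDimensional.nonempty_linearEquiv_iff_finrank_eq]
  exact finrank_homology_congr K.spherical K.symMir.spherical (symMirEquiv (D := K.toKnotoidCode))
    totalCoeff_symMir hDeg_symMirEquiv (closed_qDeg_uDeg K.spherical j (-k))
    (closed_qDeg_uDeg K.symMir.spherical j k)
    (fun g => and_congr (Eq.congr_left (qDeg_symMirEquiv (D := K.toKnotoidCode) g))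
      ((Eq.congr_left (uDeg_symMirEquiv (D := K.toKnotoidCode) g)).trans neg_eq_iff_eq_neg)) i

end KnotoidDiagram

/-! ### Sets of natural numbers as bit masks

The functions in this section are meant to be evaluated by the kernel; they are written with
recursors and with the arithmetic functions for which it has built-in support. -/

namespace BitMask

/-- Whether `a` belongs to the mask `m`. -/
def has (m a : ℕ) : Bool := Nat.beq (Nat.land 1 (Nat.shiftRight m a)) 1

theorem beq_eq (x y : ℕ) : Nat.beq x y = (x == y) := by
  rw [Bool.eq_iff_iff, beq_iff_eq, Nat.beq_eq]

theorem has_eq (m a : ℕ) : has m a = m.testBit a := by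
  rw [has, beq_eq, Nat.testBit]
  change (1 &&& m >>> a == 1) = (1 &&& m >>> a != 0)
  rw [Nat.and_comm, Nat.and_one_is_mod]
  rcases Nat.mod_two_eq_zero_or_one (m >>> a) with h | h <;> simp [h]

theorem has_lor (m m' a : ℕ) : has (Nat.lor m m') a = (has m a || has m' a) := by
  simp only [has_eq]; exact Nat.testBit_or ..

theorem has_two_pow (k a : ℕ) : has (Nat.pow 2 k) a = true ↔ k = a := by
  rw [has_eq]
  change (2 ^ k).testBit a = true ↔ _
  rw [Nat.testBit_two_pow]
  simp

theorem has_zero (a : ℕ) : has 0 a = false := by rw [has_eq]; exact Nat.zero_testBit a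

theorem ext {m m' : ℕ} (h : ∀ a, has m a = has m' a) : m = m' :=
  Nat.eq_of_testBit_eq fun a => by rw [← has_eq, ← has_eq, h]

/-- The first mask of a list to which `a` belongs. -/
noncomputable def block (L : List ℕ) (a : ℕ) : ℕ :=
  List.rec 0 (fun m _ r => cond (has m a) m r) L

/-- Removes the masks `m₁` and `m₂` from a list. -/
noncomputable def remove (L : List ℕ) (m₁ m₂ : ℕ) : List ℕ :=
  List.rec [] (fun m _ r => cond (Nat.beq m m₁) r (cond (Nat.beq m m₂) r (m :: r))) L

/-- Replaces the masks `m₁` and `m₂` by their union. -/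
noncomputable def unite (L : List ℕ) (m₁ m₂ : ℕ) : List ℕ :=
  cond (Nat.beq m₁ m₂) L (Nat.lor m₁ m₂ :: remove L m₁ m₂)

/-- Unites the block of `a` and the block of `b`. -/
noncomputable def join (L : List ℕ) (a b : ℕ) : List ℕ := unite L (block L a) (block L b)

/-- The partition of `{0, …, E - 1}` into singletons. -/
noncomputable def singletons (E : ℕ) : List ℕ := Nat.rec [] (fun k r => Nat.pow 2 k :: r) E

theorem block_cons (m : ℕ) (L : List ℕ) (a : ℕ) :
    block (m :: L) a = cond (has m a) m (block L a) := rfl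

theorem mem_remove {L : List ℕ} {m₁ m₂ m : ℕ} :
    m ∈ remove L m₁ m₂ ↔ m ∈ L ∧ m ≠ m₁ ∧ m ≠ m₂ := by
  induction L with
  | nil => exact ⟨fun h => absurd h List.not_mem_nil, fun h => absurd h.1 List.not_mem_nil⟩
  | cons x L ih =>
    have h : remove (x :: L) m₁ m₂ =
      cond (x == m₁) (remove L m₁ m₂) (cond (x == m₂) (remove L m₁ m₂) (x :: remove L m₁ m₂)) := by
      rw [← beq_eq, ← beq_eq]; rfl
    rw [h]
    by_cases h1 : x = m₁
    · subst h1
      simp only [beq_self_eq_true, cond_true, ih, List.mem_cons]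
      tauto
    by_cases h2 : x = m₂
    · subst h2
      simp only [beq_eq_false_iff_ne.2 h1, cond_false, beq_self_eq_true, cond_true, ih,
        List.mem_cons]
      tauto
    · simp only [beq_eq_false_iff_ne.2 h1, beq_eq_false_iff_ne.2 h2, cond_false, ih, List.mem_cons]
      constructor
      · rintro (rfl | h)
        · exact ⟨Or.inl rfl, h1, h2⟩
        · exact ⟨Or.inr h.1, h.2⟩
      · rintro ⟨rfl | h, h'⟩
        · exact Or.inl rfl
        · exact Or.inr ⟨h, h'⟩

theorem remove_sublist (L : List ℕ) (m₁ m₂ : ℕ) : (remove L m₁ m₂).Sublist L := by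
  induction L with
  | nil => exact List.Sublist.refl _
  | cons x L ih =>
    have h : remove (x :: L) m₁ m₂ =
      cond (x == m₁) (remove L m₁ m₂) (cond (x == m₂) (remove L m₁ m₂) (x :: remove L m₁ m₂)) := by
      rw [← beq_eq, ← beq_eq]; rfl
    rw [h]
    cases x == m₁ <;> cases x == m₂ <;> simp only [cond_true, cond_false]
    · exact ih.cons_cons x
    all_goals exact ih.cons x

/-- `L` is a list of the blocks of a partition of `{0, …, E - 1}`. -/
structure IsPartition (E : ℕ) (L : List ℕ) : Prop where
  cover : ∀ a < E, ∃ m ∈ L, has m a = true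
  disjoint : L.Pairwise fun m m' => ∀ a, has m a = true → has m' a = false
  nonempty : ∀ m ∈ L, ∃ a, has m a = true
  lt : ∀ m ∈ L, ∀ a, has m a = true → a < E

/-- `a` and `b` lie in the same block. -/
def Together (L : List ℕ) (a b : ℕ) : Prop := ∃ m ∈ L, has m a = true ∧ has m b = true

variable {E : ℕ} {L : List ℕ}

theorem IsPartition.eq (h : IsPartition E L) {m m' a : ℕ} (hm : m ∈ L) (hm' : m' ∈ L)
    (ha : has m a = true) (ha' : has m' a = true) : m = m' := by
  by_contra hne
  have h1 : L.Pairwise fun m m' => ∀ a, ¬ (has m a = true ∧ has m' a = true) :=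
    h.disjoint.imp fun h a h' => by rw [h a h'.1] at h'; exact absurd h'.2 (by decide)
  have : Std.Symm fun m m' => ∀ a, ¬ (has m a = true ∧ has m' a = true) :=
    ⟨fun x y h a h' => h a ⟨h'.2, h'.1⟩⟩
  exact h1.forall hm hm' hne a ⟨ha, ha'⟩

theorem IsPartition.nodup (h : IsPartition E L) : L.Nodup := by
  refine List.Pairwise.imp_of_mem ?_ h.disjoint
  rintro m m' hm - h1 rfl
  obtain ⟨a, ha⟩ := h.nonempty m hm
  rw [h1 a ha] at ha
  exact absurd ha (by decide)

theorem IsPartition.block_eq (h : IsPartition E L) {m a : ℕ} (hm : m ∈ L) (ha : has m a = true) :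
    block L a = m := by
  have key : ∀ L : List ℕ, m ∈ L → block L a ∈ L ∧ has (block L a) a = true := by
    intro L
    induction L with
    | nil => intro hm; exact absurd hm List.not_mem_nil
    | cons x L ih =>
      intro hm
      rw [block_cons]
      rcases hx : has x a with _ | _
      · rcases List.mem_cons.1 hm with rfl | hm
        · rw [ha] at hx; exact absurd hx (by decide)
        · exact ⟨List.mem_cons_of_mem _ (ih hm).1, (ih hm).2⟩
      · exact ⟨List.mem_cons_self, hx⟩
  exact h.eq (key L hm).1 hm (key L hm).2 ha

theorem IsPartition.block_mem (h : IsPartition E L) {a : ℕ} (ha : a < E) :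
    block L a ∈ L ∧ has (block L a) a = true := by
  obtain ⟨m, hm, hma⟩ := h.cover a ha
  rw [h.block_eq hm hma]
  exact ⟨hm, hma⟩

theorem IsPartition.has_block (h : IsPartition E L) {a b : ℕ} (ha : a < E) :
    has (block L a) b = true ↔ Together L a b := by
  obtain ⟨h1, h2⟩ := h.block_mem ha
  refine ⟨fun hb => ⟨_, h1, h2, hb⟩, ?_⟩
  rintro ⟨m, hm, hma, hmb⟩
  rw [h.block_eq hm hma]
  exact hmb

theorem IsPartition.block_eq_block (h : IsPartition E L) {a b : ℕ} (ha : a < E) (hb : b < E) :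
    block L a = block L b ↔ Together L a b := by
  rw [← h.has_block ha]
  refine ⟨fun he => ?_, fun hab => (h.block_eq (h.block_mem ha).1 hab).symm⟩
  rw [he]
  exact (h.block_mem hb).2

theorem IsPartition.together_self (h : IsPartition E L) {a : ℕ} (ha : a < E) : Together L a a := by
  obtain ⟨m, hm, hma⟩ := h.cover a ha
  exact ⟨m, hm, hma, hma⟩

theorem Together.symm {a b : ℕ} (h : Together L a b) : Together L b a := by
  obtain ⟨m, hm, h1, h2⟩ := h
  exact ⟨m, hm, h2, h1⟩

theorem IsPartition.together_trans (h : IsPartition E L) {a b c : ℕ} (h1 : Together L a b)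
    (h2 : Together L b c) : Together L a c := by
  obtain ⟨m, hm, hma, hmb⟩ := h1
  obtain ⟨m', hm', hmb', hmc⟩ := h2
  obtain rfl := h.eq hm hm' hmb hmb'
  exact ⟨m, hm, hma, hmc⟩

theorem isPartition_singletons (E : ℕ) : IsPartition E (singletons E) := by
  have hs : ∀ k, singletons (k + 1) = Nat.pow 2 k :: singletons k := fun _ => rfl
  induction E with
  | zero =>
    exact ⟨fun a ha => absurd ha (Nat.not_lt_zero a), List.Pairwise.nil,
      fun m hm => absurd hm List.not_mem_nil, fun m hm => absurd hm List.not_mem_nil⟩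
  | succ k ih =>
    rw [hs]
    refine ⟨fun a ha => ?_, List.pairwise_cons.2 ⟨fun m hm a h => ?_, ih.disjoint⟩, ?_, ?_⟩
    · rcases Nat.lt_succ_iff_lt_or_eq.1 ha with h | rfl
      · obtain ⟨m, hm, hma⟩ := ih.cover a h
        exact ⟨m, List.mem_cons_of_mem _ hm, hma⟩
      · exact ⟨_, List.mem_cons_self, (has_two_pow _ _).2 rfl⟩
    · rw [has_two_pow] at h
      subst h
      by_contra hne
      exact absurd (ih.lt m hm _ (by simpa using hne)) (lt_irrefl _)
    · intro m hm
      rcases List.mem_cons.1 hm with rfl | hm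
      · exact ⟨k, (has_two_pow _ _).2 rfl⟩
      · exact ih.nonempty m hm
    · intro m hm a ha
      rcases List.mem_cons.1 hm with rfl | hm
      · rw [has_two_pow] at ha; omega
      · exact (ih.lt m hm a ha).trans (Nat.lt_succ_self k)

theorem together_singletons {a b : ℕ} (h : Together (singletons E) a b) : a = b := by
  have hs : ∀ k, singletons (k + 1) = Nat.pow 2 k :: singletons k := fun _ => rfl
  induction E with
  | zero =>
    obtain ⟨m, hm, -⟩ := h
    exact absurd hm List.not_mem_nil
  | succ k ih =>
    obtain ⟨m, hm, h1, h2⟩ := h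
    rw [hs] at hm
    rcases List.mem_cons.1 hm with rfl | hm
    · exact ((has_two_pow _ _).1 h1).symm.trans ((has_two_pow _ _).1 h2)
    · exact ih ⟨m, hm, h1, h2⟩

theorem join_of_eq {a b : ℕ} (h : block L a = block L b) : join L a b = L := by
  have h' : join L a b = cond (block L a == block L b) L
    (Nat.lor (block L a) (block L b) :: remove L (block L a) (block L b)) := by
    rw [← beq_eq]; rfl
  rw [h', h, beq_self_eq_true]
  rfl

theorem join_of_ne {a b : ℕ} (h : block L a ≠ block L b) : join L a b =
    Nat.lor (block L a) (block L b) :: remove L (block L a) (block L b) := by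
  have h' : join L a b = cond (block L a == block L b) L
    (Nat.lor (block L a) (block L b) :: remove L (block L a) (block L b)) := by
    rw [← beq_eq]; rfl
  rw [h', beq_eq_false_iff_ne.2 h]
  rfl

theorem isPartition_join (h : IsPartition E L) {a b : ℕ} (ha : a < E) (hb : b < E) :
    IsPartition E (join L a b) := by
  by_cases he : block L a = block L b
  · rwa [join_of_eq he]
  obtain ⟨ha1, ha2⟩ := h.block_mem ha
  obtain ⟨hb1, hb2⟩ := h.block_mem hb
  rw [join_of_ne he]
  refine ⟨fun x hx => ?_, List.pairwise_cons.2 ⟨fun m hm x hx => ?_,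
    h.disjoint.sublist (remove_sublist ..)⟩, ?_, ?_⟩
  · obtain ⟨m, hm, hmx⟩ := h.cover x hx
    by_cases h1 : m = block L a
    · exact ⟨_, List.mem_cons_self, by rw [has_lor, ← h1, hmx, Bool.true_or]⟩
    by_cases h2 : m = block L b
    · exact ⟨_, List.mem_cons_self, by rw [has_lor, ← h2, hmx, Bool.or_true]⟩
    · exact ⟨m, List.mem_cons_of_mem _ (mem_remove.2 ⟨hm, h1, h2⟩), hmx⟩
  · obtain ⟨hm, h1, h2⟩ := mem_remove.1 hm
    by_contra hne
    rw [Bool.not_eq_false] at hne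
    rw [has_lor, Bool.or_eq_true] at hx
    rcases hx with hx | hx
    · exact h1 (h.eq hm ha1 hne hx)
    · exact h2 (h.eq hm hb1 hne hx)
  · intro m hm
    rcases List.mem_cons.1 hm with rfl | hm
    · exact ⟨a, by rw [has_lor, ha2, Bool.true_or]⟩
    · exact h.nonempty m (mem_remove.1 hm).1
  · intro m hm x hx
    rcases List.mem_cons.1 hm with rfl | hm
    · rw [has_lor, Bool.or_eq_true] at hx
      exact hx.elim (h.lt _ ha1 x) (h.lt _ hb1 x)
    · exact h.lt m (mem_remove.1 hm).1 x hx

theorem together_join (h : IsPartition E L) {a b : ℕ} (ha : a < E) (hb : b < E)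
    {x y : ℕ} : Together (join L a b) x y ↔ Together L x y ∨
      (Together L a x ∨ Together L b x) ∧ (Together L a y ∨ Together L b y) := by
  by_cases he : block L a = block L b
  · rw [join_of_eq he]
    refine ⟨Or.inl, ?_⟩
    have hab : Together L a b := (h.block_eq_block ha hb).1 he
    have key : ∀ {z}, Together L a z ∨ Together L b z → Together L a z := by
      rintro z (h1 | h1)
      · exact h1
      · exact h.together_trans hab h1
    rintro (h1 | ⟨h1, h2⟩)
    · exact h1
    · exact h.together_trans (key h1).symm (key h2)
  rw [join_of_ne he, ← h.has_block ha, ← h.has_block hb, ← h.has_block ha, ← h.has_block hb,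
    ← Bool.or_eq_true, ← Bool.or_eq_true, ← has_lor, ← has_lor]
  obtain ⟨ha1, ha2⟩ := h.block_mem ha
  obtain ⟨hb1, hb2⟩ := h.block_mem hb
  constructor
  · rintro ⟨m, hm, h1, h2⟩
    rcases List.mem_cons.1 hm with rfl | hm
    · exact Or.inr ⟨h1, h2⟩
    · exact Or.inl ⟨m, (mem_remove.1 hm).1, h1, h2⟩
  · rintro (⟨m, hm, h1, h2⟩ | h1)
    · by_cases h3 : m = block L a
      · exact ⟨_, List.mem_cons_self, by rw [has_lor, ← h3, h1, Bool.true_or],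
          by rw [has_lor, ← h3, h2, Bool.true_or]⟩
      by_cases h4 : m = block L b
      · exact ⟨_, List.mem_cons_self, by rw [has_lor, ← h4, h1, Bool.or_true],
          by rw [has_lor, ← h4, h2, Bool.or_true]⟩
      · exact ⟨m, List.mem_cons_of_mem _ (mem_remove.2 ⟨hm, h3, h4⟩), h1, h2⟩
    · exact ⟨_, List.mem_cons_self, h1⟩

end BitMask

/-! ### The components of a state as bit masks -/

namespace BitMask

/-- Smoothing a crossing with the half-edges `q`. -/
noncomputable def smoothAt (b : Bool) (L : List ℕ) (q : ℕ × ℕ × ℕ × ℕ) : List ℕ :=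
  cond b (join (join L q.1 q.2.2.2) q.2.1 q.2.2.1) (join (join L q.1 q.2.1) q.2.2.1 q.2.2.2)

/-- Binary trees with a list at each leaf. -/
inductive Tree
  | leaf (L : List ℕ)
  | node (a b : Tree)

/-- The tree of the partitions obtained by smoothing the crossings `qs` in all possible ways. -/
noncomputable def build (qs : List (ℕ × ℕ × ℕ × ℕ)) : List ℕ → Tree :=
  List.rec (fun L => .leaf L)
    (fun q _ ih L => .node (ih (smoothAt false L q)) (ih (smoothAt true L q))) qs

/-- The leaf of a tree reached by following the bits of a number. -/
noncomputable def look (t : Tree) : ℕ → List ℕ :=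
  Tree.rec (fun L _ => L)
    (fun _ _ iha ihb S => cond (has S 0) (ihb (Nat.div S 2)) (iha (Nat.div S 2))) t

/-- The tree of all states. -/
noncomputable def stateTree (qs : List (ℕ × ℕ × ℕ × ℕ)) (n : ℕ) : Tree :=
  build qs (singletons (2 * n + 1))

theorem has_div_two (S i : ℕ) : has (Nat.div S 2) i = has S (i + 1) := by
  rw [has_eq, has_eq, Nat.testBit_succ]; rfl

end BitMask

namespace KnotoidCode

open BitMask

variable {D : KnotoidCode}

/-- The edges at the four half-edges of a crossing. -/
def corners (D : KnotoidCode) (c : Fin D.n) : ℕ × ℕ × ℕ × ℕ :=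
  ((D.edge c 0).val, (D.edge c 1).val, (D.edge c 2).val, (D.edge c 3).val)

/-- Smooths the crossings of a list as prescribed by a state. -/
noncomputable def smooth (s : D.State) : List (Fin D.n) → List ℕ → List ℕ
  | [], L => L
  | c :: cs, L => smooth s cs (smoothAt (s c) L (D.corners c))

/-- The state whose `1`-smoothings are the elements of a mask. -/
def stateOf (D : KnotoidCode) (S : ℕ) : D.State := fun c => has S c

/-- The lowest bit of `S` chooses the smoothing of the first crossing of the list, and division by
two passes on to the next crossing. -/
theorem look_build (s : D.State) (cs : List (Fin D.n)) (L : List ℕ) (S : ℕ)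
    (h : ∀ i (hi : i < cs.length), has S i = s cs[i]) :
    look (build (cs.map D.corners) L) S = smooth s cs L := by
  induction cs generalizing L S with
  | nil => rfl
  | cons c cs ih =>
    have h0 : has S 0 = s c := h 0 (Nat.succ_pos _)
    have h1 : ∀ L, look (build (cs.map D.corners) L) (Nat.div S 2) = smooth s cs L := fun L =>
      ih L _ fun i hi => by
        rw [has_div_two]
        exact h (i + 1) (Nat.succ_lt_succ hi)
    have h2 : look (build ((c :: cs).map D.corners) L) S = cond (has S 0)
        (look (build (cs.map D.corners) (smoothAt true L (D.corners c))) (Nat.div S 2))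
        (look (build (cs.map D.corners) (smoothAt false L (D.corners c))) (Nat.div S 2)) := rfl
    rw [h2, h0, h1, h1, smooth]
    cases s c <;> rfl

/-- The masks of a list are the components of a state. -/
structure Represents (s : D.State) (L : List ℕ) : Prop where
  isPartition : IsPartition (2 * D.n + 1) L
  together_iff : ∀ e e' : D.Edge, Together L e e' ↔ D.Rel (State.toP s) e e'

theorem Represents.has_block {s : D.State} {L : List ℕ} (h : Represents s L) (e e' : D.Edge) :
    has (block L e) e' = true ↔ D.Rel (State.toP s) e e' := by
  rw [h.isPartition.has_block e.isLt, h.together_iff]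

theorem Represents.block_eq_block {s : D.State} {L : List ℕ} (h : Represents s L)
    (e e' : D.Edge) : block L e = block L e' ↔ D.Rel (State.toP s) e e' := by
  rw [h.isPartition.block_eq_block e.isLt e'.isLt, h.together_iff]

/-- An invariant of the successive unions: blocks remain a partition, join only edges of one
component, never fall apart, and contain the links at every crossing treated so far. -/
theorem smooth_spec (s : D.State) (cs : List (Fin D.n)) (L : List ℕ)
    (hL : IsPartition (2 * D.n + 1) L)
    (hr : ∀ e e' : D.Edge, Together L e e' → D.Rel (State.toP s) e e') :
    IsPartition (2 * D.n + 1) (smooth s cs L) ∧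
    (∀ e e' : D.Edge, Together (smooth s cs L) e e' → D.Rel (State.toP s) e e') ∧
    (∀ a b, Together L a b → Together (smooth s cs L) a b) ∧
    ∀ c ∈ cs, ∀ p, Together (smooth s cs L) (D.edge c p) (D.edge c (partner (s c) p)) := by
  induction cs generalizing L with
  | nil => exact ⟨hL, hr, fun _ _ h => h, fun c hc => absurd hc List.not_mem_nil⟩
  | cons c cs ih =>
    have key : ∀ p₁ p₂ p₃ p₄ : Fin 4, p₂ = partner (s c) p₁ → p₄ = partner (s c) p₃ →
        ∀ L', L' = join (join L (D.edge c p₁) (D.edge c p₂)) (D.edge c p₃) (D.edge c p₄) →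
        IsPartition (2 * D.n + 1) L' ∧
        (∀ e e' : D.Edge, Together L' e e' → D.Rel (State.toP s) e e') ∧
        (∀ a b, Together L a b → Together L' a b) ∧
        Together L' (D.edge c p₁) (D.edge c p₂) ∧ Together L' (D.edge c p₃) (D.edge c p₄) := by
      intro p₁ p₂ p₃ p₄ h₂ h₄ L' hL'
      have q1 := isPartition_join hL (D.edge c p₁).isLt (D.edge c p₂).isLt
      have q2 := isPartition_join q1 (D.edge c p₃).isLt (D.edge c p₄).isLt
      have j1 := fun x y => together_join hL (D.edge c p₁).isLt (D.edge c p₂).isLt (x := x) (y := y)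
      have j2 := fun x y => together_join q1 (D.edge c p₃).isLt (D.edge c p₄).isLt (x := x) (y := y)
      have mono : ∀ L : List ℕ, (∀ e e' : D.Edge, Together L e e' → D.Rel (State.toP s) e e') →
          ∀ p (e e' : D.Edge), (Together L e e' ∨
            (Together L (D.edge c p) e ∨ Together L (D.edge c (partner (s c) p)) e) ∧
            (Together L (D.edge c p) e' ∨ Together L (D.edge c (partner (s c) p)) e')) →
          D.Rel (State.toP s) e e' := by
        intro L hr p e e' h
        have hp := rel_partner s c p
        have aux : ∀ x : D.Edge,
            (Together L (D.edge c p) x ∨ Together L (D.edge c (partner (s c) p)) x) →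
            D.Rel (State.toP s) (D.edge c p) x := fun x h => h.elim (hr _ _) fun h => hp.trans (hr _ _ h)
        rcases h with h | ⟨h, h'⟩
        · exact hr _ _ h
        · exact (aux _ h).symm.trans (aux _ h')
      subst hL'
      refine ⟨q2, fun e e' h => ?_, fun a b h => ?_, ?_, ?_⟩
      · rw [j2, h₄] at h
        refine mono _ (fun e e' h => ?_) _ e e' h
        rw [j1, h₂] at h
        exact mono _ hr _ e e' h
      · rw [j2, j1]
        exact Or.inl (Or.inl h)
      · rw [j2, j1]
        exact Or.inl (Or.inr ⟨Or.inl (hL.together_self (D.edge c p₁).isLt),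
          Or.inr (hL.together_self (D.edge c p₂).isLt)⟩)
      · rw [j2]
        exact Or.inr ⟨Or.inl (q1.together_self (D.edge c p₃).isLt),
          Or.inr (q1.together_self (D.edge c p₄).isLt)⟩
    have h1 : ∃ L', L' = smoothAt (s c) L (D.corners c) ∧ IsPartition (2 * D.n + 1) L' ∧
        (∀ e e' : D.Edge, Together L' e e' → D.Rel (State.toP s) e e') ∧
        (∀ a b, Together L a b → Together L' a b) ∧
        ∀ p, Together L' (D.edge c p) (D.edge c (partner (s c) p)) := by
      refine ⟨_, rfl, ?_⟩
      rcases hb : s c with _ | _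
      · obtain ⟨a1, a2, a3, a4, a5⟩ := key 0 1 2 3 (by rw [hb]; rfl) (by rw [hb]; rfl) _ rfl
        refine ⟨a1, a2, a3, fun p => ?_⟩
        fin_cases p
        exacts [a4, a4.symm, a5, a5.symm]
      · obtain ⟨a1, a2, a3, a4, a5⟩ := key 0 3 1 2 (by rw [hb]; rfl) (by rw [hb]; rfl) _ rfl
        refine ⟨a1, a2, a3, fun p => ?_⟩
        fin_cases p
        exacts [a4, a5, a5.symm, a4.symm]
    obtain ⟨L', hL', a1, a2, a3, a4⟩ := h1
    obtain ⟨b1, b2, b3, b4⟩ := ih L' a1 a2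
    rw [smooth, ← hL']
    refine ⟨b1, b2, fun a b h => b3 _ _ (a3 _ _ h), fun c' hc' p => ?_⟩
    rcases List.mem_cons.1 hc' with rfl | hc'
    · exact b3 _ _ (a4 p)
    · exact b4 c' hc' p

theorem represents_smooth (s : D.State) :
    Represents s (smooth s (List.finRange D.n) (singletons (2 * D.n + 1))) := by
  obtain ⟨h1, h2, -, h4⟩ := smooth_spec s (List.finRange D.n) _ (isPartition_singletons _)
    fun e e' h => by rw [Fin.ext (together_singletons h)]; exact Rel.refl _
  refine ⟨h1, fun e e' => ⟨h2 e e', fun h => ?_⟩⟩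
  refine (h.iff_of_forall (P := fun x => Together _ e x) fun c p b hb h' => ?_).1
    (h1.together_self e.isLt)
  have hb' : s c = b := by simpa [State.toP] using hb
  rw [← hb']
  exact h1.together_trans h' (h4 c (List.mem_finRange c) p)

theorem represents_look (D : KnotoidCode) (S : ℕ) : Represents (D.stateOf S)
    (look (stateTree ((List.finRange D.n).map D.corners) D.n) S) := by
  rw [stateTree, look_build (D.stateOf S)]
  · exact represents_smooth _
  · intro i hi
    rw [List.getElem_finRange]
    rfl

/-! ### Generators as bit masks -/

/-- The mask of the `1`-smoothings of a state. -/
def stateCode (s : D.State) : ℕ := Nat.ofBits s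

theorem has_stateCode (s : D.State) (c : Fin D.n) : has (stateCode s) c = s c := by
  rw [has_eq, stateCode, Nat.testBit_ofBits_lt _ _ c.isLt]

theorem has_stateCode_of_le (s : D.State) {a : ℕ} (h : D.n ≤ a) : has (stateCode s) a = false := by
  rw [has_eq, stateCode, Nat.testBit_ofBits_ge _ _ h]

theorem stateOf_stateCode (s : D.State) : D.stateOf (stateCode s) = s :=
  funext fun c => has_stateCode s c

theorem stateCode_injective : Function.Injective (stateCode (D := D)) := fun s s' h => by
  rw [← stateOf_stateCode s, h, stateOf_stateCode]

theorem stateCode_flip (c : Fin D.n) (s : D.State) :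
    stateCode (flip c s) = Nat.lor (stateCode s) (Nat.pow 2 c) := by
  apply BitMask.ext
  intro a
  rw [has_lor, Bool.eq_iff_iff, Bool.or_eq_true, has_two_pow]
  by_cases ha : a < D.n
  · have h1 := has_stateCode (flip c s) ⟨a, ha⟩
    have h2 := has_stateCode s ⟨a, ha⟩
    simp only at h1 h2
    rw [h1, h2]
    by_cases hca : c = ⟨a, ha⟩
    · subst hca
      simp
    · have : ¬ (c : ℕ) = a := fun h => hca (Fin.ext h)
      simp [Function.update_of_ne (Ne.symm hca), this]
  · have : ¬ (c : ℕ) = a := fun h => ha (h ▸ c.isLt)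
    rw [has_stateCode_of_le _ (not_lt.1 ha), has_stateCode_of_le _ (not_lt.1 ha)]
    simp [this]

/-- The mask of the edges labelled by `X`. -/
def Generator.mask (g : D.Generator) : ℕ := Nat.ofBits fun e => !g.lab e

theorem has_mask (g : D.Generator) (e : D.Edge) : has g.mask e = !g.lab e := by
  rw [has_eq, Generator.mask, Nat.testBit_ofBits_lt _ _ e.isLt]

theorem has_mask_of_le (g : D.Generator) {a : ℕ} (h : 2 * D.n + 1 ≤ a) :
    has g.mask a = false := by
  rw [has_eq, Generator.mask, Nat.testBit_ofBits_ge _ _ h]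

theorem mask_eq {g : D.Generator} {m : ℕ} (hlt : ∀ a, has m a = true → a < 2 * D.n + 1)
    (h : ∀ e : D.Edge, has m e = !g.lab e) : g.mask = m := by
  apply BitMask.ext
  intro a
  by_cases ha : a < 2 * D.n + 1
  · exact (has_mask g ⟨a, ha⟩).trans (h ⟨a, ha⟩).symm
  · rw [has_mask_of_le g (not_lt.1 ha)]
    by_contra hne
    exact ha (hlt a (by simpa using Ne.symm hne))

/-- A generator is named by two numbers, which allows sums over generators to be matched with lists
of codes. -/
theorem Generator.ext_code {g h : D.Generator} (h1 : stateCode g.state = stateCode h.state)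
    (h2 : g.mask = h.mask) : g = h :=
  Generator.ext_lab (stateCode_injective h1) fun e => by
    have h3 := has_mask g e
    rw [h2, has_mask] at h3
    simpa using h3.symm

/-- Each union of components that contains the segment is the mask of a generator. -/
theorem exists_generator (s : D.State) {m : ℕ} (hlt : ∀ a, has m a = true → a < 2 * D.n + 1)
    (h0 : has m 0 = true) (h : ∀ e e' : D.Edge, D.Rel (State.toP s) e e' →
      has m e = true → has m e' = true) : ∃ g : D.Generator, g.state = s ∧ g.mask = m := by
  refine ⟨ofEdges s ((List.finRange _).filter fun e : D.Edge => has m e), rfl,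
    mask_eq hlt fun e => ?_⟩
  have key : (ofEdges s ((List.finRange _).filter fun e : D.Edge => has m e)).lab e = false ↔
      has m e = true := by
    rw [lab_ofEdges]
    simp only [List.mem_cons, List.mem_filter, List.mem_finRange, true_and]
    constructor
    · rintro ⟨x, rfl | hx, hr⟩
      · exact h _ _ hr.symm h0
      · exact h _ _ hr.symm hx
    · exact fun he => ⟨e, Or.inr he, Rel.refl e⟩
  rcases hl : (ofEdges s ((List.finRange _).filter fun e : D.Edge => has m e)).lab e with _ | _
  · exact key.1 hl
  · rw [hl] at key
    simpa using key

end KnotoidCode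

/-! ### The differential in terms of bit masks -/

namespace BitMask

/-- The terms of the edge map at the crossing with the half-edges `q`, for the generator with state
`S` and mask `m`; here `L` are the components of `S` and `t` is the tree of all states.  A term with
sign `par`, state `S'` and mask `m'` is put as `f par S' m'` in front of `r`. -/
noncomputable def imageAt {α : Type} (t : Tree) (S m : ℕ) (L : List ℕ) (f : Bool → ℕ → ℕ → α)
    (add : α → α → α) (q : ℕ × ℕ × ℕ × ℕ) (bit : ℕ) (par : Bool) (r : α) : α :=
  (fun A B => cond (Nat.beq A B)
    ((fun L' => (fun A' B' => cond (has m q.1)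
        (cond (Nat.beq A' B') r (add (f par (Nat.lor S bit) m) r))
        (add (f par (Nat.lor S bit) (Nat.lor m A'))
          (add (f par (Nat.lor S bit) (Nat.lor m B')) r)))
      (block L' q.1) (block L' q.2.2.1)) (look t (Nat.lor S bit)))
    (cond (has m q.1)
      (cond (has m q.2.2.1) r (add (f par (Nat.lor S bit) (Nat.lor m B)) r))
      (add (f par (Nat.lor S bit) (cond (has m q.2.2.1) (Nat.lor m A) m)) r)))
  (block L q.1) (block L q.2.2.1)

/-- The terms of the differential. -/
noncomputable def image {α : Type} (qs : List (ℕ × ℕ × ℕ × ℕ)) (t : Tree) (S m : ℕ) (L : List ℕ)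
    (f : Bool → ℕ → ℕ → α) (add : α → α → α) (z : α) : ℕ → Bool → α :=
  List.rec (fun _ _ => z) (fun q _ ih bit par => cond (Nat.beq (Nat.land S bit) 0)
    (imageAt t S m L f add q bit par (ih (Nat.mul 2 bit) par))
    (ih (Nat.mul 2 bit) (not par))) qs

end BitMask

namespace KnotoidCode

open BitMask

variable {D : KnotoidCode} {c : Fin D.n} {g : D.Generator} {m : ℕ}

/-- A generator which is related to `g` by an edge map, given by its mask. -/
theorem exists_adm (hc : g.state c = false) (hlt : ∀ a, has m a = true → a < 2 * D.n + 1)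
    (h0 : has m 0 = true)
    (hu : ∀ e, ¬ Touches g.state c e → has m e = !g.lab e)
    (ha : ∀ e, D.Rel (State.toP (flip c g.state)) (D.edge c 0) e → has m e = has m (D.edge c 0))
    (hb : ∀ e, D.Rel (State.toP (flip c g.state)) (D.edge c 2) e → has m e = has m (D.edge c 2)) :
    ∃ h : D.Generator, Adm c g h ∧ h.mask = m ∧
      stateCode h.state = Nat.lor (stateCode g.state) (Nat.pow 2 c) := by
  have hA := agreeOff_flip c g.state
  obtain ⟨h, hs, hm⟩ := exists_generator (flip c g.state) hlt h0 fun e e' hr he => by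
    by_cases hT : Touches g.state c e
    · rcases hA.touches_iff.1 hT with h1 | h1
      · rw [ha _ (h1.trans hr), ← ha _ h1, he]
      · rw [hb _ (h1.trans hr), ← hb _ h1, he]
    · have hr' : D.Rel (State.toP g.state) e e' := (hA.rel_iff hT).2 hr
      rw [hu e' fun hT' => hT (hT'.congr hr'.symm), ← Generator.lab_congr hr', ← hu e hT, he]
  refine ⟨h, ⟨hc, hs, fun e he => ?_⟩, hm, by rw [hs, stateCode_flip]⟩
  have h1 := hu e he
  rw [← hm, has_mask] at h1
  simpa using h1

/-- Targets of an edge map differ only on the components through `c`, each of which contains the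
half-edge `0` or `2`. -/
theorem Adm.eq_iff {h k : D.Generator} (hh : Adm c g h) (hk : Adm c g k) :
    k = h ↔ k.lab (D.edge c 0) = h.lab (D.edge c 0) ∧ k.lab (D.edge c 2) = h.lab (D.edge c 2) := by
  refine ⟨fun e => e ▸ ⟨rfl, rfl⟩, fun ⟨h0, h2⟩ => ?_⟩
  have hs : k.state = h.state := hk.state.trans hh.state.symm
  refine Generator.ext_lab hs fun e => ?_
  by_cases hT : Touches g.state c e
  · have h1 := (agreeOff_flip c g.state).touches_iff.1 hT
    have hk' := hk.state
    have hh' := hh.state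
    rcases h1 with h1 | h1
    · rw [← Generator.lab_congr (g := k) (hk' ▸ h1), ← Generator.lab_congr (g := h) (hh' ▸ h1), h0]
    · rw [← Generator.lab_congr (g := k) (hk' ▸ h1), ← Generator.lab_congr (g := h) (hh' ▸ h1), h2]
  · rw [hk.lab e hT, hh.lab e hT]

variable {R : Type*} [CommRing R]

theorem sum_edgeCoeff_eq [DecidableEq D.Generator] (Ψ : D.Generator → R) {h : D.Generator} {x : ℤ}
    (hx : ∀ k, D.edgeCoeff c g k = if k = h then x else 0) :
    ∑ k, (D.edgeCoeff c g k : R) * Ψ k = x * Ψ h := by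
  rw [Finset.sum_eq_single h]
  · rw [hx, if_pos rfl]
  · intro k _ hk
    rw [hx, if_neg hk, Int.cast_zero, zero_mul]
  · exact fun h => absurd (Finset.mem_univ _) h

/-- The value of a function on the generator with given codes. -/
def onCodes (Φ : ℕ → ℕ → R) (h : D.Generator) : R := Φ (stateCode h.state) h.mask

theorem sum_edgeCoeff_merge (Φ : ℕ → ℕ → R)
    (hc : g.state c = false) (hr : ¬ D.Rel (State.toP g.state) (D.edge c 0) (D.edge c 2))
    (hlt : ∀ a, has m a = true → a < 2 * D.n + 1) (h0 : has m 0 = true) {v : Bool}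
    (hu : ∀ e, ¬ Touches g.state c e → has m e = !g.lab e)
    (ht : ∀ e, Touches g.state c e → has m e = !v)
    (hv : ∀ z, mergeCoeff (g.lab (D.edge c 0)) (g.lab (D.edge c 2)) z = if z = v then 1 else 0) :
    ∑ k, (D.edgeCoeff c g k : R) * onCodes Φ k =
      edgeSign c g.state * Φ (Nat.lor (stateCode g.state) (Nat.pow 2 c)) m := by
  classical
  have hA := agreeOff_flip c g.state
  have hr' := rel_of_not_rel hA (by rw [flip_self, hc]; rfl) hr
  have t0 := ht (D.edge c 0) (Or.inl (Rel.refl _))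
  have t2 := ht (D.edge c 2) (Or.inr (Rel.refl _))
  obtain ⟨h, hh, hm, hs⟩ := exists_adm hc hlt h0 hu
    (fun e he => by rw [t0, ht e (hA.touches_iff.2 (Or.inl he))])
    (fun e he => by rw [t2, ht e (hA.touches_iff.2 (Or.inr he))])
  have l0 : h.lab (D.edge c 0) = v := by rw [← hm, has_mask] at t0; simpa using t0
  have l2 : h.lab (D.edge c 2) = v := by rw [← hm, has_mask] at t2; simpa using t2
  rw [← hm, ← hs]
  refine sum_edgeCoeff_eq (onCodes Φ) fun k => ?_
  by_cases hk : Adm c g k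
  · have e2 : k.lab (D.edge c 2) = k.lab (D.edge c 0) :=
      Generator.lab_congr (by rw [hk.state]; exact hr'.symm)
    rw [edgeCoeff_merge hk hr, hv]
    by_cases h1 : k.lab (D.edge c 0) = v
    · rw [if_pos h1, if_pos ((hh.eq_iff hk).2 ⟨h1.trans l0.symm, by rw [e2, h1, l2]⟩), mul_one]
    · rw [if_neg h1, if_neg fun h2 => h1 (by rw [h2, l0]), mul_zero]
  · rw [edgeCoeff_of_not_adm hk, if_neg]
    rintro rfl
    exact hk hh

theorem sum_edgeCoeff_merge_zero (Ψ : D.Generator → R)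
    (hr : ¬ D.Rel (State.toP g.state) (D.edge c 0) (D.edge c 2))
    (h0 : g.lab (D.edge c 0) = false) (h2 : g.lab (D.edge c 2) = false) :
    ∑ k, (D.edgeCoeff c g k : R) * Ψ k = 0 := by
  refine Finset.sum_eq_zero fun k _ => ?_
  have : D.edgeCoeff c g k = 0 := by
    by_cases hk : Adm c g k
    · rw [edgeCoeff_merge hk hr, h0, h2]
      cases k.lab (D.edge c 0) <;> exact mul_zero _
    · exact edgeCoeff_of_not_adm hk
  rw [this, Int.cast_zero, zero_mul]

/-- A generator in the image of a splitting edge map. -/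
theorem exists_split (hc : g.state c = false)
    (hlt : ∀ a, has m a = true → a < 2 * D.n + 1) (h0 : has m 0 = true) {v w : Bool}
    (hu : ∀ e, ¬ Touches g.state c e → has m e = !g.lab e)
    (ha : ∀ e, D.Rel (State.toP (flip c g.state)) (D.edge c 0) e → has m e = !v)
    (hb : ∀ e, D.Rel (State.toP (flip c g.state)) (D.edge c 2) e → has m e = !w) :
    ∃ h : D.Generator, h.mask = m ∧
      stateCode h.state = Nat.lor (stateCode g.state) (Nat.pow 2 c) ∧
      ∀ k : D.Generator, k = h ↔ Adm c g k ∧ k.lab (D.edge c 0) = v ∧ k.lab (D.edge c 2) = w := by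
  have t0 := ha (D.edge c 0) (Rel.refl _)
  have t2 := hb (D.edge c 2) (Rel.refl _)
  obtain ⟨h, hh, hm, hs⟩ := exists_adm hc hlt h0 hu (fun e he => by rw [t0, ha e he])
    (fun e he => by rw [t2, hb e he])
  have l0 : h.lab (D.edge c 0) = v := by rw [← hm, has_mask] at t0; simpa using t0
  have l2 : h.lab (D.edge c 2) = w := by rw [← hm, has_mask] at t2; simpa using t2
  refine ⟨h, hm, hs, fun k => ⟨?_, fun ⟨hk, h1, h2⟩ => ?_⟩⟩
  · rintro rfl
    exact ⟨hh, l0, l2⟩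
  · exact (hh.eq_iff hk).2 ⟨h1.trans l0.symm, h2.trans l2.symm⟩

theorem edgeCoeff_eq_of_split (hr : D.Rel (State.toP g.state) (D.edge c 0) (D.edge c 2))
    (hr' : ¬ D.Rel (State.toP (flip c g.state)) (D.edge c 0) (D.edge c 2)) (k : D.Generator)
    [Decidable (Adm c g k)] : D.edgeCoeff c g k = edgeSign c g.state * if Adm c g k then
      splitCoeff (g.lab (D.edge c 0)) (k.lab (D.edge c 0)) (k.lab (D.edge c 2)) else 0 := by
  by_cases hk : Adm c g k
  · rw [if_pos hk, edgeCoeff_split hk hr (by rw [hk.state]; exact hr')]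
  · rw [if_neg hk, edgeCoeff_of_not_adm hk, mul_zero]

/-- The image of `1` has two terms: in `m` the new component through the half-edge `0` receives `X`,
in `m'` the one through the half-edge `2`. -/
theorem sum_edgeCoeff_split {m' : ℕ} (Φ : ℕ → ℕ → R) (hc : g.state c = false)
    (hr : D.Rel (State.toP g.state) (D.edge c 0) (D.edge c 2))
    (hr' : ¬ D.Rel (State.toP (flip c g.state)) (D.edge c 0) (D.edge c 2))
    (hg : g.lab (D.edge c 0) = true)
    (hlt : ∀ a, has m a = true → a < 2 * D.n + 1) (h0 : has m 0 = true)
    (hu : ∀ e, ¬ Touches g.state c e → has m e = !g.lab e)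
    (ha : ∀ e, D.Rel (State.toP (flip c g.state)) (D.edge c 0) e → has m e = true)
    (hb : ∀ e, D.Rel (State.toP (flip c g.state)) (D.edge c 2) e → has m e = false)
    (hlt' : ∀ a, has m' a = true → a < 2 * D.n + 1) (h0' : has m' 0 = true)
    (hu' : ∀ e, ¬ Touches g.state c e → has m' e = !g.lab e)
    (ha' : ∀ e, D.Rel (State.toP (flip c g.state)) (D.edge c 0) e → has m' e = false)
    (hb' : ∀ e, D.Rel (State.toP (flip c g.state)) (D.edge c 2) e → has m' e = true) :
    ∑ k, (D.edgeCoeff c g k : R) * onCodes Φ k =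
      edgeSign c g.state * Φ (Nat.lor (stateCode g.state) (Nat.pow 2 c)) m +
      edgeSign c g.state * Φ (Nat.lor (stateCode g.state) (Nat.pow 2 c)) m' := by
  classical
  obtain ⟨h, hm, hs, hh⟩ := exists_split (v := false) (w := true) hc hlt h0 hu ha hb
  obtain ⟨h', hm', hs', hh'⟩ := exists_split (v := true) (w := false) hc hlt' h0' hu' ha' hb'
  have hsum : ∀ k, D.edgeCoeff c g k =
      (if k = h then edgeSign c g.state else 0) + if k = h' then edgeSign c g.state else 0 := by
    intro k
    rw [edgeCoeff_eq_of_split hr hr', hg]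
    simp only [hh, hh']
    by_cases hk : Adm c g k
    · cases k.lab (D.edge c 0) <;> cases k.lab (D.edge c 2) <;> simp [hk, splitCoeff]
    · simp [hk]
  simp only [hsum, Int.cast_add, Int.cast_ite, Int.cast_zero, add_mul, ite_mul, zero_mul,
    Finset.sum_add_distrib, Finset.sum_ite_eq', Finset.mem_univ, if_true, onCodes]
  rw [hm, hs, hm', hs']

theorem sum_edgeCoeff_split_segment (Φ : ℕ → ℕ → R) (hc : g.state c = false)
    (hr : D.Rel (State.toP g.state) (D.edge c 0) (D.edge c 2))
    (hr' : ¬ D.Rel (State.toP (flip c g.state)) (D.edge c 0) (D.edge c 2))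
    (hg : g.lab (D.edge c 0) = false) :
    ∑ k, (D.edgeCoeff c g k : R) * onCodes Φ k =
      edgeSign c g.state * Φ (Nat.lor (stateCode g.state) (Nat.pow 2 c)) g.mask := by
  classical
  have hA := agreeOff_flip c g.state
  have ht : ∀ e, Touches g.state c e → g.lab e = false := by
    rintro e (h | h)
    · rw [← Generator.lab_congr h, hg]
    · rw [← Generator.lab_congr (hr.trans h), hg]
  obtain ⟨h, hm, hs, hh⟩ := exists_split (v := false) (w := false) (m := g.mask) hc
    (fun a ha => by
      by_contra hle
      rw [has_mask_of_le g (not_lt.1 hle)] at ha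
      exact absurd ha (by decide))
    (by rw [show (0 : ℕ) = ((0 : D.Edge) : ℕ) from rfl, has_mask,
      Generator.lab_of_rel_zero (Rel.refl _)]; rfl)
    (fun e _ => has_mask g e)
    (fun e he => by rw [has_mask, ht e (hA.touches_iff.2 (Or.inl he))])
    (fun e he => by rw [has_mask, ht e (hA.touches_iff.2 (Or.inr he))])
  rw [← hs]
  conv_rhs => rw [← hm]
  refine sum_edgeCoeff_eq (onCodes Φ) fun k => ?_
  rw [edgeCoeff_eq_of_split hr hr', hg]
  simp only [hh]
  by_cases hk : Adm c g k
  · cases k.lab (D.edge c 0) <;> cases k.lab (D.edge c 2) <;> simp [hk, splitCoeff]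
  · simp [hk]

theorem sum_edgeCoeff_single (Ψ : D.Generator → R)
    (hr : D.Rel (State.toP g.state) (D.edge c 0) (D.edge c 2))
    (hr' : D.Rel (State.toP (flip c g.state)) (D.edge c 0) (D.edge c 2)) :
    ∑ k, (D.edgeCoeff c g k : R) * Ψ k = 0 := by
  refine Finset.sum_eq_zero fun k _ => ?_
  have : D.edgeCoeff c g k = 0 := by
    by_cases hk : Adm c g k
    · exact edgeCoeff_single hr (by rw [hk.state]; exact hr')
    · exact edgeCoeff_of_not_adm hk
  rw [this, Int.cast_zero, zero_mul]

/-- `imageAt` lists the terms of the edge map. -/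
theorem sum_imageAt {α : Type} (hS : D.IsSpherical) {t : Tree} {L : List ℕ}
    (hL : Represents g.state L)
    (ht : ∀ s : D.State, Represents s (look t (stateCode s)))
    {φ : α → R} {f : Bool → ℕ → ℕ → α} {add : α → α → α} (hadd : ∀ a b, φ (add a b) = φ a + φ b)
    {Φ : ℕ → ℕ → R} (hf : ∀ b S m, φ (f b S m) = (cond b (-1) 1) * Φ S m)
    (hc : g.state c = false) {par : Bool} (hpar : edgeSign c g.state = cond par (-1) 1) (r : α) :
    φ (imageAt t (stateCode g.state) g.mask L f add (D.corners c) (Nat.pow 2 c) par r) =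
      (∑ k, (D.edgeCoeff c g k : R) * onCodes Φ k) + φ r := by
  have hA := agreeOff_flip c g.state
  have hL' : Represents (flip c g.state) (look t (Nat.lor (stateCode g.state) (Nat.pow 2 c))) := by
    rw [← stateCode_flip]; exact ht _
  have hpar' : ((edgeSign c g.state : ℤ) : R) = cond par (-1) 1 := by
    rw [hpar]; cases par <;> simp
  generalize hL'' : look t (Nat.lor (stateCode g.state) (Nat.pow 2 c)) = L' at hL'
  generalize hS' : Nat.lor (stateCode g.state) (Nat.pow 2 c) = S' at *
  have himg : imageAt t (stateCode g.state) g.mask L f add (D.corners c) (Nat.pow 2 c) par r =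
      cond (block L (D.edge c 0) == block L (D.edge c 2))
        (cond (has g.mask (D.edge c 0))
          (cond (block L' (D.edge c 0) == block L' (D.edge c 2)) r (add (f par S' g.mask) r))
          (add (f par S' (Nat.lor g.mask (block L' (D.edge c 0))))
            (add (f par S' (Nat.lor g.mask (block L' (D.edge c 2)))) r)))
        (cond (has g.mask (D.edge c 0)) (cond (has g.mask (D.edge c 2)) r
          (add (f par S' (Nat.lor g.mask (block L (D.edge c 2)))) r))
          (add (f par S' (cond (has g.mask (D.edge c 2))
            (Nat.lor g.mask (block L (D.edge c 0))) g.mask)) r)) := by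
    rw [← hL'', ← beq_eq, ← beq_eq, ← hS']
    rfl
  rw [himg]
  have hmlt : ∀ a, has g.mask a = true → a < 2 * D.n + 1 := fun a ha => by
    by_contra hle
    rw [has_mask_of_le g (not_lt.1 hle)] at ha
    exact absurd ha (by decide)
  have hm0 : has g.mask 0 = true := by
    rw [show (0 : ℕ) = ((0 : D.Edge) : ℕ) from rfl, has_mask,
      Generator.lab_of_rel_zero (Rel.refl _)]
    rfl
  have hblt : ∀ {s : D.State} {L : List ℕ}, Represents s L → ∀ (e : D.Edge) a,
      has (Nat.lor g.mask (block L e)) a = true → a < 2 * D.n + 1 := by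
    intro s L hL e a ha
    rw [has_lor, Bool.or_eq_true] at ha
    exact ha.elim (hmlt a) (hL.isPartition.lt _ (hL.isPartition.block_mem e.isLt).1 a)
  have hb0 : ∀ x, has (Nat.lor g.mask x) 0 = true := fun x => by rw [has_lor, hm0, Bool.true_or]
  have hblk : ∀ {s : D.State} {L : List ℕ}, Represents s L → ∀ e e' : D.Edge,
      ¬ D.Rel (State.toP s) e e' → has (block L e) e' = false := fun hL e e' h => by
    rw [← Bool.not_eq_true, hL.has_block]; exact h
  by_cases hr : D.Rel (State.toP g.state) (D.edge c 0) (D.edge c 2)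
  · rw [beq_iff_eq.2 ((hL.block_eq_block _ _).2 hr), cond_true]
    rw [has_mask]
    rcases h0 : g.lab (D.edge c 0) with _ | _
    · rw [Bool.not_false, cond_true]
      by_cases hr' : D.Rel (State.toP (flip c g.state)) (D.edge c 0) (D.edge c 2)
      · rw [beq_iff_eq.2 ((hL'.block_eq_block _ _).2 hr'), cond_true,
          sum_edgeCoeff_single _ hr hr', zero_add]
      · rw [beq_eq_false_iff_ne.2 (mt (hL'.block_eq_block _ _).1 hr'), cond_false, hadd, hf,
          sum_edgeCoeff_split_segment Φ hc hr hr' h0, hpar', hS']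
    -- A component labelled `1` is not the segment, so on the sphere it is divided. That is why
    -- `imageAt` makes no test in this branch.
    · have hr' : ¬ D.Rel (State.toP (flip c g.state)) (D.edge c 0) (D.edge c 2) :=
        not_rel_of_rel hS hA (by rw [flip_self, hc]; rfl) hr fun h => by
          rw [Generator.lab_of_rel_zero h] at h0; exact absurd h0 (by decide)
      have hT : ∀ e, Touches g.state c e → has g.mask e = false := by
        rintro e (h | h)
        · rw [has_mask, ← Generator.lab_congr h, h0]; rfl
        · rw [has_mask, ← Generator.lab_congr (hr.trans h), h0]; rfl
      have hu : ∀ p (e : D.Edge), ¬ Touches g.state c e → (p = 0 ∨ p = 2) →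
          has (Nat.lor g.mask (block L' (D.edge c p))) e = !g.lab e := by
        intro p e he hp
        have he' := fun h => he (hA.touches_iff.2 h)
        rw [has_lor, has_mask, hblk hL' _ _ (by
          rcases hp with rfl | rfl
          · exact fun h => he' (Or.inl h)
          · exact fun h => he' (Or.inr h)), Bool.or_false]
      rw [Bool.not_true, cond_false, hadd, hadd, hf, hf,
        sum_edgeCoeff_split Φ hc hr hr' h0 (hblt hL' (D.edge c 0)) (hb0 _)
          (fun e he => hu 0 e he (Or.inl rfl))
          (fun e he => by rw [has_lor, (hL'.has_block _ _).2 he, Bool.or_true])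
          (fun e he => by
            rw [has_lor, hT e (hA.touches_iff.2 (Or.inr he)), Bool.false_or]
            exact hblk hL' _ _ fun h => hr' (h.trans he.symm))
          (hblt hL' (D.edge c 2)) (hb0 _)
          (fun e he => hu 2 e he (Or.inr rfl))
          (fun e he => by
            rw [has_lor, hT e (hA.touches_iff.2 (Or.inl he)), Bool.false_or]
            exact hblk hL' _ _ fun h => hr' (he.trans h.symm))
          (fun e he => by rw [has_lor, (hL'.has_block _ _).2 he, Bool.or_true]),
        hpar', hS', add_assoc]
  · rw [beq_eq_false_iff_ne.2 (mt (hL.block_eq_block _ _).1 hr), cond_false, has_mask, has_mask]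
    have hlab0 : ∀ {e}, D.Rel (State.toP g.state) (D.edge c 0) e →
        has g.mask e = !g.lab (D.edge c 0) := fun h => by rw [has_mask, ← Generator.lab_congr h]
    have hlab2 : ∀ {e}, D.Rel (State.toP g.state) (D.edge c 2) e →
        has g.mask e = !g.lab (D.edge c 2) := fun h => by rw [has_mask, ← Generator.lab_congr h]
    rcases h0 : g.lab (D.edge c 0) with _ | _ <;> rcases h2 : g.lab (D.edge c 2) with _ | _ <;>
      simp only [Bool.not_false, Bool.not_true, cond_true, cond_false]
    · rw [sum_edgeCoeff_merge_zero _ hr h0 h2, zero_add]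
    · rw [hadd, hf, sum_edgeCoeff_merge (v := false) Φ hc hr (hblt hL (D.edge c 2)) (hb0 _)
        (fun e he => by
          rw [has_lor, has_mask, hblk hL _ _ fun h => he (Or.inr h), Bool.or_false])
        (by
          rintro e (h | h)
          · rw [has_lor, hlab0 h, h0]; rfl
          · rw [has_lor, (hL.has_block _ _).2 h, Bool.or_true]; rfl)
        (by rw [h0, h2]; decide), hpar', hS']
    · rw [hadd, hf, sum_edgeCoeff_merge (v := false) Φ hc hr (hblt hL (D.edge c 0)) (hb0 _)
        (fun e he => by
          rw [has_lor, has_mask, hblk hL _ _ fun h => he (Or.inl h), Bool.or_false])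
        (by
          rintro e (h | h)
          · rw [has_lor, (hL.has_block _ _).2 h, Bool.or_true]; rfl
          · rw [has_lor, hlab2 h, h2]; rfl)
        (by rw [h0, h2]; decide), hpar', hS']
    · rw [hadd, hf, sum_edgeCoeff_merge (v := true) Φ hc hr hmlt hm0
        (fun e _ => has_mask g e)
        (by
          rintro e (h | h)
          · rw [hlab0 h, h0]
          · rw [hlab2 h, h2])
        (by rw [h0, h2]; decide), hpar', hS']

end KnotoidCode

/-! ### Summing the edge maps over all crossings -/

namespace KnotoidCode

open BitMask

variable {D : KnotoidCode} {g : D.Generator} {R : Type*} [CommRing R]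

/-- The list runs over the crossings from `k` on, and `par` is the parity of the `1`-smoothings
before `k`, which is the exterior sign. Leaving `α`, `f` and `add` open lets one traversal serve for
hashes, for lists of terms and for integers. -/
theorem sum_image_aux {α : Type} (hS : D.IsSpherical) {t : Tree} {L : List ℕ}
    (hL : Represents g.state L)
    (ht : ∀ s : D.State, Represents s (look t (stateCode s)))
    {φ : α → R} {f : Bool → ℕ → ℕ → α} {add : α → α → α} {z : α}
    (hadd : ∀ a b, φ (add a b) = φ a + φ b) (hz : φ z = 0)
    {Φ : ℕ → ℕ → R} (hf : ∀ b S m, φ (f b S m) = (cond b (-1) 1) * Φ S m)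
    (cs : List (Fin D.n)) (k : ℕ) (par : Bool) (hcs : cs.map Fin.val = List.range' k cs.length)
    (hpar : (-1 : ℤ) ^ (Finset.univ.filter fun c' : Fin D.n =>
      c'.val < k ∧ g.state c' = true).card = cond par (-1) 1) :
    φ (image (cs.map D.corners) t (stateCode g.state) g.mask L f add z (Nat.pow 2 k) par) =
      (cs.map fun c => ∑ h, (D.edgeCoeff c g h : R) * onCodes Φ h).sum := by
  induction cs generalizing k par with
  | nil => exact hz
  | cons c cs ih =>
    obtain ⟨hck, hcs'⟩ := List.cons.inj hcs
    subst hck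
    have hstep : image ((c :: cs).map D.corners) t (stateCode g.state) g.mask L f add z
        (Nat.pow 2 c) par = cond (Nat.beq (Nat.land (stateCode g.state) (Nat.pow 2 c)) 0)
        (imageAt t (stateCode g.state) g.mask L f add (D.corners c) (Nat.pow 2 c) par
          (image (cs.map D.corners) t (stateCode g.state) g.mask L f add z
            (Nat.mul 2 (Nat.pow 2 c)) par))
        (image (cs.map D.corners) t (stateCode g.state) g.mask L f add z
          (Nat.mul 2 (Nat.pow 2 c)) (not par)) := rfl
    have hpow : Nat.mul 2 (Nat.pow 2 c) = Nat.pow 2 (c.val + 1) := (Nat.pow_succ'.symm :)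
    -- The mask meets the single bit `2 ^ c` in zero exactly when `c` is `0`-smoothed.
    have hbit : Nat.beq (Nat.land (stateCode g.state) (Nat.pow 2 c)) 0 = !g.state c := by
      have h1 : stateCode g.state &&& 2 ^ c.val = (g.state c).toNat * 2 ^ c.val := by
        rw [Nat.and_two_pow, ← has_eq, has_stateCode]
      have h2 : Nat.land (stateCode g.state) (Nat.pow 2 c) = (g.state c).toNat * 2 ^ c.val := h1
      rw [h2, beq_eq]
      cases g.state c <;> simp
    have hfilter : ∀ b, g.state c = b → (Finset.univ.filter fun c' : Fin D.n =>
        c'.val < c.val + 1 ∧ g.state c' = true).card = (Finset.univ.filter fun c' : Fin D.n =>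
        c'.val < c.val ∧ g.state c' = true).card + b.toNat := by
      intro b hb
      cases b
      · rw [Bool.toNat_false, add_zero]
        congr 1
        refine Finset.filter_congr fun x _ => ⟨fun ⟨h1, h2⟩ => ⟨?_, h2⟩, fun ⟨h1, h2⟩ => ⟨by omega, h2⟩⟩
        rcases Nat.lt_succ_iff_lt_or_eq.1 h1 with h | h
        · exact h
        · rw [Fin.ext h, hb] at h2
          exact absurd h2 (by decide)
      · rw [Bool.toNat_true, ← Finset.card_insert_of_notMem (a := c) (by simp)]
        congr 1
        ext x
        simp only [Finset.mem_filter, Finset.mem_univ, true_and, Finset.mem_insert]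
        constructor
        · rintro ⟨h1, h2⟩
          rcases Nat.lt_succ_iff_lt_or_eq.1 h1 with h | h
          · exact Or.inr ⟨h, h2⟩
          · exact Or.inl (Fin.ext h)
        · rintro (rfl | ⟨h1, h2⟩)
          · exact ⟨Nat.lt_succ_self _, hb⟩
          · exact ⟨by omega, h2⟩
    rw [hstep, hbit, hpow, List.map_cons, List.sum_cons]
    rcases hc : g.state c with _ | _
    · rw [Bool.not_false, cond_true, sum_imageAt hS hL ht hadd hf hc hpar, ih _ _ hcs']
      rw [hfilter false hc, Bool.toNat_false, add_zero, hpar]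
    · rw [Bool.not_true, cond_false, ih _ _ hcs' (by
        rw [hfilter true hc, Bool.toNat_true, pow_succ, hpar]; cases par <;> rfl)]
      rw [Finset.sum_eq_zero, zero_add]
      intro k _
      rw [edgeCoeff_of_not_adm, Int.cast_zero, zero_mul]
      intro hA
      rw [hA.zero] at hc
      exact absurd hc (by decide)

/-- The list of the crossings, each given by the edges at its half-edges. -/
def crossings (D : KnotoidCode) : List (ℕ × ℕ × ℕ × ℕ) := (List.finRange D.n).map D.corners

/-- The partitions of the set of edges into the components of the states. -/
noncomputable def tree (D : KnotoidCode) : Tree := stateTree D.crossings D.n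

theorem represents_tree (s : D.State) : Represents s (look D.tree (stateCode s)) := by
  have := represents_look D (stateCode s)
  rwa [stateOf_stateCode] at this

/-- `image` lists the terms of the differential. -/
theorem sum_image {α : Type} (hS : D.IsSpherical) (g : D.Generator)
    {φ : α → R} {f : Bool → ℕ → ℕ → α} {add : α → α → α} {z : α}
    (hadd : ∀ a b, φ (add a b) = φ a + φ b) (hz : φ z = 0)
    {Φ : ℕ → ℕ → R} (hf : ∀ b S m, φ (f b S m) = (cond b (-1) 1) * Φ S m) :
    φ (image D.crossings D.tree (stateCode g.state) g.mask
      (look D.tree (stateCode g.state)) f add z 1 false) =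
      ∑ h, (totalCoeff g h : R) * onCodes Φ h := by
  have h := sum_image_aux hS (represents_tree g.state) represents_tree hadd hz hf
    (List.finRange D.n) 0 false (by simp [List.range_eq_range']) (by simp)
  refine h.trans ?_
  simp only [totalCoeff, Int.cast_sum, Finset.sum_mul]
  rw [Finset.sum_comm, ← List.ofFn_eq_map, List.sum_ofFn]

end KnotoidCode

/-! ### Ranks modulo two -/

namespace BitMask

/-- Computes `f w`, after the kernel has evaluated `w`. -/
noncomputable def force {α : Type} (w : ℕ) (f : ℕ → α) : α :=
  Nat.rec (f 0) (fun k _ => f (Nat.succ k)) w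

theorem force_eq {α : Type} (w : ℕ) (f : ℕ → α) : force w f = f w := by cases w <;> rfl

/-- Reduces a vector by a list of pairs of a pivot and a vector. -/
noncomputable def reduce (P : List (ℕ × ℕ)) (v : ℕ) : ℕ :=
  List.rec v (fun p _ r => force r fun r => cond (has r p.1) (Nat.xor r p.2) r) P

/-- The position of a bit of `w`, in general the lowest one from position `64` on. -/
noncomputable def pivot (w : ℕ) : ℕ :=
  List.rec (fun _ p => p) (fun b _ ih x p => force x fun x =>
    cond (Nat.beq (Nat.mod x (Nat.pow 2 b)) 0) (ih (Nat.shiftRight x b) (Nat.add p b)) (ih x p))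
    [1024, 512, 256, 128, 64, 32, 16, 8, 4, 2, 1] (Nat.shiftRight w 64) 64

/-- A lower bound of the rank of a list of vectors. -/
noncomputable def rank (l : List ℕ) : List (ℕ × ℕ) → ℕ :=
  List.rec (fun P => P.length) (fun v _ ih P => force (reduce P v) fun w => force (pivot w) fun k =>
    cond (has w k) (ih ((k, w) :: P)) (ih P)) l

/-- The vector over `ℤ/2` of the bits of a number. -/
def toVec (w : ℕ) (k : ℕ) : ZMod 2 := cond (has w k) 1 0

theorem toVec_zero : toVec 0 = 0 := funext fun k => by rw [toVec, has_zero]; rfl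

theorem has_xor (v w k : ℕ) : has (Nat.xor v w) k = Bool.xor (has v k) (has w k) := by
  simp only [has_eq]; exact Nat.testBit_xor ..

theorem toVec_xor (v w : ℕ) : toVec (Nat.xor v w) = toVec v + toVec w := by
  funext k
  simp only [toVec, has_xor, Pi.add_apply]
  cases has v k <;> cases has w k <;> rfl

/-- Each vector has its pivot, and no pivot of the following ones. -/
def IsEchelon : List (ℕ × ℕ) → Prop
  | [] => True
  | p :: P => has p.2 p.1 = true ∧ (∀ p' ∈ P, has p.2 p'.1 = false) ∧ IsEchelon P

theorem reduce_cons (p : ℕ × ℕ) (P : List (ℕ × ℕ)) (v : ℕ) : reduce (p :: P) v =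
    cond (has (reduce P v) p.1) (Nat.xor (reduce P v) p.2) (reduce P v) := by
  have : reduce (p :: P) v =
    force (reduce P v) fun r => cond (has r p.1) (Nat.xor r p.2) r := rfl
  rw [this, force_eq]

theorem has_reduce {P : List (ℕ × ℕ)} (hP : IsEchelon P) (v : ℕ) :
    ∀ p ∈ P, has (reduce P v) p.1 = false := by
  induction P with
  | nil => exact fun p hp => absurd hp List.not_mem_nil
  | cons q P ih =>
    obtain ⟨h1, h2, h3⟩ := hP
    intro p hp
    rw [reduce_cons]
    rcases hr : has (reduce P v) q.1 with _ | _
    · rw [cond_false]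
      rcases List.mem_cons.1 hp with rfl | hp
      · exact hr
      · exact ih h3 p hp
    · rw [cond_true, has_xor]
      rcases List.mem_cons.1 hp with rfl | hp
      · rw [hr, h1]; rfl
      · rw [ih h3 p hp, h2 p hp]; rfl

theorem toVec_reduce_mem {W : Submodule (ZMod 2) (ℕ → ZMod 2)} {P : List (ℕ × ℕ)}
    (hP : ∀ p ∈ P, toVec p.2 ∈ W) {v : ℕ} (hv : toVec v ∈ W) : toVec (reduce P v) ∈ W := by
  induction P with
  | nil => exact hv
  | cons q P ih =>
    have h := ih fun p hp => hP p (List.mem_cons_of_mem _ hp)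
    rw [reduce_cons]
    cases has (reduce P v) q.1
    · exact h
    · rw [cond_true, toVec_xor]
      exact W.add_mem h (hP q List.mem_cons_self)

/-- The span of the vectors of a list. -/
def spanOf (P : List (ℕ × ℕ)) : Submodule (ZMod 2) (ℕ → ZMod 2) :=
  Submodule.span _ {x | ∃ p ∈ P, toVec p.2 = x}

theorem spanOf_cons (p : ℕ × ℕ) (P : List (ℕ × ℕ)) :
    spanOf (p :: P) = Submodule.span _ {toVec p.2} ⊔ spanOf P := by
  rw [spanOf, spanOf, ← Submodule.span_union]
  congr 1
  ext x
  simp [eq_comm]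

instance (P : List (ℕ × ℕ)) : FiniteDimensional (ZMod 2) (spanOf P) := by
  refine FiniteDimensional.span_of_finite _ (Set.Finite.subset
    (((P.map fun p => toVec p.2).finite_toSet)) ?_)
  rintro x ⟨p, hp, rfl⟩
  exact List.mem_map.2 ⟨p, hp, rfl⟩

/-- The head of the list has no bit at the pivots of the tail. So the tail part of a combination
vanishes by induction, and then the pivot of the head kills its coefficient. -/
theorem eq_zero_of_mem_spanOf {P : List (ℕ × ℕ)} (hP : IsEchelon P) {x : ℕ → ZMod 2}
    (hx : x ∈ spanOf P) (h : ∀ p ∈ P, x p.1 = 0) : x = 0 := by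
  induction P generalizing x with
  | nil =>
    have : spanOf [] = ⊥ := by
      rw [spanOf, Submodule.span_eq_bot]
      rintro x ⟨p, hp, -⟩
      exact absurd hp List.not_mem_nil
    rw [this] at hx
    exact hx
  | cons q P ih =>
    obtain ⟨h1, h2, h3⟩ := hP
    rw [spanOf_cons, Submodule.mem_sup] at hx
    obtain ⟨y, hy, z, hz, rfl⟩ := hx
    obtain ⟨a, rfl⟩ := Submodule.mem_span_singleton.1 hy
    have hz0 : z = 0 := ih h3 hz fun p hp => by
      have := h p (List.mem_cons_of_mem _ hp)
      simpa [toVec, h2 p hp] using this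
    have := h q List.mem_cons_self
    rw [hz0, add_zero, Pi.smul_apply, toVec, h1, cond_true, smul_eq_mul, mul_one] at this
    rw [hz0, this, zero_smul, zero_add]

theorem length_le_finrank_spanOf {P : List (ℕ × ℕ)} (hP : IsEchelon P) :
    P.length ≤ Module.finrank (ZMod 2) (spanOf P) := by
  induction P with
  | nil => exact Nat.zero_le _
  | cons q P ih =>
    obtain ⟨h1, h2, h3⟩ := hP
    refine (Nat.succ_le_succ (ih h3)).trans (Submodule.finrank_lt_finrank_of_lt ?_)
    have hle : spanOf P ≤ spanOf (q :: P) := by rw [spanOf_cons]; exact le_sup_right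
    refine lt_of_le_of_ne hle fun he => ?_
    have hq : toVec q.2 ∈ spanOf P := by
      rw [he]; exact Submodule.subset_span ⟨q, List.mem_cons_self, rfl⟩
    have := congrFun (eq_zero_of_mem_spanOf h3 hq fun p hp => by rw [toVec, h2 p hp]; rfl) q.1
    rw [toVec, h1] at this
    exact one_ne_zero this

/-- `P` stays an echelon family inside `W`. A vector enters only after a test that its bit at the
proposed pivot is set, so nothing depends on how `pivot` works; a rejected vector can only lower the
result. -/
theorem rank_le_finrank {W : Submodule (ZMod 2) (ℕ → ZMod 2)} [FiniteDimensional (ZMod 2) W]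
    {l : List ℕ} (hl : ∀ v ∈ l, toVec v ∈ W) {P : List (ℕ × ℕ)} (hP : IsEchelon P)
    (hPW : ∀ p ∈ P, toVec p.2 ∈ W) : rank l P ≤ Module.finrank (ZMod 2) W := by
  induction l generalizing P with
  | nil =>
    refine (length_le_finrank_spanOf hP).trans (Submodule.finrank_mono (Submodule.span_le.2 ?_))
    rintro x ⟨p, hp, rfl⟩
    exact hPW p hp
  | cons v l ih =>
    have h : rank (v :: l) P = force (reduce P v) fun w => force (pivot w) fun k =>
      cond (has w k) (rank l ((k, w) :: P)) (rank l P) := rfl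
    rw [h, force_eq, force_eq]
    have hl' := fun v hv => hl v (List.mem_cons_of_mem _ hv)
    rcases hk : has (reduce P v) (pivot (reduce P v)) with _ | _
    · exact ih hl' hP hPW
    · refine ih hl' ⟨hk, has_reduce hP v, hP⟩ fun p hp => ?_
      rcases List.mem_cons.1 hp with rfl | hp
      · exact toVec_reduce_mem hPW (hl v List.mem_cons_self)
      · exact hPW p hp

end BitMask

/-! ### From ranks modulo two to rational nullities -/

namespace KnotoidCode

open BitMask

variable {D : KnotoidCode}

/-- The number of cycles is bounded by the rank modulo two of an image of the differential. -/
theorem nullity_add_finrank_le {K : Type*} (Q : D.Generator → Prop) (F : K → D.Generator → ZMod 2) :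
    nullity Q + Module.finrank (ZMod 2) (Submodule.span (ZMod 2)
      (Set.range fun (g : {g : D.Generator // Q g}) (k : K) =>
        ∑ h, (totalCoeff g.1 h : ZMod 2) * F k h)) ≤ Nat.card {g : D.Generator // Q g} := by
  classical
  -- Selects generators whose images form a basis of the span modulo `2`.
  obtain ⟨κ, a, ha, hspan, hind⟩ := exists_linearIndependent' (ZMod 2)
    fun (g : {g : D.Generator // Q g}) (k : K) => ∑ h, (totalCoeff g.1 h : ZMod 2) * F k h
  have : Finite κ := Finite.of_injective a ha
  have : Fintype κ := Fintype.ofFinite κ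
  rw [← hspan, finrank_span_eq_card hind]
  -- an integral cycle supported on the independent columns vanishes
  have hz : ∀ (N : ℕ) (w : κ → ℤ), (∑ x, |w x| ≤ N) →
      (∀ h, ∑ x, totalCoeff (a x).1 h * w x = 0) → w = 0 := by
    intro N
    induction N using Nat.strong_induction_on with
    | _ N ih =>
      intro w hN hw
      -- Reduced modulo `2` and paired with `F`, the cycle equation becomes a linear relation
      -- between the independent images, so all coefficients of the cycle are even.
      have h1 : ∀ x, (w x : ZMod 2) = 0 := by
        refine Fintype.linearIndependent_iff.1 hind (fun x => (w x : ZMod 2)) ?_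
        funext k
        simp only [Finset.sum_apply, Pi.smul_apply, Function.comp_apply, smul_eq_mul, Pi.zero_apply,
          Finset.mul_sum]
        rw [Finset.sum_comm]
        refine Finset.sum_eq_zero fun h _ => ?_
        have h2 := congrArg (fun z : ℤ => (z : ZMod 2) * F k h) (hw h)
        simp only [Int.cast_sum, Int.cast_mul, Int.cast_zero, zero_mul, Finset.sum_mul] at h2
        rw [← h2]
        exact Finset.sum_congr rfl fun x _ => by ring
      choose w' hw' using fun x => (ZMod.intCast_zmod_eq_zero_iff_dvd (w x) 2).1 (h1 x)
      have hw'' : w = fun x => 2 * w' x := funext fun x => by rw [hw']; rfl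
      by_contra hne
      have hw'0 : w' ≠ 0 := fun h => hne (by rw [hw'', h]; simp; rfl)
      have hpos : 0 < ∑ x, |w' x| := by
        refine lt_of_le_of_ne (Finset.sum_nonneg fun x _ => abs_nonneg _) fun h => hw'0 ?_
        funext x
        exact abs_eq_zero.1 ((Finset.sum_eq_zero_iff_of_nonneg fun x _ => abs_nonneg _).1 h.symm x
          (Finset.mem_univ x))
      have hdouble : ∑ x, |w x| = 2 * ∑ x, |w' x| := by
        rw [hw'', Finset.mul_sum]
        exact Finset.sum_congr rfl fun x _ => by rw [abs_mul]; rfl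
      -- Half of a nonzero integral cycle is again one, with a smaller sum of absolute values:
      -- infinite descent.
      refine hw'0 (ih (∑ x, |w' x|).toNat ?_ w' ?_ fun h => ?_)
      · omega
      · omega
      · have h3 := hw h
        rw [hw''] at h3
        have h4 : ∑ x, totalCoeff (a x).1 h * (2 * w' x) =
            2 * ∑ x, totalCoeff (a x).1 h * w' x := by
          rw [Finset.mul_sum]
          exact Finset.sum_congr rfl fun x _ => by ring
        rw [h4] at h3
        exact (mul_eq_zero.1 h3).resolve_left two_ne_zero
  -- hence a cycle is determined by its values off these columns
  let J : Type := {g : {g : D.Generator // Q g} // g ∉ Set.range a}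
  let res : cycles Q →ₗ[ℚ] (J → ℚ) :=
    { toFun := fun v j => v.1 j.1.1
      map_add' := fun _ _ => rfl
      map_smul' := fun _ _ => rfl }
  have hinj : Function.Injective res := by
    rw [← LinearMap.ker_eq_bot, LinearMap.ker_eq_bot']
    intro v hv
    obtain ⟨hv1, hv2⟩ := mem_cycles.1 v.2
    have hv3 : ∀ g, (∀ x, (a x).1 ≠ g) → v.1 g = 0 := by
      intro g hg
      by_cases hQ : Q g
      · exact congrFun hv (⟨⟨g, hQ⟩, fun ⟨x, hx⟩ => hg x (congrArg Subtype.val hx)⟩ : J)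
      · exact hv1 g hQ
    have hsum : ∀ h, ∑ x, (totalCoeff (a x).1 h : ℚ) * v.1 (a x).1 = 0 := by
      intro h
      rw [← hv2 h]
      have hinj' : Function.Injective fun x => (a x).1 := Subtype.val_injective.comp ha
      refine (Finset.sum_map Finset.univ ⟨_, hinj'⟩
        fun g => (totalCoeff g h : ℚ) * v.1 g).symm.trans ?_
      refine Finset.sum_subset (Finset.subset_univ _) fun g _ hg => ?_
      rw [hv3 g fun x hx => hg (Finset.mem_map.2 ⟨x, Finset.mem_univ _, hx⟩), mul_zero]
    -- A common denominator turns the rational cycle into an integral one.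
    obtain ⟨b, hb⟩ := IsLocalization.exist_integer_multiples_of_finite (nonZeroDivisors ℤ)
      fun x => v.1 (a x).1
    choose w hw using hb
    have hw0 : w = 0 := by
      refine hz (∑ x, |w x|).toNat w ?_ fun h => ?_
      · rw [Int.toNat_of_nonneg (Finset.sum_nonneg fun x _ => abs_nonneg _)]
      · have h1 : ((∑ x, totalCoeff (a x).1 h * w x : ℤ) : ℚ) = 0 := by
          rw [Int.cast_sum, ← mul_zero ((b : ℤ) : ℚ), ← hsum h, Finset.mul_sum]
          refine Finset.sum_congr rfl fun x _ => ?_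
          have h2 : (w x : ℚ) = ((b : ℤ) : ℚ) * v.1 (a x).1 := by
            rw [← zsmul_eq_mul]; exact hw x
          rw [Int.cast_mul, h2]
          ring
        exact_mod_cast h1
    ext g
    by_cases hg : ∃ x, (a x).1 = g
    · obtain ⟨x, rfl⟩ := hg
      have h2 := hw x
      rw [hw0] at h2
      have h3 : ((b : ℤ) : ℚ) * v.1 (a x).1 = 0 := by
        rw [← zsmul_eq_mul]; exact h2.symm.trans (by simp)
      have hb0 : ((b : ℤ) : ℚ) ≠ 0 := by exact_mod_cast nonZeroDivisors.ne_zero b.2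
      exact (mul_eq_zero.1 h3).resolve_left hb0
    · exact hv3 g fun x hx => hg ⟨x, hx⟩
  have h1 : nullity Q ≤ Nat.card J := by
    have := LinearMap.finrank_le_finrank_of_injective hinj
    rw [Module.finrank_pi] at this
    rw [Nat.card_eq_fintype_card]
    exact this
  have h2 : Nat.card J + Nat.card κ = Nat.card {g : D.Generator // Q g} := by
    rw [Nat.card_congr (Equiv.ofInjective a ha), ← Nat.card_sum]
    exact Nat.card_congr ((Equiv.sumComm _ _).trans (Equiv.Set.sumCompl (Set.range a)))
  rw [← Nat.card_eq_fintype_card]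
  omega

end KnotoidCode

/-! ### Enumeration of the generators -/

namespace BitMask

/-- The unions of `m` with some masks of a list, and the number `x` of them, added to the given
one. -/
noncomputable def unions (L : List ℕ) : ℕ → ℕ → List (ℕ × ℕ) :=
  List.rec (fun m x => [(m, x)])
    (fun a _ ih m x => ih m x ++ ih (Nat.lor m a) (Nat.add x 1)) L

/-- The masks of the subsets of `{0, …, n - 1}` with `o` elements. -/
noncomputable def subsets (n : ℕ) : ℕ → List ℕ :=
  Nat.rec (fun o => cond (Nat.beq o 0) [0] [])
    (fun _ ih o => (ih o).map (Nat.mul 2) ++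
      cond (Nat.beq o 0) [] ((ih (Nat.sub o 1)).map fun S => Nat.add (Nat.mul 2 S) 1)) n

/-- The masks that do not contain `0`. -/
def closedBlocks (L : List ℕ) : List ℕ := L.filter fun m => !has m 0

theorem mem_unions {L : List ℕ} {m x : ℕ} {p : ℕ × ℕ} : p ∈ unions L m x ↔
    ∃ l : List ℕ, l.Sublist L ∧ p = (l.foldl Nat.lor m, x + l.length) := by
  induction L generalizing m x with
  | nil =>
    have h : unions [] m x = [(m, x)] := rfl
    rw [h, List.mem_singleton]
    constructor
    · rintro rfl
      exact ⟨[], List.Sublist.refl _, rfl⟩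
    · rintro ⟨l, hl, rfl⟩
      rw [List.sublist_nil.1 hl]
      rfl
  | cons a L ih =>
    have h : unions (a :: L) m x = unions L m x ++ unions L (Nat.lor m a) (x + 1) := rfl
    rw [h, List.mem_append, ih, ih]
    constructor
    · rintro (⟨l, hl, rfl⟩ | ⟨l, hl, rfl⟩)
      · exact ⟨l, hl.cons a, rfl⟩
      · exact ⟨a :: l, hl.cons_cons a, by rw [List.foldl_cons, List.length_cons, add_assoc, add_comm 1]⟩
    · rintro ⟨l, hl, rfl⟩
      rcases List.sublist_cons_iff.1 hl with h1 | ⟨r, rfl, h1⟩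
      · exact Or.inl ⟨l, h1, rfl⟩
      · exact Or.inr ⟨r, h1, by rw [List.foldl_cons, List.length_cons, add_assoc, add_comm 1]⟩

theorem has_foldl_lor {l : List ℕ} {m a : ℕ} :
    has (l.foldl Nat.lor m) a = true ↔ has m a = true ∨ ∃ x ∈ l, has x a = true := by
  induction l generalizing m with
  | nil => simp
  | cons b l ih =>
    rw [List.foldl_cons, ih, has_lor, Bool.or_eq_true]
    simp only [List.mem_cons, exists_eq_or_imp]
    tauto

theorem mem_subsets {n o S : ℕ} : S ∈ subsets n o ↔ ∃ s : Fin n → Bool, S = Nat.ofBits s ∧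
    (Finset.univ.filter fun i => s i = true).card = o := by
  induction n generalizing o S with
  | zero =>
    have h : subsets 0 o = cond (o == 0) [0] [] := by rw [← beq_eq]; rfl
    rw [h]
    constructor
    · intro hS
      by_cases ho : o = 0
      · subst ho
        have : S = 0 := by simpa using hS
        exact ⟨fun i => i.elim0, by rw [this, Nat.ofBits_zero], by simp⟩
      · rw [beq_eq_false_iff_ne.2 ho] at hS
        exact absurd hS List.not_mem_nil
    · rintro ⟨s, rfl, rfl⟩
      simp
  | succ n ih =>
    have h : subsets (n + 1) o = (subsets n o).map (Nat.mul 2) ++ cond (o == 0) []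
        ((subsets n (o - 1)).map fun S => Nat.add (Nat.mul 2 S) 1) := by rw [← beq_eq]; rfl
    have hcard : ∀ s : Fin (n + 1) → Bool, (Finset.univ.filter fun i => s i = true).card =
        (s 0).toNat + (Finset.univ.filter fun i : Fin n => (s ∘ Fin.succ) i = true).card := by
      intro s
      simp only [Finset.card_filter, Fin.sum_univ_succ, Function.comp_apply]
      cases s 0 <;> rfl
    rw [h, List.mem_append, List.mem_map]
    constructor
    · rintro (⟨S', hS', rfl⟩ | hS)
      · obtain ⟨s, rfl, rfl⟩ := ih.1 hS'
        refine ⟨Fin.cons false s, ?_, ?_⟩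
        · rw [Nat.ofBits_succ]; rfl
        · rw [hcard, Fin.cons_zero, Bool.toNat_false, zero_add]; rfl
      · by_cases ho : o = 0
        · subst ho
          exact absurd hS List.not_mem_nil
        · rw [beq_eq_false_iff_ne.2 ho, cond_false, List.mem_map] at hS
          obtain ⟨S', hS', rfl⟩ := hS
          obtain ⟨s, rfl, hs⟩ := ih.1 hS'
          refine ⟨Fin.cons true s, ?_, ?_⟩
          · rw [Nat.ofBits_succ]; rfl
          · rw [hcard, Fin.cons_zero, Bool.toNat_true]
            change 1 + (Finset.univ.filter fun i => s i = true).card = o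
            omega
    · rintro ⟨s, rfl, rfl⟩
      rcases h0 : s 0 with _ | _
      · refine Or.inl ⟨Nat.ofBits (s ∘ Fin.succ), ?_, ?_⟩
        · rw [hcard, h0, Bool.toNat_false, zero_add]
          exact ih.2 ⟨s ∘ Fin.succ, rfl, rfl⟩
        · rw [Nat.ofBits_succ, h0]; rfl
      · refine Or.inr ?_
        rw [hcard, h0, Bool.toNat_true, beq_eq_false_iff_ne.2 (by omega), cond_false, List.mem_map,
          Nat.add_sub_cancel_left]
        exact ⟨_, ih.2 ⟨s ∘ Fin.succ, rfl, rfl⟩, by rw [Nat.ofBits_succ, h0]; rfl⟩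

end BitMask

namespace KnotoidCode

open BitMask

variable {D : KnotoidCode} {s : D.State} {L : List ℕ}

theorem mem_subsets_iff {o S : ℕ} :
    S ∈ subsets D.n o ↔ ∃ s : D.State, stateCode s = S ∧ D.ones s = o := by
  rw [mem_subsets]
  exact exists_congr fun s => and_congr_left fun _ => eq_comm

theorem Represents.sum_eq (hL : Represents s L) (F : ℕ → ℤ) :
    ∑ x : D.Component s, F (block L x.out) = ∑ m ∈ L.toFinset, F m := by
  have hinj : Function.Injective fun x : D.Component s => block L x.out := fun x y h => by
    rw [← comp_out x, ← comp_out y, D.comp_eq_comp_iff]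
    exact (hL.block_eq_block _ _).1 h
  rw [← Finset.sum_image (f := F) fun x _ y _ h => hinj h]
  congr 1
  ext m
  simp only [Finset.mem_image, Finset.mem_univ, true_and, List.mem_toFinset]
  constructor
  · rintro ⟨x, rfl⟩
    exact (hL.isPartition.block_mem x.out.isLt).1
  · intro hm
    obtain ⟨a, ha⟩ := hL.isPartition.nonempty m hm
    have hlt := hL.isPartition.lt m hm a ha
    refine ⟨D.comp s ⟨a, hlt⟩, ?_⟩
    rw [← hL.isPartition.block_eq hm ha]
    refine (hL.block_eq_block _ ⟨a, hlt⟩).2 ?_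
    rw [← D.comp_eq_comp_iff, comp_out]

theorem Represents.numComp_eq (hL : Represents s L) : D.numComp s = L.length := by
  have h := hL.sum_eq fun _ => 1
  rw [Finset.sum_const, Finset.sum_const, List.toFinset_card_of_nodup hL.isPartition.nodup] at h
  simp only [Finset.card_univ, nsmul_eq_mul, mul_one, Nat.cast_inj] at h
  rw [numComp, Nat.card_eq_fintype_card, h]

theorem numComp_le (s : D.State) : D.numComp s ≤ 2 * D.n + 1 := by
  have h := Nat.card_le_card_of_surjective (D.comp s) (fun x => ⟨x.out, comp_out x⟩)
  rwa [Nat.card_fin] at h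

/-- The degree of a generator with a given list of components labelled by `X`. -/
theorem deg_eq_of_mask (hL : Represents s L) {g : D.Generator} (hg : g.state = s) {l : List ℕ}
    (hl : ∀ m ∈ l, m ∈ L) (hn : l.Nodup)
    (hm : ∀ a, has g.mask a = true ↔ ∃ m ∈ l, has m a = true) :
    g.deg = L.length - 2 * l.length := by
  subst hg
  have h1 : ∀ x : D.Component g.state,
      weight (g.label x) = if block L x.out ∈ l then -1 else 1 := by
    intro x
    have h2 := has_mask g x.out
    have h3 : g.lab x.out = g.label x := congrArg g.label (comp_out x)
    have h4 : has g.mask x.out = true ↔ block L x.out ∈ l := by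
      rw [hm]
      constructor
      · rintro ⟨m, hml, ha⟩
        rwa [hL.isPartition.block_eq (hl m hml) ha]
      · exact fun h => ⟨_, h, (hL.isPartition.block_mem x.out.isLt).2⟩
    rw [← h3]
    rw [h2] at h4
    cases hx : g.lab x.out
    · rw [if_pos (h4.1 (by rw [hx]; rfl))]; rfl
    · rw [if_neg fun h => by have := h4.2 h; rw [hx] at this; exact absurd this (by decide)]; rfl
  rw [deg_eq_sum]
  simp_rw [h1]
  rw [hL.sum_eq fun m => if m ∈ l then -1 else 1, Finset.sum_ite, Finset.sum_const, Finset.sum_const]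
  have h5 : (L.toFinset.filter fun m => m ∈ l) = l.toFinset := by
    ext m
    simp only [Finset.mem_filter, List.mem_toFinset]
    exact ⟨fun h => h.2, fun h => ⟨hl m h, h⟩⟩
  have h6 := Finset.card_filter_add_card_filter_not (s := L.toFinset) (fun m => m ∈ l)
  rw [h5, List.toFinset_card_of_nodup hn, List.toFinset_card_of_nodup hL.isPartition.nodup] at h6
  rw [h5, List.toFinset_card_of_nodup hn]
  simp only [nsmul_eq_mul, mul_one, mul_neg]
  omega

theorem Represents.block_zero (hL : Represents s L) :
    block L 0 ∈ L ∧ has (block L 0) 0 = true :=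
  hL.isPartition.block_mem (Nat.succ_pos _)

theorem mem_closedBlocks {m : ℕ} : m ∈ closedBlocks L ↔ m ∈ L ∧ has m 0 = false := by
  simp [closedBlocks]

theorem sublist_closedBlocks (hL : Represents s L) {l : List ℕ} (hl : l.Sublist (closedBlocks L)) :
    (∀ m ∈ block L 0 :: l, m ∈ L) ∧ (block L 0 :: l).Nodup := by
  have h1 : ∀ m ∈ l, m ∈ L ∧ has m 0 = false := fun m hm => mem_closedBlocks.1 (hl.subset hm)
  refine ⟨fun m hm => ?_, List.nodup_cons.2 ⟨fun hm => ?_, (hl.trans List.filter_sublist).nodup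
    hL.isPartition.nodup⟩⟩
  · rcases List.mem_cons.1 hm with rfl | hm
    · exact hL.block_zero.1
    · exact (h1 m hm).1
  · have := (h1 _ hm).2
    rw [hL.block_zero.2] at this
    exact absurd this (by decide)

/-- The union starts with the block of the edge `0` and the count `1` because the segment always
carries `X`. The chosen closed blocks are the circles labelled `X`. -/
theorem exists_generator_of_mem_unions (hL : Represents s L) {p : ℕ × ℕ}
    (hp : p ∈ unions (closedBlocks L) (block L 0) 1) :
    ∃ g : D.Generator, g.state = s ∧ g.mask = p.1 ∧ g.deg = L.length - 2 * p.2 ∧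
      p.2 ≤ L.length := by
  obtain ⟨l, hl, rfl⟩ := mem_unions.1 hp
  obtain ⟨h1, h2⟩ := sublist_closedBlocks hL hl
  have h3 : ∀ a, has (l.foldl Nat.lor (block L 0)) a = true ↔
      ∃ m ∈ block L 0 :: l, has m a = true := fun a => by
    rw [has_foldl_lor]; simp
  obtain ⟨g, hgs, hgm⟩ := exists_generator s (m := l.foldl Nat.lor (block L 0))
    (fun a ha => by
      obtain ⟨m, hm, hma⟩ := (h3 a).1 ha
      exact hL.isPartition.lt m (h1 m hm) a hma)
    ((h3 0).2 ⟨_, List.mem_cons_self, hL.block_zero.2⟩)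
    fun e e' hr he => by
      obtain ⟨m, hm, hma⟩ := (h3 e).1 he
      refine (h3 e').2 ⟨m, hm, ?_⟩
      rw [← hL.isPartition.block_eq (h1 m hm) hma, hL.has_block]
      exact hr
  refine ⟨g, hgs, hgm, ?_, ?_⟩
  · rw [deg_eq_of_mask hL hgs h1 h2 (by rw [hgm]; exact h3), List.length_cons]
    push_cast
    ring
  · have := (h2.subperm h1).length_le
    rw [List.length_cons] at this
    simp only
    omega

/-- The converse: the closed blocks that meet the mask of `g` are recovered as a sublist, and their
union with the segment is the mask. -/
theorem mem_unions_of_generator {g : D.Generator} (hL : Represents g.state L) :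
    ∃ x, (g.mask, x) ∈ unions (closedBlocks L) (block L 0) 1 ∧ g.deg = L.length - 2 * x ∧
      x ≤ L.length := by
  classical
  have hrel : ∀ {m a b}, m ∈ L → has m a = true → has m b = true → has g.mask a = true →
      has g.mask b = true := by
    intro m a b hm ha hb h
    have ha' := hL.isPartition.lt m hm a ha
    have hb' := hL.isPartition.lt m hm b hb
    have hr : D.Rel (State.toP g.state) ⟨a, ha'⟩ ⟨b, hb'⟩ := (hL.together_iff _ _).1 ⟨m, hm, ha, hb⟩
    have h1 := has_mask g ⟨a, ha'⟩
    have h2 := has_mask g ⟨b, hb'⟩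
    rw [Generator.lab_congr hr] at h1
    exact (h2.trans h1.symm).trans h
  have h0 : has g.mask 0 = true := by
    have := has_mask g 0
    rw [Generator.lab_of_rel_zero (Rel.refl _)] at this
    exact this
  set l := (closedBlocks L).filter fun m => decide (∃ a, has m a = true ∧ has g.mask a = true)
    with hl
  have hls : l.Sublist (closedBlocks L) := List.filter_sublist
  have hmask : g.mask = l.foldl Nat.lor (block L 0) := by
    apply BitMask.ext
    intro a
    rw [Bool.eq_iff_iff, has_foldl_lor]
    constructor
    · intro ha
      have hlt : a < 2 * D.n + 1 := by
        by_contra hle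
        rw [has_mask_of_le g (not_lt.1 hle)] at ha
        exact absurd ha (by decide)
      obtain ⟨h1, h2⟩ := hL.isPartition.block_mem hlt
      rcases hm0 : has (block L a) 0 with _ | _
      · refine Or.inr ⟨block L a, ?_, h2⟩
        rw [hl, List.mem_filter]
        exact ⟨mem_closedBlocks.2 ⟨h1, hm0⟩, decide_eq_true ⟨a, h2, ha⟩⟩
      · rw [hL.isPartition.block_eq h1 hm0]
        exact Or.inl h2
    · rintro (h | ⟨m, hm, h⟩)
      · exact hrel hL.block_zero.1 hL.block_zero.2 h h0
      · obtain ⟨h1, h2⟩ := List.mem_filter.1 hm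
        obtain ⟨b, hb, hb'⟩ := of_decide_eq_true h2
        exact hrel (mem_closedBlocks.1 h1).1 hb h hb'
  have hp : (g.mask, 1 + l.length) ∈ unions (closedBlocks L) (block L 0) 1 :=
    mem_unions.2 ⟨l, hls, by rw [hmask]⟩
  obtain ⟨g', hs', hm', hd, hle⟩ := exists_generator_of_mem_unions hL hp
  have hgg : g' = g := Generator.ext_code (by rw [hs']) hm'
  exact ⟨1 + l.length, hp, hgg ▸ hd, hle⟩

end KnotoidCode

/-! ### Computation of the gradings -/

namespace BitMask

/-- The byte number `d` of a table. -/
def byte (t d : ℕ) : ℕ := Nat.land 255 (Nat.shiftRight t (Nat.mul 8 d))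

/-- The combinatorial data of a diagram with `n` crossings: the edges around the crossings, and
tables indexed by the darts, which give the dart after a `0`- and a `1`-smoothed crossing, the
crossing to which a dart leads, and the number of times a dart crosses the shortcut from right to
left and from left to right.  The numbers `right₀` and `left₀` account for the diagram itself and
`shift` for the signs of the crossings. -/
structure Tables where
  n : ℕ
  crossings : List (ℕ × ℕ × ℕ × ℕ)
  next₀ : ℕ
  next₁ : ℕ
  crossing : ℕ
  right : ℕ
  left : ℕ
  right₀ : ℕ
  left₀ : ℕ
  shift : ℕ

/-- Follows the segment component of the state `S` up to the head, counting the intersections with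
the shortcut, and applies `κ` to the result. -/
noncomputable def trace (T : Tables) (S : ℕ) (κ : ℕ → ℕ → ℕ) (fuel : ℕ) : ℕ → ℕ → ℕ → ℕ :=
  Nat.rec (fun _ _ _ => 0) (fun _ ih d p m =>
    cond (Nat.beq d (Nat.add (Nat.mul 4 T.n) 1))
      (κ (Nat.add p (byte T.right d)) (Nat.add m (byte T.left d)))
      (ih (cond (has S (byte T.crossing d)) (byte T.next₁ d) (byte T.next₀ d))
        (Nat.add p (byte T.right d)) (Nat.add m (byte T.left d)))) fuel

/-- The value of `κ` at the `u`-grading of the state `S`. -/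
noncomputable def windingKey (T : Tables) (κ : ℕ → ℕ → ℕ) (S : ℕ) : ℕ :=
  trace T S κ 50 1 T.right₀ T.left₀

end BitMask

namespace KnotoidCode

open BitMask

variable {D : KnotoidCode}

/-- The number of a dart. -/
def dartCode (d : D.Dart) : ℕ := 2 * d.1.val + d.2.toNat

theorem dartCode_injective : Function.Injective (dartCode (D := D)) := by
  rintro ⟨e, b⟩ ⟨e', b'⟩ h
  unfold dartCode at h
  simp only at h
  have h1 : e.val = e'.val ∧ b = b' := by cases b <;> cases b' <;> simp at h ⊢ <;> omega
  exact Prod.ext (Fin.ext h1.1) h1.2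

/-- The contribution of a dart to the intersection number with the shortcut. -/
def dartWeight (d : D.Dart) : ℤ :=
  ∑ c : Fin D.n, (((if D.dartIn c (D.crossedByUnder c) = d then 1 else 0) -
      (if D.dartOut c (D.crossedByUnder c) = d then 1 else 0)) +
    ((if D.dartIn c (D.crossedByOver c) = d then 1 else 0) -
      (if D.dartOut c (D.crossedByOver c) = d then 1 else 0)))

/-- Collected by darts instead of crossings, the intersections can be added up while the segment is
traced. -/
theorem dotShortcut_eq_sum (γ : Set D.Dart) :
    D.dotShortcut γ = ∑ d : D.Dart, ind γ d * dartWeight d := by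
  have h : ∀ d' : D.Dart, (ind γ d' : ℤ) = ∑ d, ind γ d * if d' = d then 1 else 0 := fun d' => by
    simp
  simp only [dartWeight, Finset.mul_sum]
  rw [Finset.sum_comm, dotShortcut]
  refine Finset.sum_congr rfl fun c _ => ?_
  simp only [crossingNumber_eq, mul_add, mul_sub, Finset.sum_add_distrib, Finset.sum_sub_distrib,
    ← h]

theorem dotShortcut_wholeCurve :
    D.dotShortcut D.wholeCurve = ∑ e : D.Edge, dartWeight ((e, true) : D.Dart) := by
  rw [dotShortcut_eq_sum, Fintype.sum_prod_type]
  refine Finset.sum_congr rfl fun e _ => ?_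
  rw [Fintype.sum_bool, ind_of_mem (show (e, true) ∈ D.wholeCurve from rfl),
    ind_of_notMem (show (e, false) ∉ D.wholeCurve from Bool.false_ne_true), one_mul, zero_mul,
    add_zero]

theorem dotShortcut_segmentCurve {s : D.State} {m : ℕ}
    (h : IsDihedralCycle D.rev (D.turn (State.toP s)) D.legDart m)
    (hc : D.segmentCurve s = {d | ∃ i, 1 ≤ i ∧ i ≤ m ∧ d = (D.walk (State.toP s))^[i] D.legDart}) :
    D.dotShortcut (D.segmentCurve s) =
      ∑ i ∈ Finset.Icc 1 m, dartWeight ((D.walk (State.toP s))^[i] D.legDart) := by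
  have hpos := h.pos
  have hinj : Set.InjOn (fun i => (D.walk (State.toP s))^[i] D.legDart) (Finset.Icc 1 m) := by
    intro i hi j hj hij
    have hi' := Finset.mem_Icc.1 (Finset.mem_coe.1 hi)
    have hj' := Finset.mem_Icc.1 (Finset.mem_coe.1 hj)
    exact h.inj i (by omega) j (by omega) hij
  rw [dotShortcut_eq_sum, ← Finset.sum_image hinj]
  have hmem : ∀ d, d ∈ D.segmentCurve s ↔
      d ∈ (Finset.Icc 1 m).image fun i => (D.walk (State.toP s))^[i] D.legDart := by
    intro d
    rw [hc, Set.mem_ofPred_eq, Finset.mem_image]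
    simp only [Finset.mem_Icc, and_assoc]
    exact exists_congr fun i => and_congr_right fun _ => and_congr_right fun _ => eq_comm
  rw [← Finset.sum_subset (Finset.subset_univ _) fun d _ hd => ?_]
  · refine Finset.sum_congr rfl fun d hd => ?_
    rw [ind_of_mem ((hmem d).2 hd), one_mul]
  · rw [ind_of_notMem fun h => hd ((hmem d).1 h), zero_mul]

/-- The tables describe the diagram `D`. -/
def IsTables (D : KnotoidCode) (T : Tables) : Prop :=
  T.n = D.n ∧ T.crossings = D.crossings ∧ (T.shift : ℤ) = 65 + D.nPlus - 2 * D.nMinus ∧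
  (∀ c p, byte T.next₀ (dartCode (D.dartIn c p)) = dartCode (D.dartOut c (partner false p))) ∧
  (∀ c p, byte T.next₁ (dartCode (D.dartIn c p)) = dartCode (D.dartOut c (partner true p))) ∧
  (∀ c p, byte T.crossing (dartCode (D.dartIn c p)) = c.val) ∧
  (∀ d : D.Dart, (byte T.right (dartCode d) : ℤ) - byte T.left (dartCode d) = dartWeight d) ∧
  (T.right₀ : ℤ) - T.left₀ = - ∑ e : D.Edge, dartWeight ((e, true) : D.Dart)

instance (D : KnotoidCode) (T : Tables) : Decidable (D.IsTables T) := by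
  unfold IsTables; infer_instance

/-- Induction on the number `j` of darts left before the head. The two kinds of intersections are
counted separately because the computation uses natural numbers; only their difference enters `K`.
-/
theorem trace_eq {T : Tables} (hT : D.IsTables T) {s : D.State} {κ : ℕ → ℕ → ℕ} {K : ℤ → ℕ}
    (hκ : ∀ p m, κ p m = K ((p : ℤ) - m)) {m : ℕ}
    (h : IsDihedralCycle D.rev (D.turn (State.toP s)) D.legDart m)
    (hm : (D.walk (State.toP s))^[m] D.legDart = D.headDart) (j : ℕ) :
    ∀ i, 1 ≤ i → i + j = m → ∀ fuel, j < fuel → ∀ p q,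
      trace T (stateCode s) κ fuel (dartCode ((D.walk (State.toP s))^[i] D.legDart)) p q =
        K ((p : ℤ) - q +
          ∑ k ∈ Finset.Icc i m, dartWeight ((D.walk (State.toP s))^[k] D.legDart)) := by
  obtain ⟨hn, -, -, hn0, hn1, hcr, hw, -⟩ := hT
  have hpos := h.pos
  have hhead : Nat.add (Nat.mul 4 T.n) 1 = dartCode D.headDart := by
    change 4 * T.n + 1 = 2 * (2 * D.n) + 1
    omega
  have hcast : ∀ d : D.Dart, ∀ p q : ℕ, ((Nat.add p (byte T.right (dartCode d)) : ℕ) : ℤ) -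
      (Nat.add q (byte T.left (dartCode d)) : ℕ) = (p : ℤ) - q + dartWeight d := fun d p q => by
    rw [← hw d]
    change ((p + byte T.right (dartCode d) : ℕ) : ℤ) - (q + byte T.left (dartCode d) : ℕ) = _
    push_cast
    ring
  induction j with
  | zero =>
    intro i hi hij fuel hf p q
    obtain rfl : i = m := by omega
    obtain ⟨f, rfl⟩ := Nat.exists_eq_succ_of_ne_zero hf.ne'
    have hstep : ∀ d p q, trace T (stateCode s) κ (f + 1) d p q =
      cond (d == Nat.add (Nat.mul 4 T.n) 1)
        (κ (Nat.add p (byte T.right d)) (Nat.add q (byte T.left d)))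
        (trace T (stateCode s) κ f
          (cond (has (stateCode s) (byte T.crossing d)) (byte T.next₁ d) (byte T.next₀ d))
          (Nat.add p (byte T.right d)) (Nat.add q (byte T.left d))) := fun d p q => by
      rw [← beq_eq]; rfl
    rw [Nat.succ_eq_add_one, hstep, hhead, hm, beq_self_eq_true, cond_true, hκ, hcast,
      Finset.Icc_self, Finset.sum_singleton, hm]
  | succ j ih =>
    intro i hi hij fuel hf p q
    obtain ⟨f, rfl⟩ := Nat.exists_eq_succ_of_ne_zero (Nat.ne_zero_of_lt hf)
    have hstep : ∀ d p q, trace T (stateCode s) κ (f + 1) d p q =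
      cond (d == Nat.add (Nat.mul 4 T.n) 1)
        (κ (Nat.add p (byte T.right d)) (Nat.add q (byte T.left d)))
        (trace T (stateCode s) κ f
          (cond (has (stateCode s) (byte T.crossing d)) (byte T.next₁ d) (byte T.next₀ d))
          (Nat.add p (byte T.right d)) (Nat.add q (byte T.left d))) := fun d p q => by
      rw [← beq_eq]; rfl
    set d := (D.walk (State.toP s))^[i] D.legDart with hd
    have hd1 : d ≠ D.legDart := fun he => by
      have := h.inj i (by omega) 0 (by omega) he
      omega
    have hd2 : d ≠ D.headDart := fun he => by
      have := h.inj i (by omega) m (by omega) (he.trans hm.symm)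
      omega
    obtain ⟨c, x, hcx⟩ := exists_dartIn D hd1 hd2
    have hnext : cond (has (stateCode s) (byte T.crossing (dartCode d)))
        (byte T.next₁ (dartCode d)) (byte T.next₀ (dartCode d)) =
        dartCode ((D.walk (State.toP s))^[i + 1] D.legDart) := by
      rw [Function.iterate_succ_apply', ← hd, ← hcx, hcr, has_stateCode, hn0, hn1]
      have hwalk : D.walk (State.toP s) (D.dartIn c x) = D.dartOut c (partner (s c) x) := by
        unfold walk
        rw [Function.comp_apply, turn_dartIn rfl, rev_dartIn]
      rw [hwalk]
      cases s c <;> rfl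
    rw [Nat.succ_eq_add_one, hstep, hhead, beq_eq_false_iff_ne.2 fun he => hd2 (dartCode_injective he),
      cond_false, hnext, ih (i + 1) (by omega) (by omega) f (by omega), hcast, add_assoc,
      ← Finset.sum_insert (s := Finset.Icc (i + 1) m) (a := i)
        (f := fun k => dartWeight ((D.walk (State.toP s))^[k] D.legDart)) (by simp)]
    congr 3
    ext k
    simp only [Finset.mem_insert, Finset.mem_Icc]
    omega

theorem windingKey_eq {T : Tables} (hT : D.IsTables T) (hn : D.n ≤ 12) {κ : ℕ → ℕ → ℕ} {K : ℤ → ℕ}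
    (hκ : ∀ p m, κ p m = K ((p : ℤ) - m)) (s : D.State) :
    windingKey T κ (stateCode s) = K (D.mu s) := by
  obtain ⟨m, h1, h2, h3⟩ := exists_segment_cycle s
  -- The walk visits each dart at most once. For at most `12` crossings this gives `m ≤ 25`, so the
  -- fuel `50` suffices.
  have hm : 2 * m ≤ 2 * (2 * D.n + 1) := by
    have hinj : Function.Injective fun i : Fin (2 * m) =>
        (D.walk (State.toP s))^[i.val] D.legDart := fun i j h =>
      Fin.ext (h1.inj i i.isLt j j.isLt h)
    have := Fintype.card_le_of_injective _ hinj
    simp only [Fintype.card_fin, Fintype.card_prod, Fintype.card_bool] at this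
    omega
  have hpos := h1.pos
  have h := trace_eq hT hκ h1 h2 (m - 1) 1 le_rfl (by omega) 50 (by omega) T.right₀ T.left₀
  have hstart : dartCode ((D.walk (State.toP s))^[1] D.legDart) = 1 := by
    rw [Function.iterate_one, walk_legDart]; rfl
  rw [hstart] at h
  refine h.trans (congrArg K ?_)
  rw [hT.2.2.2.2.2.2.2, ← dotShortcut_wholeCurve, ← dotShortcut_segmentCurve h1 h3, mu]
  ring

end KnotoidCode

/-! ### Computation of homology groups -/

namespace BitMask

/-- The partitions of the edges into the components of the states. -/
noncomputable def Tables.tree (T : Tables) : Tree := stateTree T.crossings T.n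

/-- The generators with `o` smoothings of type `1` whose gradings are selected by `sel`, each given
by its state, its mask and the components of its state. -/
noncomputable def generators (T : Tables) (κ : ℕ → ℕ → ℕ) (sel : ℕ → ℕ → Bool) (o : ℕ) :
    List (ℕ × ℕ × List ℕ) :=
  (subsets T.n o).flatMap fun S => (fun L => (fun N u =>
    ((unions (closedBlocks L) (block L 0) 1).filter fun p =>
      sel (Nat.sub (Nat.add (Nat.add o T.shift) N) (Nat.mul 2 p.2)) u).map fun p => (S, p.1, L))
    L.length (windingKey T κ S)) (look T.tree S)

/-- The differential of a generator. -/
noncomputable def boundary {α : Type} (T : Tables) (f : Bool → ℕ → ℕ → α) (add : α → α → α) (z : α)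
    (g : ℕ × ℕ × List ℕ) : α :=
  image T.crossings T.tree g.1 g.2.1 g.2.2 f add z 1 false

/-- A vector over `ℤ/2` associated to a state and a mask. -/
noncomputable def hash (S m : ℕ) : ℕ :=
  -- Here `33554432 = 2 ^ 25` keeps the state apart from the mask, which has at most `25` bits. The
  -- rest is scrambling meant to keep the hashed columns in general position; any function would
  -- give a valid lower bound of the rank.
  force (Nat.mod (Nat.mul (Nat.pow (Nat.add (Nat.mul S 33554432) m) 3) (Nat.pow 3 690))
    (Nat.pow 2 1088)) fun y => Nat.xor y (Nat.shiftRight y 333)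

/-- A lower bound of the rank of the differential. -/
noncomputable def boundaryRank (T : Tables) (κ : ℕ → ℕ → ℕ) (sel : ℕ → ℕ → Bool) (o : ℕ) : ℕ :=
  rank ((generators T κ sel o).map (boundary T (fun _ => hash) Nat.xor 0)) []

/-- Whether the ranks of the two differentials add up to the number of generators. -/
noncomputable def isExact (T : Tables) (κ : ℕ → ℕ → ℕ) (sel : ℕ → ℕ → Bool) (o : ℕ) : Bool :=
  Nat.ble (generators T κ sel o).length (Nat.add (boundaryRank T κ sel o)
    (cond (Nat.beq o 0) 0 (boundaryRank T κ sel (Nat.sub o 1))))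

/-- The coefficient of a chain that is given as a list. -/
noncomputable def coefficient (l : List (ℤ × ℕ × ℕ)) (S m : ℕ) : ℤ :=
  List.rec 0 (fun x _ r => cond (and (Nat.beq x.2.1 S) (Nat.beq x.2.2 m)) (Int.add x.1 r) r) l

/-- Whether an integer is zero. -/
noncomputable def isZero (x : ℤ) : Bool := Int.rec (fun n => Nat.beq n 0) (fun _ => false) x

/-- `x` or `-x`. -/
noncomputable def signed (b : Bool) (x : ℤ) : ℤ := cond b (Int.neg x) x

/-- The boundary of a chain, as a list. -/
noncomputable def chainBoundary (T : Tables) (z : List (ℤ × ℕ × ℕ)) : List (ℤ × ℕ × ℕ) :=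
  z.flatMap fun x => boundary T (fun b S m => [(signed b x.1, S, m)]) List.append []
    (x.2.1, x.2.2, look T.tree x.2.1)

/-- Whether `z` is a cycle with `o + 1` smoothings of type `1`, and `ψ` a cocycle that does not
vanish at `z`. -/
noncomputable def detects (T : Tables) (κ : ℕ → ℕ → ℕ) (sel : ℕ → ℕ → Bool) (o : ℕ)
    (z ψ : List (ℤ × ℕ × ℕ)) : Bool :=
  (z.all fun x => (generators T κ sel (o + 1)).any fun g =>
    and (Nat.beq g.1 x.2.1) (Nat.beq g.2.1 x.2.2)) &&
  ((chainBoundary T z).all fun x => isZero (coefficient (chainBoundary T z) x.2.1 x.2.2)) &&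
  ((generators T κ sel o).all fun g =>
    isZero (boundary T (fun b S m => signed b (coefficient ψ S m)) Int.add 0 g)) &&
  !isZero (List.rec 0 (fun x _ r => Int.add (Int.mul x.1 (coefficient ψ x.2.1 x.2.2)) r) z)

theorem isZero_iff {x : ℤ} : isZero x = true ↔ x = 0 := by
  cases x with
  | ofNat n =>
    change Nat.beq n 0 = true ↔ _
    rw [beq_eq, beq_iff_eq]
    simp
  | negSucc n => exact ⟨fun h => absurd h Bool.false_ne_true, fun h => absurd h (by simp)⟩

theorem coefficient_cons (x : ℤ × ℕ × ℕ) (l : List (ℤ × ℕ × ℕ)) (S m : ℕ) :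
    coefficient (x :: l) S m = (if x.2.1 = S ∧ x.2.2 = m then x.1 else 0) + coefficient l S m := by
  have h : coefficient (x :: l) S m = cond (x.2.1 == S && x.2.2 == m)
    (x.1 + coefficient l S m) (coefficient l S m) := by rw [← beq_eq, ← beq_eq]; rfl
  rw [h]
  by_cases h1 : x.2.1 = S
  · by_cases h2 : x.2.2 = m
    · simp [h1, h2]
    · simp [h1, h2, beq_eq_false_iff_ne.2 h2]
  · simp [h1, beq_eq_false_iff_ne.2 h1]

theorem coefficient_append (l l' : List (ℤ × ℕ × ℕ)) (S m : ℕ) :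
    coefficient (l ++ l') S m = coefficient l S m + coefficient l' S m := by
  induction l with
  | nil => exact (zero_add _).symm
  | cons x l ih => rw [List.cons_append, coefficient_cons, coefficient_cons, ih, add_assoc]

theorem coefficient_eq_zero {l : List (ℤ × ℕ × ℕ)} {S m : ℕ}
    (h : ∀ x ∈ l, ¬ (x.2.1 = S ∧ x.2.2 = m)) : coefficient l S m = 0 := by
  induction l with
  | nil => rfl
  | cons x l ih =>
    rw [coefficient_cons, if_neg (h x List.mem_cons_self), zero_add,
      ih fun y hy => h y (List.mem_cons_of_mem _ hy)]

end BitMask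

/-! ### Correctness of the enumeration and vanishing of homology -/

namespace KnotoidCode

open BitMask

variable {D : KnotoidCode} {T : Tables} {κ : ℕ → ℕ → ℕ} {K : ℤ → ℕ} {sel : ℕ → ℕ → Bool} {o : ℕ}

/-- The `q`-grading, shifted to be a natural number. -/
noncomputable def Generator.qKey (g : D.Generator) : ℕ := (g.qDeg + 64).toNat

theorem neg_numComp_le_deg (g : D.Generator) : -(D.numComp g.state : ℤ) ≤ g.deg ∧
    g.deg ≤ D.numComp g.state := by
  obtain ⟨x, -, h1, h2⟩ := mem_unions_of_generator (represents_tree g.state)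
  rw [(represents_tree g.state).numComp_eq]
  omega

theorem ones_le (s : D.State) : D.ones s ≤ D.n :=
  (Finset.card_le_univ _).trans_eq (Fintype.card_fin _)

theorem qDeg_bounds (hn : D.n ≤ 12) (g : D.Generator) : -64 ≤ g.qDeg ∧ g.qDeg < 64 := by
  have h1 := neg_numComp_le_deg g
  have h2 := numComp_le g.state
  have h3 := nPlus_add_nMinus D
  have h4 := ones_le g.state
  unfold Generator.qDeg Generator.hDeg
  omega

theorem IsTables.tree_eq (hT : D.IsTables T) : T.tree = D.tree := by
  rw [Tables.tree, hT.1, hT.2.1]; rfl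

theorem mem_generators (hT : D.IsTables T) (hn : D.n ≤ 12) (hκ : ∀ p m, κ p m = K ((p : ℤ) - m))
    {x : ℕ × ℕ × List ℕ} : x ∈ generators T κ sel o ↔ ∃ g : D.Generator,
      D.ones g.state = o ∧ sel g.qKey (K g.uDeg) = true ∧
      x = (stateCode g.state, g.mask, look D.tree (stateCode g.state)) := by
  -- The `65` in `shift` is the `1` of the `q`-grading plus the offset `64` which makes it
  -- nonnegative; `y` components labelled `X` out of `N` give the degree `N - 2y`.
  have hkey : ∀ (g : D.Generator) (L : List ℕ) (y : ℕ), g.deg = L.length - 2 * y →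
      y ≤ L.length → L.length ≤ 2 * D.n + 1 →
      Nat.sub (Nat.add (Nat.add (D.ones g.state) T.shift) L.length) (Nat.mul 2 y) = g.qKey := by
    intro g L y h1 h2 h3
    have h4 := hT.2.2.1
    have h5 := nPlus_add_nMinus D
    change D.ones g.state + T.shift + L.length - 2 * y = _
    rw [Generator.qKey, Generator.qDeg, Generator.hDeg, h1]
    omega
  have hlen : ∀ s : D.State, (look D.tree (stateCode s)).length ≤ 2 * D.n + 1 := fun s => by
    rw [← (represents_tree s).numComp_eq]; exact numComp_le s
  simp only [generators, List.mem_flatMap, List.mem_map, List.mem_filter, hT.tree_eq, hT.1]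
  constructor
  · rintro ⟨S, hS, p, ⟨hp, hsel⟩, rfl⟩
    obtain ⟨s, rfl, hs⟩ := mem_subsets_iff.1 hS
    obtain ⟨g, rfl, h2, h3, h4⟩ := exists_generator_of_mem_unions (represents_tree s) hp
    rw [windingKey_eq hT hn hκ, ← hs, hkey g _ _ h3 h4 (hlen _)] at hsel
    exact ⟨g, hs, hsel, by rw [h2]⟩
  · rintro ⟨g, hg, hsel, rfl⟩
    obtain ⟨y, h1, h2, h3⟩ := mem_unions_of_generator (represents_tree g.state)
    refine ⟨stateCode g.state, mem_subsets_iff.2 ⟨_, rfl, hg⟩, _, ⟨h1, ?_⟩, rfl⟩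
    rw [windingKey_eq hT hn hκ, ← hg, hkey g _ _ h2 h3 (hlen _)]
    exact hsel

/-- The value of a homomorphism at the boundary of a generator. -/
theorem map_boundary {R : Type*} [CommRing R] {α : Type} (hS : D.IsSpherical) (hT : D.IsTables T)
    (g : D.Generator) {φ : α → R} {f : Bool → ℕ → ℕ → α} {add : α → α → α} {z : α}
    (hadd : ∀ a b, φ (add a b) = φ a + φ b) (hz : φ z = 0)
    {Φ : ℕ → ℕ → R} (hf : ∀ b S m, φ (f b S m) = (cond b (-1) 1) * Φ S m) :
    φ (boundary T f add z (stateCode g.state, g.mask, look D.tree (stateCode g.state))) =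
      ∑ h, (totalCoeff g h : R) * onCodes Φ h := by
  rw [boundary, hT.tree_eq, hT.2.1]
  exact sum_image hS g hadd hz hf

/-- Only an upper bound is needed, so repetitions in the enumerated list need not be excluded. -/
theorem count_le (hT : D.IsTables T) (hn : D.n ≤ 12) (hκ : ∀ p m, κ p m = K ((p : ℤ) - m))
    {Q : D.Generator → Prop}
    (hQ : ∀ g, Q g ↔ D.ones g.state = o ∧ sel g.qKey (K g.uDeg) = true) :
    Nat.card {g // Q g} ≤ (generators T κ sel o).length := by
  let l : List (ℕ × ℕ) := (generators T κ sel o).map fun x => (x.1, x.2.1)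
  have hmem : ∀ g : {g // Q g}, (stateCode g.1.state, g.1.mask) ∈ l.toFinset := fun g => by
    obtain ⟨h1, h2⟩ := (hQ g.1).1 g.2
    rw [List.mem_toFinset]
    exact List.mem_map.2 ⟨_, (mem_generators hT hn hκ).2 ⟨g.1, h1, h2, rfl⟩, rfl⟩
  have hinj : Function.Injective fun g : {g // Q g} =>
      (⟨(stateCode g.1.state, g.1.mask), hmem g⟩ : l.toFinset) := by
    intro g g' h
    have h' := congrArg Subtype.val h
    exact Subtype.ext (Generator.ext_code (congrArg Prod.fst h') (congrArg Prod.snd h'))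
  refine (Nat.card_le_card_of_injective _ hinj).trans ?_
  rw [Nat.card_eq_fintype_card, Fintype.card_coe]
  exact (List.toFinset_card_le l).trans_eq (List.length_map _)

/-- The rows fed to `rank` are sums modulo `2` of the hashes of the terms of a boundary, hence
images of generators under a linear map composed with the differential. Signs do not matter modulo
`2`. -/
theorem nullity_add_boundaryRank_le (hS : D.IsSpherical) (hT : D.IsTables T) (hn : D.n ≤ 12)
    (hκ : ∀ p m, κ p m = K ((p : ℤ) - m)) {Q : D.Generator → Prop}
    (hQ : ∀ g, Q g ↔ D.ones g.state = o ∧ sel g.qKey (K g.uDeg) = true) :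
    nullity Q + boundaryRank T κ sel o ≤ Nat.card {g // Q g} := by
  refine le_trans (Nat.add_le_add_left ?_ _)
    (nullity_add_finrank_le Q fun (k : ℕ) h => onCodes (fun S m => toVec (hash S m) k) h)
  have : FiniteDimensional (ZMod 2) (Submodule.span (ZMod 2)
      (Set.range fun (g : {g : D.Generator // Q g}) (k : ℕ) => ∑ h, (totalCoeff g.1 h : ZMod 2) *
        onCodes (fun S m => toVec (hash S m) k) h)) :=
    FiniteDimensional.span_of_finite _ (Set.finite_range _)
  refine rank_le_finrank (fun v hv => ?_) trivial fun p hp => absurd hp List.not_mem_nil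
  obtain ⟨x, hx, rfl⟩ := List.mem_map.1 hv
  obtain ⟨g, hg, hsel, rfl⟩ := (mem_generators hT hn hκ).1 hx
  refine Submodule.subset_span ⟨⟨g, (hQ g).2 ⟨hg, hsel⟩⟩, ?_⟩
  funext k
  refine (map_boundary hS hT g (φ := fun w => toVec w k)
    (fun a b => congrFun (toVec_xor a b) k) (congrFun toVec_zero k) fun b S m => ?_).symm
  cases b
  · exact (one_mul _).symm
  · rw [cond_true, show (-1 : ZMod 2) = 1 from rfl, one_mul]

/-- Both differentials have at least their computed ranks over `ℚ`. If these fill up the number of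
generators in the middle, cycles and boundaries coincide. For `o = 0` there is no incoming
differential. -/
theorem finrank_homology_eq_zero (hS : D.IsSpherical) (hT : D.IsTables T) (hn : D.n ≤ 12)
    (hκ : ∀ p m, κ p m = K ((p : ℤ) - m)) {P : D.Generator → Prop} (hP : Closed P)
    (hsel : ∀ g, P g ↔ sel g.qKey (K g.uDeg) = true) {i : ℤ} (hi : i = o - D.nMinus)
    (h : isExact T κ sel o = true) : Module.finrank ℚ (D.Homology P i) = 0 := by
  subst hi
  have h0 := finrank_homology hS hP (o - D.nMinus)
  have hQ : ∀ o : ℕ, ∀ g : D.Generator, (g.hDeg = o - D.nMinus ∧ P g) ↔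
      D.ones g.state = o ∧ sel g.qKey (K g.uDeg) = true := fun o g => by
    rw [hsel, Generator.hDeg]
    exact and_congr_left fun _ => by omega
  have h1 := nullity_add_boundaryRank_le hS hT hn hκ (hQ o)
  have h2 := count_le hT hn hκ (hQ o)
  have h3 : (generators T κ sel o).length ≤ boundaryRank T κ sel o +
      cond (o == 0) 0 (boundaryRank T κ sel (o - 1)) := by
    rw [← beq_eq]; exact Nat.le_of_ble_eq_true h
  by_cases ho : o = 0
  · subst ho
    rw [beq_self_eq_true, cond_true] at h3
    have h4 : nullity (fun g : D.Generator => g.hDeg = ((0 : ℕ) : ℤ) - D.nMinus - 1 ∧ P g) = 0 :=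
      nullity_of_forall_not fun g hg => by
        have := hg.1
        unfold Generator.hDeg at this
        omega
    rw [h4] at h0
    omega
  · obtain ⟨o', rfl⟩ : ∃ o', o = o' + 1 := ⟨o - 1, by omega⟩
    rw [beq_eq_false_iff_ne.2 ho, cond_false, Nat.add_sub_cancel] at h3
    have hi : ((o' + 1 : ℕ) : ℤ) - D.nMinus - 1 = o' - D.nMinus := by omega
    generalize Module.finrank ℚ (D.Homology P ((o' + 1 : ℕ) - D.nMinus)) = r at h0 ⊢
    rw [hi] at h0
    have h4 := nullity_add_boundaryRank_le hS hT hn hκ (hQ o')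
    have h5 : Nat.card {g : D.Generator // g.hDeg = o' - D.nMinus ∧ P g} = count P (o' - D.nMinus) :=
      rfl
    rw [h5] at h4
    omega

end KnotoidCode

namespace KnotoidCode

open BitMask

variable {D : KnotoidCode} {T : Tables} {κ : ℕ → ℕ → ℕ} {K : ℤ → ℕ} {sel : ℕ → ℕ → Bool} {o : ℕ}

/-! ### Homology groups that do not vanish -/

/-- Each term of a list of terms belongs to a generator. -/
def Listed (D : KnotoidCode) (z : List (ℤ × ℕ × ℕ)) : Prop :=
  ∀ x ∈ z, ∃ g : D.Generator, stateCode g.state = x.2.1 ∧ g.mask = x.2.2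

theorem sum_mul_coefficient_cons (F : D.Generator → ℤ) {x : ℤ × ℕ × ℕ} {z : List (ℤ × ℕ × ℕ)}
    {g : D.Generator} (h1 : stateCode g.state = x.2.1) (h2 : g.mask = x.2.2) :
    ∑ h, F h * onCodes (coefficient (x :: z)) h =
      F g * x.1 + ∑ h, F h * onCodes (coefficient z) h := by
  simp only [onCodes, coefficient_cons, mul_add, Finset.sum_add_distrib]
  congr 1
  rw [Finset.sum_eq_single g]
  · rw [if_pos ⟨h1.symm, h2.symm⟩]
  · intro h _ hh
    rw [if_neg, mul_zero]
    exact fun h' => hh (Generator.ext_code (h'.1.symm.trans h1.symm) (h'.2.symm.trans h2.symm))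
  · exact fun h => absurd (Finset.mem_univ _) h

theorem sum_totalCoeff_mul_coefficient (hS : D.IsSpherical) (hT : D.IsTables T)
    {z : List (ℤ × ℕ × ℕ)} (hz : D.Listed z) (h : D.Generator) :
    ∑ g, totalCoeff g h * onCodes (coefficient z) g = onCodes (coefficient (chainBoundary T z)) h := by
  classical
  induction z with
  | nil => exact Finset.sum_eq_zero fun g _ => mul_zero _
  | cons x z ih =>
    obtain ⟨g, h1, h2⟩ := hz x List.mem_cons_self
    rw [sum_mul_coefficient_cons _ h1 h2, ih fun y hy => hz y (List.mem_cons_of_mem _ hy)]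
    have h3 : chainBoundary T (x :: z) = boundary T (fun b S m => [(signed b x.1, S, m)])
        List.append [] (x.2.1, x.2.2, look T.tree x.2.1) ++ chainBoundary T z := rfl
    rw [h3, onCodes, onCodes, coefficient_append]
    congr 1
    have h4 := map_boundary (R := ℤ) hS hT g (f := fun b S m => [(signed b x.1, S, m)])
      (add := List.append) (z := [])
      (φ := fun l => coefficient l (stateCode h.state) h.mask)
      (fun a b => coefficient_append a b _ _) rfl
      (Φ := fun S m => if S = stateCode h.state ∧ m = h.mask then x.1 else 0) fun b S m => by
        rw [coefficient_cons]
        have : ∀ b, signed b x.1 = (cond b (-1) 1) * x.1 := fun b => by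
          cases b
          · exact (one_mul _).symm
          · exact (neg_one_mul _).symm
        rw [this, mul_ite, mul_zero]
        exact add_zero _
    rw [← h1, ← h2, hT.tree_eq, h4, Finset.sum_eq_single h]
    · rw [onCodes, if_pos ⟨rfl, rfl⟩, Int.cast_id]
    · intro k _ hk
      rw [onCodes, if_neg fun h' => hk (Generator.ext_code h'.1 h'.2), mul_zero]
    · exact fun h => absurd (Finset.mem_univ _) h

theorem sum_coefficient_mul_coefficient {z ψ : List (ℤ × ℕ × ℕ)} (hz : D.Listed z) :
    ∑ g : D.Generator, onCodes (coefficient ψ) g * onCodes (coefficient z) g =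
      List.rec 0 (fun x _ r => Int.add (Int.mul x.1 (coefficient ψ x.2.1 x.2.2)) r) z := by
  induction z with
  | nil => exact Finset.sum_eq_zero fun g _ => mul_zero _
  | cons x z ih =>
    obtain ⟨g, h1, h2⟩ := hz x List.mem_cons_self
    rw [sum_mul_coefficient_cons _ h1 h2, ih fun y hy => hz y (List.mem_cons_of_mem _ hy), onCodes,
      h1, h2, mul_comm]
    rfl

/-- If `z` were a boundary, its pairing with `ψ` would vanish, because `ψ` vanishes on the boundary
of every generator with `o` smoothings of type `1` and the selected gradings. Nothing else is
required of `ψ`. -/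
theorem finrank_homology_ne_zero (hS : D.IsSpherical) (hT : D.IsTables T) (hn : D.n ≤ 12)
    (hκ : ∀ p m, κ p m = K ((p : ℤ) - m)) {P : D.Generator → Prop} (hP : Closed P)
    (hsel : ∀ g, P g ↔ sel g.qKey (K g.uDeg) = true) {i : ℤ} (hi : i = o + 1 - D.nMinus)
    {z ψ : List (ℤ × ℕ × ℕ)} (h : detects T κ sel o z ψ = true) :
    Module.finrank ℚ (D.Homology P i) ≠ 0 := by
  intro h0
  simp only [detects, Bool.and_eq_true, List.all_eq_true, List.any_eq_true, beq_eq, beq_iff_eq,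
    isZero_iff, Bool.not_eq_true', Bool.eq_false_iff, ne_eq] at h
  obtain ⟨⟨⟨hz, hcycle⟩, hcocycle⟩, hne⟩ := h
  have hmem : ∀ x ∈ z, ∃ g : D.Generator, stateCode g.state = x.2.1 ∧ g.mask = x.2.2 ∧
      g.hDeg = i ∧ P g := by
    intro x hx
    obtain ⟨y, hy, h1, h2⟩ := hz x hx
    obtain ⟨g, h3, h4, rfl⟩ := (mem_generators hT hn hκ).1 hy
    refine ⟨g, h1, h2, ?_, (hsel g).2 h4⟩
    rw [Generator.hDeg, h3, hi]
    push_cast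
    rfl
  have hlist : D.Listed z := fun x hx => by
    obtain ⟨g, h1, h2, -⟩ := hmem x hx
    exact ⟨g, h1, h2⟩
  have hsupp : ∀ g : D.Generator, ¬ (g.hDeg = i ∧ P g) → onCodes (coefficient z) g = 0 := by
    intro g hg
    refine coefficient_eq_zero fun x hx hx' => hg ?_
    obtain ⟨g', h1, h2, h3⟩ := hmem x hx
    rwa [Generator.ext_code (h1.trans hx'.1) (h2.trans hx'.2)] at h3
  let v : D.Chain P i := fun g => ((onCodes (coefficient z) g.1 : ℤ) : ℚ)
  have hext : ∀ g, extend P i v g = (onCodes (coefficient z) g : ℤ) := by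
    intro g
    by_cases hg : g.hDeg = i ∧ P g
    · rw [extend_of _ hg]
    · rw [extend_of_not _ hg, hsupp g hg, Int.cast_zero]
  have hv : v ∈ LinearMap.ker (D.diff P i (i + 1)) := by
    rw [mem_ker_diff hP rfl]
    intro k
    simp only [hext]
    have h1 := sum_totalCoeff_mul_coefficient hS hT hlist k
    have h2 : onCodes (coefficient (chainBoundary T z)) k = 0 := by
      by_cases hk : ∃ x ∈ chainBoundary T z, x.2.1 = stateCode k.state ∧ x.2.2 = k.mask
      · obtain ⟨x, hx, h3, h4⟩ := hk
        rw [onCodes, ← h3, ← h4, hcycle x hx]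
      · push Not at hk
        exact coefficient_eq_zero fun x hx h => hk x hx h.1 h.2
    rw [h2] at h1
    exact_mod_cast h1
  have hsub := Module.finrank_zero_iff.1 h0
  have hrange := (Submodule.Quotient.mk_eq_zero _).1
    (Subsingleton.elim (Submodule.Quotient.mk (⟨v, hv⟩ : LinearMap.ker (D.diff P i (i + 1))) :
      D.Homology P i) 0)
  obtain ⟨y, hy⟩ := hrange
  have hy' : ∀ k, ((onCodes (coefficient z) k : ℤ) : ℚ) =
      ∑ g, (totalCoeff g k : ℚ) * extend P (i - 1) y g := fun k => by
    rw [← hext, ← extend_diff hP (by ring)]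
    exact congrArg (fun w => extend P i w k) hy.symm
  rw [← sum_coefficient_mul_coefficient hlist] at hne
  refine hne ?_
  -- The pairing is moved across the differential from `z` to `ψ`.
  have hsum : ∑ k : D.Generator, ((onCodes (coefficient ψ) k : ℤ) : ℚ) *
      ((onCodes (coefficient z) k : ℤ) : ℚ) = 0 := by
    simp only [hy', Finset.mul_sum]
    rw [Finset.sum_comm]
    refine Finset.sum_eq_zero fun g _ => ?_
    have h1 : ∑ k : D.Generator, ((onCodes (coefficient ψ) k : ℤ) : ℚ) *
        ((totalCoeff g k : ℚ) * extend P (i - 1) y g) =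
        ((∑ k, totalCoeff g k * onCodes (coefficient ψ) k : ℤ) : ℚ) * extend P (i - 1) y g := by
      push_cast
      rw [Finset.sum_mul]
      exact Finset.sum_congr rfl fun k _ => by ring
    rw [h1]
    by_cases hg : g.hDeg = i - 1 ∧ P g
    · have h2 := hcocycle _ ((mem_generators hT hn hκ).2 ⟨g, ?_, (hsel g).1 hg.2, rfl⟩)
      · have h3 := map_boundary (R := ℤ) hS hT g (φ := id) (add := Int.add) (z := 0)
          (f := fun b S m => signed b (coefficient ψ S m)) (fun _ _ => rfl) rfl
          (Φ := coefficient ψ) fun b S m => by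
            cases b
            · exact (one_mul _).symm
            · exact (neg_one_mul _).symm
        simp only [id, h2, Int.cast_id] at h3
        rw [← h3, Int.cast_zero, zero_mul]
      · have := hg.1
        unfold Generator.hDeg at this
        omega
    · rw [extend_of_not _ hg, mul_zero]
  exact_mod_cast hsum

end KnotoidCode

/-! ### Computation of the Turaev polynomial -/

namespace BitMask

/-- The number of the first `n` bits that are set. -/
noncomputable def popcount (n S : ℕ) : ℕ :=
  Nat.rec 0 (fun k r => cond (has S k) (Nat.succ r) r) n

/-- The sum of the values of `f` at the `2 ^ k` numbers from `a` on. -/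
noncomputable def sumFrom (f : ℕ → ℤ) (k : ℕ) : ℕ → ℤ :=
  Nat.rec f (fun k ih a => Int.add (ih a) (ih (Nat.add a (Nat.pow 2 k)))) k

/-- The sum of `(-1) ^ i * 2 ^ (40 * key)` over the generators of a state. -/
noncomputable def packedState (T : Tables) (κ : ℕ → ℕ → ℕ) (S : ℕ) : ℤ :=
  (fun o N => signed (has o 0) (Int.ofNat (Nat.mul
    (Nat.pow 2 (Nat.mul 40 (Nat.add (Nat.sub (Nat.add o T.shift) N) (windingKey T κ S))))
    (Nat.pow (Nat.succ (Nat.pow 2 80)) (Nat.sub N 1)))))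
  (popcount T.n S) (look T.tree S).length

/-- The sum of `(-1) ^ i * 2 ^ (40 * key)` over all generators. -/
noncomputable def packed (T : Tables) (κ : ℕ → ℕ → ℕ) : ℤ := sumFrom (packedState T κ) T.n 0

theorem sumFrom_eq (f : ℕ → ℤ) (k a : ℕ) : sumFrom f k a = ∑ i ∈ Finset.range (2 ^ k), f (a + i) := by
  induction k generalizing a with
  | zero => exact (Finset.sum_range_one fun i => f (a + i)).symm
  | succ k ih =>
    have h : sumFrom f (k + 1) a = sumFrom f k a + sumFrom f k (a + 2 ^ k) := rfl
    rw [h, ih, ih, pow_succ, mul_two, Finset.sum_range_add]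
    simp only [add_assoc]

theorem popcount_eq (n S : ℕ) : popcount n S = ∑ i ∈ Finset.range n, (has S i).toNat := by
  induction n with
  | zero => rfl
  | succ n ih =>
    rw [Finset.sum_range_succ, ← ih]
    have h : popcount (n + 1) S = cond (has S n) (Nat.succ (popcount n S)) (popcount n S) := rfl
    rw [h]
    cases has S n <;> rfl

end BitMask

/-- Digits of absolute value less than `B / 2` are unique. -/
theorem digits_unique {B : ℤ} {M : ℕ} {a b : ℕ → ℤ} (ha : ∀ i, 2 * |a i| < B)
    (hb : ∀ i, 2 * |b i| < B)
    (h : ∑ i ∈ Finset.range M, a i * B ^ i = ∑ i ∈ Finset.range M, b i * B ^ i) :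
    ∀ i < M, a i = b i := by
  induction M generalizing a b with
  | zero => exact fun i hi => absurd hi (Nat.not_lt_zero _)
  | succ M ih =>
    have hB : 0 < B := lt_of_le_of_lt (by positivity) (ha 0)
    have hs : ∀ a : ℕ → ℤ, ∑ i ∈ Finset.range (M + 1), a i * B ^ i =
        a 0 + B * ∑ i ∈ Finset.range M, a (i + 1) * B ^ i := fun a => by
      rw [Finset.sum_range_succ', Finset.mul_sum, pow_zero, mul_one, add_comm]
      congr 1
      exact Finset.sum_congr rfl fun i _ => by ring
    rw [hs, hs] at h
    have h0 : a 0 = b 0 := by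
      have h1 : B ∣ a 0 - b 0 := ⟨∑ i ∈ Finset.range M, b (i + 1) * B ^ i -
        ∑ i ∈ Finset.range M, a (i + 1) * B ^ i, by linarith⟩
      have h2 : |a 0 - b 0| < B := by
        have := abs_sub (a 0) (b 0)
        have := ha 0
        have := hb 0
        omega
      exact sub_eq_zero.1 (Int.eq_zero_of_abs_lt_dvd h1 h2)
    rw [h0, add_right_inj, mul_right_inj' hB.ne'] at h
    have h1 := ih (fun i => ha (i + 1)) (fun i => hb (i + 1)) h
    intro i hi
    cases i with
    | zero => exact h0
    | succ i => exact h1 i (Nat.lt_of_succ_lt_succ hi)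

/-! ### The packed integer determines the Euler characteristics -/

namespace KnotoidCode

open BitMask

variable {D D' : KnotoidCode} {T T' : Tables} {κ κ' : ℕ → ℕ → ℕ} {K K' : ℤ → ℕ}

theorem ones_eq_popcount (s : D.State) : popcount D.n (stateCode s) = D.ones s := by
  rw [popcount_eq, ← Fin.sum_univ_eq_sum_range fun i => (has (stateCode s) i).toNat, ones,
    Finset.card_filter]
  refine Finset.sum_congr rfl fun c _ => ?_
  rw [has_stateCode]
  cases s c <;> rfl

theorem sum_state (f : ℕ → ℤ) : ∑ s : D.State, f (stateCode s) = sumFrom f D.n 0 := by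
  rw [sumFrom_eq]
  simp only [zero_add]
  have himage : (Finset.univ.image fun s : D.State => stateCode s) = Finset.range (2 ^ D.n) := by
    refine Finset.eq_of_subset_of_card_le (fun x hx => ?_) ?_
    · obtain ⟨s, -, rfl⟩ := Finset.mem_image.1 hx
      exact Finset.mem_range.2 (Nat.ofBits_lt_two_pow _)
    · rw [Finset.card_range, Finset.card_image_of_injective _ stateCode_injective, Finset.card_univ]
      simp
  rw [← himage, Finset.sum_image fun s _ s' _ h => stateCode_injective h]

theorem signed_has (o : ℕ) (x : ℤ) : signed (has o 0) x = sgn o * x := by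
  have h : has o 0 = (o % 2 == 1) := by
    rw [has_eq, Nat.testBit_zero]; rfl
  have h2 : ∀ b, signed b x = cond b (-1) 1 * x := fun b => by
    cases b
    · exact (one_mul _).symm
    · exact (neg_one_mul _).symm
  rw [h2, h]
  congr 1
  rcases Nat.even_or_odd o with ho | ho
  · rw [Nat.even_iff.1 ho, sgn, Int.negOnePow_even _ (by exact_mod_cast ho)]; rfl
  · rw [Nat.odd_iff.1 ho, sgn, Int.negOnePow_odd _ (by exact_mod_cast ho)]; rfl

/-- A number that determines the gradings of a generator. -/
noncomputable def Generator.key (K : ℤ → ℕ) (g : D.Generator) : ℕ := g.qKey + K g.uDeg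

theorem qKey_eq (hT : D.IsTables T) (hn : D.n ≤ 12) (g : D.Generator) :
    g.qKey = D.ones g.state + T.shift - D.numComp g.state +
      ∑ x : {x : D.Component g.state // x ≠ D.segment g.state}, 2 * (g.label x.1).toNat := by
  have h1 := deg_add_one g
  have h2 : D.numComp g.state - 1 =
      Fintype.card {x : D.Component g.state // x ≠ D.segment g.state} := by
    rw [numComp, Nat.card_eq_fintype_card, Fintype.card_subtype_compl, Fintype.card_subtype_eq]
  have h3 : ∀ b, weight b = 2 * (b.toNat : ℤ) - 1 := by decide
  have h4 : 1 ≤ D.numComp g.state := by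
    rw [numComp]
    have : Nonempty (D.Component g.state) := ⟨D.segment g.state⟩
    exact Nat.card_pos
  have h5 := numComp_le g.state
  have h6 := hT.2.2.1
  have h7 := nPlus_add_nMinus D
  simp only [h3] at h1
  rw [Finset.sum_sub_distrib, Finset.sum_const, Finset.card_univ, ← h2, nsmul_eq_mul,
    mul_one] at h1
  have h8 : ((∑ x : {x : D.Component g.state // x ≠ D.segment g.state},
      2 * (g.label x.1).toNat : ℕ) : ℤ) = ∑ x : {x : D.Component g.state // x ≠ D.segment g.state},
      2 * ((g.label x.1).toNat : ℤ) := by push_cast; rfl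
  rw [← h8] at h1
  rw [Generator.qKey, Generator.qDeg, Generator.hDeg]
  omega

/-- The labelling with `X` everywhere has the lowest key of its state, and changing a circle to `1`
raises the `q`-grading by `2`. So each circle contributes the factor `1 + (2 ^ 40) ^ 2`, and the
generators of a state need not be listed. -/
theorem packed_eq (hT : D.IsTables T) (hn : D.n ≤ 12) (hκ : ∀ p m, κ p m = K ((p : ℤ) - m)) :
    packed T κ = ∑ g : D.Generator, sgn (D.ones g.state) * (2 ^ 40) ^ g.key K := by
  have h1 : ∀ s : D.State, packedState T κ (stateCode s) =
      ∑ l : {x : D.Component s // x ≠ D.segment s} → Bool, sgn (D.ones s) *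
        (2 ^ 40) ^ (D.ones s + T.shift - D.numComp s + ∑ x, 2 * (l x).toNat + K (D.mu s)) := by
    intro s
    have h2 : D.numComp s - 1 = Fintype.card {x : D.Component s // x ≠ D.segment s} := by
      rw [numComp, Nat.card_eq_fintype_card, Fintype.card_subtype_compl, Fintype.card_subtype_eq]
    have h3 : packedState T κ (stateCode s) = signed (has (D.ones s) 0) ((
        2 ^ (40 * (D.ones s + T.shift - D.numComp s + K (D.mu s))) *
        (2 ^ 80 + 1) ^ (D.numComp s - 1) : ℕ) : ℤ) := by
      rw [(represents_tree s).numComp_eq, ← windingKey_eq hT hn hκ, ← hT.tree_eq,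
        ← ones_eq_popcount, ← hT.1]
      rfl
    rw [h3, signed_has, ← Finset.mul_sum, h2]
    congr 1
    have h4 : ((2 ^ 80 + 1 : ℕ) : ℤ) = ∑ b : Bool, (2 ^ 40) ^ (2 * b.toNat) := by
      rw [Fintype.sum_bool]; norm_num
    rw [Nat.cast_mul, Nat.cast_pow (2 ^ 80 + 1), h4, ← Finset.card_univ, ← Finset.prod_const,
      Fintype.prod_sum, Finset.mul_sum]
    refine Finset.sum_congr rfl fun l _ => ?_
    rw [Finset.prod_pow_eq_pow_sum, Nat.cast_pow, pow_mul, Nat.cast_ofNat, ← pow_add,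
      Nat.add_right_comm]
  rw [packed, hT.1, ← sum_state]
  simp_rw [h1]
  rw [← sum_generator fun s l => sgn (D.ones s) *
    (2 ^ 40) ^ (D.ones s + T.shift - D.numComp s + ∑ x, 2 * (l x).toNat + K (D.mu s))]
  refine Finset.sum_congr rfl fun g _ => ?_
  rw [Generator.key, qKey_eq hT hn]
  rfl

/-- For `n ≤ 12` the two masks have at most `12 + 25 = 37` bits. Hence every signed count is below
`2 ^ 38` in absolute value, less than half of the base `2 ^ 40`. -/
theorem card_generator_lt (hn : D.n ≤ 12) : Fintype.card D.Generator < 2 ^ 38 := by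
  have hinj : Function.Injective fun g : D.Generator =>
      ((⟨stateCode g.state, Nat.ofBits_lt_two_pow _⟩, ⟨g.mask, Nat.ofBits_lt_two_pow _⟩) :
        Fin (2 ^ D.n) × Fin (2 ^ (2 * D.n + 1))) := fun g h e => by
    simp only [Prod.mk.injEq] at e
    exact Generator.ext_code (congrArg Fin.val e.1) (congrArg Fin.val e.2)
  have h1 := Fintype.card_le_of_injective _ hinj
  rw [Fintype.card_prod, Fintype.card_fin, Fintype.card_fin, ← pow_add] at h1
  refine h1.trans_lt (Nat.pow_lt_pow_right (by norm_num) (by omega))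

open Classical in
/-- The number of the generators with a given key, counted with sign. -/
noncomputable def keyCount (K : ℤ → ℕ) (D : KnotoidCode) (m : ℕ) : ℤ :=
  ∑ g : D.Generator, if g.key K = m then sgn (D.ones g.state) else 0

theorem abs_sgn (i : ℤ) : |sgn i| = 1 := by
  rw [sgn]
  rcases Int.units_eq_one_or i.negOnePow with h | h <;> rw [h] <;> rfl

theorem abs_keyCount_lt (hn : D.n ≤ 12) (m : ℕ) : 2 * |keyCount K D m| < 2 ^ 40 := by
  classical
  have h1 : |keyCount K D m| ≤ ∑ g : D.Generator, 1 :=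
    (Finset.abs_sum_le_sum_abs _ _).trans (Finset.sum_le_sum fun g _ => by
      by_cases h : g.key K = m
      · rw [if_pos h, abs_sgn]
      · rw [if_neg h, abs_zero]; exact zero_le_one)
  rw [Finset.sum_const, Finset.card_univ, nsmul_eq_mul, mul_one] at h1
  have h2 := card_generator_lt hn
  zify at h2
  linarith

theorem sum_keyCount {M : ℕ} (hM : ∀ g : D.Generator, g.key K < M) :
    ∑ m ∈ Finset.range M, keyCount K D m * (2 ^ 40) ^ m =
      ∑ g : D.Generator, sgn (D.ones g.state) * (2 ^ 40) ^ g.key K := by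
  simp only [keyCount, Finset.sum_mul, ite_mul, zero_mul]
  rw [Finset.sum_comm]
  refine Finset.sum_congr rfl fun g _ => ?_
  rw [Finset.sum_ite_eq, if_pos (Finset.mem_range.2 (hM g))]

/-- The counts are small enough to be recovered as signed digits; the range of summation is chosen
to exceed the keys of both diagrams. -/
theorem packed_eq_iff (hT : D.IsTables T) (hn : D.n ≤ 12) (hκ : ∀ p m, κ p m = K ((p : ℤ) - m))
    (hT' : D'.IsTables T') (hn' : D'.n ≤ 12) (hκ' : ∀ p m, κ' p m = K' ((p : ℤ) - m)) :
    packed T κ = packed T' κ' ↔ ∀ m, keyCount K D m = keyCount K' D' m := by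
  obtain ⟨M, hM⟩ := (Set.finite_range fun g : D.Generator => g.key K).bddAbove
  obtain ⟨M', hM'⟩ := (Set.finite_range fun g : D'.Generator => g.key K').bddAbove
  have h1 : ∀ N, M < N → ∀ g : D.Generator, g.key K < N := fun N hN g =>
    (hM ⟨g, rfl⟩).trans_lt hN
  have h2 : ∀ N, M' < N → ∀ g : D'.Generator, g.key K' < N := fun N hN g =>
    (hM' ⟨g, rfl⟩).trans_lt hN
  constructor
  · intro h m
    rw [packed_eq hT hn hκ, packed_eq hT' hn' hκ', ← sum_keyCount (h1 (M + M' + m + 1) (by omega)),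
      ← sum_keyCount (h2 (M + M' + m + 1) (by omega))] at h
    exact digits_unique (abs_keyCount_lt hn) (abs_keyCount_lt hn') h m (by omega)
  · intro h
    rw [packed_eq hT hn hκ, packed_eq hT' hn' hκ', ← sum_keyCount (h1 (M + M' + 1) (by omega)),
      ← sum_keyCount (h2 (M + M' + 1) (by omega))]
    simp only [h]

theorem euler_eq_keyCount {P : D.Generator → Prop} {m : ℕ} (h : ∀ g, P g ↔ g.key K = m) :
    euler P = sgn D.nMinus * keyCount K D m := by
  classical
  rw [euler, keyCount, Finset.mul_sum]
  refine Finset.sum_congr rfl fun g _ => ?_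
  have h1 : sgn g.hDeg = sgn D.nMinus * sgn (D.ones g.state) := by
    have h2 : (D.ones g.state : ℤ) = D.nMinus + g.hDeg := by unfold Generator.hDeg; ring
    rw [h2, sgn_add, ← mul_assoc, sgn_mul_self, one_mul]
  by_cases hg : P g
  · rw [if_pos hg, if_pos ((h g).1 hg), h1]
  · rw [if_neg hg, if_neg fun h' => hg ((h g).2 h'), mul_zero]

theorem euler_of_forall_not {P : D.Generator → Prop} (h : ∀ g, ¬ P g) : euler P = 0 := by
  classical
  exact Finset.sum_eq_zero fun g _ => if_neg (h g)

/-- A bijection from the integers to the natural numbers. -/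
def zigzag (u : ℤ) : ℕ := if 0 ≤ u then 2 * u.toNat else 2 * (-u).toNat - 1

theorem zigzag_inj {u v : ℤ} : zigzag u = zigzag v ↔ u = v := by
  unfold zigzag
  split <;> split <;> omega

theorem exists_zigzag (m : ℕ) : ∃ u, zigzag u = m := by
  rcases Nat.even_or_odd' m with ⟨c, rfl | rfl⟩
  · exact ⟨c, by unfold zigzag; split <;> omega⟩
  · exact ⟨-(c + 1), by unfold zigzag; split <;> omega⟩

/-- The shifted `q`-grading is smaller than `128`, so a key splits into its residue and its quotient
by `128`. -/
theorem key_eq_iff {Z : ℤ → ℕ} (hn : D.n ≤ 12) (g : D.Generator) {j k : ℤ} (hj : -64 ≤ j) (hj' : j < 64) :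
    g.key (fun u => 128 * Z u) = (j + 64).toNat + 128 * Z k ↔ g.qDeg = j ∧ Z g.uDeg = Z k := by
  have := qDeg_bounds hn g
  simp only [Generator.key, Generator.qKey]
  omega

theorem euler_eq_zero_of_not_mem (hn : D.n ≤ 12) {j : ℤ} (hj : ¬ (-64 ≤ j ∧ j < 64))
    (P : D.Generator → Prop) : euler (fun g => g.qDeg = j ∧ P g) = 0 :=
  euler_of_forall_not fun g hg => hj (hg.1 ▸ qDeg_bounds hn g)

/-- `packed` uses the sign of the number of `1`-smoothings instead of that of the homological
degree. They differ by `(-1) ^ n₋`, which is why the two diagrams must agree in `hs`. -/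
theorem turaev_eq_iff_packed (hT : D.IsTables T) (hn : D.n ≤ 12) (hT' : D'.IsTables T')
    (hn' : D'.n ≤ 12) (hκ : ∀ p m, κ p m = 128 * zigzag ((p : ℤ) - m))
    (hs : sgn D.nMinus = sgn D'.nMinus) : D.turaev = D'.turaev ↔ packed T κ = packed T' κ := by
  rw [turaev_eq_iff, packed_eq_iff (K := fun u => 128 * zigzag u)
    (K' := fun u => 128 * zigzag u) hT hn hκ hT' hn' hκ]
  have h : ∀ {D : KnotoidCode}, D.n ≤ 12 → ∀ {j k : ℤ}, -64 ≤ j → j < 64 →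
      euler (fun g : D.Generator => g.qDeg = j ∧ g.uDeg = k) = sgn D.nMinus *
        keyCount (fun u => 128 * zigzag u) D ((j + 64).toNat + 128 * zigzag k) :=
    fun hn j k hj hj' => euler_eq_keyCount fun g => by rw [key_eq_iff hn g hj hj', zigzag_inj]
  constructor
  · intro he m
    -- Every number `m` is the key of some pair of gradings, so no digit escapes the comparison.
    obtain ⟨k, hk⟩ := exists_zigzag (m / 128)
    have h1 := he ((m % 128 : ℕ) - 64) k
    rw [h hn (by omega) (by omega), h hn' (by omega) (by omega), ← hs,
      hk, show (((m % 128 : ℕ) : ℤ) - 64 + 64).toNat + 128 * (m / 128) = m by omega] at h1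
    exact sgn_mul_left_cancel h1
  · intro he j k
    by_cases hj : -64 ≤ j ∧ j < 64
    · rw [h hn hj.1 hj.2, h hn' hj.1 hj.2, he, hs]
    · rw [euler_eq_zero_of_not_mem hn hj fun g => g.uDeg = k, euler_eq_zero_of_not_mem hn' hj fun g => g.uDeg = k]

theorem euler_symMir (P : D.mir.sym.Generator → Prop) :
    euler P = euler fun g : D.Generator => P (symMirEquiv g) := by
  classical
  rw [euler, ← Equiv.sum_comp symMirEquiv]
  simp only [hDeg_symMirEquiv]
  rfl

/-- A diagram has the same Turaev polynomial as its `Sym(Mir)` if this is symmetric. -/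
theorem turaev_symMir_of_packed (hT : D.IsTables T) (hn : D.n ≤ 12)
    (hκ : ∀ p m, κ p m = 128 * zigzag ((p : ℤ) - m)) (h : packed T κ = packed T fun p m => κ m p) :
    D.turaev = D.mir.sym.turaev := by
  -- Exchanging the two intersection counts negates the `u`-grading.
  rw [packed_eq_iff (K := fun u => 128 * zigzag u) (K' := fun u => 128 * zigzag (-u)) hT hn hκ hT hn
    fun p m => by rw [hκ, neg_sub]] at h
  refine turaev_eq_iff.2 fun j k => ?_
  rw [euler_symMir]
  simp only [qDeg_symMirEquiv, uDeg_symMirEquiv]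
  by_cases hj : -64 ≤ j ∧ j < 64
  · rw [euler_eq_keyCount (K := fun u => 128 * zigzag u) (m := (j + 64).toNat + 128 * zigzag k)
      fun g => by rw [key_eq_iff hn g hj.1 hj.2, zigzag_inj], h]
    refine (euler_eq_keyCount fun g => ?_).symm
    have h1 := key_eq_iff (Z := fun u => zigzag (-u)) hn g (k := -k) hj.1 hj.2
    rw [neg_neg, zigzag_inj] at h1
    exact h1.symm
  · rw [euler_eq_zero_of_not_mem hn hj fun g => g.uDeg = k, euler_eq_zero_of_not_mem hn hj fun g => -g.uDeg = k]

/-- With a constant key for the `u`-grading, the packed integer carries the information of the Jones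
polynomial. -/
theorem euler_qDeg_eq_of_packed (hT : D.IsTables T) (hn : D.n ≤ 12) (hT' : D'.IsTables T')
    (hn' : D'.n ≤ 12) (hs : sgn D.nMinus = sgn D'.nMinus)
    (h : packed T (fun _ _ => 0) = packed T' fun _ _ => 0) (j : ℤ) :
    euler (fun g : D.Generator => g.qDeg = j) = euler fun g : D'.Generator => g.qDeg = j := by
  rw [packed_eq_iff (K := fun _ => 0) (K' := fun _ => 0) hT hn (fun _ _ => rfl) hT' hn'
    fun _ _ => rfl] at h
  by_cases hj : -64 ≤ j ∧ j < 64
  · have h1 : ∀ {D : KnotoidCode}, D.n ≤ 12 → euler (fun g : D.Generator => g.qDeg = j) =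
        sgn D.nMinus * keyCount (fun _ => 0) D (j + 64).toNat := fun hn =>
      euler_eq_keyCount fun g => by
        have := qDeg_bounds hn g
        change g.qDeg = j ↔ (g.qDeg + 64).toNat + 0 = _
        omega
    rw [h1 hn, h1 hn', h, hs]
  · have h1 : ∀ {D : KnotoidCode}, D.n ≤ 12 → euler (fun g : D.Generator => g.qDeg = j) = 0 :=
      fun hn => euler_of_forall_not fun g hg => hj (hg ▸ qDeg_bounds hn g)
    rw [h1 hn, h1 hn']

end KnotoidCode

/-! ### Homology groups of diagrams given by tables -/

namespace BitMask

/-- The code `zigzag (p - m)` of a difference. -/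
def zigzagSub (p m : ℕ) : ℕ :=
  cond (Nat.ble m p) (Nat.mul 2 (Nat.sub p m)) (Nat.sub (Nat.mul 2 (Nat.sub m p)) 1)

/-- Selects a `q`-grading and a `u`-grading. -/
def bidegree (a b q u : ℕ) : Bool := and (Nat.beq u b) (Nat.beq q a)

/-- Selects a `q`-grading. -/
def quantum (a q _u : ℕ) : Bool := Nat.beq q a

/-- Selects all but two neighbouring `q`-gradings. -/
def offDiagonal (d q _u : ℕ) : Bool := not (Nat.beq (Nat.div q 2) d)

end BitMask

/-! ### Certificates for winding and Khovanov homology -/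

namespace KnotoidCode

open BitMask

variable {D : KnotoidCode} {T : Tables} {o : ℕ}

theorem zigzagSub_eq (p m : ℕ) : zigzagSub p m = zigzag ((p : ℤ) - m) := by
  unfold zigzagSub zigzag
  rcases h : Nat.ble m p with _ | _
  · have h1 : ¬ m ≤ p := fun h' => by rw [Nat.ble_eq_true_of_le h'] at h; exact Bool.noConfusion h
    rw [cond_false, if_neg (by omega)]
    change 2 * (m - p) - 1 = _
    omega
  · have h1 := Nat.le_of_ble_eq_true h
    rw [cond_true, if_pos (by omega)]
    change 2 * (p - m) = _
    omega

theorem bidegree_iff (hn : D.n ≤ 12) (g : D.Generator) {j k : ℤ} {a : ℕ} (ha : a = j + 64) :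
    (g.qDeg = j ∧ g.uDeg = k) ↔ bidegree a (zigzag k) g.qKey (zigzag g.uDeg) = true := by
  have := qDeg_bounds hn g
  rw [bidegree, beq_eq, beq_eq, Bool.and_eq_true, beq_iff_eq, beq_iff_eq, zigzag_inj,
    Generator.qKey]
  omega

theorem finrank_windingHomology_eq_zero (hS : D.IsSpherical) (hT : D.IsTables T) (hn : D.n ≤ 12)
    {i j k : ℤ} {a : ℕ} (hi : i = o - D.nMinus) (ha : a = j + 64)
    (h : isExact T zigzagSub (bidegree a (zigzag k)) o = true) :
    Module.finrank ℚ (D.windingHomology i j k) = 0 :=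
  finrank_homology_eq_zero hS hT hn zigzagSub_eq (closed_qDeg_uDeg hS j k)
    (fun g => bidegree_iff hn g ha) hi h

theorem finrank_windingHomology_ne_zero (hS : D.IsSpherical) (hT : D.IsTables T) (hn : D.n ≤ 12)
    {i j k : ℤ} {a : ℕ} {z ψ : List (ℤ × ℕ × ℕ)} (hi : i = o + 1 - D.nMinus) (ha : a = j + 64)
    (h : detects T zigzagSub (bidegree a (zigzag k)) o z ψ = true) :
    Module.finrank ℚ (D.windingHomology i j k) ≠ 0 :=
  finrank_homology_ne_zero hS hT hn zigzagSub_eq (closed_qDeg_uDeg hS j k)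
    (fun g => bidegree_iff hn g ha) hi h

theorem finrank_khovanovHomology_eq_zero (hS : D.IsSpherical) (hT : D.IsTables T) (hn : D.n ≤ 12)
    {i j : ℤ} {a : ℕ} (hi : i = o - D.nMinus) (ha : a = j + 64)
    (h : isExact T zigzagSub (quantum a) o = true) :
    Module.finrank ℚ (D.khovanovHomology i j) = 0 := by
  refine finrank_homology_eq_zero hS hT hn zigzagSub_eq (closed_qDeg j) (fun g => ?_) hi h
  have := qDeg_bounds hn g
  rw [quantum, beq_eq, beq_iff_eq, Generator.qKey]
  omega

theorem finrank_homology_of_isEmpty {P : D.Generator → Prop} {i : ℤ} (h : ∀ g, ¬ (g.hDeg = i ∧ P g)) :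
    Module.finrank ℚ (D.Homology P i) = 0 := by
  have : IsEmpty {g : D.Generator // g.hDeg = i ∧ P g} := ⟨fun g => h g.1 g.2⟩
  exact Module.finrank_zero_of_subsingleton

/-- The homology of the generators away from a diagonal, if it vanishes in all degrees. -/
theorem finrank_khovanovHomology_eq_zero_of_ne (hS : D.IsSpherical) (hT : D.IsTables T)
    (hn : D.n ≤ 12) {d : ℕ} (hd : (d : ℤ) = 32 - D.nMinus)
    (h : ∀ o ≤ D.n, isExact T zigzagSub (offDiagonal (d + o)) o = true) {i j : ℤ} (hij : j / 2 ≠ i) :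
    Module.finrank ℚ (D.khovanovHomology i j) = 0 := by
  classical
  by_cases hi : ∃ o : ℕ, o ≤ D.n ∧ i = o - D.nMinus
  · obtain ⟨o, ho, rfl⟩ := hi
    have hq : ∀ g h : D.Generator, totalCoeff g h ≠ 0 → h.qDeg = g.qDeg :=
      fun _ _ hn => qDeg_of_totalCoeff_ne_zero hn
    have hP : Closed fun g : D.Generator => g.qDeg / 2 ≠ o - D.nMinus :=
      fun g h hn => by simp only [hq g h hn]
    -- The offset `64` of the `q`-key becomes `32` after halving. In homological degree `i = o - n₋`
    -- the excluded diagonal `j / 2 = i` is therefore the value `d + o`, and one test covers all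
    -- other `j` at once.
    have h1 := finrank_homology_eq_zero hS hT hn zigzagSub_eq hP (fun g => by
      have := qDeg_bounds hn g
      rw [offDiagonal, beq_eq, Bool.not_eq_true', beq_eq_false_iff_ne, Generator.qKey]
      change _ ↔ (g.qDeg + 64).toNat / 2 ≠ _
      omega) rfl (h o ho)
    rw [finrank_homology_eq_sum hS hP hq (insert j (Finset.univ.image Generator.qDeg))
      fun g => Finset.mem_insert_of_mem (Finset.mem_image_of_mem _ (Finset.mem_univ g)),
      Finset.sum_eq_zero_iff] at h1
    have h2 : (fun g : D.Generator => g.qDeg / 2 ≠ o - D.nMinus ∧ g.qDeg = j) =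
        fun g => g.qDeg = j :=
      funext fun g => propext ⟨fun h => h.2, fun h => ⟨by rwa [h], h⟩⟩
    rw [← h1 j (Finset.mem_insert_self _ _), h2]
  · refine finrank_homology_of_isEmpty fun g hg => hi ⟨_, ones_le g.state, ?_⟩
    rw [← hg.1, Generator.hDeg]

/-- For each `j` at most one homological degree survives, so the Euler characteristic of the grading
`j` is, up to sign, the dimension there. -/
theorem finrank_khovanovHomology_diagonal (hS : D.IsSpherical)
    (h : ∀ i j : ℤ, j / 2 ≠ i → Module.finrank ℚ (D.khovanovHomology i j) = 0) (j : ℤ) :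
    (Module.finrank ℚ (D.khovanovHomology (j / 2) j) : ℤ) =
      sgn (j / 2) * euler fun g : D.Generator => g.qDeg = j := by
  rw [← sum_sgn_mul_finrank hS (closed_qDeg j) (M := D.n + (j / 2).natAbs + 1) (by omega),
    Finset.sum_eq_single (j / 2 + (D.n + (j / 2).natAbs + 1 : ℕ)).toNat]
  · have h1 : (((j / 2 + (D.n + (j / 2).natAbs + 1 : ℕ)).toNat : ℕ) : ℤ) -
        (D.n + (j / 2).natAbs + 1 : ℕ) = j / 2 := by omega
    rw [h1, ← mul_assoc, sgn_mul_self, one_mul]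
  · intro t _ ht
    rw [h _ j (by omega), Nat.cast_zero, mul_zero]
  · intro ht
    rw [Finset.mem_range] at ht
    omega

/-- Khovanov homology is the sum over `k` of the winding homologies, and dimensions do not cancel.
-/
theorem finrank_khovanovHomology_ne_zero (hS : D.IsSpherical) {i j k : ℤ}
    (h : Module.finrank ℚ (D.windingHomology i j k) ≠ 0) :
    Module.finrank ℚ (D.khovanovHomology i j) ≠ 0 := by
  classical
  rw [finrank_khovanovHomology hS (insert k (Finset.univ.image Generator.uDeg))
    fun g => Finset.mem_insert_of_mem (Finset.mem_image_of_mem _ (Finset.mem_univ g))]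
  exact fun h0 => h (Finset.sum_eq_zero_iff.1 h0 k (Finset.mem_insert_self _ _))

end KnotoidCode

/-! ### Criteria for comparing two diagrams -/

namespace KnotoidDiagram

open KnotoidCode BitMask

/-- Khovanov homology that is concentrated on the diagonal is determined by its Euler
characteristic. -/
theorem sameKhovanov_of_diagonal {K L : KnotoidDiagram}
    (hK : ∀ i j : ℤ, j / 2 ≠ i → Module.finrank ℚ (K.khovanovHomology i j) = 0)
    (hL : ∀ i j : ℤ, j / 2 ≠ i → Module.finrank ℚ (L.khovanovHomology i j) = 0)
    (h : ∀ j, euler (fun g : K.Generator => g.qDeg = j) = euler fun g : L.Generator => g.qDeg = j) :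
    SameKhovanov K L := by
  refine sameKhovanov_iff.2 fun i j => ?_
  by_cases hij : j / 2 = i
  · subst hij
    zify
    rw [finrank_khovanovHomology_diagonal K.spherical hK, finrank_khovanovHomology_diagonal L.spherical hL, h]
  · rw [hK i j hij, hL i j hij]

/-- Passing to Sym(Mir(K)) exchanges `k` and `-k`, so it suffices that the winding homology of `K`
is asymmetric in one place. -/
theorem not_sameWinding_symMir {K : KnotoidDiagram} {i j k : ℤ}
    (h0 : Module.finrank ℚ (K.windingHomology i j k) = 0)
    (h1 : Module.finrank ℚ (K.windingHomology i j (-k)) ≠ 0) : ¬ SameWinding K K.symMir := by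
  intro h
  obtain ⟨e⟩ := K.nonempty_windingHomology_symMir i j k
  exact h1 (by rw [← e.finrank_eq, ← sameWinding_iff.1 h i j k, h0])

/-- Vanishing Khovanov homology makes the winding homology vanish for every `k`, so one certificate
of each kind separates the diagrams. -/
theorem not_nonempty_windingHomology_equiv {K L : KnotoidDiagram} {i j k : ℤ}
    (hK : Module.finrank ℚ (K.khovanovHomology i j) = 0)
    (hL : Module.finrank ℚ (L.windingHomology i j k) ≠ 0) :
    ¬ Nonempty (K.windingHomology i j k ≃ₗ[ℚ] L.windingHomology i j k) := fun ⟨e⟩ =>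
  finrank_khovanovHomology_ne_zero K.spherical (by rwa [e.finrank_eq]) hK

theorem not_sameKhovanov {K L : KnotoidDiagram} {i j k : ℤ}
    (hK : Module.finrank ℚ (K.khovanovHomology i j) = 0)
    (hL : Module.finrank ℚ (L.windingHomology i j k) ≠ 0) : ¬ SameKhovanov K L := fun h =>
  finrank_khovanovHomology_ne_zero L.spherical hL (by rw [← sameKhovanov_iff.1 h, hK])

end KnotoidDiagram

/-! ### The nine diagrams -/

set_option maxRecDepth 100000

namespace KnotoidCode

open BitMask

/-- Tables for `code1`. -/
def tables1 : Tables where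
  n := 10
  crossings := [(3, 1, 4, 0), (1, 10, 2, 11), (9, 2, 10, 3), (14, 4, 15, 5), (5, 19, 6, 20),
    (13, 7, 14, 6), (7, 18, 8, 17), (16, 9, 17, 8), (11, 16, 12, 15), (18, 13, 19, 12)]
  next₀ := 27852054126871286791813325194794098556802845440874574614241205867791373922145735420900372979779840
  next₁ := 21469221514454537581893779471632002460869856815883947812332271016512231825916870631102870077376000
  crossing := 8577617423128882163856335696993612886041918356664019984215649551439677231013702378881296461987840
  right := 8343699359066055009357320386789591332020917766610294323600390847589196072681624107102159044608
  left := 32592575621351777832607979597816438950243435465855228886485381285668195947236176066466807808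
  right₀ := 0
  left₀ := 0
  shift := 63

/-- Tables for `code2`. -/
def tables2 : Tables where
  n := 10
  crossings := [(0, 5, 1, 6), (12, 2, 13, 1), (2, 10, 3, 9), (17, 4, 18, 3), (4, 15, 5, 14),
    (6, 13, 7, 14), (19, 8, 20, 7), (8, 19, 9, 18), (10, 16, 11, 17), (15, 11, 16, 12)]
  next₀ := 30046185295188626185236962002103372413031926284881691503426997189914402365118281408691991292480000
  next₁ := 36429212702142895785493872623891201831806756527514505476957450064025048320171499626604302667746560
  crossing := 12866213452410304595702913006257358050419070844776606948926248225793221485875282514766167613112320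
  right := 1942668892227495918089554189759703651292844964544637889131038498854301680674634006528
  left := 7588550812569602766956918863285941960897704610788346578063745740614075433068003328
  right₀ := 0
  left₀ := 0
  shift := 63

/-- Tables for `code3`. -/
def tables3 : Tables where
  n := 10
  crossings := [(3, 1, 4, 0), (1, 12, 2, 13), (11, 2, 12, 3), (16, 4, 17, 5), (5, 17, 6, 18),
    (13, 7, 14, 6), (7, 15, 8, 14), (18, 8, 19, 9), (9, 19, 10, 20), (15, 11, 16, 10)]
  next₀ := 45006535645259795214492082724036788975876664721795552767214589534600101033078072050902916871358720
  next₁ := 38623508238305480260789670189913446642343505560619063149494906456198497364375418693492953999541760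
  crossing := 17154874923469484684848007936864189327967904905583903437063258005884576765723345109380746297999360
  right := 105312291668652969130723870180506679051251636301410682695269285888
  left := 411376163850604308812121080802337407315873406253309767228325888
  right₀ := 0
  left₀ := 0
  shift := 57

/-- Tables for `code4`. -/
def tables4 : Tables where
  n := 12
  crossings := [(3, 1, 4, 0), (1, 12, 2, 13), (11, 2, 12, 3), (16, 4, 17, 5), (5, 23, 6, 24),
    (15, 7, 16, 6), (21, 7, 22, 8), (8, 20, 9, 21), (19, 9, 20, 10), (10, 18, 11, 19),
    (13, 18, 14, 17), (22, 15, 23, 14)]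
  next₀ := 513782128734690555129728340415166935708236681028916634948480233787677728488460298890384790596515549265507677704161536
  next₁ := 396039649013282043316238984876330534806295942544334346466577519275355888377717325929958328760760336517087857849468416
  crossing := 158230320517538048225522460972518344982421657241130402204963153200287798245553035738347059128204624945668548653481984
  right := 153914086704665934422965000391193579976452988279544242486415203448733144717363344199929187607330972477271648043008
  left := 601226901190101306339707034720739171233903803440403169888435625519045313510852193121579587899830743598112964608
  right₀ := 0
  left₀ := 0
  shift := 53

/-- Tables for `code5`. -/
def tables5 : Tables where
  n := 10
  crossings := [(3, 1, 4, 0), (1, 10, 2, 11), (9, 2, 10, 3), (4, 13, 5, 14), (19, 6, 20, 5),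
    (16, 6, 17, 7), (7, 15, 8, 16), (14, 8, 15, 9), (11, 17, 12, 18), (18, 12, 19, 13)]
  next₀ := 21469221518448634350607402288444886476844848786612215418364748457913181002458367453614063086864640
  next₁ := 27852054130865383560526937451935071983215242063976676870777325582504243682323928323325225127708160
  crossing := 8577617424127398737841608527201272750142762162117090499376901898156760108768788117734821231329280
  right := 105312291668557186697918027683670432318896304326440783477523677184
  left := 411376139330301510538742295639337626555168976230021509555421184
  right₀ := 0
  left₀ := 0
  shift := 51

/-- Tables for `code6`. -/
def tables6 : Tables where
  n := 12
  crossings := [(3, 1, 4, 0), (1, 10, 2, 11), (9, 2, 10, 3), (4, 17, 5, 18), (19, 5, 20, 6),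
    (6, 20, 7, 21), (12, 8, 13, 7), (8, 16, 9, 15), (16, 12, 17, 11), (21, 13, 22, 14),
    (14, 22, 15, 23), (23, 18, 24, 19)]
  next₀ := 1542237852840861553343831315040819389395590538621477495279442010002075961936929217956702401163455282380059429459855616
  next₁ := 1424491779849301397565503288593697662756338051776262987917817773546555777856949126784891715964242872596115461019076096
  crossing := 435121158951417501446506929699318906754734677979541511584386941548648038791137040740531938811553918370806546923782144
  right := 39402006196394479212279040227460304994877347158161391746117250129353337443403477918802808781192672151605923306078208
  left := 10086913586276986678343434265637262464925373852450912496199822518510837659451867328091355852306376907529775194998571008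
  right₀ := 0
  left₀ := 0
  shift := 53

/-- Tables for `code7`. -/
def tables7 : Tables where
  n := 12
  crossings := [(3, 1, 4, 0), (1, 7, 2, 6), (7, 3, 8, 2), (4, 13, 5, 12), (13, 6, 14, 5),
    (8, 18, 9, 19), (9, 22, 10, 23), (16, 10, 17, 11), (20, 11, 21, 12), (19, 15, 20, 14),
    (23, 16, 24, 15), (21, 17, 22, 18)]
  next₀ := 1187152019132439562258141145214496579608425911936975522562621068208594451239219820018621099809398161513985672338606336
  next₁ := 1304894498799018286159715429385260438661963799329006740003831343875887910059473096894604232570642755375744468057130496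
  crossing := 395562824384963347162215575326955216710460883918451124188526557024691549848739208789806726642285704078690039904600064
  right := 153914086704805918477694939828160407599158060694599566231977155198338906286607256214793582378200877831195753185280
  left := 601226937026017181217167474641764598497378070392950862598704807138487589200286926143321259928779613207925882880
  right₀ := 0
  left₀ := 0
  shift := 62

/-- Tables for `code8`. -/
def tables8 : Tables where
  n := 12
  crossings := [(3, 1, 4, 0), (1, 9, 2, 10), (8, 2, 9, 3), (15, 4, 16, 5), (5, 23, 6, 22),
    (13, 7, 14, 6), (20, 8, 21, 7), (16, 10, 17, 11), (11, 17, 12, 18), (12, 20, 13, 19),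
    (21, 15, 22, 14), (23, 18, 24, 19)]
  next₀ := 1542225191838802867497968421298549019461883330157630112244424358338397904739773031090044042974398841734494608410675456
  next₁ := 1424482712172224143609159802352618658828876572870577745099027445165083166039442203442949390794622558249544704953222656
  crossing := 435117537507964835117085376021463203782877835300578931417215136146313690541238164712694533897556771757092537005768704
  right := 39402607423331505229460224801860059472869016801510255337476653054876639434700597203074671380020635387476241985634304
  left := 10087067500363691484261903616750416803198034895298203897202998867330398762392115893523132581480891338448652213948514304
  right₀ := 0
  left₀ := 0
  shift := 59

/-- Tables for `code9`. -/
def tables9 : Tables where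
  n := 12
  crossings := [(5, 1, 6, 0), (1, 12, 2, 13), (9, 2, 10, 3), (3, 19, 4, 20), (16, 4, 17, 5),
    (15, 7, 16, 6), (7, 21, 8, 20), (23, 9, 24, 8), (18, 11, 19, 10), (11, 18, 12, 17),
    (22, 13, 23, 14), (14, 21, 15, 22)]
  next₀ := 633373963717341188327052863182916868507405109485048910602015575770753449621744523176250671591553919839814892649057536
  next₁ := 751116443383920748839263711630908256269068226790266101830436397394936638454667382067665428967453705699829564318747136
  crossing := 276897477837440722148083809541364733020728715492521320089933884265596504093697825819224714842273111322970135004708864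
  right := 8343699359073643559715810294013405994346945358334464292042542922869069167104089650524588146688
  left := 32592577564020669606024201934423339816774811988409472675717428942946138775952139027467993088
  right₀ := 0
  left₀ := 0
  shift := 59

theorem isTables1 : code1.IsTables tables1 := by decide +kernel

theorem isTables2 : code2.IsTables tables2 := by decide +kernel

theorem isTables3 : code3.IsTables tables3 := by decide +kernel

theorem isTables4 : code4.IsTables tables4 := by decide +kernel

theorem isTables5 : code5.IsTables tables5 := by decide +kernel

theorem isTables6 : code6.IsTables tables6 := by decide +kernel

theorem isTables7 : code7.IsTables tables7 := by decide +kernel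

theorem isTables8 : code8.IsTables tables8 := by decide +kernel

theorem isTables9 : code9.IsTables tables9 := by decide +kernel

/-- In this and the following certificates `o + 1 = i + n₋` and `a = j + 64`. A term of `z` or `ψ`
consists of a coefficient, the mask of the `1`-smoothings and the mask of the edges labelled `X`;
for `12` crossings `33554431 = 2 ^ 25 - 1` labels all edges by `X`. -/
theorem winding4_ne_zero :
    Module.finrank ℚ (code4.windingHomology (-5) (-10) 0) ≠ 0 :=
  finrank_windingHomology_ne_zero (o := 2) (a := 54)
    (z := [(1, 35, 33554431), (1, 37, 33554431)])
    (ψ := [(1, 35, 33554431)])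
    spherical4 isTables4 (by decide) (by decide +kernel) (by decide) (by decide +kernel)

theorem winding6_ne_zero :
    Module.finrank ℚ (code6.windingHomology (-4) (-11) (-2)) ≠ 0 :=
  finrank_windingHomology_ne_zero (o := 3) (a := 53)
    (z := [(1, 15, 33553403)])
    (ψ := [(1, 15, 33553403), (1, 135, 33553403), (1, 141, 33554431), (-1, 263, 33553403),
      (-1, 269, 33554431), (-1, 390, 33486325), (1, 390, 33553403)])
    spherical6 isTables6 (by decide) (by decide +kernel) (by decide) (by decide +kernel)

/-- The cycle is a single generator, but the cocycle needs many terms, since it must vanish on every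
boundary from seven `1`-smoothings in these gradings. -/
theorem winding6_zero_ne_zero :
    Module.finrank ℚ (code6.windingHomology 0 (-4) 0) ≠ 0 :=
  finrank_windingHomology_ne_zero (o := 7) (a := 60)
    (z := [(1, 3646, 22526907)])
    (ψ := [(-1, 255, 29343743), (1, 759, 33553403), (1, 765, 33554431), (-1, 766, 32302421),
      (-1, 1014, 33553403), (1, 1271, 33421293), (-1, 1271, 33553403), (-1, 1275, 33554431),
      (1, 1526, 33553403), (1, 1599, 33553403), (-1, 1655, 33421293), (1, 1655, 33553403),
      (1, 1659, 33554431), (1, 1786, 32301393), (1, 1847, 33351405), (-1, 1847, 33553403),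
      (-1, 1851, 33554431), (1, 1910, 33553403), (-1, 1974, 33486325), (-1, 1977, 28135007),
      (1, 1978, 28135007), (1, 2034, 33485297), (-1, 2036, 33485297), (-1, 2809, 32302427),
      (1, 3321, 32302427), (1, 3639, 22526907), (-1, 3643, 22527935), (1, 3645, 22527935),
      (1, 3646, 28135761), (-1, 3646, 22526907), (-1, 3705, 28066907), (-1, 3763, 22527935),
      (1, 3769, 28066907), (-1, 3801, 21275931), (1, 3817, 21275931), (1, 3832, 32301393),
      (1, 3891, 22527935), (-1, 4017, 22527935), (1, 4018, 22527935), (1, 4024, 28066907),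
      (-1, 4024, 22459835), (1, 4024, 17108511)])
    spherical6 isTables6 (by decide) (by decide +kernel) (by decide) (by decide +kernel)

theorem winding7_ne_zero :
    Module.finrank ℚ (code7.windingHomology 0 3 2) ≠ 0 :=
  finrank_windingHomology_ne_zero (o := 4) (a := 67)
    (z := [(1, 2078, 33546075)])
    (ψ := [(1, 2078, 33546075)])
    spherical7 isTables7 (by decide) (by decide +kernel) (by decide) (by decide +kernel)

theorem winding8_ne_zero :
    Module.finrank ℚ (code8.windingHomology 3 5 (-2)) ≠ 0 :=
  finrank_windingHomology_ne_zero (o := 8) (a := 69)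
    (z := [(1, 2551, 24632763), (-1, 3031, 32497019)])
    (ψ := [(1, 2551, 24632763)])
    spherical8 isTables8 (by decide) (by decide +kernel) (by decide) (by decide +kernel)

theorem winding9_ne_zero :
    Module.finrank ℚ (code9.windingHomology (-3) (-5) (-2)) ≠ 0 :=
  finrank_windingHomology_ne_zero (o := 2) (a := 59)
    (z := [(1, 44, 33554431)])
    (ψ := [(1, 44, 33554431)])
    spherical9 isTables9 (by decide) (by decide +kernel) (by decide) (by decide +kernel)

/-- The counterpart of `winding7_ne_zero` at the opposite `u`-grading; together they show the
asymmetry of the winding homology. Here `o = i + n₋`. -/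
theorem winding7_eq_zero :
    Module.finrank ℚ (code7.windingHomology 0 3 (-2)) = 0 :=
  finrank_windingHomology_eq_zero (o := 5) (a := 67) spherical7 isTables7 (by decide)
    (by decide +kernel) (by decide) (by decide +kernel)

theorem winding8_eq_zero :
    Module.finrank ℚ (code8.windingHomology 3 5 2) = 0 :=
  finrank_windingHomology_eq_zero (o := 9) (a := 69) spherical8 isTables8 (by decide)
    (by decide +kernel) (by decide) (by decide +kernel)

theorem winding9_eq_zero :
    Module.finrank ℚ (code9.windingHomology (-3) (-5) 2) = 0 :=
  finrank_windingHomology_eq_zero (o := 3) (a := 59) spherical9 isTables9 (by decide)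
    (by decide +kernel) (by decide) (by decide +kernel)

theorem khovanov3_eq_zero :
    Module.finrank ℚ (code3.khovanovHomology (-5) (-10)) = 0 :=
  finrank_khovanovHomology_eq_zero (o := 1) (a := 54) spherical3 isTables3 (by decide)
    (by decide +kernel) (by decide) (by decide +kernel)

/-- The bidegree is that of `winding6_zero_ne_zero`, so `K5` and `K6` differ at `k = 0`;
`khovanov5_eq_zero` matches `winding6_ne_zero` at `k = -2` in the same way. -/
theorem khovanov5_zero_eq_zero :
    Module.finrank ℚ (code5.khovanovHomology 0 (-4)) = 0 :=
  finrank_khovanovHomology_eq_zero (o := 8) (a := 60) spherical5 isTables5 (by decide)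
    (by decide +kernel) (by decide) (by decide +kernel)

theorem khovanov5_eq_zero :
    Module.finrank ℚ (code5.khovanovHomology (-4) (-11)) = 0 :=
  finrank_khovanovHomology_eq_zero (o := 4) (a := 53) spherical5 isTables5 (by decide)
    (by decide +kernel) (by decide) (by decide +kernel)

/-- The diagram has four negative crossings, whence `d = 32 - 4`. The kernel runs the exactness test
for all eleven numbers of `1`-smoothings. -/
theorem khovanov1_eq_zero_of_ne (i j : ℤ) (hij : j / 2 ≠ i) :
    Module.finrank ℚ (code1.khovanovHomology i j) = 0 :=
  finrank_khovanovHomology_eq_zero_of_ne (d := 28) spherical1 isTables1 (by decide)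
    (by decide +kernel) (by decide +kernel) hij

theorem khovanov2_eq_zero_of_ne (i j : ℤ) (hij : j / 2 ≠ i) :
    Module.finrank ℚ (code2.khovanovHomology i j) = 0 :=
  finrank_khovanovHomology_eq_zero_of_ne (d := 28) spherical2 isTables2 (by decide)
    (by decide +kernel) (by decide +kernel) hij

/-- The Turaev key of a difference of intersection numbers. -/
def turaevKey (p m : ℕ) : ℕ := Nat.mul 128 (zigzagSub p m)

theorem turaevKey_eq (p m : ℕ) : turaevKey p m = 128 * zigzag ((p : ℤ) - m) :=
  congrArg (128 * ·) (zigzagSub_eq p m)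

theorem packed1_ne_packed2 : packed tables1 turaevKey ≠ packed tables2 turaevKey := by
  decide +kernel

/-- Equality of the `q`-graded Euler characteristics, which together with the confinement to the
diagonal gives equal Khovanov homology. -/
theorem packed1_eq_packed2 : packed tables1 (fun _ _ => 0) = packed tables2 fun _ _ => 0 := by
  decide +kernel

theorem packed3_eq_packed4 : packed tables3 turaevKey = packed tables4 turaevKey := by
  decide +kernel

theorem packed5_eq_packed6 : packed tables5 turaevKey = packed tables6 turaevKey := by
  decide +kernel

/-- Symmetry of the Turaev polynomial under `u ↦ u⁻¹`, after the normalization by the diagram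
itself. -/
theorem packed7_symm : packed tables7 turaevKey = packed tables7 fun p m => turaevKey m p := by
  decide +kernel

theorem packed8_symm : packed tables8 turaevKey = packed tables8 fun p m => turaevKey m p := by
  decide +kernel

theorem packed9_symm : packed tables9 turaevKey = packed tables9 fun p m => turaevKey m p := by
  decide +kernel

theorem turaev1_ne_turaev2 : code1.turaev ≠ code2.turaev := fun h =>
  packed1_ne_packed2 ((turaev_eq_iff_packed isTables1 (by decide) isTables2 (by decide) turaevKey_eq
    (by decide +kernel)).1 h)

theorem turaev3_eq_turaev4 : code3.turaev = code4.turaev :=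
  (turaev_eq_iff_packed isTables3 (by decide) isTables4 (by decide) turaevKey_eq
    (by decide +kernel)).2 packed3_eq_packed4

theorem turaev5_eq_turaev6 : code5.turaev = code6.turaev :=
  (turaev_eq_iff_packed isTables5 (by decide) isTables6 (by decide) turaevKey_eq
    (by decide +kernel)).2 packed5_eq_packed6

end KnotoidCode

/-! ### Comparison of the nine diagrams -/

namespace KnotoidDiagram

open KnotoidCode

theorem sameKhovanov_K1_K2 : SameKhovanov K1 K2 :=
  sameKhovanov_of_diagonal (K := K1) (L := K2) khovanov1_eq_zero_of_ne khovanov2_eq_zero_of_ne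
    (euler_qDeg_eq_of_packed isTables1 (by decide) isTables2 (by decide) (by decide +kernel)
      packed1_eq_packed2)

theorem not_sameKhovanov_K3_K4 : ¬ SameKhovanov K3 K4 :=
  not_sameKhovanov (K := K3) (L := K4) khovanov3_eq_zero winding4_ne_zero

theorem not_sameKhovanov_K5_K6 : ¬ SameKhovanov K5 K6 :=
  not_sameKhovanov (K := K5) (L := K6) khovanov5_eq_zero winding6_ne_zero

theorem symMir_K7_K8_K9 (K : KnotoidDiagram) (hK : K = K7 ∨ K = K8 ∨ K = K9) :
    SameTuraev K K.symMir ∧ ¬ SameWinding K K.symMir := by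
  rcases hK with rfl | rfl | rfl
  · exact ⟨turaev_symMir_of_packed isTables7 (by decide) turaevKey_eq packed7_symm,
      not_sameWinding_symMir (K := K7) winding7_eq_zero winding7_ne_zero⟩
  · exact ⟨turaev_symMir_of_packed isTables8 (by decide) turaevKey_eq packed8_symm,
      not_sameWinding_symMir (K := K8) winding8_eq_zero winding8_ne_zero⟩
  · exact ⟨turaev_symMir_of_packed isTables9 (by decide) turaevKey_eq packed9_symm,
      not_sameWinding_symMir (K := K9) winding9_eq_zero winding9_ne_zero⟩

end KnotoidDiagram

open KnotoidDiagram in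
theorem mainTheorem9 :
    (∀ K : KnotoidDiagram, K = K7 ∨ K = K8 ∨ K = K9 →
      SameTuraev K K.symMir ∧ SameKhovanov K K.symMir ∧ ¬ SameWinding K K.symMir ∧
      ∀ i j k : ℤ,
        Nonempty (K.symMir.windingHomology i j k ≃ₗ[ℚ] K.windingHomology i j (-k))) ∧
    (SameJones K1 K2 ∧ SameKhovanov K1 K2 ∧ ¬ SameTuraev K1 K2 ∧ ¬ SameWinding K1 K2) ∧
    (SameJones K3 K4 ∧ SameTuraev K3 K4 ∧ ¬ SameKhovanov K3 K4 ∧ ¬ SameWinding K3 K4) ∧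
    (SameJones K5 K6 ∧ SameTuraev K5 K6 ∧ ¬ SameKhovanov K5 K6 ∧
      (∃ i j : ℤ, ¬ Nonempty (K5.windingHomology i j 0 ≃ₗ[ℚ] K6.windingHomology i j 0)) ∧
      (∃ i j k : ℤ, k ≠ 0 ∧
        ¬ Nonempty (K5.windingHomology i j k ≃ₗ[ℚ] K6.windingHomology i j k))) ∧
    Stronger SameTuraev SameJones ∧
    Stronger SameKhovanov SameJones ∧
    Stronger SameWinding SameTuraev ∧
    Stronger SameWinding SameKhovanov ∧
    ¬ Determines SameTuraev SameKhovanov ∧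
    ¬ Determines SameKhovanov SameTuraev ∧
    Stronger SameWinding SameTuraevAndKhovanov := by
  have hT : ¬ SameTuraev K1 K2 := KnotoidCode.turaev1_ne_turaev2
  have h34 : SameTuraev K3 K4 := KnotoidCode.turaev3_eq_turaev4
  have h56 : SameTuraev K5 K6 := KnotoidCode.turaev5_eq_turaev6
  have h7 := symMir_K7_K8_K9 K7 (Or.inl rfl)
  have hJ := determines_khovanov_jones _ _ sameKhovanov_K1_K2
  have hW := determines_winding_khovanov
  -- The pair `K1`, `K2` separates the Turaev polynomial from what Khovanov homology sees, and `K3`,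
  -- `K4` does the reverse, which also yields the strictness over the Jones polynomial. `K7` and its
  -- mirrored reflection agree in both invariants and differ in winding homology, so they witness
  -- all three strictness claims for the latter.
  refine ⟨fun K hK => ?_, ⟨hJ, sameKhovanov_K1_K2, hT, fun h => hT (determines_winding_turaev _ _ h)⟩,
    ⟨determines_turaev_jones _ _ h34, h34, not_sameKhovanov_K3_K4,
      fun h => not_sameKhovanov_K3_K4 (hW _ _ h)⟩,
    ⟨determines_turaev_jones _ _ h56, h56, not_sameKhovanov_K5_K6, ⟨0, -4, ?_⟩, ⟨-4, -11, -2, ?_⟩⟩,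
    ⟨determines_turaev_jones, K1, K2, hJ, hT⟩,
    ⟨determines_khovanov_jones, K3, K4, determines_turaev_jones _ _ h34, not_sameKhovanov_K3_K4⟩,
    ⟨determines_winding_turaev, K7, K7.symMir, h7.1, h7.2⟩,
    ⟨hW, K7, K7.symMir, K7.sameKhovanov_symMir, h7.2⟩,
    fun h => not_sameKhovanov_K3_K4 (h _ _ h34), fun h => hT (h _ _ sameKhovanov_K1_K2),
    ⟨fun K L h => ⟨determines_winding_turaev K L h, hW K L h⟩, K7, K7.symMir,
      ⟨h7.1, K7.sameKhovanov_symMir⟩, h7.2⟩⟩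
  · obtain ⟨h1, h2⟩ := symMir_K7_K8_K9 K hK
    exact ⟨h1, K.sameKhovanov_symMir, h2, K.nonempty_windingHomology_symMir⟩
  · exact not_nonempty_windingHomology_equiv (K := K5) (L := K6) KnotoidCode.khovanov5_zero_eq_zero
      KnotoidCode.winding6_zero_ne_zero
  · exact ⟨by decide, not_nonempty_windingHomology_equiv (K := K5) (L := K6)
      KnotoidCode.khovanov5_eq_zero KnotoidCode.winding6_ne_zero⟩
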